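/- **Setting.** Let $d\in\{2,3\}$, $\ell>0$, let $\Lambda$ be the torus $\mathbb R^d/\ell\mathbb Z^d$ with $|\Lambda|=\ell^d$ and dual lattice $\Lambda^*=\frac{2\pi}{\ell}\mathbb Z^d$. Let $\rho>0$ be such that $N=\rho\ell^d$ is an integer. Let $v\ge 0$ be a radial integrable function on $\mathbb R^d$ with support in the ball of radius $R$, $0<R\le \ell/4$. Let $\varphi^0$ be its scattering solution and $a>0$ its scattering length: $\varphi^0$ is radial and continuous, solves $-\Delta\varphi^0+\frac12 v\varphi^0=0$ on $\mathbb R^d$ in the sense of distributions, and for $|x|\ge R$ equals $\log(|x|/a)$ if $d=2$ and $1-a/|x|$ if $d=3$. Let $\varphi=\varphi^0$ if $d=3$; if $d=2$, let $\varphi=2\delta\varphi^0$, where $\delta>0$ is any number with $a e^{1/(2\delta)}>R$. Put $\omega=1-\varphi$ and $g=v(1-\omega)=v\varphi$. With $x^*=\min_{m\in\mathbb Z^d}|x-m\ell|$, the functions $v,\omega,g$ are regarded as functions on $\Lambda$ via $v(x)=v(x^*)$ etc., and $\widehat f(k)=\int_\Lambda f(x)e^{-ikx}\,dx$ for $k\in\Lambda^*$.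 On $L^2_{\rm sym}(\Lambda^N)$ consider $\mathcal H_N=\sum_j-\Delta_j+\sum_{i<j}v(x_i-x_j)$ with the periodic Laplacian, defined through its closed quadratic form. Let $P=|\Lambda|^{-1}|1\rangle\langle 1|$, $Q=1-P$ on $L^2(\Lambda)$, let $P_j,Q_j$ denote their action on the $j$-th variable, and let $$\mathcal Q_3^{\rm ren}=\sum_{i\ne j}P_iQ_j\,g(x_i-x_j)\,Q_jQ_i+h.c.,\qquad \mathcal Q_4^{\rm ren}=\tfrac12\sum_{i\ne j}B_{ij}^*\,v(x_i-x_j)\,B_{ij},$$ $$B_{ij}=Q_jQ_i+\omega(x_i-x_j)(P_jP_i+P_jQ_i+Q_jP_i).$$ For $k\in\Lambda^*$ let $a_k,a_k^\dagger$ be the bosonic annihilation and creation operators of the normalized plane wave $|\Lambda|^{-1/2}e^{ikx}$. Identify $\mathscr F_s(L^2(\Lambda))=\mathscr F_s(\mathrm{Ran}\,P)\otimes\mathscr F_s(\mathrm{Ran}\,Q)$. For $z\in\mathbb C$ let $|z\rangle=e^{-|z|^2/2+za_0^\dagger}\Omega=e^{-|z|^2/2}\sum_{j\ge0}\frac{(za_0^\dagger)^j}{j!}\Omega\in\mathscr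 F_s(\mathrm{Ran}\,P)$ be the coherent state (so $a_0|z\rangle=z|z\rangle$), let $\langle z|\Psi\rangle\in\mathscr F_s(\mathrm{Ran}\,Q)$ be the partial inner product, and put $\rho_z=|z|^2|\Lambda|^{-1}$, $z=|z|e^{i\theta}$ with $\theta=\arg z$, $\tilde a_k=e^{-i\theta}a_k$, $n_+=\sum_{k\ne0}a_k^\dagger a_k$. Define on $\mathscr F_s(\mathrm{Ran}\,Q)$ $$\mathcal K(z)=\mathcal Q(z)+\mathcal Q_2^{\rm ex}(z)+(\rho_z-\rho)n_+\widehat g(0)-\rho\rho_z|\Lambda|\widehat g(0)+\rho^2|\Lambda|\widehat g(0),$$ $$\mathcal Q(z)=\tfrac12\rho_z^2|\Lambda|\big(\widehat g(0)+\widehat{g\omega}(0)\big)+\tfrac12\sum_{k\ne0}\mathcal A_k\big(\tilde a_k^\dagger\tilde a_k+\tilde a_{-k}^\dagger\tilde a_{-k}\big)+\tfrac12\sum_{k\ne0}\mathcal B_k\big(\tilde a_k^\dagger\tilde a_{-k}^\dagger+\tilde a_k\tilde a_{-k}\big),$$ $$\mathcal A_k=k^2+\rho_z\widehat g(k),\qquad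 \mathcal B_k=\rho_z\widehat g(k),\qquad \mathcal Q_2^{\rm ex}(z)=\rho_z\sum_{k\ne0}\big(\widehat{g\omega}(k)+\widehat{g\omega}(0)\big)\tilde a_k^\dagger\tilde a_k .$$ **Proposition (c-number substitution).** There is a universal constant $C>0$ such that, for all data as above, there is a bounded operator $\mathcal R_0$ on $L^2_{\rm sym}(\Lambda^N)$ with $$\mathcal H_N=\frac1\pi\int_{\mathbb C}\mathcal K(z)\,|z\rangle\langle z|\,dz+\mathcal Q_3^{\rm ren}+\mathcal Q_4^{\rm ren}+\mathcal R_0$$ in the sense of quadratic forms on the form domain of $\mathcal H_N$, that is, for every $\Psi$ of finite kinetic and potential energy, $$\langle\Psi,\mathcal H_N\Psi\rangle=\frac1\pi\int_{\mathbb C}\big\langle \langle z|\Psi\rangle,\mathcal K(z)\langle z|\Psi\rangle\big\rangle\,dz+\langle\Psi,\mathcal Q_3^{\rm ren}\Psi\rangle+\langle\Psi,\mathcal Q_4^{\rm ren}\Psi\rangle+\langle\Psi,\mathcal R_0\Psi\rangle ,$$ all sums and integrals on the right being absolutely convergent, and $$|\langle\Psi,\mathcal R_0\Psi\rangle|\le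 C\,N\,|\Lambda|^{-1}\,\widehat g(0)\qquad\text{for all normalized }\Psi\in L^2_{\rm sym}(\Lambda^N).$$ -/

import Mathlib

open MeasureTheory
open scoped ComplexConjugate ContDiff

namespace BoseGas

noncomputable section

/-! ### The scattering solution

A radial function on `ℝ^d` is represented by its profile, a function of the radius. -/

/-- `φ₀` is the profile of the scattering solution of the radial potential `v` (supported in the ball
of radius `R`) in dimension `d = 2, 3`, and `a` is the scattering length: `-Δ φ₀ + v φ₀ / 2 = 0` on
`ℝ^d` in the sense of distributions, with `φ₀ = log (|x| / a)` for `d = 2` and `φ₀ = 1 - a / |x|`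
for `d = 3` outside the ball of radius `R`. -/
structure IsScatteringSolution (d : ℕ) (v : ℝ → ℝ) (R a : ℝ) (φ₀ : ℝ → ℝ) : Prop where
  continuousOn : ContinuousOn φ₀ (Set.Ici 0)
  equation : ∀ η : EuclideanSpace ℝ (Fin d) → ℝ, ContDiff ℝ ∞ η → HasCompactSupport η →
    (-∫ x, φ₀ ‖x‖ * Laplacian.laplacian η x) + ∫ x, 1 / 2 * v ‖x‖ * φ₀ ‖x‖ * η x = 0
  outside : ∀ r, R ≤ r → φ₀ r = if d = 2 then Real.log (r / a) else 1 - a / r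

/-- The normalized scattering solution: `φ = 2 δ φ₀` for `d = 2` (equal to `1` at distance
`a exp (1 / (2 δ))`), and `φ = φ₀` for `d = 3`. -/
def normalizedSol (d : ℕ) (δ : ℝ) (φ₀ : ℝ → ℝ) (r : ℝ) : ℝ :=
  if d = 2 then 2 * δ * φ₀ r else φ₀ r

/-- The profile of `ω = 1 - φ`. -/
def omegaFn (φ : ℝ → ℝ) (r : ℝ) : ℝ := 1 - φ r

/-- The profile of `g = v (1 - ω) = v φ`. -/
def gFn (v φ : ℝ → ℝ) (r : ℝ) : ℝ := v r * (1 - omegaFn φ r)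

/-- The profile of `g ω`. -/
def gOmegaFn (v φ : ℝ → ℝ) (r : ℝ) : ℝ := gFn v φ r * omegaFn φ r

/-! ### The torus and its plane waves -/

/-- The `d`-dimensional torus `Λ` of side length `ℓ`, of volume `ℓ ^ d`. -/
abbrev Torus (d : ℕ) (ℓ : ℝ) : Type := Fin d → AddCircle ℓ

/-- `x* = min_{z ∈ ℤ^d} |x - z ℓ|`; the norm of `AddCircle ℓ` is the distance to `ℓ ℤ`. -/
def torusDist {d : ℕ} {ℓ : ℝ} (x : Torus d ℓ) : ℝ := Real.sqrt (∑ c, ‖x c‖ ^ 2)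

/-- `n : Mode d` labels the momentum `k = (2 π / ℓ) n` of the dual lattice `Λ*`. -/
abbrev Mode (d : ℕ) : Type := Fin d → ℤ

/-- `k ^ 2` for `k = (2 π / ℓ) n`. -/
def kSq {d : ℕ} (ℓ : ℝ) (n : Mode d) : ℝ := (2 * Real.pi / ℓ) ^ 2 * ∑ c, (n c : ℝ) ^ 2

/-- The plane wave `x ↦ exp (i k x)`. -/
def planeWave {d : ℕ} {ℓ : ℝ} (n : Mode d) (x : Torus d ℓ) : ℂ := ∏ c, fourier (n c) (x c)

/-- `f̂(k) = ∫_Λ f(x) exp (-i k x) dx`, where `f(x) = f(x*)` is the periodic version of a radial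
function with profile `f`. -/
def fourierCoefTorus {d : ℕ} (ℓ : ℝ) [Fact (0 < ℓ)] (f : ℝ → ℝ) (n : Mode d) : ℂ :=
  ∫ x : Torus d ℓ, (f (torusDist x) : ℂ) * conj (planeWave n x)

/-! ### The `N`-particle space -/

/-- Configurations of `N` particles, i.e. `Λ^N`. -/
abbrev Config (d : ℕ) (ℓ : ℝ) (N : ℕ) : Type := Fin N → Torus d ℓ

/-- `L²(Λ^N)`. -/
abbrev L2 (d : ℕ) (ℓ : ℝ) [Fact (0 < ℓ)] (N : ℕ) : Type :=
  Lp ℂ 2 (volume : Measure (Config d ℓ N))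

theorem measurePreserving_perm {d : ℕ} {ℓ : ℝ} [Fact (0 < ℓ)] {N : ℕ} (σ : Equiv.Perm (Fin N)) :
    MeasurePreserving (fun x : Config d ℓ N => x ∘ σ) volume volume := by
  have h := volume_measurePreserving_piCongrLeft (fun _ : Fin N => Torus d ℓ) σ.symm
  convert h using 1
  funext x i
  have := MeasurableEquiv.piCongrLeft_apply_apply (β := fun _ : Fin N => Torus d ℓ) σ.symm x (σ i)
  simpa using this.symm

/-- `L²_sym(Λ^N)`: the functions invariant under permutations of the particles. -/
def L2sym (d : ℕ) (ℓ : ℝ) [Fact (0 < ℓ)] (N : ℕ) : Submodule ℂ (L2 d ℓ N) where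
  carrier := {Ψ | ∀ σ : Equiv.Perm (Fin N), (fun x => Ψ (x ∘ σ)) =ᵐ[volume] Ψ}
  zero_mem' := by
    intro σ
    have h := Lp.coeFn_zero ℂ 2 (volume : Measure (Config d ℓ N))
    have h' := (measurePreserving_perm σ).quasiMeasurePreserving.ae h
    filter_upwards [h, h'] with x hx hx'
    exact hx'.trans hx.symm
  add_mem' := by
    intro Ψ Ψ' hΨ hΨ' σ
    have h := Lp.coeFn_add Ψ Ψ'
    have h' := (measurePreserving_perm σ).quasiMeasurePreserving.ae h
    filter_upwards [h, h', hΨ σ, hΨ' σ] with x hx hx' h1 h2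
    rw [hx', hx, Pi.add_apply, Pi.add_apply, h1, h2]
  smul_mem' := by
    intro c Ψ hΨ σ
    have h := Lp.coeFn_smul c Ψ
    have h' := (measurePreserving_perm σ).quasiMeasurePreserving.ae h
    filter_upwards [h, h', hΨ σ] with x hx hx' h1
    rw [hx', hx, Pi.smul_apply, Pi.smul_apply, h1]

/-- The coefficient of `Ψ` in the orthonormal basis `∏_j |Λ|^{-1/2} exp (i k_j x_j)` of
`L²(Λ^N)`. -/
def momentumCoef {d : ℕ} {ℓ : ℝ} [Fact (0 < ℓ)] {N : ℕ} (Ψ : Config d ℓ N → ℂ)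
    (κ : Fin N → Mode d) : ℂ :=
  ∫ x : Config d ℓ N, conj (∏ j, ((Real.sqrt (ℓ ^ d))⁻¹ : ℂ) * planeWave (κ j) (x j)) * Ψ x

/-! ### The Hamiltonian, as a closed quadratic form -/

/-- The form domain of `H_N = ∑_j -Δ_j + ∑_{i<j} v(x_i - x_j)`: finite kinetic energy for the
periodic Laplacian (diagonal in the plane waves) and finite potential energy. -/
def InFormDomain {d : ℕ} {ℓ : ℝ} [Fact (0 < ℓ)] {N : ℕ} (v : ℝ → ℝ) (Ψ : Config d ℓ N → ℂ) :
    Prop :=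
  Summable (fun κ : Fin N → Mode d => (∑ j, kSq ℓ (κ j)) * ‖momentumCoef Ψ κ‖ ^ 2) ∧
  ∀ i j : Fin N, i < j → Integrable (fun x => v (torusDist (x i - x j)) * ‖Ψ x‖ ^ 2)

/-- `⟨Ψ, H_N Ψ⟩`. -/
def energy {d : ℕ} {ℓ : ℝ} [Fact (0 < ℓ)] {N : ℕ} (v : ℝ → ℝ) (Ψ : Config d ℓ N → ℂ) : ℝ :=
  (∑' κ : Fin N → Mode d, (∑ j, kSq ℓ (κ j)) * ‖momentumCoef Ψ κ‖ ^ 2) +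
  ∑ i : Fin N, ∑ j : Fin N,
    if i < j then ∫ x, v (torusDist (x i - x j)) * ‖Ψ x‖ ^ 2 else 0

/-! ### The renormalized interaction terms -/

/-- `P_i`: the projection `P = |Λ|⁻¹ |1⟩⟨1|` acting on the `i`-th particle. -/
def projP {d : ℕ} {ℓ : ℝ} [Fact (0 < ℓ)] {N : ℕ} (i : Fin N) (Ψ : Config d ℓ N → ℂ) :
    Config d ℓ N → ℂ :=
  fun x => ((ℓ ^ d)⁻¹ : ℂ) * ∫ y : Torus d ℓ, Ψ (Function.update x i y)

/-- `Q_i = 1 - P_i`. -/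
def projQ {d : ℕ} {ℓ : ℝ} [Fact (0 < ℓ)] {N : ℕ} (i : Fin N) (Ψ : Config d ℓ N → ℂ) :
    Config d ℓ N → ℂ :=
  fun x => Ψ x - projP i Ψ x

/-- The integrand of `⟨Ψ, P_i Q_j g(x_i - x_j) Q_j Q_i Ψ⟩`. -/
def q3Integrand {d : ℕ} {ℓ : ℝ} [Fact (0 < ℓ)] {N : ℕ} (v φ : ℝ → ℝ) (Ψ : Config d ℓ N → ℂ)
    (i j : Fin N) (x : Config d ℓ N) : ℂ :=
  conj (projP i (projQ j Ψ) x) * (gFn v φ (torusDist (x i - x j)) : ℂ) * projQ j (projQ i Ψ) x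

/-- `⟨Ψ, Q₃^ren Ψ⟩` for `Q₃^ren = ∑_{i ≠ j} P_i Q_j g(x_i - x_j) Q_j Q_i + h.c.` -/
def q3Ren {d : ℕ} {ℓ : ℝ} [Fact (0 < ℓ)] {N : ℕ} (v φ : ℝ → ℝ) (Ψ : Config d ℓ N → ℂ) : ℂ :=
  ∑ i : Fin N, ∑ j : Fin N, if i ≠ j then
    (∫ x, q3Integrand v φ Ψ i j x) + conj (∫ x, q3Integrand v φ Ψ i j x) else 0

/-- `[Q_j Q_i + ω(x_i - x_j) (P_j P_i + P_j Q_i + Q_j P_i)] Ψ`. -/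
def q4Vector {d : ℕ} {ℓ : ℝ} [Fact (0 < ℓ)] {N : ℕ} (φ : ℝ → ℝ) (Ψ : Config d ℓ N → ℂ)
    (i j : Fin N) (x : Config d ℓ N) : ℂ :=
  projQ j (projQ i Ψ) x + (omegaFn φ (torusDist (x i - x j)) : ℂ) *
    (projP j (projP i Ψ) x + projP j (projQ i Ψ) x + projQ j (projP i Ψ) x)

/-- The integrand `v(x_i - x_j) |[Q_j Q_i + ω(x_i - x_j) (P_j P_i + P_j Q_i + Q_j P_i)] Ψ|²`. -/
def q4Integrand {d : ℕ} {ℓ : ℝ} [Fact (0 < ℓ)] {N : ℕ} (v φ : ℝ → ℝ) (Ψ : Config d ℓ N → ℂ)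
    (i j : Fin N) (x : Config d ℓ N) : ℝ :=
  v (torusDist (x i - x j)) * ‖q4Vector φ Ψ i j x‖ ^ 2

/-- `⟨Ψ, Q₄^ren Ψ⟩` for `Q₄^ren = (1/2) ∑_{i ≠ j} B_{ij}^* v(x_i - x_j) B_{ij}`,
`B_{ij} = Q_j Q_i + ω(x_i - x_j) (P_j P_i + P_j Q_i + Q_j P_i)`. -/
def q4Ren {d : ℕ} {ℓ : ℝ} [Fact (0 < ℓ)] {N : ℕ} (v φ : ℝ → ℝ) (Ψ : Config d ℓ N → ℂ) : ℝ :=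
  1 / 2 * ∑ i : Fin N, ∑ j : Fin N, if i ≠ j then ∫ x, q4Integrand v φ Ψ i j x else 0

/-! ### Bosonic Fock spaces in the occupation number representation -/

/-- The amplitudes `n ↦ ⟨n|Φ⟩` of vectors of the bosonic Fock space over a one-particle space with
orthonormal basis indexed by `ι`. The vectors of the Hilbert space are the square-summable ones;
creation and annihilation operators act on all amplitudes. -/
abbrev Fock (ι : Type) : Type := (ι →₀ ℕ) → ℂ

/-- `⟨Φ, Φ'⟩`. -/
def fockInner {ι : Type} (Φ Φ' : Fock ι) : ℂ := ∑' n, conj (Φ n) * Φ' n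

/-- The annihilation operator `a_k`: `a_k |n⟩ = √(n_k) |n - e_k⟩`. -/
def ann {ι : Type} (k : ι) (Φ : Fock ι) : Fock ι :=
  fun n => (Real.sqrt (n k + 1) : ℂ) * Φ (n + Finsupp.single k 1)

/-- The creation operator `a_k†`: `a_k† |n⟩ = √(n_k + 1) |n + e_k⟩`. -/
def cre {ι : Type} (k : ι) (Φ : Fock ι) : Fock ι :=
  fun n => (Real.sqrt (n k) : ℂ) * Φ (n - Finsupp.single k 1)

/-- The vacuum vector. -/
def vacuum {ι : Type} : Fock ι := fun n => open Classical in if n = 0 then 1 else 0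

/-- The coherent state `|z⟩ = exp (-|z|²/2 + z a₀†) Ω` in the Fock space of the condensate `Ran P`,
which has the single mode `k = 0`. -/
def coherent (z : ℂ) : Fock Unit :=
  fun m => Complex.exp (-(‖z‖ : ℂ) ^ 2 / 2) *
    ∑' j : ℕ, z ^ j / (j.factorial : ℂ) * ((cre ())^[j] vacuum) m

theorem cre_iterate_vacuum (j : ℕ) (m : Unit →₀ ℕ) :
    ((cre ())^[j] vacuum) m = if m () = j then (Real.sqrt (j.factorial : ℝ) : ℂ) else 0 := by
  induction j generalizing m with
  | zero =>
    have : m = 0 ↔ m () = 0 := by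
      constructor
      · rintro rfl; rfl
      · intro h; ext; exact h
    simp [vacuum, this]
  | succ j ih =>
    rw [Function.iterate_succ_apply']
    simp only [cre, ih, Finsupp.coe_tsub, Pi.sub_apply, Finsupp.single_eq_same]
    by_cases h : m () = j + 1
    · have h1 : m () - 1 = j := by omega
      rw [if_pos h1, if_pos h, h, ← Complex.ofReal_mul, ← Real.sqrt_mul (by positivity),
        Nat.factorial_succ]
      push_cast
      rfl
    · rw [if_neg h]
      by_cases h0 : m () = 0
      · simp [h0]
      · rw [if_neg (by omega), mul_zero]

theorem coherent_apply (z : ℂ) (m : Unit →₀ ℕ) :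
    coherent z m = Complex.exp (-(‖z‖ : ℂ) ^ 2 / 2) * z ^ m () /
      (Real.sqrt ((m ()).factorial : ℝ) : ℂ) := by
  have h : (Real.sqrt ((m ()).factorial : ℝ) : ℂ) ≠ 0 := by
    rw [Complex.ofReal_ne_zero]; positivity
  have h2 : ((m ()).factorial : ℂ) = (Real.sqrt ((m ()).factorial : ℝ) : ℂ) ^ 2 := by
    rw [← Complex.ofReal_pow, Real.sq_sqrt (by positivity)]; simp
  rw [coherent, tsum_eq_single (m ()), cre_iterate_vacuum, if_pos rfl, h2]
  · field_simp
  · intro j hj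
    rw [cre_iterate_vacuum, if_neg (Ne.symm hj), mul_zero]

/-- `a₀ |z⟩ = z |z⟩`. -/
theorem ann_coherent (z : ℂ) : ann () (coherent z) = z • coherent z := by
  funext m
  have h : (Real.sqrt ((m ()).factorial : ℝ) : ℂ) ≠ 0 := by
    rw [Complex.ofReal_ne_zero]; positivity
  have h1 : (Real.sqrt ((m () : ℝ) + 1) : ℂ) ≠ 0 := by
    rw [Complex.ofReal_ne_zero]; positivity
  have h2 : (Real.sqrt (((m () + 1).factorial : ℕ) : ℝ) : ℂ) =
      Real.sqrt ((m () : ℝ) + 1) * Real.sqrt ((m ()).factorial : ℝ) := by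
    rw [← Complex.ofReal_mul, ← Real.sqrt_mul (by positivity), Nat.factorial_succ]
    push_cast
    rfl
  simp only [ann, coherent_apply, Pi.smul_apply, smul_eq_mul, Finsupp.coe_add, Pi.add_apply,
    Finsupp.single_eq_same, h2]
  field_simp
  ring

/-- The nonzero momenta, which label the plane wave basis of `Ran Q`. -/
abbrev ExcMode (d : ℕ) : Type := {k : Mode d // k ≠ 0}

/-- `-k`. -/
def negMode {d : ℕ} (k : ExcMode d) : ExcMode d := ⟨-k.1, neg_ne_zero.mpr k.2⟩

/-- The basis vector `|m⟩ ⊗ |n⟩` of `F(Ran P) ⊗ F(Ran Q) = F(L²(Λ))`: `m` particles of momentum `0`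
together with the excitations `n`. -/
def joinOcc {d : ℕ} (m : Unit →₀ ℕ) (n : ExcMode d →₀ ℕ) : Mode d →₀ ℕ :=
  Finsupp.single 0 (m ()) + n.embDomain (Function.Embedding.subtype _)

/-- The partial inner product `⟨z|Ψ⟩`, a vector of `F(Ran Q)`. -/
def braCoherent {d : ℕ} (z : ℂ) (Ψ : Fock (Mode d)) : Fock (ExcMode d) :=
  fun n => ∑' m, conj (coherent z m) * Ψ (joinOcc m n)

/-- The occupation numbers of the momenta `κ 0, …, κ (N - 1)`. -/
def occ {d N : ℕ} (κ : Fin N → Mode d) : Mode d →₀ ℕ := ∑ j, Finsupp.single (κ j) 1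

/-- The inclusion of `L²_sym(Λ^N)` in `F(L²(Λ))`: the amplitude `⟨n|Ψ⟩`, where
`|n⟩ = ∏_k (a_k†)^{n_k} / √(n_k!) Ω = √(∏_k n_k! / N!) ∑_{κ with occupation n} ⊗_j e_{κ j}`. -/
def toFock {d : ℕ} {ℓ : ℝ} [Fact (0 < ℓ)] {N : ℕ} (Ψ : Config d ℓ N → ℂ) : Fock (Mode d) :=
  fun n => (Real.sqrt ((n.prod fun _ m => (m.factorial : ℝ)) / (N.factorial : ℝ)) : ℂ) *
    ∑' κ : {κ : Fin N → Mode d // occ κ = n}, momentumCoef Ψ κ.1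

/-! ### The `z`-dependent Hamiltonian -/

/-- `ρ_z = |z|² / |Λ|`. -/
def rhoZ (d : ℕ) (ℓ : ℝ) (z : ℂ) : ℝ := ‖z‖ ^ 2 / ℓ ^ d

/-- `a_k` in `K(z)`, with the phase of `z = |z| exp (i θ)` absorbed: `exp (-i θ) a_k`. -/
def annZ {d : ℕ} (z : ℂ) (k : ExcMode d) (Φ : Fock (ExcMode d)) : Fock (ExcMode d) :=
  Complex.exp (-(z.arg : ℂ) * Complex.I) • ann k Φ

/-- `a_k†` in `K(z)`, with the phase of `z = |z| exp (i θ)` absorbed: `exp (i θ) a_k†`. -/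
def creZ {d : ℕ} (z : ℂ) (k : ExcMode d) (Φ : Fock (ExcMode d)) : Fock (ExcMode d) :=
  Complex.exp ((z.arg : ℂ) * Complex.I) • cre k Φ

/-- `A_k = k² + ρ_z ĝ(k)`. -/
def coefA {d : ℕ} (ℓ : ℝ) [Fact (0 < ℓ)] (v φ : ℝ → ℝ) (z : ℂ) (k : ExcMode d) : ℂ :=
  kSq ℓ k.1 + rhoZ d ℓ z * fourierCoefTorus ℓ (gFn v φ) k.1

/-- `B_k = ρ_z ĝ(k)`. -/
def coefB {d : ℕ} (ℓ : ℝ) [Fact (0 < ℓ)] (v φ : ℝ → ℝ) (z : ℂ) (k : ExcMode d) : ℂ :=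
  rhoZ d ℓ z * fourierCoefTorus ℓ (gFn v φ) k.1

/-- `B_k (a_k† a_{-k}† + a_k a_{-k}) Φ`. -/
def pairTerm {d : ℕ} (ℓ : ℝ) [Fact (0 < ℓ)] (v φ : ℝ → ℝ) (z : ℂ) (Φ : Fock (ExcMode d))
    (n : ExcMode d →₀ ℕ) (k : ExcMode d) : ℂ :=
  coefB ℓ v φ z k *
    (creZ z k (creZ z (negMode k) Φ) n + annZ z k (annZ z (negMode k) Φ) n)

/-- The Bogoliubov Hamiltonian
`(1/2) ∑_{k≠0} A_k (a_k† a_k + a_{-k}† a_{-k}) + (1/2) ∑_{k≠0} B_k (a_k† a_{-k}† + a_k a_{-k})`. -/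
def bogHam {d : ℕ} (ℓ : ℝ) [Fact (0 < ℓ)] (v φ : ℝ → ℝ) (z : ℂ) (Φ : Fock (ExcMode d)) :
    Fock (ExcMode d) :=
  fun n => 1 / 2 * (∑' k : ExcMode d, coefA ℓ v φ z k *
      (creZ z k (annZ z k Φ) n + creZ z (negMode k) (annZ z (negMode k) Φ) n)) +
    1 / 2 * ∑' k : ExcMode d, pairTerm ℓ v φ z Φ n k

/-- `Q(z) = (1/2) ρ_z² |Λ| (ĝ(0) + (gω)^(0)) + K^Bog`. -/
def opQ {d : ℕ} (ℓ : ℝ) [Fact (0 < ℓ)] (v φ : ℝ → ℝ) (z : ℂ) (Φ : Fock (ExcMode d)) :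
    Fock (ExcMode d) :=
  fun n => 1 / 2 * (rhoZ d ℓ z : ℂ) ^ 2 * (ℓ : ℂ) ^ d *
      (fourierCoefTorus ℓ (gFn v φ) (0 : Mode d) +
        fourierCoefTorus ℓ (gOmegaFn v φ) (0 : Mode d)) * Φ n +
    bogHam ℓ v φ z Φ n

/-- `Q₂^ex(z) = ρ_z ∑_{k≠0} ((gω)^(k) + (gω)^(0)) a_k† a_k`. -/
def opQ2ex {d : ℕ} (ℓ : ℝ) [Fact (0 < ℓ)] (v φ : ℝ → ℝ) (z : ℂ) (Φ : Fock (ExcMode d)) :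
    Fock (ExcMode d) :=
  fun n => (rhoZ d ℓ z : ℂ) * ∑' k : ExcMode d,
    (fourierCoefTorus ℓ (gOmegaFn v φ) k.1 + fourierCoefTorus ℓ (gOmegaFn v φ) (0 : Mode d)) *
      creZ z k (annZ z k Φ) n

/-- `n₊ = ∑_{k≠0} a_k† a_k`. -/
def opNplus {d : ℕ} (Φ : Fock (ExcMode d)) : Fock (ExcMode d) :=
  fun n => ∑' k : ExcMode d, cre k (ann k Φ) n

/-- `K(z) = Q(z) + Q₂^ex(z) + (ρ_z - ρ) n₊ ĝ(0) - ρ ρ_z |Λ| ĝ(0) + ρ² |Λ| ĝ(0)`. -/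
def opK {d : ℕ} (ℓ : ℝ) [Fact (0 < ℓ)] (v φ : ℝ → ℝ) (ρ : ℝ) (z : ℂ) (Φ : Fock (ExcMode d)) :
    Fock (ExcMode d) :=
  fun n => opQ ℓ v φ z Φ n + opQ2ex ℓ v φ z Φ n +
    ((rhoZ d ℓ z : ℂ) - ρ) * fourierCoefTorus ℓ (gFn v φ) (0 : Mode d) * opNplus Φ n -
    (ρ : ℂ) * rhoZ d ℓ z * (ℓ : ℂ) ^ d * fourierCoefTorus ℓ (gFn v φ) (0 : Mode d) * Φ n +
    (ρ : ℂ) ^ 2 * (ℓ : ℂ) ^ d * fourierCoefTorus ℓ (gFn v φ) (0 : Mode d) * Φ n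

/-- `⟨Φ(z), K(z) Φ(z)⟩` with `Φ(z) = ⟨z|Ψ⟩`, i.e. `⟨Ψ, K(z) |z⟩⟨z| Ψ⟩`. -/
def expectK {d : ℕ} {ℓ : ℝ} [Fact (0 < ℓ)] {N : ℕ} (v φ : ℝ → ℝ) (ρ : ℝ)
    (Ψ : Config d ℓ N → ℂ) (z : ℂ) : ℂ :=
  fockInner (braCoherent z (toFock Ψ)) (opK ℓ v φ ρ z (braCoherent z (toFock Ψ)))

/-- All sums and integrals occurring in `⟨Ψ, (π⁻¹ ∫ K(z) |z⟩⟨z| dz + Q₃^ren + Q₄^ren) Ψ⟩` converge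
absolutely (the sums over `k` not listed have only finitely many nonzero terms). -/
def TermsConverge {d : ℕ} {ℓ : ℝ} [Fact (0 < ℓ)] {N : ℕ} (v φ : ℝ → ℝ) (ρ : ℝ)
    (Ψ : Config d ℓ N → ℂ) : Prop :=
  (∀ z n, Summable (pairTerm ℓ v φ z (braCoherent z (toFock Ψ)) n)) ∧
  (∀ z, Summable fun n => conj (braCoherent z (toFock Ψ) n) *
    opK ℓ v φ ρ z (braCoherent z (toFock Ψ)) n) ∧
  Integrable (expectK v φ ρ Ψ) ∧
  ∀ i j, i ≠ j → Integrable (q3Integrand v φ Ψ i j) ∧ Integrable (q4Integrand v φ Ψ i j)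

end

end BoseGas

/-! The proof is an algebraic identity in momentum space, made legitimate by a few estimates on the
scattering solution.

For a pair `i ≠ j` write `Ψ = A + q`, where `q = Q_j Q_i Ψ` and `A` is the part with at least one of
the two particles in the condensate. Since `g = v (1 - ω)`, completing the square gives `v |A + q|²
= v |ω A + q|² + 2 g Re (conj A q) + (g + g ω) |A|²` (`interaction_pointwise`). The square is the
integrand of `Q₄^ren`. In the cross term the parts of `A` with exactly one condensed particle give
`Q₃^ren`, and the part with two condensed particles creates pairs `k, -k`. In `(g + g ω) |A|²` only
direct and exchange matrix elements survive, and by permutation symmetry both are diagonal in the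
momentum basis (`integral_lowIntegrand`).

On the other side, `Ψ` has exactly `N` particles, so `⟨z|Ψ⟩` has at the excitation pattern `n` the
single amplitude `exp (-|z|²/2) (conj z)^m / √(m!)`, up to the `z`-independent factor `excAmp Ψ n`,
with `m = N - |n|`. The phases put into the operators make `⟨Φ(z), K(z) Φ(z)⟩` a series of terms
`exp (-|z|²) |z|^(2p)`, and `π⁻¹ ∫ exp (-|z|²) |z|^(2p) dz = p!` evaluates it (`expectK_integral`).
Pair terms acquire the factor `√(m (m - 1))` and agree exactly with those of `H_N`. Diagonal terms
acquire `m + 1` and `(m + 1) (m + 2)`, because the coherent integral orders operators antinormally.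
The terms of `K(z)` containing `ρ` cancel on `N` particles up to this same effect. The contributions
quadratic in the particle numbers cancel in the difference, which is thus multiplication in momentum
space by a real symmetric function of size `O(N ĝ(0) / |Λ|)` (`remainder_eq`, `abs_remainder_le`);
this multiplier is `R₀`. The bound uses `0 ≤ g ω ≤ g`, that is `0 ≤ φ ≤ 1` on the support of `v`.

The analytic difficulty is the pair creation term. As `v` is only integrable, `ĝ(k)` need not decay,
and `∑_k ĝ(k) t̂(k)`, with `t` the density of pairs in `x_i - x_j`, has to be shown to converge to
`|Λ| ∫ g t`. Cauchy–Schwarz and the finite kinetic energy place `t` in `H¹`. The scattering equation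
places `g` in `H⁻¹` (`ScatteringData.summable_coef_sq_div`), because `g = 2 Δφ` in the ball and `∇φ`
is square integrable there. For the latter, the weak equation is reduced to `φ₀' = r^(1-d) W` with
the flux `W`. A maximum principle gives `φ₀ ≥ 0`, so `W` and `φ₀` are nondecreasing, `φ₀'` is
integrable, and `r^(d-1) φ₀'² = W φ₀'` is integrable near the origin. Finally, the pairing of `g ∈
L¹ ∩ H⁻¹` with `t ∈ H¹` is computed by truncating `t`, which does not increase its `H¹` norm
(`hasSum_integral_mul_of_h1`). -/

set_option linter.unusedSectionVars false

namespace BoseGas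

noncomputable section

/-! ### Fourier analysis with respect to a separating group of characters -/

section Characters

open Filter Topology

variable {K X : Type*} [AddCommGroup K] [MetricSpace X] [CompactSpace X] [MeasurableSpace X]
  [BorelSpace X]

/-- A family of continuous functions, multiplicative in the label, separating the points and with
vanishing mean for nonzero labels. -/
structure IsCharFamily (μ : Measure X) (e : K → C(X, ℂ)) : Prop where
  zero : e 0 = 1
  add : ∀ k l, e (k + l) = e k * e l
  neg : ∀ k x, e (-k) x = conj (e k x)
  separates : ∀ x y, x ≠ y → ∃ k, e k x ≠ e k y
  integral : ∀ k, k ≠ 0 → ∫ x, e k x ∂μ = 0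

/-- Unnormalized Fourier coefficients. -/
def charCoef (μ : Measure X) (e : K → C(X, ℂ)) (f : X → ℂ) (k : K) : ℂ :=
  ∫ x, conj (e k x) * f x ∂μ

namespace IsCharFamily

variable {μ : Measure X} {e : K → C(X, ℂ)}

theorem norm_apply (he : IsCharFamily μ e) (k : K) (x : X) : ‖e k x‖ = 1 := by
  have h : e k x * conj (e k x) = 1 := by
    rw [← he.neg, ← ContinuousMap.mul_apply, ← he.add, add_neg_cancel, he.zero]; rfl
  rw [Complex.mul_conj, Complex.normSq_eq_norm_sq] at h
  have h2 : ‖e k x‖ ^ 2 = 1 := by exact_mod_cast h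
  exact (pow_eq_one_iff_of_nonneg (norm_nonneg _) two_ne_zero).1 h2

theorem conj_mul_integrable (he : IsCharFamily μ e) {f : X → ℂ} (hf : Integrable f μ) (k : K) :
    Integrable (fun x => conj (e k x) * f x) μ := by
  refine hf.bdd_mul (c := 1) (by fun_prop) (ae_of_all _ fun x => ?_)
  simp [he.norm_apply]

/-- Stone–Weierstrass. A product of characters is a character, so the span is already a subalgebra;
conjugation corresponds to `k ↦ -k`, and the points are separated by assumption. -/
theorem span_dense (he : IsCharFamily μ e) :
    (Submodule.span ℂ (Set.range e)).topologicalClosure = ⊤ := by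
  have key : (Algebra.adjoin ℂ (Set.range e)).toSubmodule = Submodule.span ℂ (Set.range e) := by
    apply Algebra.adjoin_eq_span_of_subset
    refine .trans (fun x ↦ Submonoid.closure_induction (fun _ ↦ id) ⟨0, he.zero⟩ ?_)
      Submodule.subset_span
    rintro _ _ _ _ ⟨m, rfl⟩ ⟨n, rfl⟩
    exact ⟨m + n, he.add m n⟩
  let A : StarSubalgebra ℂ C(X, ℂ) :=
    { toSubalgebra := Algebra.adjoin ℂ (Set.range e)
      star_mem' := by
        change Algebra.adjoin ℂ (Set.range e) ≤ star (Algebra.adjoin ℂ (Set.range e))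
        refine Algebra.adjoin_le ?_
        rintro _ ⟨n, rfl⟩
        refine Algebra.subset_adjoin ⟨-n, ?_⟩
        ext1 x
        simp only [he.neg, starRingEnd_apply, ContinuousMap.star_apply] }
  have hA : A.topologicalClosure = ⊤ := by
    apply ContinuousMap.starSubalgebra_topologicalClosure_eq_top_of_separatesPoints
    intro x y hxy
    obtain ⟨k, hk⟩ := he.separates x y hxy
    exact ⟨_, ⟨e k, Algebra.subset_adjoin ⟨k, rfl⟩, rfl⟩, hk⟩
  rw [← key]
  exact congr_arg (Subalgebra.toSubmodule <| StarSubalgebra.toSubalgebra ·) hA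

variable [IsFiniteMeasure μ]

theorem integral_conj_mul (he : IsCharFamily μ e) (k l : K) [Decidable (k = l)] :
    ∫ x, e l x * conj (e k x) ∂μ = if k = l then (μ.real Set.univ : ℂ) else 0 := by
  have h : ∀ x, e l x * conj (e k x) = e (l - k) x := fun x => by
    rw [sub_eq_add_neg, he.add, ContinuousMap.mul_apply, he.neg]
  simp_rw [h]
  split_ifs with hkl
  · subst hkl
    simp [he.zero]
  · exact he.integral _ (sub_ne_zero.2 (Ne.symm hkl))

theorem orthonormal (he : IsCharFamily μ e) (hμ : 0 < μ.real Set.univ) :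
    Orthonormal ℂ (fun k => ((Real.sqrt (μ.real Set.univ))⁻¹ : ℂ) •
      ContinuousMap.toLp (E := ℂ) 2 μ ℂ (e k)) := by
  classical
  rw [orthonormal_iff_ite]
  intro k l
  rw [inner_smul_left, inner_smul_right, ContinuousMap.inner_toLp, he.integral_conj_mul]
  split_ifs
  · rw [← Complex.ofReal_inv, Complex.conj_ofReal, ← Complex.ofReal_mul, ← Complex.ofReal_mul,
      Complex.ofReal_eq_one, ← mul_assoc, ← mul_inv, Real.mul_self_sqrt hμ.le,
      inv_mul_cancel₀ hμ.ne']
  · simp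

theorem span_toLp_dense (he : IsCharFamily μ e) (hμ : 0 < μ.real Set.univ) :
    (Submodule.span ℂ (Set.range (fun k => ((Real.sqrt (μ.real Set.univ))⁻¹ : ℂ) •
      ContinuousMap.toLp (E := ℂ) 2 μ ℂ (e k)))).topologicalClosure = ⊤ := by
  have h1 : (Submodule.span ℂ (Set.range (fun k => ContinuousMap.toLp (E := ℂ) 2 μ ℂ
      (e k)))).topologicalClosure = ⊤ := by
    simpa only [Submodule.map_span, ContinuousLinearMap.coe_coe, ← Set.range_comp,
      Function.comp_def] using (ContinuousMap.toLp_denseRange ℂ μ ℂ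
        (by simp : (2 : ENNReal) ≠ ⊤)).topologicalClosure_map_submodule he.span_dense
  rw [eq_top_iff, ← h1]
  refine Submodule.topologicalClosure_mono (Submodule.span_le.2 ?_)
  rintro _ ⟨k, rfl⟩
  have hs : ((Real.sqrt (μ.real Set.univ)) : ℂ) ≠ 0 := by
    rw [Complex.ofReal_ne_zero]; positivity
  have := Submodule.smul_mem _ ((Real.sqrt (μ.real Set.univ)) : ℂ)
    (Submodule.subset_span (R := ℂ) (Set.mem_range_self (f := fun k =>
      ((Real.sqrt (μ.real Set.univ))⁻¹ : ℂ) • ContinuousMap.toLp (E := ℂ) 2 μ ℂ (e k)) k))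
  simpa [smul_smul, hs] using this

/-- The Hilbert basis of normalized characters. -/
def basis (he : IsCharFamily μ e) (hμ : 0 < μ.real Set.univ) : HilbertBasis K ℂ (Lp ℂ 2 μ) :=
  HilbertBasis.mk (he.orthonormal hμ) (he.span_toLp_dense hμ).ge

theorem basis_repr (he : IsCharFamily μ e) (hμ : 0 < μ.real Set.univ) (f : Lp ℂ 2 μ) (k : K) :
    (he.basis hμ).repr f k = ((Real.sqrt (μ.real Set.univ))⁻¹ : ℂ) * charCoef μ e f k := by
  rw [HilbertBasis.repr_apply_apply, basis, HilbertBasis.coe_mk, inner_smul_left, L2.inner_def,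
    ← Complex.ofReal_inv, Complex.conj_ofReal, charCoef]
  congr 1
  apply integral_congr_ae
  filter_upwards [ContinuousMap.coeFn_toLp (p := 2) (𝕜 := ℂ) μ (e k)] with x hx
  rw [hx, RCLike.inner_apply, mul_comm]

theorem charCoef_congr {f g : X → ℂ} (h : f =ᵐ[μ] g) : charCoef μ e f = charCoef μ e g := by
  funext k
  exact integral_congr_ae (h.mono fun x hx => by simp only [hx])

/-- Parseval's identity. -/
theorem hasSum_conj_mul (he : IsCharFamily μ e) (hμ : 0 < μ.real Set.univ) {f g : X → ℂ}
    (hf : MemLp f 2 μ) (hg : MemLp g 2 μ) :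
    HasSum (fun k => conj (charCoef μ e f k) * charCoef μ e g k)
      (μ.real Set.univ * ∫ x, conj (f x) * g x ∂μ) := by
  have h := ((he.basis hμ).hasSum_inner_mul_inner (hf.toLp f) (hg.toLp g)).mul_left
    (μ.real Set.univ : ℂ)
  have hV : (μ.real Set.univ : ℂ) = (Real.sqrt (μ.real Set.univ) : ℂ) ^ 2 := by
    rw [← Complex.ofReal_pow, Real.sq_sqrt hμ.le]
  have hs : ((Real.sqrt (μ.real Set.univ)) : ℂ) ≠ 0 := by
    rw [Complex.ofReal_ne_zero]; positivity
  have h1 : (fun k => conj (charCoef μ e f k) * charCoef μ e g k) = fun k =>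
      (μ.real Set.univ : ℂ) * (inner ℂ (hf.toLp f) (he.basis hμ k) *
        inner ℂ (he.basis hμ k) (hg.toLp g)) := by
    funext k
    rw [← inner_conj_symm, ← HilbertBasis.repr_apply_apply, ← HilbertBasis.repr_apply_apply,
      basis_repr, basis_repr, charCoef_congr hf.coeFn_toLp, charCoef_congr hg.coeFn_toLp, map_mul,
      ← Complex.ofReal_inv, Complex.conj_ofReal, Complex.ofReal_inv, hV]
    field_simp
  have h2 : ∫ x, conj (f x) * g x ∂μ = inner ℂ (hf.toLp f) (hg.toLp g) := by
    rw [L2.inner_def]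
    apply integral_congr_ae
    filter_upwards [hf.coeFn_toLp, hg.coeFn_toLp] with x h1 h2
    rw [h1, h2, RCLike.inner_apply, mul_comm]
  rw [h1, h2]
  exact h

theorem hasSum_norm_sq (he : IsCharFamily μ e) (hμ : 0 < μ.real Set.univ) {f : X → ℂ}
    (hf : MemLp f 2 μ) :
    HasSum (fun k => ‖charCoef μ e f k‖ ^ 2) (μ.real Set.univ * ∫ x, ‖f x‖ ^ 2 ∂μ) := by
  have h := he.hasSum_conj_mul hμ hf hf
  have h2 : ∀ z : ℂ, conj z * z = ((‖z‖ ^ 2 : ℝ) : ℂ) := fun z => by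
    rw [mul_comm, Complex.mul_conj, Complex.normSq_eq_norm_sq]
  simp_rw [h2, integral_complex_ofReal, ← Complex.ofReal_mul] at h
  exact Complex.hasSum_ofReal.1 h

/-- Riesz–Fischer. -/
theorem exists_memLp_charCoef_eq (he : IsCharFamily μ e) (hμ : 0 < μ.real Set.univ) {c : K → ℂ}
    (hc : Summable fun k => ‖c k‖ ^ 2) : ∃ f : X → ℂ, MemLp f 2 μ ∧ charCoef μ e f = c := by
  have hs : ((Real.sqrt (μ.real Set.univ)) : ℂ) ≠ 0 := by
    rw [Complex.ofReal_ne_zero]; positivity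
  have hm : Memℓp (fun k => ((Real.sqrt (μ.real Set.univ))⁻¹ : ℂ) * c k) 2 := by
    rw [memℓp_gen_iff (by norm_num)]
    simpa [mul_pow] using hc.mul_left _
  refine ⟨_, Lp.memLp ((he.basis hμ).repr.symm ⟨_, hm⟩), ?_⟩
  funext k
  have h := he.basis_repr hμ ((he.basis hμ).repr.symm ⟨_, hm⟩) k
  rw [LinearIsometryEquiv.apply_symm_apply] at h
  exact (mul_left_cancel₀ (inv_ne_zero hs) h).symm

/-- An integrable function with vanishing Fourier coefficients is zero almost everywhere. -/
theorem ae_eq_zero (he : IsCharFamily μ e) {f : X → ℂ} (hf : Integrable f μ)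
    (h : ∀ k, charCoef μ e f k = 0) : f =ᵐ[μ] 0 := by
  -- Pairing with `f` is bounded on `C(X, ℂ)` and kills every character, hence the closure of their
  -- span, which is the whole space.
  let T : C(X, ℂ) →L[ℂ] ℂ := LinearMap.mkContinuous
    { toFun := fun u => ∫ x, u x * f x ∂μ
      map_add' := fun u w => by
        simp only [ContinuousMap.add_apply, add_mul]
        rw [integral_add] <;> exact hf.bdd_mul (c := ‖_‖) (by fun_prop) (ae_of_all _ fun x => ContinuousMap.norm_coe_le_norm _ x)
      map_smul' := fun a u => by
        simp only [ContinuousMap.smul_apply, smul_eq_mul, mul_assoc, RingHom.id_apply]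
        exact integral_const_mul _ _ } (∫ x, ‖f x‖ ∂μ) (fun u => by
      refine (norm_integral_le_integral_norm _).trans ?_
      rw [mul_comm, ← integral_const_mul]
      refine integral_mono_of_nonneg (ae_of_all _ fun x => norm_nonneg _) (hf.norm.const_mul _)
        (ae_of_all _ fun x => ?_)
      simp only [norm_mul]
      gcongr
      exact ContinuousMap.norm_coe_le_norm _ x)
  have hT : ∀ u, T u = 0 := by
    intro u
    have hu : u ∈ (Submodule.span ℂ (Set.range e)).topologicalClosure := by
      rw [he.span_dense]; trivial
    have hker : (Submodule.span ℂ (Set.range e)).topologicalClosure ≤ LinearMap.ker T.toLinearMap := by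
      refine Submodule.topologicalClosure_minimal _ (Submodule.span_le.2 ?_) T.isClosed_ker
      rintro _ ⟨k, rfl⟩
      have := h (-k)
      simp only [charCoef, he.neg, Complex.conj_conj] at this
      exact this
    exact hker hu
  apply ae_eq_zero_of_forall_setIntegral_isClosed_eq_zero hf
  intro F hF
  -- Continuous thickened indicators converge pointwise to the indicator of the closed set `F`, so
  -- the integral of `f` over `F` is a limit of pairings known to vanish.
  have hlim : Tendsto (fun n : ℕ => ∫ x, ((thickenedIndicator
      (Nat.one_div_pos_of_nat (α := ℝ) (n := n)) F x : ℝ) : ℂ) * f x ∂μ) atTop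
      (𝓝 (∫ x, F.indicator f x ∂μ)) := by
    refine tendsto_integral_of_dominated_convergence (fun x => ‖f x‖) (fun n => ?_) hf.norm
      (fun n => ae_of_all _ fun x => ?_) (ae_of_all _ fun x => ?_)
    · exact AEStronglyMeasurable.mul (Continuous.aestronglyMeasurable (by fun_prop)) hf.1
    · rw [norm_mul]
      refine mul_le_of_le_one_left (norm_nonneg _) ?_
      simpa using thickenedIndicator_le_one (Nat.one_div_pos_of_nat (α := ℝ) (n := n)) F x
    · have key := thickenedIndicator_tendsto_indicator_closure
        (fun n => Nat.one_div_pos_of_nat (α := ℝ) (n := n)) tendsto_one_div_add_atTop_nhds_zero_nat F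
      rw [hF.closure_eq, tendsto_pi_nhds] at key
      have hx := ((Complex.continuous_ofReal.tendsto _).comp
        ((NNReal.continuous_coe.tendsto _).comp (key x))).mul_const (f x)
      have hi : F.indicator f x =
          (((F.indicator (fun _ => (1 : NNReal)) x : NNReal) : ℝ) : ℂ) * f x := by
        by_cases hxF : x ∈ F <;> simp [hxF]
      rw [hi]
      exact hx
  rw [integral_indicator hF.measurableSet] at hlim
  refine tendsto_nhds_unique hlim ?_
  have : ∀ n : ℕ, ∫ x, ((thickenedIndicator
      (Nat.one_div_pos_of_nat (α := ℝ) (n := n)) F x : ℝ) : ℂ) * f x ∂μ = 0 := fun n =>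
    hT ⟨fun x => ((thickenedIndicator
      (Nat.one_div_pos_of_nat (α := ℝ) (n := n)) F x : ℝ) : ℂ), by fun_prop⟩
  simp_rw [this]
  exact tendsto_const_nhds

end IsCharFamily

end Characters

theorem hasSum_of_eq {ι E : Type*} [AddCommMonoid E] [TopologicalSpace E] {f g : ι → E} {a b : E}
    (h : HasSum f a) (hf : ∀ i, g i = f i) (ha : b = a) : HasSum g b := by
  rwa [funext hf, ha]

/-! ### Absolutely convergent series of characters -/

section Characters

open Filter Topology

variable {K X : Type*} [AddCommGroup K] [MetricSpace X] [CompactSpace X] [MeasurableSpace X]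
  [BorelSpace X]

namespace IsCharFamily

variable {μ : Measure X} {e : K → C(X, ℂ)} [IsFiniteMeasure μ]

theorem norm_char_le (he : IsCharFamily μ e) (k : K) : ‖e k‖ ≤ 1 :=
  (ContinuousMap.norm_le _ zero_le_one).2 fun x => (he.norm_apply k x).le

/-- An absolutely convergent Fourier series, as a continuous function. -/
theorem summable_smul (he : IsCharFamily μ e) {c : K → ℂ} (hc : Summable fun k => ‖c k‖) :
    Summable fun k => c k • e k := by
  refine .of_norm_bounded hc fun k => ?_
  rw [norm_smul]
  exact mul_le_of_le_one_right (norm_nonneg _) (he.norm_char_le k)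

/-- The series converges in the supremum norm, and integration against an integrable function is a
bounded functional on `C(X, ℂ)`; hence it may be integrated term by term. -/
theorem hasSum_integral_mul_series (he : IsCharFamily μ e) {c : K → ℂ}
    (hc : Summable fun k => ‖c k‖) {G : X → ℂ} (hG : Integrable G μ) :
    HasSum (fun k => c k * ∫ x, G x * e k x ∂μ) (∫ x, G x * (∑' k, c k • e k : C(X, ℂ)) x ∂μ) := by
  let T : C(X, ℂ) →L[ℂ] ℂ := LinearMap.mkContinuous
    { toFun := fun u => ∫ x, G x * u x ∂μ
      map_add' := fun u w => by
        simp only [ContinuousMap.add_apply, mul_add]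
        rw [integral_add] <;> exact hG.mul_bdd (c := ‖_‖) (by fun_prop)
          (ae_of_all _ fun x => ContinuousMap.norm_coe_le_norm _ x)
      map_smul' := fun a u => by
        simp only [ContinuousMap.smul_apply, smul_eq_mul, mul_left_comm _ a, RingHom.id_apply]
        exact integral_const_mul _ _ } (∫ x, ‖G x‖ ∂μ) (fun u => by
      refine (norm_integral_le_integral_norm _).trans ?_
      rw [← integral_mul_const]
      refine integral_mono_of_nonneg (ae_of_all _ fun x => norm_nonneg _) (hG.norm.mul_const _)
        (ae_of_all _ fun x => ?_)
      simp only [norm_mul]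
      gcongr
      exact ContinuousMap.norm_coe_le_norm _ x)
  have h := (he.summable_smul hc).hasSum.mapL T
  simp only [map_smul] at h
  exact h

theorem charCoef_neg (he : IsCharFamily μ e) (G : X → ℂ) (k : K) :
    charCoef μ e G (-k) = ∫ x, G x * e k x ∂μ := by
  simp only [charCoef, he.neg, Complex.conj_conj, mul_comm]

theorem charCoef_series (he : IsCharFamily μ e) {c : K → ℂ}
    (hc : Summable fun k => ‖c k‖) (k : K) :
    charCoef μ e (∑' k, c k • e k : C(X, ℂ)) k = μ.real Set.univ * c k := by
  classical
  have hG : Integrable (fun x => conj (e k x)) μ :=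
    .of_bound (Continuous.aestronglyMeasurable (by fun_prop)) 1
      (ae_of_all _ fun x => by simp [he.norm_apply])
  have h := he.hasSum_integral_mul_series hc hG
  have h2 : HasSum (fun l => c l * ∫ x, conj (e k x) * e l x ∂μ)
      (c k * (μ.real Set.univ : ℂ)) := by
    convert hasSum_ite_eq k (c k * (μ.real Set.univ : ℂ)) using 1
    funext l
    simp_rw [mul_comm (conj _)]
    rw [he.integral_conj_mul]
    by_cases hkl : k = l
    · subst hkl; simp
    · simp [hkl, Ne.symm hkl]
  rw [charCoef, h.unique h2, mul_comm]

/-- An integrable function with summable Fourier coefficients is given by its Fourier series. -/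
theorem ae_eq_series (he : IsCharFamily μ e) (hμ : 0 < μ.real Set.univ) {h : X → ℂ}
    (hh : Integrable h μ) (hs : Summable fun k => ‖charCoef μ e h k‖) :
    h =ᵐ[μ] (∑' k, ((μ.real Set.univ : ℂ)⁻¹ * charCoef μ e h k) • e k : C(X, ℂ)) := by
  have hs' : Summable fun k => ‖(μ.real Set.univ : ℂ)⁻¹ * charCoef μ e h k‖ := by
    simp_rw [norm_mul]; exact hs.mul_left _
  have hi : Integrable (∑' k, ((μ.real Set.univ : ℂ)⁻¹ * charCoef μ e h k) • e k : C(X, ℂ)) μ :=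
    .of_bound (by fun_prop) ‖_‖ (ae_of_all _ fun x => ContinuousMap.norm_coe_le_norm _ x)
  have hμ' : (μ.real Set.univ : ℂ) ≠ 0 := by exact_mod_cast hμ.ne'
  have key := he.ae_eq_zero (hh.sub hi) fun k => by
    have h1 := he.conj_mul_integrable hh k
    have h2 := he.conj_mul_integrable hi k
    have h3 : charCoef μ e (h - (∑' k, ((μ.real Set.univ : ℂ)⁻¹ * charCoef μ e h k) • e k :
        C(X, ℂ))) k = charCoef μ e h k - charCoef μ e
          (∑' k, ((μ.real Set.univ : ℂ)⁻¹ * charCoef μ e h k) • e k : C(X, ℂ)) k := by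
      simp only [charCoef, Pi.sub_apply, mul_sub]
      exact integral_sub h1 h2
    rw [h3, he.charCoef_series hs', mul_inv_cancel_left₀ hμ', sub_self]
  filter_upwards [key] with x hx
  exact sub_eq_zero.1 hx

/-- The integral of a product of integrable functions, if the second one has summable Fourier
coefficients. -/
theorem hasSum_integral_mul (he : IsCharFamily μ e) (hμ : 0 < μ.real Set.univ) {G h : X → ℂ}
    (hG : Integrable G μ) (hh : Integrable h μ) (hs : Summable fun k => ‖charCoef μ e h k‖) :
    HasSum (fun k => charCoef μ e G (-k) * charCoef μ e h k)
      (μ.real Set.univ * ∫ x, G x * h x ∂μ) := by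
  have hs' : Summable fun k => ‖(μ.real Set.univ : ℂ)⁻¹ * charCoef μ e h k‖ := by
    simp_rw [norm_mul]; exact hs.mul_left _
  have hμ' : (μ.real Set.univ : ℂ) ≠ 0 := by exact_mod_cast hμ.ne'
  have key := (he.hasSum_integral_mul_series hs' hG).mul_left (μ.real Set.univ : ℂ)
  simp_rw [← he.charCoef_neg] at key
  refine hasSum_of_eq key (fun k => ?_) ?_
  · field_simp
  · congr 1
    apply integral_congr_ae
    filter_upwards [he.ae_eq_series hμ hh hs] with x hx
    rw [← hx]

end IsCharFamily

end Characters

/-! ### Plane waves -/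

section Torus

open Filter Topology

variable {d : ℕ} {ℓ : ℝ} [Fact (0 < ℓ)]

theorem continuous_planeWave (n : Mode d) : Continuous (planeWave (ℓ := ℓ) n) := by
  unfold planeWave; fun_prop

/-- The plane wave as a continuous function. -/
def torusChar (d : ℕ) (ℓ : ℝ) [Fact (0 < ℓ)] (n : Mode d) : C(Torus d ℓ, ℂ) :=
  ⟨planeWave n, continuous_planeWave n⟩

theorem planeWave_zero (x : Torus d ℓ) : planeWave 0 x = 1 := by simp [planeWave]

theorem planeWave_add (m n : Mode d) (x : Torus d ℓ) :
    planeWave (m + n) x = planeWave m x * planeWave n x := by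
  simp [planeWave, Finset.prod_mul_distrib]

theorem planeWave_neg (n : Mode d) (x : Torus d ℓ) : planeWave (-n) x = conj (planeWave n x) := by
  simp [planeWave]

theorem planeWave_arg_add (n : Mode d) (x y : Torus d ℓ) :
    planeWave n (x + y) = planeWave n x * planeWave n y := by
  simp only [planeWave, ← Finset.prod_mul_distrib]
  refine Finset.prod_congr rfl fun c _ => ?_
  simp [fourier_apply, smul_add, AddCircle.toCircle_add]

theorem planeWave_arg_zero (n : Mode d) : planeWave n (0 : Torus d ℓ) = 1 := by
  simp [planeWave]

theorem planeWave_arg_neg (n : Mode d) (x : Torus d ℓ) :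
    planeWave n (-x) = conj (planeWave n x) := by
  rw [← planeWave_neg]
  unfold planeWave
  refine Finset.prod_congr rfl fun c _ => ?_
  simp [fourier_apply]

theorem planeWave_separates {x y : Torus d ℓ} (h : x ≠ y) :
    ∃ n, planeWave n x ≠ planeWave n y := by
  obtain ⟨c, hc⟩ := Function.ne_iff.1 h
  have hs : ∀ x : Torus d ℓ, planeWave (Pi.single c 1) x = fourier 1 (x c) := fun x => by
    rw [planeWave, Finset.prod_eq_single c]
    · simp
    · intro b _ hb
      simp [Pi.single_eq_of_ne hb]
    · simp
  refine ⟨Pi.single c 1, ?_⟩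
  rw [hs, hs, fourier_one, fourier_one]
  intro h'
  exact hc (AddCircle.injective_toCircle (Fact.out : 0 < ℓ).ne' (Subtype.ext h'))

/-- Translation by `ℓ / (2 n)` preserves the measure and reverses the sign of the integrand. -/
theorem integral_fourier_eq_zero {n : ℤ} (hn : n ≠ 0) :
    ∫ x : AddCircle ℓ, (fourier n x : ℂ) = 0 :=
  integral_eq_zero_of_add_right_eq_neg (fourier_add_half_inv_index hn (Fact.out : 0 < ℓ))

theorem integral_planeWave {n : Mode d} (hn : n ≠ 0) :
    ∫ x : Torus d ℓ, planeWave n x = 0 := by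
  obtain ⟨c, hc⟩ := Function.ne_iff.1 hn
  simp only [planeWave]
  rw [integral_fintype_prod_volume_eq_prod (f := fun c (x : AddCircle ℓ) => (fourier (n c) x : ℂ))]
  exact Finset.prod_eq_zero (Finset.mem_univ c) (integral_fourier_eq_zero hc)

theorem isCharFamily_torusChar : IsCharFamily volume (torusChar d ℓ) where
  zero := by ext x; exact planeWave_zero x
  add k l := by ext x; exact planeWave_add k l x
  neg k x := planeWave_neg k x
  separates x y h := planeWave_separates h
  integral k hk := integral_planeWave hk

theorem volume_real_torus : (volume : Measure (Torus d ℓ)).real Set.univ = ℓ ^ d := by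
  have h : (0 : ℝ) < ℓ := Fact.out
  rw [Measure.real, volume_pi, Measure.pi_univ]
  simp [AddCircle.measure_univ, h.le]

theorem vol_pos : (0 : ℝ) < ℓ ^ d := pow_pos Fact.out _

theorem norm_planeWave (n : Mode d) (x : Torus d ℓ) : ‖planeWave n x‖ = 1 :=
  isCharFamily_torusChar.norm_apply n x

variable {N : ℕ}

/-- The plane waves on `Λ^N`. -/
def configChar (d : ℕ) (ℓ : ℝ) [Fact (0 < ℓ)] (N : ℕ) (κ : Fin N → Mode d) : C(Config d ℓ N, ℂ) :=
  ⟨fun x => ∏ j, planeWave (κ j) (x j), by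
    have := fun j => continuous_planeWave (ℓ := ℓ) (κ j)
    fun_prop⟩

theorem isCharFamily_configChar : IsCharFamily volume (configChar d ℓ N) where
  zero := by ext x; simp [configChar, planeWave_zero]
  add k l := by ext x; simp [configChar, planeWave_add, Finset.prod_mul_distrib]
  neg k x := by simp [configChar, planeWave_neg]
  separates x y h := by
    obtain ⟨j, hj⟩ := Function.ne_iff.1 h
    obtain ⟨n, hn⟩ := planeWave_separates hj
    have hs : ∀ x, configChar d ℓ N (Pi.single j n) x = planeWave n (x j) := fun x => by
      simp only [configChar, ContinuousMap.coe_mk]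
      rw [Finset.prod_eq_single j]
      · simp
      · intro b _ hb
        simp [Pi.single_eq_of_ne hb, planeWave_zero]
      · simp
    exact ⟨Pi.single j n, by rwa [hs, hs]⟩
  integral k hk := by
    obtain ⟨j, hj⟩ := Function.ne_iff.1 hk
    simp only [configChar, ContinuousMap.coe_mk]
    rw [integral_fintype_prod_volume_eq_prod (f := fun j (x : Torus d ℓ) => planeWave (k j) x)]
    exact Finset.prod_eq_zero (Finset.mem_univ j) (integral_planeWave hj)

theorem volume_real_config : (volume : Measure (Config d ℓ N)).real Set.univ = (ℓ ^ d) ^ N := by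
  have h : (0 : ℝ) < ℓ := Fact.out
  rw [Measure.real, volume_pi, Measure.pi_univ]
  have := volume_real_torus (d := d) (ℓ := ℓ)
  rw [Measure.real] at this
  simp [this]

theorem volume_real_config_pos : 0 < (volume : Measure (Config d ℓ N)).real Set.univ := by
  rw [volume_real_config]; exact pow_pos vol_pos _

theorem momentumCoef_eq (Ψ : Config d ℓ N → ℂ) (κ : Fin N → Mode d) :
    momentumCoef Ψ κ =
      ((Real.sqrt (ℓ ^ d))⁻¹ : ℂ) ^ N * charCoef volume (configChar d ℓ N) Ψ κ := by
  rw [charCoef, ← integral_const_mul, momentumCoef]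
  congr 1
  funext x
  simp only [configChar, Finset.prod_mul_distrib, Finset.prod_const, Finset.card_univ,
    Fintype.card_fin, map_mul, map_pow, ContinuousMap.coe_mk, ← Complex.ofReal_inv,
    Complex.conj_ofReal]
  ring

theorem momentumCoef_congr {Φ Ψ : Config d ℓ N → ℂ} (h : Φ =ᵐ[volume] Ψ) :
    momentumCoef Φ = momentumCoef Ψ := by
  funext κ
  rw [momentumCoef_eq, momentumCoef_eq, IsCharFamily.charCoef_congr h]

theorem sqrt_vol_ne_zero : ((Real.sqrt (ℓ ^ d)) : ℂ) ≠ 0 := by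
  have := vol_pos (d := d) (ℓ := ℓ)
  rw [Complex.ofReal_ne_zero]; positivity

theorem sqrt_vol_sq : ((Real.sqrt (ℓ ^ d)) : ℂ) ^ 2 = (ℓ : ℂ) ^ d := by
  rw [← Complex.ofReal_pow, Real.sq_sqrt vol_pos.le, Complex.ofReal_pow]

theorem hasSum_conj_momentumCoef_mul {Φ Ψ : Config d ℓ N → ℂ} (hΦ : MemLp Φ 2 volume)
    (hΨ : MemLp Ψ 2 volume) :
    HasSum (fun κ => conj (momentumCoef Φ κ) * momentumCoef Ψ κ) (∫ x, conj (Φ x) * Ψ x) := by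
  have h := (isCharFamily_configChar.hasSum_conj_mul volume_real_config_pos hΦ hΨ).mul_left
    (((ℓ : ℂ) ^ d) ^ N)⁻¹
  have hl : ((ℓ : ℂ) ^ d) ^ N ≠ 0 := by
    have := (pow_pos (vol_pos (d := d) (ℓ := ℓ)) N).ne'
    exact_mod_cast this
  rw [volume_real_config, Complex.ofReal_pow, Complex.ofReal_pow, inv_mul_cancel_left₀ hl] at h
  refine hasSum_of_eq h (fun κ => ?_) rfl
  rw [momentumCoef_eq, momentumCoef_eq, map_mul, map_pow, ← Complex.ofReal_inv,
    Complex.conj_ofReal, Complex.ofReal_inv, ← sqrt_vol_sq]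
  have h0 := pow_ne_zero N (sqrt_vol_ne_zero (d := d) (ℓ := ℓ))
  rw [inv_pow, ← pow_mul, mul_comm 2 N, pow_mul]
  field_simp

theorem conj_mul_self' (z : ℂ) : conj z * z = ((‖z‖ ^ 2 : ℝ) : ℂ) := by
  rw [mul_comm, Complex.mul_conj, Complex.normSq_eq_norm_sq]

theorem hasSum_norm_momentumCoef_sq {Ψ : Config d ℓ N → ℂ} (hΨ : MemLp Ψ 2 volume) :
    HasSum (fun κ => ‖momentumCoef Ψ κ‖ ^ 2) (∫ x, ‖Ψ x‖ ^ 2) := by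
  have h := hasSum_conj_momentumCoef_mul hΨ hΨ
  simp_rw [conj_mul_self', integral_complex_ofReal] at h
  exact Complex.hasSum_ofReal.1 h

/-- Relations among the projections `P_i` and `Q_i` are verified on momentum coefficients, where
these act as cutoffs, and are carried back to functions by this uniqueness. -/
theorem ae_eq_of_momentumCoef_eq {Φ Ψ : Config d ℓ N → ℂ} (hΦ' : Integrable Φ volume)
    (hΨ' : Integrable Ψ volume) (h : ∀ κ, momentumCoef Φ κ = momentumCoef Ψ κ) :
    Φ =ᵐ[volume] Ψ := by
  have key := isCharFamily_configChar.ae_eq_zero (hΦ'.sub hΨ') fun κ => by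
    have h1 := isCharFamily_configChar.conj_mul_integrable hΦ' κ
    have h2 := isCharFamily_configChar.conj_mul_integrable hΨ' κ
    have h3 := h κ
    rw [momentumCoef_eq, momentumCoef_eq] at h3
    have h4 := mul_left_cancel₀ (pow_ne_zero N (inv_ne_zero sqrt_vol_ne_zero)) h3
    simp only [charCoef, Pi.sub_apply, mul_sub] at h4 ⊢
    rw [integral_sub h1 h2, h4, sub_self]
  filter_upwards [key] with x hx
  exact sub_eq_zero.1 hx

end Torus

/-! ### The duality between `H¹` and integrable functions in `H⁻¹` on the torus -/

section Duality

open Filter Topology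

variable {d : ℕ} {ℓ : ℝ} [Fact (0 < ℓ)]

/-- The (unnormalized) Fourier coefficients on the torus. -/
abbrev torusCoef (f : Torus d ℓ → ℂ) (k : Mode d) : ℂ := charCoef volume (torusChar d ℓ) f k

theorem torusCoef_comp_add (h : Torus d ℓ → ℂ) (t : Torus d ℓ) (k : Mode d) :
    torusCoef (fun x => h (x + t)) k = planeWave k t * torusCoef h k := by
  have := integral_add_right_eq_self (μ := (volume : Measure (Torus d ℓ)))
    (fun y => conj (torusChar d ℓ k (y - t)) * h y) t
  simp only [add_sub_cancel_right] at this
  rw [torusCoef, charCoef, this, torusCoef, charCoef, ← integral_const_mul]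
  congr 1
  funext x
  simp only [torusChar, ContinuousMap.coe_mk, sub_eq_add_neg, planeWave_arg_add, planeWave_arg_neg,
    map_mul, Complex.conj_conj]
  ring

theorem kSq_nonneg (k : Mode d) : 0 ≤ kSq ℓ k := by unfold kSq; positivity

theorem kSq_eq_sum (k : Mode d) : kSq ℓ k = ∑ c, (2 * Real.pi / ℓ * k c) ^ 2 := by
  simp only [kSq, mul_pow, Finset.mul_sum]

theorem memLp_comp_add {h : Torus d ℓ → ℂ} (hh : MemLp h 2 volume) (t : Torus d ℓ) :
    MemLp (fun x => h (x + t)) 2 volume :=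
  hh.comp_measurePreserving (measurePreserving_add_right volume t)

/-- Parseval for difference quotients. -/
theorem hasSum_translate_sub {h : Torus d ℓ → ℂ} (hh : MemLp h 2 volume) (t : Torus d ℓ) :
    HasSum (fun k => ‖planeWave k t - 1‖ ^ 2 * ‖torusCoef h k‖ ^ 2)
      (ℓ ^ d * ∫ x, ‖h (x + t) - h x‖ ^ 2) := by
  have hm := (memLp_comp_add hh t).sub hh
  have key := (isCharFamily_torusChar (d := d) (ℓ := ℓ)).hasSum_norm_sq
    (by rw [volume_real_torus]; exact vol_pos) hm
  rw [volume_real_torus] at key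
  refine hasSum_of_eq key (fun k => ?_) rfl
  have h1 := isCharFamily_torusChar.conj_mul_integrable
    ((memLp_comp_add hh t).integrable one_le_two) k
  have h2 := isCharFamily_torusChar.conj_mul_integrable (hh.integrable one_le_two) k
  have h3 : charCoef volume (torusChar d ℓ) ((fun x => h (x + t)) - h) k =
      (planeWave k t - 1) * torusCoef h k := by
    rw [sub_mul, one_mul, ← torusCoef_comp_add]
    simp only [torusCoef, charCoef, Pi.sub_apply, mul_sub]
    exact integral_sub h1 h2
  rw [h3, norm_mul, mul_pow]

theorem planeWave_single (k : Mode d) (c : Fin d) (s : ℝ) :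
    planeWave k (Pi.single c (s : AddCircle ℓ)) =
      Complex.exp (Complex.I * ((2 * Real.pi / ℓ * k c * s : ℝ) : ℂ)) := by
  rw [planeWave, Finset.prod_eq_single c]
  · rw [Pi.single_eq_same, fourier_coe_apply]
    congr 1
    push_cast
    ring
  · intro b _ hb
    simp [Pi.single_eq_of_ne hb]
  · simp

theorem tendsto_exp_sub_one_div (θ : ℝ) :
    Tendsto (fun s : ℝ => ‖Complex.exp (Complex.I * ((θ * s : ℝ) : ℂ)) - 1‖ ^ 2 / s ^ 2)
      (𝓝[≠] 0) (𝓝 (θ ^ 2)) := by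
  have h1 : HasDerivAt (fun s : ℝ => Complex.exp (Complex.I * ((θ * s : ℝ) : ℂ)))
      (Complex.I * θ) 0 := by
    have h2 : HasDerivAt (fun s : ℝ => ((θ * s : ℝ) : ℂ)) ((θ * 1 : ℝ) : ℂ) 0 :=
      ((hasDerivAt_id (0 : ℝ)).const_mul θ).ofReal_comp
    have := (h2.const_mul Complex.I).cexp
    simpa using this
  have h2 := (h1.tendsto_slope.norm).pow 2
  have h3 : ‖Complex.I * (θ : ℂ)‖ ^ 2 = θ ^ 2 := by simp
  rw [h3] at h2
  refine h2.congr fun s => ?_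
  simp only [slope, vsub_eq_sub, sub_zero, mul_zero, Complex.ofReal_zero, Complex.exp_zero,
    norm_smul, mul_pow, norm_inv, Real.norm_eq_abs, inv_pow, sq_abs]
  ring

theorem norm_exp_sub_one_sq_le (θ s : ℝ) :
    ‖Complex.exp (Complex.I * ((θ * s : ℝ) : ℂ)) - 1‖ ^ 2 ≤ s ^ 2 * θ ^ 2 := by
  have h := Real.norm_exp_I_mul_ofReal_sub_one_le (x := θ * s)
  calc _ ≤ ‖θ * s‖ ^ 2 := by gcongr
    _ = s ^ 2 * θ ^ 2 := by rw [Real.norm_eq_abs, sq_abs]; ring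

/-- A contraction does not increase the directional `H¹` seminorms. -/
theorem sum_sq_mul_coef_le_of_contraction {h h' : Torus d ℓ → ℂ} (hh : MemLp h 2 volume)
    (hh' : MemLp h' 2 volume) (hc : ∀ x y, ‖h' x - h' y‖ ≤ ‖h x - h y‖) (c : Fin d)
    (hs : Summable fun k : Mode d => (2 * Real.pi / ℓ * k c) ^ 2 * ‖torusCoef h k‖ ^ 2)
    (F : Finset (Mode d)) :
    ∑ k ∈ F, (2 * Real.pi / ℓ * k c) ^ 2 * ‖torusCoef h' k‖ ^ 2 ≤
      ∑' k : Mode d, (2 * Real.pi / ℓ * k c) ^ 2 * ‖torusCoef h k‖ ^ 2 := by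
  -- As `s → 0` the symbol of the difference quotient tends to that of the derivative. On finitely
  -- many modes it is thus enough to bound the difference quotients of `h'` uniformly in `s`, and
  -- these are dominated pointwise by those of `h`.
  have hlim : Tendsto (fun s : ℝ => ∑ k ∈ F,
      ‖Complex.exp (Complex.I * ((2 * Real.pi / ℓ * k c * s : ℝ) : ℂ)) - 1‖ ^ 2 / s ^ 2 *
        ‖torusCoef h' k‖ ^ 2) (𝓝[≠] 0)
      (𝓝 (∑ k ∈ F, (2 * Real.pi / ℓ * k c) ^ 2 * ‖torusCoef h' k‖ ^ 2)) :=
    tendsto_finsetSum _ fun k _ => (tendsto_exp_sub_one_div _).mul_const _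
  refine le_of_tendsto hlim ?_
  filter_upwards [self_mem_nhdsWithin] with s hs0
  have hs2 : 0 < s ^ 2 := by have : s ≠ 0 := hs0; positivity
  set t : Torus d ℓ := Pi.single c (s : AddCircle ℓ) with ht
  have e1 := hasSum_translate_sub hh' t
  have e2 := hasSum_translate_sub hh t
  have hint : ∀ {f : Torus d ℓ → ℂ}, MemLp f 2 volume →
      Integrable (fun x => ‖f (x + t) - f x‖ ^ 2) volume := fun hf =>
    ((memLp_comp_add hf t).sub hf).integrable_norm_pow two_ne_zero
  have e3 : ℓ ^ d * ∫ x, ‖h' (x + t) - h' x‖ ^ 2 ≤ ℓ ^ d * ∫ x, ‖h (x + t) - h x‖ ^ 2 := by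
    refine mul_le_mul_of_nonneg_left (integral_mono (hint hh') (hint hh) fun x => ?_) vol_pos.le
    have := hc (x + t) x
    dsimp only
    gcongr
  have e4 : ∑ k ∈ F, ‖planeWave k t - 1‖ ^ 2 * ‖torusCoef h' k‖ ^ 2 ≤
      s ^ 2 * ∑' k : Mode d, (2 * Real.pi / ℓ * k c) ^ 2 * ‖torusCoef h k‖ ^ 2 := by
    refine (e1.summable.sum_le_tsum F fun _ _ => by positivity).trans ?_
    rw [e1.tsum_eq]
    refine e3.trans ?_
    rw [← e2.tsum_eq, ← tsum_mul_left]
    refine e2.summable.tsum_le_tsum (fun k => ?_) (hs.mul_left _)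
    rw [← mul_assoc]
    refine mul_le_mul_of_nonneg_right ?_ (by positivity)
    rw [ht, planeWave_single]
    exact norm_exp_sub_one_sq_le _ _
  rw [← div_le_iff₀' hs2, Finset.sum_div] at e4
  refine le_trans (le_of_eq (Finset.sum_congr rfl fun k _ => ?_)) e4
  rw [ht, planeWave_single]
  ring

/-- A contraction fixing `0` does not increase the `H¹` norm. -/
theorem h1_contraction {h h' : Torus d ℓ → ℂ} (hh : MemLp h 2 volume)
    (hh' : MemLp h' 2 volume) (hc : ∀ x y, ‖h' x - h' y‖ ≤ ‖h x - h y‖) (h0 : ∀ x, ‖h' x‖ ≤ ‖h x‖)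
    (hs : Summable fun k : Mode d => (1 + kSq ℓ k) * ‖torusCoef h k‖ ^ 2) :
    (Summable fun k : Mode d => (1 + kSq ℓ k) * ‖torusCoef h' k‖ ^ 2) ∧
      ∑' k : Mode d, (1 + kSq ℓ k) * ‖torusCoef h' k‖ ^ 2 ≤
        ∑' k : Mode d, (1 + kSq ℓ k) * ‖torusCoef h k‖ ^ 2 := by
  have hV : 0 < (volume : Measure (Torus d ℓ)).real Set.univ := by
    rw [volume_real_torus]; exact vol_pos
  have hexp : ∀ (f : Torus d ℓ → ℂ) (k : Mode d), (1 + kSq ℓ k) * ‖torusCoef f k‖ ^ 2 =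
      ‖torusCoef f k‖ ^ 2 + ∑ c, (2 * Real.pi / ℓ * k c) ^ 2 * ‖torusCoef f k‖ ^ 2 := fun f k => by
    rw [kSq_eq_sum, add_mul, one_mul, Finset.sum_mul]
  have hs0 := isCharFamily_torusChar.hasSum_norm_sq hV hh
  have hs0' := isCharFamily_torusChar.hasSum_norm_sq hV hh'
  have hsc : ∀ c, Summable fun k : Mode d => (2 * Real.pi / ℓ * k c) ^ 2 * ‖torusCoef h k‖ ^ 2 :=
    fun c => by
      refine hs.of_nonneg_of_le (fun k => by positivity) fun k => ?_
      refine mul_le_mul_of_nonneg_right ?_ (by positivity)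
      rw [kSq_eq_sum]
      have := Finset.single_le_sum (f := fun c => (2 * Real.pi / ℓ * k c) ^ 2)
        (fun i _ => by positivity) (Finset.mem_univ c)
      linarith
  have hF : ∀ F : Finset (Mode d), ∑ k ∈ F, (1 + kSq ℓ k) * ‖torusCoef h' k‖ ^ 2 ≤
      ∑' k : Mode d, (1 + kSq ℓ k) * ‖torusCoef h k‖ ^ 2 := fun F => by
    simp_rw [hexp]
    rw [Finset.sum_add_distrib, Finset.sum_comm,
      hs0.summable.tsum_add (summable_sum fun c _ => hsc c), Summable.tsum_finsetSum fun c _ => hsc c]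
    refine add_le_add ?_ (Finset.sum_le_sum fun c _ =>
      sum_sq_mul_coef_le_of_contraction hh hh' hc c (hsc c) F)
    refine (hs0'.summable.sum_le_tsum F fun _ _ => by positivity).trans ?_
    rw [hs0.tsum_eq, hs0'.tsum_eq]
    refine mul_le_mul_of_nonneg_left (integral_mono (hh'.integrable_norm_pow two_ne_zero)
      (hh.integrable_norm_pow two_ne_zero) fun x => ?_) hV.le
    have := h0 x
    dsimp only
    gcongr
  have hnn : ∀ k : Mode d, 0 ≤ (1 + kSq ℓ k) * ‖torusCoef h' k‖ ^ 2 := fun k =>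
    mul_nonneg (by linarith [kSq_nonneg (ℓ := ℓ) k]) (by positivity)
  exact ⟨summable_of_sum_le hnn hF, Real.tsum_le_of_sum_le hnn hF⟩

/-- The convolution of an integrable and a bounded function is continuous. -/
theorem continuous_integral_mul_translate {g h : Torus d ℓ → ℂ} (hg : Integrable g volume)
    (hm : AEStronglyMeasurable h volume) {B : ℝ} (hB : ∀ x, ‖h x‖ ≤ B) :
    Continuous fun y => ∫ x, g x * h (x + y) := by
  have hB0 : 0 ≤ B := (norm_nonneg _).trans (hB 0)
  have hh : Integrable h volume := .of_bound hm B (ae_of_all _ hB)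
  have hht : ∀ y, AEStronglyMeasurable (fun x => h (x + y)) volume := fun y =>
    hm.comp_measurePreserving (measurePreserving_add_right volume y)
  -- Approximate `g` in `L¹` by a bounded continuous `g'`. The error in the convolution is at most
  -- `B` times the `L¹` distance, uniformly in `y`, and for `g'` the translation can be shifted onto
  -- the continuous factor.
  refine continuous_of_uniform_approx_of_continuous fun u hu => ?_
  obtain ⟨ε, hε, hεu⟩ := Metric.mem_uniformity_dist.1 hu
  obtain ⟨g', hg', hg'i⟩ := hg.exists_boundedContinuous_integral_sub_le
    (ε := ε / (2 * (B + 1))) (by positivity)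
  refine ⟨fun y => ∫ x, g' x * h (x + y), ?_, fun y => hεu ?_⟩
  · have : ∀ y, ∫ x, g' x * h (x + y) = ∫ x, g' (x - y) * h x := fun y => by
      have := integral_add_right_eq_self (μ := (volume : Measure (Torus d ℓ)))
        (fun x => g' (x - y) * h x) y
      simpa only [add_sub_cancel_right] using this
    simp_rw [this]
    refine continuous_of_dominated (bound := fun x => ‖g'‖ * ‖h x‖)
      (fun y => (Continuous.aestronglyMeasurable (by fun_prop)).mul hm)
      (fun y => ae_of_all _ fun x => ?_) (hh.norm.const_mul _) (ae_of_all _ fun x => by fun_prop)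
    rw [norm_mul]
    gcongr
    exact g'.norm_coe_le_norm _
  · rw [dist_eq_norm, ← integral_sub (hg.mul_bdd (c := B) (hht y) (ae_of_all _ fun x => hB _))
      (hg'i.mul_bdd (c := B) (hht y) (ae_of_all _ fun x => hB _))]
    simp_rw [← sub_mul]
    calc ‖∫ x, (g x - g' x) * h (x + y)‖ ≤ ∫ x, ‖g x - g' x‖ * B := by
          refine (norm_integral_le_integral_norm _).trans ?_
          refine integral_mono_of_nonneg (ae_of_all _ fun x => norm_nonneg _)
            ((hg.sub hg'i).norm.mul_const _) (ae_of_all _ fun x => ?_)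
          simp only [norm_mul]
          gcongr
          exact hB _
      _ ≤ ε / (2 * (B + 1)) * B := by
          rw [integral_mul_const]; gcongr
      _ < ε := by
          rw [div_mul_eq_mul_div, div_lt_iff₀ (by positivity)]
          nlinarith

/-- Fubini and the covariance of Fourier coefficients under translations. The sign `-k` appears
because this is a correlation rather than a convolution. -/
theorem torusCoef_integral_mul_translate {g h : Torus d ℓ → ℂ} (hg : Integrable g volume)
    (hh : Integrable h volume) (k : Mode d) :
    torusCoef (fun y => ∫ x, g x * h (x + y)) k = torusCoef g (-k) * torusCoef h k := by
  have hmp : MeasurePreserving (fun p : Torus d ℓ × Torus d ℓ => (p.2, p.2 + p.1))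
      (volume.prod volume) (volume.prod volume) :=
    (measurePreserving_prod_add volume volume).comp Measure.measurePreserving_swap
  have hint0 : Integrable (fun p : Torus d ℓ × Torus d ℓ => g p.2 * h (p.2 + p.1))
      (volume.prod volume) := hmp.integrable_comp_of_integrable (hg.mul_prod hh)
  have hint : Integrable (Function.uncurry fun y x : Torus d ℓ =>
      conj (torusChar d ℓ k y) * (g x * h (x + y))) (volume.prod volume) := by
    refine hint0.bdd_mul (c := 1)
      (f := fun p : Torus d ℓ × Torus d ℓ => conj (torusChar d ℓ k p.1))
      (Continuous.aestronglyMeasurable (by fun_prop)) (ae_of_all _ fun p => ?_)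
    simp [isCharFamily_torusChar.norm_apply]
  rw [torusCoef, charCoef]
  simp_rw [← integral_const_mul]
  rw [integral_integral_swap hint, show torusCoef g (-k) = ∫ x, g x * torusChar d ℓ k x from
    isCharFamily_torusChar.charCoef_neg g k, ← integral_mul_const]
  congr 1
  funext x
  have h1 := torusCoef_comp_add h x k
  rw [mul_assoc, show torusChar d ℓ k x = planeWave k x from rfl, ← h1, torusCoef, charCoef,
    ← integral_const_mul]
  congr 1
  funext y
  rw [add_comm x y]
  ring

/-- The duality formula for bounded `h`. -/
theorem hasSum_integral_mul_of_bounded {g h : Torus d ℓ → ℂ} (hg : Integrable g volume)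
    (hm : AEStronglyMeasurable h volume) {B : ℝ} (hB : ∀ x, ‖h x‖ ≤ B)
    (hs : Summable fun k => ‖torusCoef g (-k) * torusCoef h k‖) :
    HasSum (fun k => torusCoef g (-k) * torusCoef h k) (ℓ ^ d * ∫ x, g x * h x) := by
  have hh : Integrable h volume := .of_bound hm B (ae_of_all _ hB)
  have hcont := continuous_integral_mul_translate hg hm hB
  set I : C(Torus d ℓ, ℂ) := ⟨fun y => ∫ x, g x * h (x + y), hcont⟩ with hI
  have hcoef : ∀ k, charCoef volume (torusChar d ℓ) I k = torusCoef g (-k) * torusCoef h k :=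
    fun k => torusCoef_integral_mul_translate hg hh k
  have hV : 0 < (volume : Measure (Torus d ℓ)).real Set.univ := by
    rw [volume_real_torus]; exact vol_pos
  have hIi : Integrable I volume :=
    .of_bound (by fun_prop) ‖_‖ (ae_of_all _ fun x => ContinuousMap.norm_coe_le_norm _ x)
  have hs' : Summable fun k => ‖charCoef volume (torusChar d ℓ) I k‖ := by simpa only [hcoef]
  -- Both sides are continuous, so equality almost everywhere is equality everywhere. Evaluation at
  -- `0` then recovers the integral of `g h`.
  have key := (Continuous.ae_eq_iff_eq volume I.continuous (ContinuousMap.continuous _)).1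
    (isCharFamily_torusChar.ae_eq_series hV hIi hs')
  have hs2 : Summable fun k => ‖((volume : Measure (Torus d ℓ)).real Set.univ : ℂ)⁻¹ *
      charCoef volume (torusChar d ℓ) I k‖ := by
    simp_rw [norm_mul]; exact hs'.mul_left _
  have h3 := ((isCharFamily_torusChar.summable_smul hs2).hasSum.mapL
    (ContinuousMap.evalCLM ℂ (0 : Torus d ℓ))).mul_left ((ℓ ^ d : ℝ) : ℂ)
  refine hasSum_of_eq h3 (fun k => ?_) ?_
  · have hl : ((ℓ ^ d : ℝ) : ℂ) ≠ 0 := by exact_mod_cast vol_pos.ne'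
    simp only [hcoef, volume_real_torus, map_smul, ContinuousMap.evalCLM_apply, smul_eq_mul]
    rw [show torusChar d ℓ k 0 = 1 from planeWave_arg_zero k, mul_one, mul_inv_cancel_left₀ hl]
  · rw [ContinuousMap.evalCLM_apply, ← congrFun key 0]
    simp [hI]

/-- Truncation of the real and imaginary parts to `[-n, n]`. -/
def clampC (n : ℝ) (z : ℂ) : ℂ := ⟨max (-n) (min n z.re), max (-n) (min n z.im)⟩

theorem abs_clamp_sub_le (n a b : ℝ) :
    |max (-n) (min n a) - max (-n) (min n b)| ≤ |a - b| := by
  refine (abs_max_sub_max_le_max _ _ _ _).trans ?_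
  rw [sub_self, abs_zero, max_eq_right (abs_nonneg _)]
  refine (abs_min_sub_min_le_max _ _ _ _).trans ?_
  rw [sub_self, abs_zero, max_eq_right (abs_nonneg _)]

theorem norm_clampC_sub_le (n : ℝ) (z w : ℂ) : ‖clampC n z - clampC n w‖ ≤ ‖z - w‖ := by
  rw [← sq_le_sq₀ (norm_nonneg _) (norm_nonneg _), ← Complex.normSq_eq_norm_sq,
    ← Complex.normSq_eq_norm_sq, Complex.normSq_apply, Complex.normSq_apply, ← sq, ← sq, ← sq, ← sq]
  exact add_le_add (sq_le_sq.2 (abs_clamp_sub_le n z.re w.re))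
    (sq_le_sq.2 (abs_clamp_sub_le n z.im w.im))

theorem clampC_zero {n : ℝ} (hn : 0 ≤ n) : clampC n 0 = 0 := by
  apply Complex.ext <;> simp [clampC, hn]

theorem norm_clampC_le {n : ℝ} (hn : 0 ≤ n) (z : ℂ) : ‖clampC n z‖ ≤ ‖z‖ := by
  simpa [clampC_zero hn] using norm_clampC_sub_le n z 0

theorem norm_clampC_le_bound {n : ℝ} (hn : 0 ≤ n) (z : ℂ) : ‖clampC n z‖ ≤ 2 * n := by
  refine (Complex.norm_le_abs_re_add_abs_im _).trans ?_
  have : ∀ a : ℝ, |max (-n) (min n a)| ≤ n := fun a => by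
    rw [abs_le]
    exact ⟨le_max_left _ _, max_le (by linarith) (min_le_left _ _)⟩
  have h1 := this z.re
  have h2 := this z.im
  simp only [clampC]
  linarith

theorem continuous_clampC (n : ℝ) : Continuous (clampC n) :=
  (LipschitzWith.of_dist_le_mul (K := 1) fun z w => by
    simpa [dist_eq_norm] using norm_clampC_sub_le n z w).continuous

theorem clampC_eq {n : ℝ} {z : ℂ} (h : ‖z‖ ≤ n) : clampC n z = z := by
  have h1 := abs_le.1 ((Complex.abs_re_le_norm z).trans h)
  have h2 := abs_le.1 ((Complex.abs_im_le_norm z).trans h)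
  apply Complex.ext
  · simp [clampC, h1.2, h1.1]
  · simp [clampC, h2.2, h2.1]

theorem tendsto_clampC (z : ℂ) : Tendsto (fun n : ℕ => clampC n z) atTop (𝓝 z) := by
  obtain ⟨m, hm⟩ := exists_nat_ge ‖z‖
  refine tendsto_const_nhds.congr' ?_
  filter_upwards [eventually_ge_atTop m] with n hn
  exact (clampC_eq (hm.trans (by exact_mod_cast hn))).symm

/-- Expansion of a square. With `w = 1 + k²` it splits a pairing of `H⁻¹` with `H¹`; the free
parameter `δ` makes one of the two parts small. -/
theorem mul_le_weighted {w δ x y : ℝ} (hw : 0 < w) (hδ : 0 < δ) :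
    x * y ≤ δ⁻¹ * (x ^ 2 / w) + δ * (w * y ^ 2) := by
  have h : 0 ≤ (x / w - δ * y) ^ 2 * (w / δ) := by positivity
  have h2 : (x / w - δ * y) ^ 2 * (w / δ) = δ⁻¹ * (x ^ 2 / w) + δ * (w * y ^ 2) - 2 * (x * y) := by
    field_simp
    ring
  have h3 : 0 ≤ δ⁻¹ * (x ^ 2 / w) + δ * (w * y ^ 2) := by positivity
  linarith

/-- Bounded sequences in a weighted `ℓ²` converging coordinatewise converge weakly. -/
theorem tendsto_tsum_mul_of_weighted {ι : Type*} {w : ι → ℝ} (hw : ∀ k, 0 < w k) {a c : ι → ℂ}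
    {b : ℕ → ι → ℂ} (ha : Summable fun k => ‖a k‖ ^ 2 / w k) {M : ℝ}
    (hb : ∀ n, Summable fun k => w k * ‖b n k‖ ^ 2) (hbM : ∀ n, ∑' k, w k * ‖b n k‖ ^ 2 ≤ M)
    (hc : Summable fun k => w k * ‖c k‖ ^ 2) (hcM : ∑' k, w k * ‖c k‖ ^ 2 ≤ M)
    (hlim : ∀ k, Tendsto (fun n => b n k) atTop (𝓝 (c k))) :
    Tendsto (fun n => ∑' k, a k * b n k) atTop (𝓝 (∑' k, a k * c k)) := by
  have hprod : ∀ e : ι → ℂ, (Summable fun k => w k * ‖e k‖ ^ 2) → Summable fun k => a k * e k :=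
    fun e he => by
      refine .of_norm_bounded (ha.add he) fun k => ?_
      have := mul_le_weighted (x := ‖a k‖) (y := ‖e k‖) (hw k) one_pos
      rw [norm_mul]
      linarith
  have hM : 0 ≤ M := le_trans (tsum_nonneg fun k => mul_nonneg (hw k).le (by positivity)) hcM
  rw [Metric.tendsto_atTop]
  intro ε hε
  -- The differences `b n - c` have weighted square norm at most `4 M`, so this choice bounds the
  -- `δ`-part of the weighted inequality by `ε / 4`.
  set δ := ε / (16 * (M + 1)) with hδ
  have hδ0 : 0 < δ := by positivity
  have hd : ∀ n, Summable fun k => w k * ‖b n k - c k‖ ^ 2 := fun n => by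
    refine (((hb n).mul_left 2).add (hc.mul_left 2)).of_nonneg_of_le
      (fun k => mul_nonneg (hw k).le (by positivity)) fun k => ?_
    have h1 := norm_sub_le (b n k) (c k)
    have h2 : ‖b n k - c k‖ ^ 2 ≤ 2 * ‖b n k‖ ^ 2 + 2 * ‖c k‖ ^ 2 := by
      nlinarith [sq_nonneg (‖b n k‖ - ‖c k‖), norm_nonneg (b n k - c k)]
    nlinarith [hw k]
  have hdM : ∀ n, ∑' k, w k * ‖b n k - c k‖ ^ 2 ≤ 4 * M := fun n => by
    have : ∑' k, w k * ‖b n k - c k‖ ^ 2 ≤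
        ∑' k, (2 * (w k * ‖b n k‖ ^ 2) + 2 * (w k * ‖c k‖ ^ 2)) := by
      refine (hd n).tsum_le_tsum (fun k => ?_) (((hb n).mul_left 2).add (hc.mul_left 2))
      have h1 := norm_sub_le (b n k) (c k)
      have h2 : ‖b n k - c k‖ ^ 2 ≤ 2 * ‖b n k‖ ^ 2 + 2 * ‖c k‖ ^ 2 := by
        nlinarith [sq_nonneg (‖b n k‖ - ‖c k‖), norm_nonneg (b n k - c k)]
      nlinarith [hw k]
    rw [((hb n).mul_left 2).tsum_add (hc.mul_left 2), tsum_mul_left, tsum_mul_left] at this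
    linarith [hbM n]
  -- With `δ` fixed, the part containing `a` is below `ε / 4` outside a finite set; inside that set
  -- coordinatewise convergence suffices.
  obtain ⟨F, hF⟩ := ((tendsto_order.1 (tendsto_tsum_compl_atTop_zero
    fun k => δ⁻¹ * (‖a k‖ ^ 2 / w k))).2 (ε / 4) (by positivity)).exists
  have hfin : Tendsto (fun n => ∑ k ∈ F, ‖a k‖ * ‖b n k - c k‖) atTop (𝓝 0) := by
    have : Tendsto (fun n => ∑ k ∈ F, ‖a k‖ * ‖b n k - c k‖) atTop (𝓝 (∑ k ∈ F, ‖a k‖ * 0)) := by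
      refine tendsto_finsetSum _ fun k _ => (Tendsto.const_mul _ ?_)
      have := (tendsto_iff_norm_sub_tendsto_zero.1 (hlim k))
      exact this
    simpa using this
  obtain ⟨n₀, hn₀⟩ := eventually_atTop.1 ((tendsto_order.1 hfin).2 (ε / 4) (by positivity))
  refine ⟨n₀, fun n hn => ?_⟩
  rw [dist_eq_norm, ← (hprod _ (hb n)).tsum_sub (hprod _ hc)]
  simp_rw [← mul_sub]
  have hsn : Summable fun k => ‖a k‖ * ‖b n k - c k‖ := by
    have := (hprod _ (hd n)).norm
    simpa only [norm_mul] using this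
  have h1 : ‖∑' k, a k * (b n k - c k)‖ ≤ ∑' k, ‖a k‖ * ‖b n k - c k‖ := by
    have := norm_tsum_le_tsum_norm (hprod _ (hd n)).norm
    simpa only [norm_mul] using this
  refine h1.trans_lt ?_
  rw [← hsn.sum_add_tsum_compl (s := F)]
  have h2 := hn₀ n hn
  have h3 : ∑' k : ↑((F : Set ι)ᶜ), ‖a k‖ * ‖b n k - c k‖ ≤
      ∑' k : ↑((F : Set ι)ᶜ), (δ⁻¹ * (‖a k‖ ^ 2 / w k) + δ * (w k * ‖b n k - c k‖ ^ 2)) := by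
    refine Summable.tsum_le_tsum (fun k => mul_le_weighted (hw k) hδ0) (hsn.subtype _)
      (((ha.mul_left _).add ((hd n).mul_left _)).subtype _)
  have h3' : ∑' k : ↑((F : Set ι)ᶜ), (δ⁻¹ * (‖a k‖ ^ 2 / w k) + δ * (w k * ‖b n k - c k‖ ^ 2)) =
      ∑' k : ↑((F : Set ι)ᶜ), δ⁻¹ * (‖a k‖ ^ 2 / w k) +
        ∑' k : ↑((F : Set ι)ᶜ), δ * (w k * ‖b n k - c k‖ ^ 2) :=
    Summable.tsum_add ((ha.mul_left δ⁻¹).subtype _) (((hd n).mul_left δ).subtype _)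
  have h4 : ∑' k : ↑((F : Set ι)ᶜ), δ * (w k * ‖b n k - c k‖ ^ 2) ≤ δ * (4 * M) := by
    refine (Summable.tsum_subtype_le _ _ (fun k => ?_) ((hd n).mul_left δ)).trans ?_
    · exact mul_nonneg hδ0.le (mul_nonneg (hw k).le (by positivity))
    · rw [tsum_mul_left]
      gcongr
      exact hdM n
  have h5 : δ * (4 * M) ≤ ε / 4 := by
    rw [hδ, div_mul_eq_mul_div, div_le_iff₀ (by positivity)]
    nlinarith
  have h6 : ∑' k : ↑((F : Set ι)ᶜ), δ⁻¹ * (‖a k‖ ^ 2 / w k) < ε / 4 := hF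
  linarith

/-- The duality between `g ∈ L¹ ∩ H⁻¹` and `h ∈ H¹`, if `g h` is integrable. -/
theorem hasSum_integral_mul_of_h1 {g h : Torus d ℓ → ℂ} (hg : Integrable g volume)
    (hh : Integrable h volume) (hgh : Integrable (fun x => g x * h x) volume)
    (hg1 : Summable fun k : Mode d => ‖torusCoef g (-k)‖ ^ 2 / (1 + kSq ℓ k))
    (hh1 : Summable fun k : Mode d => (1 + kSq ℓ k) * ‖torusCoef h k‖ ^ 2) :
    HasSum (fun k => torusCoef g (-k) * torusCoef h k) (ℓ ^ d * ∫ x, g x * h x) := by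
  have hw : ∀ k : Mode d, 0 < 1 + kSq ℓ k := fun k => by linarith [kSq_nonneg (ℓ := ℓ) k]
  have hV : 0 < (volume : Measure (Torus d ℓ)).real Set.univ := by
    rw [volume_real_torus]; exact vol_pos
  have hl2 : Summable fun k : Mode d => ‖torusCoef h k‖ ^ 2 :=
    hh1.of_nonneg_of_le (fun k => by positivity) fun k =>
      le_mul_of_one_le_left (by positivity) (by linarith [kSq_nonneg (ℓ := ℓ) k])
  -- Riesz–Fischer supplies a square integrable function with the coefficients of `h`; by uniqueness
  -- for integrable functions it is `h`.
  have hhL : MemLp h 2 volume := by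
    obtain ⟨f, hf, hfc⟩ := isCharFamily_torusChar.exists_memLp_charCoef_eq hV hl2
    have hfi := hf.integrable one_le_two
    have := isCharFamily_torusChar.ae_eq_zero (hfi.sub hh) fun k => by
      have h1 := isCharFamily_torusChar.conj_mul_integrable hfi k
      have h2 := isCharFamily_torusChar.conj_mul_integrable hh k
      have h3 := congrFun hfc k
      simp only [torusCoef, charCoef, Pi.sub_apply, mul_sub] at h3 ⊢
      rw [integral_sub h1 h2, h3, sub_self]
    refine hf.ae_eq ?_
    filter_upwards [this] with x hx
    exact sub_eq_zero.1 hx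
  -- For the truncations the formula is the bounded case. Their `H¹` norms do not exceed that of
  -- `h`, so the Fourier sums converge weakly, while the integrals converge by domination by `|g
  -- h|`.
  have hT : ∀ n : ℕ, MemLp (fun x => clampC n (h x)) 2 volume := fun n =>
    hhL.mono ((continuous_clampC n).comp_aestronglyMeasurable hhL.1)
      (ae_of_all _ fun x => norm_clampC_le n.cast_nonneg _)
  have hcon := fun n : ℕ => h1_contraction hhL (hT n) (fun x y => norm_clampC_sub_le n _ _)
    (fun x => norm_clampC_le n.cast_nonneg _) hh1
  have hprod : ∀ e : Mode d → ℂ, (Summable fun k => (1 + kSq ℓ k) * ‖e k‖ ^ 2) →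
      Summable fun k => ‖torusCoef g (-k) * e k‖ := fun e he => by
    refine (hg1.add he).of_nonneg_of_le (fun k => norm_nonneg _) fun k => ?_
    have := mul_le_weighted (x := ‖torusCoef g (-k)‖) (y := ‖e k‖) (hw k) one_pos
    rw [norm_mul]
    linarith
  have hn : ∀ n : ℕ, HasSum (fun k => torusCoef g (-k) * torusCoef (fun x => clampC n (h x)) k)
      (ℓ ^ d * ∫ x, g x * clampC n (h x)) := fun n =>
    hasSum_integral_mul_of_bounded hg (hT n).1 (fun x => norm_clampC_le_bound n.cast_nonneg _)
      (hprod _ (hcon n).1)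
  have hcoef : ∀ k, Tendsto (fun n : ℕ => torusCoef (fun x => clampC n (h x)) k) atTop
      (𝓝 (torusCoef h k)) := fun k => by
    refine tendsto_integral_of_dominated_convergence (fun x => ‖h x‖) (fun n => ?_) hh.norm
      (fun n => ae_of_all _ fun x => ?_) (ae_of_all _ fun x => ?_)
    · exact (Continuous.aestronglyMeasurable (by fun_prop)).mul (hT n).1
    · simp only [norm_mul, RCLike.norm_conj, isCharFamily_torusChar.norm_apply, one_mul]
      exact norm_clampC_le n.cast_nonneg _
    · exact (tendsto_clampC _).const_mul _
  have hint : Tendsto (fun n : ℕ => (ℓ : ℂ) ^ d * ∫ x, g x * clampC n (h x)) atTop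
      (𝓝 (ℓ ^ d * ∫ x, g x * h x)) := by
    refine Tendsto.const_mul _ (tendsto_integral_of_dominated_convergence (fun x => ‖g x * h x‖)
      (fun n => hg.1.mul (hT n).1) hgh.norm
      (fun n => ae_of_all _ fun x => ?_) (ae_of_all _ fun x => ?_))
    · rw [norm_mul, norm_mul]
      gcongr
      exact norm_clampC_le n.cast_nonneg _
    · exact (tendsto_clampC _).const_mul _
  have hlim := tendsto_tsum_mul_of_weighted hw hg1 (fun n => (hcon n).1) (fun n => (hcon n).2) hh1
    le_rfl hcoef
  simp_rw [fun n => (hn n).tsum_eq] at hlim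
  have := tendsto_nhds_unique hint hlim
  rw [this]
  exact (hprod _ hh1).of_norm.hasSum

end Duality

/-! ### The projections `P_i`, `Q_i` in momentum space -/

section Projections

open Filter Topology

variable {d : ℕ} {ℓ : ℝ} [Fact (0 < ℓ)] {N : ℕ}

instance isNegInvariant_torus : (volume : Measure (Torus d ℓ)).IsNegInvariant :=
  Measure.IsAddHaarMeasure.isNegInvariant_of_regular _

/-- Exchanging the `i`-th coordinate with an additional one preserves the measure. -/
theorem measurePreserving_update_swap (i : Fin N) :
    MeasurePreserving (fun p : Config d ℓ N × Torus d ℓ => (Function.update p.1 i p.2, p.1 i))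
      (volume.prod volume) (volume.prod volume) := by
  obtain _ | n := N
  · exact i.elim0
  have he := volume_preserving_piFinSuccAbove (fun _ : Fin (n + 1) => Torus d ℓ) i
  have h1 := he.prod (MeasurePreserving.id (volume : Measure (Torus d ℓ)))
  have h2 := measurePreserving_prodAssoc (volume : Measure (Torus d ℓ))
    (volume : Measure (Fin n → Torus d ℓ)) (volume : Measure (Torus d ℓ))
  have h3 := Measure.measurePreserving_swap (μ := (volume : Measure (Torus d ℓ)))
    (ν := (volume : Measure (Fin n → Torus d ℓ)).prod (volume : Measure (Torus d ℓ)))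
  have h4 := (Measure.measurePreserving_swap (μ := (volume : Measure (Fin n → Torus d ℓ)))
    (ν := (volume : Measure (Torus d ℓ)))).prod (MeasurePreserving.id (volume : Measure (Torus d ℓ)))
  have h5 := (he.symm).prod (MeasurePreserving.id (volume : Measure (Torus d ℓ)))
  -- With `y = x_i` split off, `x'` the remaining coordinates and `z` the additional one, the maps
  -- are `((y, x'), z) ↦ (y, (x', z)) ↦ ((x', z), y) ↦ ((z, x'), y)`, followed by reinserting `z` at
  -- position `i`.
  have h := h5.comp (h4.comp (h3.comp (h2.comp h1)))
  convert h using 1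
  funext p
  refine Prod.ext ?_ rfl
  funext j
  simp only [Function.comp_apply]
  induction j using Fin.succAboveCases i with
  | x => simp [MeasurableEquiv.piFinSuccAbove, MeasurableEquiv.prodAssoc, Fin.insertNthEquiv]
  | p j => simp [MeasurableEquiv.piFinSuccAbove, MeasurableEquiv.prodAssoc, Fin.insertNthEquiv]

theorem integrable_update {Ψ : Config d ℓ N → ℂ} (hΨ : Integrable Ψ volume) (i : Fin N) :
    Integrable (fun p : Config d ℓ N × Torus d ℓ => Ψ (Function.update p.1 i p.2))
      (volume.prod volume) :=
  (measurePreserving_update_swap i).integrable_comp_of_integrable (hΨ.comp_fst volume)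

theorem integrable_projP {Ψ : Config d ℓ N → ℂ} (hΨ : Integrable Ψ volume) (i : Fin N) :
    Integrable (projP i Ψ) volume :=
  (integrable_update hΨ i).integral_prod_left.const_mul _

theorem configChar_update (κ : Fin N → Mode d) (x : Config d ℓ N) (i : Fin N) (y : Torus d ℓ) :
    configChar d ℓ N κ (Function.update x i y) =
      configChar d ℓ N κ x * conj (planeWave (κ i) (x i)) * planeWave (κ i) y := by
  simp only [configChar, ContinuousMap.coe_mk]
  rw [← Finset.mul_prod_erase _ _ (Finset.mem_univ i), ← Finset.mul_prod_erase
    Finset.univ (fun j => planeWave (κ j) (x j)) (Finset.mem_univ i)]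
  have h1 : planeWave (κ i) (x i) * conj (planeWave (κ i) (x i)) = 1 := by
    rw [Complex.mul_conj, Complex.normSq_eq_norm_sq, norm_planeWave]; simp
  have h2 : ∏ j ∈ Finset.univ.erase i, planeWave (κ j) (Function.update x i y j) =
      ∏ j ∈ Finset.univ.erase i, planeWave (κ j) (x j) :=
    Finset.prod_congr rfl fun j hj => by rw [Function.update_of_ne (Finset.ne_of_mem_erase hj)]
  rw [h2, Function.update_self]
  linear_combination (-planeWave (κ i) y *
    ∏ j ∈ Finset.univ.erase i, planeWave (κ j) (x j)) * h1

theorem integral_conj_planeWave (k : Mode d) :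
    ∫ y : Torus d ℓ, conj (planeWave k y) = if k = 0 then (ℓ : ℂ) ^ d else 0 := by
  split_ifs with h
  · subst h
    simp [planeWave_zero, volume_real_torus]
  · simp_rw [← planeWave_neg]
    exact integral_planeWave (neg_ne_zero.2 h)

theorem vol_ne_zero : ((ℓ : ℂ) ^ d) ≠ 0 := by
  have := (vol_pos (d := d) (ℓ := ℓ)).ne'
  exact_mod_cast this

/-- Exchanging `x_i` with the integration variable moves the average from `Ψ` onto the character,
whose average in the `i`-th variable vanishes unless `κ i = 0`. -/
theorem charCoef_projP {Ψ : Config d ℓ N → ℂ} (hΨ : Integrable Ψ volume) (i : Fin N)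
    (κ : Fin N → Mode d) :
    charCoef volume (configChar d ℓ N) (projP i Ψ) κ =
      if κ i = 0 then charCoef volume (configChar d ℓ N) Ψ κ else 0 := by
  have hb : ∀ x, ‖conj (configChar d ℓ N κ x)‖ = 1 := fun x => by
    simp [isCharFamily_configChar.norm_apply]
  have hint1 : Integrable (fun p : Config d ℓ N × Torus d ℓ =>
      conj (configChar d ℓ N κ p.1) * Ψ (Function.update p.1 i p.2)) (volume.prod volume) :=
    (integrable_update hΨ i).bdd_mul (c := 1)
      (f := fun p : Config d ℓ N × Torus d ℓ => conj (configChar d ℓ N κ p.1))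
      (Continuous.aestronglyMeasurable (by fun_prop)) (ae_of_all _ fun p => (hb _).le)
  have hcu : Continuous fun p : Config d ℓ N × Torus d ℓ => Function.update p.1 i p.2 :=
    continuous_fst.update i continuous_snd
  have hint2 : Integrable (fun p : Config d ℓ N × Torus d ℓ =>
      conj (configChar d ℓ N κ (Function.update p.1 i p.2)) * Ψ p.1) (volume.prod volume) :=
    (hΨ.comp_fst volume).bdd_mul (c := 1)
      (f := fun p : Config d ℓ N × Torus d ℓ => conj (configChar d ℓ N κ (Function.update p.1 i p.2)))
      (Continuous.aestronglyMeasurable (by fun_prop)) (ae_of_all _ fun p => (hb _).le)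
  have hswap : ∫ p : Config d ℓ N × Torus d ℓ,
      conj (configChar d ℓ N κ p.1) * Ψ (Function.update p.1 i p.2) ∂(volume.prod volume) =
      ∫ p : Config d ℓ N × Torus d ℓ,
        conj (configChar d ℓ N κ (Function.update p.1 i p.2)) * Ψ p.1 ∂(volume.prod volume) := by
    have hmp := measurePreserving_update_swap (d := d) (ℓ := ℓ) i
    have := integral_map (μ := (volume : Measure (Config d ℓ N)).prod
      (volume : Measure (Torus d ℓ))) hmp.measurable.aemeasurable
      (by rw [hmp.map_eq]; exact hint2.aestronglyMeasurable)
    rw [hmp.map_eq] at this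
    rw [this]
    simp
  rw [integral_prod _ hint1, integral_prod _ hint2] at hswap
  have hl : charCoef volume (configChar d ℓ N) (projP i Ψ) κ = ((ℓ : ℂ) ^ d)⁻¹ *
      ∫ x : Config d ℓ N, ∫ y : Torus d ℓ,
        conj (configChar d ℓ N κ x) * Ψ (Function.update x i y) := by
    rw [charCoef, ← integral_const_mul]
    congr 1
    funext x
    rw [integral_const_mul, projP]
    ring
  have hr : ∀ x : Config d ℓ N, ∫ y : Torus d ℓ,
      conj (configChar d ℓ N κ (Function.update x i y)) * Ψ x =
      if κ i = 0 then (ℓ : ℂ) ^ d * (conj (configChar d ℓ N κ x) * Ψ x) else 0 := fun x => by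
    rw [integral_mul_const]
    simp_rw [configChar_update, map_mul]
    rw [integral_const_mul, integral_conj_planeWave]
    split_ifs with h
    · simp only [h, planeWave_zero, map_one]; ring
    · ring
  rw [hl, hswap]
  simp_rw [hr]
  split_ifs
  · rw [integral_const_mul, inv_mul_cancel_left₀ vol_ne_zero, charCoef]
  · simp

theorem momentumCoef_projP {Ψ : Config d ℓ N → ℂ} (hΨ : Integrable Ψ volume) (i : Fin N)
    (κ : Fin N → Mode d) :
    momentumCoef (projP i Ψ) κ = if κ i = 0 then momentumCoef Ψ κ else 0 := by
  rw [momentumCoef_eq, momentumCoef_eq, charCoef_projP hΨ]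
  split_ifs <;> simp

theorem summable_charCoef_sq {Ψ : Config d ℓ N → ℂ} (hΨ : MemLp Ψ 2 volume) :
    Summable fun κ => ‖charCoef volume (configChar d ℓ N) Ψ κ‖ ^ 2 :=
  (isCharFamily_configChar.hasSum_norm_sq volume_real_config_pos hΨ).summable

/-- On coefficients `P_i` is a cutoff, which preserves square summability; Riesz–Fischer and
uniqueness translate this into square integrability. -/
theorem memLp_projP {Ψ : Config d ℓ N → ℂ} (hΨ : MemLp Ψ 2 volume) (i : Fin N) :
    MemLp (projP i Ψ) 2 volume := by
  have hΨ1 := hΨ.integrable one_le_two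
  have hs : Summable fun κ => ‖charCoef volume (configChar d ℓ N) (projP i Ψ) κ‖ ^ 2 := by
    refine (summable_charCoef_sq hΨ).of_nonneg_of_le (fun κ => by positivity) fun κ => ?_
    rw [charCoef_projP hΨ1]
    split_ifs
    · exact le_rfl
    · simp
  obtain ⟨f, hf, hfc⟩ :=
    (isCharFamily_configChar (d := d) (ℓ := ℓ)).exists_memLp_charCoef_eq
      volume_real_config_pos hs
  refine hf.ae_eq (ae_eq_of_momentumCoef_eq (hf.integrable one_le_two) (integrable_projP hΨ1 i)
    fun κ => ?_)
  rw [momentumCoef_eq, momentumCoef_eq, hfc]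

theorem memLp_projQ {Ψ : Config d ℓ N → ℂ} (hΨ : MemLp Ψ 2 volume) (i : Fin N) :
    MemLp (projQ i Ψ) 2 volume :=
  hΨ.sub (memLp_projP hΨ i)

theorem momentumCoef_add {Φ Ψ : Config d ℓ N → ℂ} (hΦ : Integrable Φ volume)
    (hΨ : Integrable Ψ volume) (κ : Fin N → Mode d) :
    momentumCoef (fun x => Φ x + Ψ x) κ = momentumCoef Φ κ + momentumCoef Ψ κ := by
  simp only [momentumCoef_eq, charCoef, mul_add]
  rw [integral_add (isCharFamily_configChar.conj_mul_integrable hΦ κ)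
    (isCharFamily_configChar.conj_mul_integrable hΨ κ)]
  ring

theorem momentumCoef_sub {Φ Ψ : Config d ℓ N → ℂ} (hΦ : Integrable Φ volume)
    (hΨ : Integrable Ψ volume) (κ : Fin N → Mode d) :
    momentumCoef (fun x => Φ x - Ψ x) κ = momentumCoef Φ κ - momentumCoef Ψ κ := by
  simp only [momentumCoef_eq, charCoef, mul_sub]
  rw [integral_sub (isCharFamily_configChar.conj_mul_integrable hΦ κ)
    (isCharFamily_configChar.conj_mul_integrable hΨ κ)]
  ring

theorem momentumCoef_projQ {Ψ : Config d ℓ N → ℂ} (hΨ : Integrable Ψ volume) (i : Fin N)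
    (κ : Fin N → Mode d) :
    momentumCoef (projQ i Ψ) κ = if κ i = 0 then 0 else momentumCoef Ψ κ := by
  rw [show projQ i Ψ = fun x => Ψ x - projP i Ψ x from rfl,
    momentumCoef_sub hΨ (integrable_projP hΨ i), momentumCoef_projP hΨ]
  split_ifs <;> simp

theorem projP_update (Ψ : Config d ℓ N → ℂ) (i : Fin N) (x : Config d ℓ N) (y : Torus d ℓ) :
    projP i Ψ (Function.update x i y) = projP i Ψ x := by
  simp [projP]

/-- An integrable function of `x_i - x_j` is integrable against `|P_j Ψ|²`. -/
theorem integrable_mul_projP_sq {G : Torus d ℓ → ℝ} (hG : Integrable G volume)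
    {Ψ : Config d ℓ N → ℂ} (hΨ : MemLp Ψ 2 volume) {i j : Fin N} (hij : i ≠ j) :
    Integrable (fun x => G (x i - x j) * ‖projP j Ψ x‖ ^ 2) volume := by
  -- This shear produces `G (x_i - y)` from `G (y)`. Exchanging `y` with `x_j` then gives `G (x_i -
  -- x_j)`, and leaves `P_j Ψ` unchanged because it does not depend on `x_j`.
  have hskew : MeasurePreserving (fun p : Config d ℓ N × Torus d ℓ => (p.1, p.1 i - p.2))
      (volume.prod volume) (volume.prod volume) :=
    (MeasurePreserving.id (volume : Measure (Config d ℓ N))).skew_product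
      (g := fun x y => x i - y) (by fun_prop)
      (ae_of_all _ fun x => (Measure.measurePreserving_sub_left (volume : Measure (Torus d ℓ)) (x i)).map_eq)
  have h1 : Integrable (fun p : Config d ℓ N × Torus d ℓ => ‖projP j Ψ p.1‖ ^ 2 * G p.2)
      (volume.prod volume) :=
    ((memLp_projP hΨ j).integrable_norm_pow two_ne_zero).mul_prod hG
  have h2 := (measurePreserving_update_swap (d := d) (ℓ := ℓ) j).integrable_comp_of_integrable
    (hskew.integrable_comp_of_integrable h1)
  have h3 : Integrable (fun p : Config d ℓ N × Torus d ℓ =>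
      G (p.1 i - p.1 j) * ‖projP j Ψ p.1‖ ^ 2) (volume.prod volume) := by
    refine h2.congr (ae_of_all _ fun p => ?_)
    simp only [Function.comp_apply, projP_update, Function.update_of_ne hij]
    ring
  have : NeZero (volume : Measure (Torus d ℓ)) := ⟨fun h => by
    have := volume_real_torus (d := d) (ℓ := ℓ)
    rw [h] at this
    simp only [Measure.real, Measure.coe_zero, Pi.zero_apply, ENNReal.toReal_zero] at this
    exact (vol_pos (d := d) (ℓ := ℓ)).ne this⟩
  -- The integrand no longer involves the auxiliary variable, so integrability for almost every
  -- value of it, hence for one value, is enough; the measure being nonzero provides such a value.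
  exact h3.prod_left_ae.exists.choose_spec

/-- Disintegration of an integrable function along `x_i - x_j`. -/
theorem exists_difference_density {F : Config d ℓ N → ℂ} (hF : Integrable F volume) {i j : Fin N}
    (hij : i ≠ j) : ∃ h : Torus d ℓ → ℂ, Integrable h volume ∧ ∀ G : Torus d ℓ → ℂ,
      Integrable (fun x => G (x i - x j) * F x) volume →
        Integrable (fun y => G y * h y) volume ∧
          ∫ y, G y * h y = ∫ x, G (x i - x j) * F x := by
  have hskew : MeasurePreserving (fun p : Config d ℓ N × Torus d ℓ => (p.1, p.2 + p.1 j))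
      (volume.prod volume) (volume.prod volume) :=
    (MeasurePreserving.id (volume : Measure (Config d ℓ N))).skew_product
      (g := fun x y => y + x j) (by fun_prop)
      (ae_of_all _ fun x => (measurePreserving_add_right (volume : Measure (Torus d ℓ)) (x j)).map_eq)
  have hS := (measurePreserving_update_swap (d := d) (ℓ := ℓ) i).comp hskew
  -- Replacing `x_i` by `y + x_j` makes the difference of the two positions equal to `y`, so
  -- integrating over the configuration at fixed `y` gives the density. The old `x_i` is integrated
  -- idly, which accounts for the factor `ℓ ^ d`.
  set S : Config d ℓ N × Torus d ℓ → Config d ℓ N := fun p =>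
    Function.update p.1 i (p.2 + p.1 j) with hSdef
  have hint : ∀ F' : Config d ℓ N → ℂ, Integrable F' volume →
      Integrable (fun p => F' (S p)) (volume.prod volume) := fun F' hF' =>
    hS.integrable_comp_of_integrable (hF'.comp_fst volume)
  have hval : ∀ F' : Config d ℓ N → ℂ, Integrable F' volume →
      ∫ p, F' (S p) ∂(volume.prod volume) = (ℓ : ℂ) ^ d * ∫ x, F' x := fun F' hF' => by
    have h1 := hF'.comp_fst (volume : Measure (Torus d ℓ))
    have := integral_map (μ := (volume : Measure (Config d ℓ N)).prod
      (volume : Measure (Torus d ℓ))) hS.measurable.aemeasurable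
      (by rw [hS.map_eq]; exact h1.aestronglyMeasurable)
    rw [hS.map_eq] at this
    calc _ = _ := this.symm
      _ = _ := by
        rw [integral_prod _ h1]
        simp only [integral_const, volume_real_torus]
        rw [integral_smul]
        simp
  refine ⟨fun y => ((ℓ : ℂ) ^ d)⁻¹ * ∫ x, F (S (x, y)),
    ((hint F hF).integral_prod_right).const_mul _, fun G hG => ?_⟩
  have hSG : ∀ p, G (S p i - S p j) = G p.2 := fun p => by
    simp [hSdef, Function.update_of_ne hij.symm]
  have h1 := hint _ hG
  simp only [hSG] at h1
  have h2 := hval _ hG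
  simp only [hSG] at h2
  have e1 : ∀ y, G y * (((ℓ : ℂ) ^ d)⁻¹ * ∫ x, F (S (x, y))) =
      ((ℓ : ℂ) ^ d)⁻¹ * ∫ x, G y * F (S (x, y)) := fun y => by
    rw [integral_const_mul]; ring
  simp_rw [e1]
  refine ⟨h1.integral_prod_right.const_mul _, ?_⟩
  rw [integral_const_mul, ← integral_prod_symm _ h1, h2, inv_mul_cancel_left₀ vol_ne_zero]

theorem configChar_single (i : Fin N) (k : Mode d) (x : Config d ℓ N) :
    configChar d ℓ N (Pi.single i k) x = planeWave k (x i) := by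
  simp only [configChar, ContinuousMap.coe_mk]
  rw [Finset.prod_eq_single i]
  · simp
  · intro b _ hb
    simp [Pi.single_eq_of_ne hb, planeWave_zero]
  · simp

/-- Multiplication by a plane wave in `x_i - x_j` shifts the momenta. -/
theorem momentumCoef_mul_planeWave (Ψ : Config d ℓ N → ℂ) (i j : Fin N) (k : Mode d)
    (κ : Fin N → Mode d) :
    momentumCoef (fun x => planeWave k (x i - x j) * Ψ x) κ =
      momentumCoef Ψ (κ - Pi.single i k + Pi.single j k) := by
  rw [momentumCoef_eq, momentumCoef_eq]
  congr 1
  refine integral_congr_ae (ae_of_all _ fun x => ?_)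
  simp only [sub_eq_add_neg, planeWave_arg_add, planeWave_arg_neg, isCharFamily_configChar.add,
    ContinuousMap.mul_apply, isCharFamily_configChar.neg, configChar_single, map_mul,
    Complex.conj_conj]
  ring

/-- Parseval's identity after absorbing the plane wave into `Φ₁`, where it shifts the momenta of
particles `i` and `j` oppositely. -/
theorem hasSum_coef_difference {Φ₁ Φ₂ : Config d ℓ N → ℂ} (h₁ : MemLp Φ₁ 2 volume)
    (h₂ : MemLp Φ₂ 2 volume) (i j : Fin N) (k : Mode d) :
    HasSum (fun κ => conj (momentumCoef Φ₁ (κ - Pi.single i k + Pi.single j k)) *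
      momentumCoef Φ₂ κ) (∫ x, conj (planeWave k (x i - x j)) * (conj (Φ₁ x) * Φ₂ x)) := by
  have hm : MemLp (fun x => planeWave k (x i - x j) * Φ₁ x) 2 volume := by
    refine h₁.mono (AEStronglyMeasurable.mul (Continuous.aestronglyMeasurable ?_) h₁.1)
      (ae_of_all _ fun x => ?_)
    · exact (continuous_planeWave k).comp (by fun_prop)
    · rw [norm_mul, norm_planeWave, one_mul]
  refine hasSum_of_eq (hasSum_conj_momentumCoef_mul hm h₂) (fun κ => ?_) ?_
  · rw [momentumCoef_mul_planeWave]
  · congr 1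
    funext x
    rw [map_mul, mul_assoc]

end Projections

/-! ### The scattering equation as an ordinary differential equation -/

section Scattering

open Filter Topology

/-- Radial test functions are taken as functions of `|x|²`, so that smoothness of the profile gives
smoothness at the origin as well. The formula is the trace of the Hessian `4 H'' x ⊗ x + 2 H' 1`. -/
theorem laplacian_comp_norm_sq {d : ℕ} {H : ℝ → ℝ} (hH : ContDiff ℝ ∞ H)
    (x : EuclideanSpace ℝ (Fin d)) :
    Laplacian.laplacian (fun x : EuclideanSpace ℝ (Fin d) => H (‖x‖ ^ 2)) x =
      4 * ‖x‖ ^ 2 * deriv (deriv H) (‖x‖ ^ 2) + 2 * d * deriv H (‖x‖ ^ 2) := by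
  have hH1 : Differentiable ℝ H := hH.differentiable (by simp)
  have hH2 : Differentiable ℝ (deriv H) :=
    ((contDiff_infty_iff_deriv.1 hH).2).differentiable (by simp)
  have hn : ∀ y : EuclideanSpace ℝ (Fin d), HasFDerivAt (fun y => ‖y‖ ^ 2)
      ((2 : ℝ) • innerSL ℝ y) y := fun y => by
    have := (hasStrictFDerivAt_norm_sq y).hasFDerivAt
    rwa [two_nsmul, ← two_smul ℝ] at this
  let L : EuclideanSpace ℝ (Fin d) →ₗ[ℝ] (EuclideanSpace ℝ (Fin d) →L[ℝ] ℝ) :=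
    { toFun := fun y => innerSL ℝ y
      map_add' := fun y z => by simp
      map_smul' := fun c y => by simp }
  have h1 : fderiv ℝ (fun x : EuclideanSpace ℝ (Fin d) => H (‖x‖ ^ 2)) =
      fun y => (2 * deriv H (‖y‖ ^ 2)) • LinearMap.toContinuousLinearMap L y := by
    funext y
    have := ((hH1 _).hasDerivAt.comp_hasFDerivAt y (hn y)).fderiv
    rw [show (fun x : EuclideanSpace ℝ (Fin d) => H (‖x‖ ^ 2)) = H ∘ fun y => ‖y‖ ^ 2 from rfl, this,
      smul_smul, mul_comm]
    rfl
  rw [InnerProductSpace.laplacian_eq_iteratedFDeriv_orthonormalBasis _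
    (EuclideanSpace.basisFun (Fin d) ℝ)]
  simp only [iteratedFDeriv_two_apply, h1, Matrix.cons_val_zero, Matrix.cons_val_one]
  have h2 : HasFDerivAt (fun y : EuclideanSpace ℝ (Fin d) => (2 * deriv H (‖y‖ ^ 2)) •
        LinearMap.toContinuousLinearMap L y)
      ((2 * deriv H (‖x‖ ^ 2)) • LinearMap.toContinuousLinearMap L +
        ((2 : ℝ) • (deriv (deriv H) (‖x‖ ^ 2) • ((2 : ℝ) • innerSL ℝ x))).smulRight
          (LinearMap.toContinuousLinearMap L x)) x :=
    (((hH2 _).hasDerivAt.comp_hasFDerivAt x (hn x)).const_mul 2).smul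
      (LinearMap.toContinuousLinearMap L).hasFDerivAt
  have hL : ∀ y z, LinearMap.toContinuousLinearMap L y z = inner ℝ y z := fun y z => rfl
  rw [h2.fderiv]
  have h3 : ∑ i, (x i) ^ 2 = ‖x‖ ^ 2 := (EuclideanSpace.real_norm_sq_eq x).symm
  simp only [add_apply, smul_apply, innerSL_apply_apply,
    ContinuousLinearMap.smulRight_apply, hL, smul_eq_mul, EuclideanSpace.basisFun_apply,
    EuclideanSpace.inner_single_right, conj_trivial, one_mul]
  simp only [Finset.sum_add_distrib, PiLp.single_apply, if_true, mul_one, Finset.sum_const,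
    Finset.card_univ, Fintype.card_fin, nsmul_eq_mul]
  rw [← h3, Finset.mul_sum, Finset.sum_mul, add_comm]
  congr 1
  · exact Finset.sum_congr rfl fun i _ => by ring
  · ring

/-- Integration by parts against the primitive of an integrable function. -/
theorem integral_mul_eq_sub_primitive {w K : ℝ → ℝ} {B : ℝ}
    (hw : IntervalIntegrable w volume 0 B) (hK : ContDiff ℝ 1 K) :
    ∫ r in 0..B, w r * K r = (∫ r in 0..B, w r) * K B -
      ∫ r in 0..B, (∫ u in 0..r, w u) * deriv K r := by
  have h1 := hw.absolutelyContinuousOnInterval_intervalIntegral (c := 0) (by simp)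
  have h2 : AbsolutelyContinuousOnInterval K 0 B := hK.contDiffOn.absolutelyContinuousOnInterval
  rw [h1.integral_mul_deriv_eq_deriv_mul h2]
  simp only [intervalIntegral.integral_same, zero_mul, sub_zero, sub_sub_cancel]
  apply intervalIntegral.integral_congr_ae
  filter_upwards [hw.ae_hasDerivAt_integral] with r hr hr'
  rw [(hr (Set.uIoc_subset_uIcc hr') 0 (by simp)).deriv]

variable {d : ℕ} {v φ₀ : ℝ → ℝ} {R a : ℝ}

/-- The density `r ^ (d - 1) v(r) φ₀(r) / 2`. -/
def scatDensity (d : ℕ) (v φ₀ : ℝ → ℝ) (r : ℝ) : ℝ := r ^ (d - 1) * (1 / 2 * v r * φ₀ r)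

/-- The flux `∫_0^r u ^ (d - 1) v(u) φ₀(u) / 2 du`. -/
def scatFlux (d : ℕ) (v φ₀ : ℝ → ℝ) (r : ℝ) : ℝ := ∫ u in 0..r, scatDensity d v φ₀ u

theorem integrableOn_radial (hd : 1 ≤ d) {f : ℝ → ℝ} :
    Integrable (fun x : EuclideanSpace ℝ (Fin d) => f ‖x‖) ↔
      IntegrableOn (fun r => r ^ (d - 1) * f r) (Set.Ioi 0) := by
  have : Nontrivial (EuclideanSpace ℝ (Fin d)) := by
    have : Nonempty (Fin d) := ⟨⟨0, hd⟩⟩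
    infer_instance
  have := integrable_fun_norm_addHaar (volume : Measure (EuclideanSpace ℝ (Fin d))) (f := f)
  simpa only [finrank_euclideanSpace_fin, smul_eq_mul] using this

theorem integral_radial (hd : 1 ≤ d) (f : ℝ → ℝ) :
    ∫ x : EuclideanSpace ℝ (Fin d), f ‖x‖ =
      (d * volume.real (Metric.ball (0 : EuclideanSpace ℝ (Fin d)) 1)) *
        ∫ r in Set.Ioi 0, r ^ (d - 1) * f r := by
  have : Nontrivial (EuclideanSpace ℝ (Fin d)) := by
    have : Nonempty (Fin d) := ⟨⟨0, hd⟩⟩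
    infer_instance
  have := integral_fun_norm_addHaar (volume : Measure (EuclideanSpace ℝ (Fin d))) f
  simpa only [finrank_euclideanSpace_fin, smul_eq_mul, nsmul_eq_mul, mul_assoc] using this

theorem ball_volume_pos : 0 < volume.real (Metric.ball (0 : EuclideanSpace ℝ (Fin d)) 1) :=
  ENNReal.toReal_pos (Metric.measure_ball_pos _ _ one_pos).ne' measure_ball_lt_top.ne

/-- `φ₀` is continuous, hence bounded on `[0, R]`, and `v` vanishes beyond `R`; integrability is
inherited from `v`. -/
theorem integrableOn_scatDensity (hd : 1 ≤ d) (hv : Measurable v)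
    (hv0 : ∀ r, 0 ≤ v r) (hvR : ∀ r, R < r → v r = 0)
    (hvi : Integrable (fun x : EuclideanSpace ℝ (Fin d) => v ‖x‖))
    (hφ : IsScatteringSolution d v R a φ₀) :
    IntegrableOn (scatDensity d v φ₀) (Set.Ioi 0) := by
  have h1 := (integrableOn_radial hd).1 hvi
  obtain ⟨B, hB⟩ := (isCompact_Icc (a := (0 : ℝ)) (b := R)).exists_bound_of_continuousOn
    (hφ.continuousOn.mono Set.Icc_subset_Ici_self)
  have hm : AEStronglyMeasurable φ₀ (volume.restrict (Set.Ioi (0 : ℝ))) :=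
    (hφ.continuousOn.mono Set.Ioi_subset_Ici_self).aestronglyMeasurable measurableSet_Ioi
  have h2 : IntegrableOn (fun r => B * (r ^ (d - 1) * v r)) (Set.Ioi 0) := h1.const_mul B
  refine h2.mono' ?_ ?_
  · unfold scatDensity
    have h3 : Measurable fun r : ℝ => r ^ (d - 1) := by fun_prop
    exact h3.aestronglyMeasurable.mul ((((measurable_const.mul hv)).aestronglyMeasurable).mul hm)
  · refine (ae_restrict_mem measurableSet_Ioi).mono fun r (hr : 0 < r) => ?_
    by_cases hrR : r ≤ R
    · have h3 := hB r ⟨hr.le, hrR⟩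
      rw [Real.norm_eq_abs] at h3
      rw [scatDensity, Real.norm_eq_abs, abs_mul, abs_mul, abs_mul, abs_of_nonneg (hv0 r),
        abs_of_pos (pow_pos hr _), abs_of_pos (by norm_num : (0 : ℝ) < 1 / 2)]
      have h4 : 0 ≤ r ^ (d - 1) * v r := mul_nonneg (pow_pos hr _).le (hv0 r)
      nlinarith [mul_le_mul_of_nonneg_left h3 h4, abs_nonneg (φ₀ r), mul_nonneg h4 (abs_nonneg (φ₀ r))]
    · simp [scatDensity, hvR r (not_le.1 hrR)]

theorem weak_radial (hd : 1 ≤ d) (hφ : IsScatteringSolution d v R a φ₀) {H : ℝ → ℝ}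
    (hH : ContDiff ℝ ∞ H) {β : ℝ} (hβ : ∀ s, β ≤ s → H s = 0) :
    ∫ r in Set.Ioi 0, r ^ (d - 1) *
        (φ₀ r * (4 * r ^ 2 * deriv (deriv H) (r ^ 2) + 2 * d * deriv H (r ^ 2))) =
      ∫ r in Set.Ioi 0, scatDensity d v φ₀ r * H (r ^ 2) := by
  have hcs : HasCompactSupport fun x : EuclideanSpace ℝ (Fin d) => H (‖x‖ ^ 2) := by
    refine HasCompactSupport.intro (isCompact_closedBall (0 : EuclideanSpace ℝ (Fin d))
      (Real.sqrt |β|)) fun x hx => hβ _ ?_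
    rw [mem_closedBall_zero_iff, not_le] at hx
    have := Real.lt_sq_of_sqrt_lt hx
    exact (le_abs_self β).trans this.le
  have h := hφ.equation _ (hH.comp (contDiff_norm_sq ℝ)) hcs
  simp_rw [Function.comp_def, laplacian_comp_norm_sq hH] at h
  rw [integral_radial hd (fun r => φ₀ r * (4 * r ^ 2 * deriv (deriv H) (r ^ 2) +
    2 * d * deriv H (r ^ 2))), integral_radial hd (fun r => 1 / 2 * v r * φ₀ r * H (r ^ 2)),
    ← mul_neg, ← mul_add] at h
  have hc : (d * volume.real (Metric.ball (0 : EuclideanSpace ℝ (Fin d)) 1)) ≠ 0 :=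
    mul_ne_zero (by positivity) ball_volume_pos.ne'
  have h2 := (mul_eq_zero.1 h).resolve_left hc
  rw [neg_add_eq_zero] at h2
  rw [h2]
  refine integral_congr_ae (ae_of_all _ fun r => ?_)
  simp only [scatDensity]
  ring

theorem intervalIntegrable_scatDensity
    (hw : IntegrableOn (scatDensity d v φ₀) (Set.Ioi 0)) {s t : ℝ} (hs : 0 ≤ s) (ht : 0 ≤ t) :
    IntervalIntegrable (scatDensity d v φ₀) volume s t :=
  intervalIntegrable_iff.2 (hw.mono_set fun _ hx => (le_min hs ht).trans_lt hx.1)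

/-- The weak form of `φ₀' = r ^ (1 - d) W`. -/
theorem weak_ode (hd : 1 ≤ d) (hφ : IsScatteringSolution d v R a φ₀)
    (hw : IntegrableOn (scatDensity d v φ₀) (Set.Ioi 0)) {ψ : ℝ → ℝ} (hψ : ContDiff ℝ ∞ ψ)
    {α β : ℝ} (hα : 0 < α) (hαβ : α < β) (hψα : ∀ r, r ≤ α → ψ r = 0)
    (hψβ : ∀ r, β ≤ r → ψ r = 0) :
    ∫ r in α..β, φ₀ r * deriv ψ r =
      -∫ r in α..β, scatFlux d v φ₀ r * (r ^ (d - 1))⁻¹ * ψ r := by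
  have hβ : 0 < β := hα.trans hαβ
  -- Chosen so that `ψ(r) = 2 r^d Θ(r²)`. If `H' = -Θ`, the Laplacian of `H(|x|²)` multiplied by
  -- `r^(d-1)` is exactly `-ψ'(r)`. The square root is harmless because `ψ` vanishes for `r ≤ α`.
  set Θ : ℝ → ℝ := fun s => ψ (Real.sqrt s) / (2 * Real.sqrt s ^ d) with hΘ
  have hΘ0 : ∀ s, s ≤ α ^ 2 → Θ s = 0 := fun s hs => by
    simp only [hΘ]
    rw [hψα _ ((Real.sqrt_le_left hα.le).2 hs), zero_div]
  have hΘβ : ∀ s, β ^ 2 ≤ s → Θ s = 0 := fun s hs => by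
    simp only [hΘ]
    rw [hψβ _ (Real.le_sqrt_of_sq_le hs), zero_div]
  have hΘs : ContDiff ℝ ∞ Θ := by
    rw [contDiff_iff_contDiffAt]
    intro s
    rcases lt_or_ge 0 s with hs | hs
    · have h1 : ContDiffAt ℝ ∞ Real.sqrt s := Real.contDiffAt_sqrt hs.ne'
      exact (hψ.contDiffAt.comp s h1).div (contDiffAt_const.mul (h1.pow d)) (by positivity)
    · refine (contDiffAt_const (c := (0 : ℝ))).congr_of_eventuallyEq ?_
      filter_upwards [gt_mem_nhds (hs.trans_lt (by positivity : 0 < α ^ 2))] with u hu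
      exact hΘ0 u hu.le
  set H : ℝ → ℝ := fun s => -∫ u in (β ^ 2)..s, Θ u with hHdef
  have hHd : ∀ s, HasDerivAt H (-Θ s) s := fun s =>
    (intervalIntegral.integral_hasDerivAt_right (hΘs.continuous.intervalIntegrable _ _)
      (hΘs.continuous.stronglyMeasurableAtFilter _ _) hΘs.continuous.continuousAt).neg
  have hH' : deriv H = fun s => -Θ s := funext fun s => (hHd s).deriv
  have hHs : ContDiff ℝ ∞ H := contDiff_infty_iff_deriv.2
    ⟨fun s => (hHd s).differentiableAt, by rw [hH']; exact hΘs.neg⟩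
  have hHβ : ∀ s, β ^ 2 ≤ s → H s = 0 := fun s hs => by
    simp only [hHdef]
    rw [neg_eq_zero]
    refine intervalIntegral.integral_zero_ae (ae_of_all _ fun u hu => ?_)
    rw [Set.uIoc_of_le hs] at hu
    exact hΘβ u hu.1.le
  have hψ'α : ∀ r, r ≤ α → deriv ψ r = 0 := fun r hr => by
    have hc : IsClosed {r | deriv ψ r = 0} :=
      isClosed_eq ((contDiff_infty_iff_deriv.1 hψ).2).continuous continuous_const
    have hs : Set.Iio α ⊆ {r | deriv ψ r = 0} := fun u hu => by
      have : ψ =ᶠ[𝓝 u] fun _ => 0 := by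
        filter_upwards [gt_mem_nhds hu] with x hx
        exact hψα x hx.le
      exact this.deriv_eq.trans (deriv_const _ _)
    have := closure_minimal hs hc
    rw [closure_Iio] at this
    exact this hr
  have hψ'β : ∀ r, β < r → deriv ψ r = 0 := fun r hr => by
    have : ψ =ᶠ[𝓝 r] fun _ => 0 := by
      filter_upwards [lt_mem_nhds hr] with x hx
      exact hψβ x hx.le
    rw [this.deriv_eq, deriv_const]
  have hψΘ : ∀ r, 0 < r → ψ r = 2 * r ^ d * Θ (r ^ 2) := fun r hr => by
    simp only [hΘ, Real.sqrt_sq hr.le]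
    field_simp
  have hΘd : Differentiable ℝ Θ := hΘs.differentiable (by simp)
  have hψ' : ∀ r, 0 < r → deriv ψ r =
      r ^ (d - 1) * (4 * r ^ 2 * deriv Θ (r ^ 2) + 2 * d * Θ (r ^ 2)) := fun r hr => by
    have h1 : ψ =ᶠ[𝓝 r] fun r => 2 * r ^ d * Θ (r ^ 2) := by
      filter_upwards [lt_mem_nhds hr] with u hu
      exact hψΘ u hu
    have h2 : HasDerivAt (fun r : ℝ => Θ (r ^ 2)) (deriv Θ (r ^ 2) * (2 * r)) r := by
      have := (hΘd (r ^ 2)).hasDerivAt.comp r (hasDerivAt_pow 2 r)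
      simpa [Function.comp_def] using this
    have h3 : HasDerivAt (fun r => 2 * r ^ d * Θ (r ^ 2)) _ r :=
      ((hasDerivAt_pow d r).const_mul 2).mul h2
    rw [h1.deriv_eq, h3.deriv]
    obtain ⟨e, rfl⟩ := Nat.exists_eq_add_of_le' hd
    simp only [Nat.add_sub_cancel]
    push_cast
    ring
  have key := weak_radial hd hφ hHs hHβ
  have hH'' : deriv (deriv H) = fun s => -deriv Θ s := by rw [hH']; funext s; simp
  rw [hH'', hH'] at key
  have hsub : Set.Ioc α β ⊆ Set.Ioi (0 : ℝ) := fun r hr => hα.trans hr.1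
  have hL : ∫ r in Set.Ioi 0, r ^ (d - 1) *
      (φ₀ r * (4 * r ^ 2 * -deriv Θ (r ^ 2) + 2 * d * -Θ (r ^ 2))) =
      -∫ r in α..β, φ₀ r * deriv ψ r := by
    rw [intervalIntegral.integral_of_le hαβ.le, ← integral_neg,
      ← setIntegral_eq_of_subset_of_forall_sdiff_eq_zero measurableSet_Ioi hsub]
    · refine setIntegral_congr_fun measurableSet_Ioi fun r hr => ?_
      rw [hψ' r hr]
      ring
    · rintro r ⟨hr0, hr⟩
      rcases le_or_gt r α with h1 | h1
      · rw [hψ'α r h1]; simp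
      · rw [hψ'β r (not_le.1 fun h => hr ⟨h1, h⟩)]; simp
  have hR1 : ∫ r in Set.Ioi 0, scatDensity d v φ₀ r * H (r ^ 2) =
      ∫ r in 0..β, scatDensity d v φ₀ r * H (r ^ 2) := by
    rw [intervalIntegral.integral_of_le hβ.le]
    refine setIntegral_eq_of_subset_of_forall_sdiff_eq_zero measurableSet_Ioi
      Set.Ioc_subset_Ioi_self ?_
    rintro r ⟨hr0, hr⟩
    have h2 : β < r := not_le.1 fun h => hr ⟨hr0, h⟩
    rw [hHβ (r ^ 2) (by gcongr), mul_zero]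
  have hR2 := integral_mul_eq_sub_primitive
    (intervalIntegrable_scatDensity hw le_rfl hβ.le)
    (K := fun r => H (r ^ 2)) ((hHs.of_le (by norm_cast)).comp (contDiff_id.pow 2))
  have hK : ∀ r, deriv (fun r => H (r ^ 2)) r = -(2 * r * Θ (r ^ 2)) := fun r => by
    have := (hHd (r ^ 2)).comp r (hasDerivAt_pow 2 r)
    have h2 := this.deriv
    simp only [Function.comp_def] at h2
    rw [h2]
    simp only [Nat.cast_ofNat]
    ring
  -- The derivative of `H(r²)` is `-2 r Θ(r²) = -r^(1-d) ψ(r)`, so the partial integration against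
  -- the flux yields the right-hand side.
  have hR3 : ∫ r in 0..β, (∫ u in 0..r, scatDensity d v φ₀ u) * deriv (fun r => H (r ^ 2)) r =
      -∫ r in α..β, scatFlux d v φ₀ r * (r ^ (d - 1))⁻¹ * ψ r := by
    rw [intervalIntegral.integral_of_le hβ.le, intervalIntegral.integral_of_le hαβ.le,
      ← integral_neg, ← setIntegral_eq_of_subset_of_forall_sdiff_eq_zero measurableSet_Ioc
        (Set.Ioc_subset_Ioc_left hα.le)]
    · refine setIntegral_congr_fun measurableSet_Ioc fun r hr => ?_
      have hr0 : 0 < r := hr.1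
      rw [hK, hψΘ r hr0, scatFlux]
      obtain ⟨e, rfl⟩ := Nat.exists_eq_add_of_le' hd
      simp only [Nat.add_sub_cancel]
      field_simp
      ring
    · rintro r ⟨hr0, hr⟩
      rw [hψα r (not_lt.1 fun h => hr ⟨h, hr0.2⟩)]
      simp
  rw [hL, hR1, hR2, hR3, hHβ _ le_rfl] at key
  linarith

/-- The du Bois-Reymond lemma. A test function minus its integral times a fixed bump of mass one has
mean zero and is thus the derivative of an admissible `ψ`. It follows that `D - c` is orthogonal to
all test functions, with `c` the average of `D` over the bump. -/
theorem const_of_integral_mul_deriv {D : ℝ → ℝ} (hD : ContinuousOn D (Set.Ioi 0))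
    (h : ∀ ψ : ℝ → ℝ, ContDiff ℝ ∞ ψ → ∀ α β : ℝ, 0 < α → α < β → (∀ r, r ≤ α → ψ r = 0) →
      (∀ r, β ≤ r → ψ r = 0) → ∫ r in α..β, D r * deriv ψ r = 0) :
    ∃ c, ∀ r, 0 < r → D r = c := by
  -- Centre `2` and outer radius `1` keep the support inside `(0, ∞)`.
  let b : ContDiffBump (2 : ℝ) := ⟨1 / 2, 1, by norm_num, by norm_num⟩
  set χ : ℝ → ℝ := b.normed volume with hχ
  have hχs : ContDiff ℝ ∞ χ := b.contDiff_normed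
  have hχc : HasCompactSupport χ := b.hasCompactSupport_normed
  have hχ1 : ∫ r, χ r = 1 := b.integral_normed
  have hχ0 : tsupport χ ⊆ Set.Ioi 0 := by
    rw [hχ, b.tsupport_normed_eq]
    intro x hx
    have : |x - 2| ≤ 1 := by simpa [Real.dist_eq] using hx
    have := abs_le.1 this
    simp only [Set.mem_Ioi]
    linarith
  set c : ℝ := ∫ r, D r * χ r with hc
  have hloc : ∀ g : ℝ → ℝ, ContDiff ℝ ∞ g → HasCompactSupport g → tsupport g ⊆ Set.Ioi 0 →
      Integrable fun r => D r * g r := by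
    intro g hg hgc hg0
    have hcont : Continuous fun r => D r * g r := by
      rw [continuous_iff_continuousAt]
      intro r
      by_cases hr : r ∈ tsupport g
      · exact (hD.continuousAt (isOpen_Ioi.mem_nhds (hg0 hr))).mul hg.continuous.continuousAt
      · refine (continuousAt_const (y := (0 : ℝ))).congr ?_
        filter_upwards [(isClosed_tsupport g).isOpen_compl.mem_nhds hr] with u hu
        rw [image_eq_zero_of_notMem_tsupport hu, mul_zero]
    exact hcont.integrable_of_hasCompactSupport hgc.mul_left
  have key : ∀ g : ℝ → ℝ, ContDiff ℝ ∞ g → HasCompactSupport g → tsupport g ⊆ Set.Ioi 0 →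
      ∫ r, g r • (D r - c) = 0 := by
    intro g hg hgc hg0
    set m : ℝ := ∫ r, g r with hm
    have hgi : Integrable g := hg.continuous.integrable_of_hasCompactSupport hgc
    have hχi : Integrable χ := hχs.continuous.integrable_of_hasCompactSupport hχc
    set γ : ℝ → ℝ := fun r => g r - m * χ r with hγ
    have hγs : ContDiff ℝ ∞ γ := hg.sub (contDiff_const.mul hχs)
    have hγi : Integrable γ := hgi.sub (hχi.const_mul m)
    have hγ0 : ∫ r, γ r = 0 := by
      rw [hγ, integral_sub hgi (hχi.const_mul m), integral_const_mul, hχ1, mul_one, sub_self]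
    have hK : IsCompact (tsupport g ∪ tsupport χ) := hgc.isCompact.union hχc.isCompact
    have hK0 : tsupport g ∪ tsupport χ ⊆ Set.Ioi 0 := Set.union_subset hg0 hχ0
    have hKn : (tsupport g ∪ tsupport χ).Nonempty := by
      refine Set.Nonempty.inr ?_
      by_contra hne
      rw [Set.not_nonempty_iff_eq_empty, tsupport_eq_empty_iff] at hne
      rw [hne] at hχ1
      simp at hχ1
    obtain ⟨α', hα', hmin⟩ := hK.exists_isLeast hKn
    obtain ⟨β', hβ', hmax⟩ := hK.exists_isGreatest hKn
    have hα0 : 0 < α' := hK0 hα'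
    set α := α' / 2 with hαdef
    set β := β' + 1 with hβdef
    have hα : 0 < α := by positivity
    have hαβ : α < β := by have := hmin hβ'; linarith
    have hγz : ∀ r, r ∉ tsupport g ∪ tsupport χ → γ r = 0 := fun r hr => by
      rw [Set.mem_union, not_or] at hr
      simp only [hγ]
      rw [image_eq_zero_of_notMem_tsupport hr.1, image_eq_zero_of_notMem_tsupport hr.2]
      simp
    have hγα : ∀ r, r ≤ α → γ r = 0 := fun r hr => hγz r fun h => by
      have := hmin h
      linarith
    have hγβ : ∀ r, β ≤ r → γ r = 0 := fun r hr => hγz r fun h => by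
      have := hmax h
      linarith
    set ψ : ℝ → ℝ := fun r => ∫ u in α..r, γ u with hψ
    have hψd : ∀ r, HasDerivAt ψ (γ r) r := fun r =>
      intervalIntegral.integral_hasDerivAt_right (hγs.continuous.intervalIntegrable _ _)
        (hγs.continuous.stronglyMeasurableAtFilter _ _) hγs.continuous.continuousAt
    have hψ' : deriv ψ = γ := funext fun r => (hψd r).deriv
    have hψs : ContDiff ℝ ∞ ψ := contDiff_infty_iff_deriv.2
      ⟨fun r => (hψd r).differentiableAt, by rw [hψ']; exact hγs⟩
    have hfull : ∀ r, β ≤ r → ∫ u in α..r, γ u = ∫ u, γ u := fun r hr => by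
      rw [intervalIntegral.integral_of_le (hαβ.le.trans hr)]
      refine setIntegral_eq_integral_of_forall_compl_eq_zero fun u hu => ?_
      rcases le_or_gt u α with h1 | h1
      · exact hγα u h1
      · exact hγβ u (hr.trans (not_le.1 fun h2 => hu ⟨h1, h2⟩).le)
    have h0 := h ψ hψs α β hα hαβ
      (fun r hr => by
        simp only [hψ]
        refine intervalIntegral.integral_zero_ae (ae_of_all _ fun u hu => hγα u ?_)
        rw [Set.uIoc_of_ge hr] at hu
        exact hu.2)
      (fun r hr => by simp only [hψ]; rw [hfull r hr, hγ0])
    rw [hψ', intervalIntegral.integral_of_le hαβ.le,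
      setIntegral_eq_integral_of_forall_compl_eq_zero] at h0
    · have h1 : ∫ r, D r * γ r = (∫ r, D r * g r) - m * c := by
        rw [hc, ← integral_const_mul, ← integral_sub (hloc g hg hgc hg0)
          ((hloc χ hχs hχc hχ0).const_mul m)]
        refine integral_congr_ae (ae_of_all _ fun r => ?_)
        simp only [hγ]
        ring
      have h2 : ∫ r, g r • (D r - c) = (∫ r, D r * g r) - m * c := by
        rw [hm, ← integral_mul_const, ← integral_sub (hloc g hg hgc hg0) (hgi.mul_const c)]
        refine integral_congr_ae (ae_of_all _ fun r => ?_)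
        simp only [smul_eq_mul]
        ring
      rw [h2, ← h1, h0]
    · intro u hu
      rcases le_or_gt u α with h1 | h1
      · rw [hγα u h1, mul_zero]
      · rw [hγβ u (not_le.1 fun h2 => hu ⟨h1, h2⟩).le, mul_zero]
  refine ⟨c, fun r hr => ?_⟩
  have hcont : ContinuousOn (fun r => D r - c) (Set.Ioi 0) := hD.sub continuousOn_const
  have hae : ∀ᵐ r, r ∈ Set.Ioi (0 : ℝ) → D r - c = 0 :=
    isOpen_Ioi.ae_eq_zero_of_integral_contDiff_smul_eq_zero
      (hcont.locallyIntegrableOn measurableSet_Ioi) key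
  have := Measure.eqOn_open_of_ae_eq (μ := volume) (U := Set.Ioi (0 : ℝ)) (f := fun r => D r - c)
    (g := fun _ => 0) ((ae_restrict_iff' measurableSet_Ioi).2 hae) isOpen_Ioi hcont
    continuousOn_const hr
  exact sub_eq_zero.1 this

theorem continuousOn_scatFlux (hw : IntegrableOn (scatDensity d v φ₀) (Set.Ioi 0)) :
    ContinuousOn (scatFlux d v φ₀) (Set.Ici 0) := by
  have h : IntegrableOn (scatDensity d v φ₀) (Set.Ici 0) := by
    rwa [integrableOn_Ici_iff_integrableOn_Ioi]
  have := intervalIntegral.continuous_primitive (μ := volume)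
    (f := (Set.Ici (0 : ℝ)).indicator (scatDensity d v φ₀))
    (fun s t => (h.integrable_indicator measurableSet_Ici).intervalIntegrable) 0
  refine this.continuousOn.congr fun r (hr : 0 ≤ r) => ?_
  refine intervalIntegral.integral_congr fun u hu => ?_
  rw [Set.uIcc_of_le hr] at hu
  exact (Set.indicator_of_mem (show u ∈ Set.Ici (0 : ℝ) from hu.1) _).symm

/-- The scattering solution is differentiable away from the origin, `φ₀' = r ^ (1 - d) W`. -/
theorem hasDerivAt_scattering (hd : 1 ≤ d) (hφ : IsScatteringSolution d v R a φ₀)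
    (hw : IntegrableOn (scatDensity d v φ₀) (Set.Ioi 0)) {r : ℝ} (hr : 0 < r) :
    HasDerivAt φ₀ (scatFlux d v φ₀ r * (r ^ (d - 1))⁻¹) r := by
  set w : ℝ → ℝ := fun r => scatFlux d v φ₀ r * (r ^ (d - 1))⁻¹ with hwdef
  have hwc : ContinuousOn w (Set.Ioi 0) :=
    ((continuousOn_scatFlux hw).mono Set.Ioi_subset_Ici_self).mul
      ((continuousOn_id.pow _).inv₀ fun x hx => (pow_pos hx _).ne')
  -- An explicit primitive of the expected derivative, based at `1` to avoid the origin. The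
  -- difference `φ₀ - U` has zero weak derivative on the half-line, hence is constant there.
  set U : ℝ → ℝ := fun r => ∫ u in (1 : ℝ)..r, w u with hU
  have hwi : ∀ s t, 0 < s → 0 < t → IntervalIntegrable w volume s t := fun s t hs ht =>
    (hwc.mono fun x hx => (lt_min hs ht).trans_le hx.1).intervalIntegrable
  have hUd : ∀ s, 0 < s → HasDerivAt U (w s) s := fun s hs =>
    intervalIntegral.integral_hasDerivAt_right (hwi 1 s one_pos hs)
      (hwc.stronglyMeasurableAtFilter isOpen_Ioi _ hs) (hwc.continuousAt (isOpen_Ioi.mem_nhds hs))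
  have hUc : ContinuousOn U (Set.Ioi 0) := fun s hs =>
    (hUd s hs).continuousAt.continuousWithinAt
  have hφc : ContinuousOn φ₀ (Set.Ioi 0) := hφ.continuousOn.mono Set.Ioi_subset_Ici_self
  obtain ⟨c, hc⟩ := const_of_integral_mul_deriv (hφc.sub hUc) (by
    intro ψ hψ α β hα hαβ hψα hψβ
    have hpos : Set.uIcc α β ⊆ Set.Ioi 0 := fun x hx => by
      rw [Set.uIcc_of_le hαβ.le] at hx
      exact hα.trans_le hx.1
    have hψ'c : Continuous (deriv ψ) := (contDiff_infty_iff_deriv.1 hψ).2.continuous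
    have h1 := weak_ode hd hφ hw hψ hα hαβ hψα hψβ
    have h2 : ∫ r in α..β, U r * deriv ψ r = -∫ r in α..β, w r * ψ r := by
      rw [intervalIntegral.integral_mul_deriv_eq_deriv_mul (u' := w)
        (fun x hx => hUd x (hpos hx))
        (fun x _ => (hψ.differentiable (by simp) x).hasDerivAt)
        (hwi α β hα (hα.trans hαβ)) (hψ'c.intervalIntegrable _ _),
        hψα α le_rfl, hψβ β le_rfl]
      simp
    simp only [Pi.sub_apply, sub_mul]
    rw [intervalIntegral.integral_sub, h1, h2, sub_self]
    · exact ((hφc.mono hpos).mul hψ'c.continuousOn).intervalIntegrable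
    · exact ((hUc.mono hpos).mul hψ'c.continuousOn).intervalIntegrable)
  have : φ₀ =ᶠ[𝓝 r] fun s => U s + c := by
    filter_upwards [lt_mem_nhds hr] with s hs
    have := hc s hs
    simp only [Pi.sub_apply] at this
    linarith
  exact ((hUd r hr).add_const c).congr_of_eventuallyEq this

end Scattering

/-! ### Positivity and monotonicity of the scattering solution -/

section ScatteringSign

open Filter Topology

variable {d : ℕ} {v φ₀ : ℝ → ℝ} {R a δ : ℝ}

theorem scatFlux_sub (hw : IntegrableOn (scatDensity d v φ₀) (Set.Ioi 0)) {s t : ℝ}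
    (hs : 0 ≤ s) (ht : 0 ≤ t) :
    scatFlux d v φ₀ t - scatFlux d v φ₀ s = ∫ u in s..t, scatDensity d v φ₀ u :=
  intervalIntegral.integral_interval_sub_left (intervalIntegrable_scatDensity hw le_rfl ht)
    (intervalIntegrable_scatDensity hw le_rfl hs)

/-- A maximum principle for `φ₀' = r^(1-d) W`: wherever `φ₀ ≤ 0` the flux `W` is nonincreasing. A
negative value could never return to `0` going outwards if `W ≤ 0` there, and would force a
nonpositive flux coming from the origin if `W > 0`. -/
theorem scattering_nonneg (hd : 1 ≤ d) (hv0 : ∀ r, 0 ≤ v r) (ha : 0 < a)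
    (hφ : IsScatteringSolution d v R a φ₀)
    (hw : IntegrableOn (scatDensity d v φ₀) (Set.Ioi 0)) {r : ℝ} (hr : 0 ≤ r) : 0 ≤ φ₀ r := by
  have hdens : ∀ u, 0 < u → φ₀ u ≤ 0 → scatDensity d v φ₀ u ≤ 0 := fun u hu h =>
    mul_nonpos_of_nonneg_of_nonpos (pow_pos hu _).le
      (mul_nonpos_of_nonneg_of_nonpos (mul_nonneg (by norm_num) (hv0 u)) h)
  have hcont := hφ.continuousOn
  have hder : ∀ u, 0 < u → HasDerivAt φ₀ (scatFlux d v φ₀ u * (u ^ (d - 1))⁻¹) u := fun u hu =>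
    hasDerivAt_scattering hd hφ hw hu
  have key : ∀ s, 0 < s → 0 ≤ φ₀ s := by
    intro s hs
    by_contra! hneg
    rcases le_or_gt (scatFlux d v φ₀ s) 0 with hW | hW
    -- At `M`, which lies beyond `R` and `a`, the explicit formula gives `φ₀ M ≥ 0`. Up to the first
    -- point `t ≥ s` with `φ₀ t ≥ 0` the flux stays nonpositive, so `φ₀` decreases from its negative
    -- value at `s`, a contradiction at `t`.
    · set M := max (max R s) (a + 1) with hM
      have hMs : s ≤ M := (le_max_right R s).trans (le_max_left _ _)
      have hMR : R ≤ M := (le_max_left R s).trans (le_max_left _ _)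
      have hMa : a < M := (lt_add_one a).trans_le (le_max_right _ _)
      have hM0 : 0 ≤ φ₀ M := by
        rw [hφ.outside M hMR]
        have h1 : 1 ≤ M / a := (one_le_div ha).2 hMa.le
        have h2 : a / M ≤ 1 := (div_le_one (ha.trans hMa)).2 hMa.le
        split_ifs
        · exact Real.log_nonneg h1
        · linarith
      have hcs : ContinuousOn φ₀ (Set.Icc s M) := hcont.mono fun x hx => hs.le.trans hx.1
      have hK : IsCompact (Set.Icc s M ∩ φ₀ ⁻¹' Set.Ici 0) :=
        isCompact_Icc.of_isClosed_subset
          (hcs.preimage_isClosed_of_isClosed isClosed_Icc isClosed_Ici) Set.inter_subset_left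
      obtain ⟨t, ⟨⟨hst, htM⟩, ht0⟩, hmin⟩ := hK.exists_isLeast ⟨M, ⟨hMs, le_rfl⟩, hM0⟩
      have hlt : ∀ u, s ≤ u → u < t → φ₀ u < 0 := fun u hu hut => by
        by_contra! h
        exact absurd (hmin ⟨⟨hu, hut.le.trans htM⟩, h⟩) (not_le.2 hut)
      have hanti : AntitoneOn φ₀ (Set.Icc s t) := by
        refine antitoneOn_of_deriv_nonpos (convex_Icc s t)
          (hcont.mono fun x hx => hs.le.trans hx.1) ?_ ?_
        · intro x hx
          rw [interior_Icc] at hx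
          exact (hder x (hs.trans hx.1)).differentiableAt.differentiableWithinAt
        · intro x hx
          rw [interior_Icc] at hx
          have hx0 : 0 < x := hs.trans hx.1
          rw [(hder x hx0).deriv]
          refine mul_nonpos_of_nonpos_of_nonneg ?_ (by positivity)
          have h1 := scatFlux_sub hw hs.le hx0.le
          have h2 : ∫ u in s..x, scatDensity d v φ₀ u ≤ 0 := by
            rw [intervalIntegral.integral_of_le hx.1.le]
            refine setIntegral_nonpos measurableSet_Ioc fun u hu => ?_
            exact hdens u (hs.trans hu.1) (hlt u hu.1.le (hu.2.trans_lt hx.2)).le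
          linarith
      have := hanti ⟨le_rfl, hst⟩ ⟨hst, le_rfl⟩ hst
      have ht0' : 0 ≤ φ₀ t := ht0
      linarith
    -- Take the last `t ≤ s` with `φ₀ t ≥ 0`. On `(t, s)` the flux is at least its value at `s`, so
    -- `φ₀` increases from `t` to `s` and cannot be negative at `s`. Hence `φ₀ < 0` on all of `(0,
    -- s]`, which makes the flux at `s` nonpositive.
    · have hall : ∀ u, 0 < u → u ≤ s → φ₀ u < 0 := by
        intro u hu hus
        by_contra! hu0
        have hcs : ContinuousOn φ₀ (Set.Icc u s) := hcont.mono fun x hx => hu.le.trans hx.1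
        have hK : IsCompact (Set.Icc u s ∩ φ₀ ⁻¹' Set.Ici 0) :=
          isCompact_Icc.of_isClosed_subset
          (hcs.preimage_isClosed_of_isClosed isClosed_Icc isClosed_Ici) Set.inter_subset_left
        obtain ⟨t, ⟨⟨hut, hts⟩, ht0⟩, hmax⟩ := hK.exists_isGreatest ⟨u, ⟨le_rfl, hus⟩, hu0⟩
        have ht : 0 < t := hu.trans_le hut
        have hlt : ∀ x, t < x → x ≤ s → φ₀ x < 0 := fun x hx hxs => by
          by_contra! h
          exact absurd (hmax ⟨⟨hut.trans hx.le, hxs⟩, h⟩) (not_le.2 hx)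
        have hmono : MonotoneOn φ₀ (Set.Icc t s) := by
          refine monotoneOn_of_deriv_nonneg (convex_Icc t s)
            (hcont.mono fun x hx => ht.le.trans hx.1) ?_ ?_
          · intro x hx
            rw [interior_Icc] at hx
            exact (hder x (ht.trans hx.1)).differentiableAt.differentiableWithinAt
          · intro x hx
            rw [interior_Icc] at hx
            have hx0 : 0 < x := ht.trans hx.1
            rw [(hder x hx0).deriv]
            refine mul_nonneg ?_ (by positivity)
            have h1 := scatFlux_sub hw hx0.le hs.le
            have h2 : ∫ u in x..s, scatDensity d v φ₀ u ≤ 0 := by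
              rw [intervalIntegral.integral_of_le hx.2.le]
              refine setIntegral_nonpos measurableSet_Ioc fun u hu => ?_
              exact hdens u (hx0.trans hu.1) (hlt u (hx.1.trans hu.1) hu.2).le
            linarith
        have := hmono ⟨le_rfl, hts⟩ ⟨hts, le_rfl⟩ hts
        have ht0' : 0 ≤ φ₀ t := ht0
        linarith
      have h2 : scatFlux d v φ₀ s ≤ 0 := by
        rw [scatFlux, intervalIntegral.integral_of_le hs.le]
        exact setIntegral_nonpos measurableSet_Ioc fun u hu => hdens u hu.1 (hall u hu.1 hu.2).le
      linarith
  rcases hr.eq_or_lt with rfl | hr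
  · have hc : ContinuousWithinAt φ₀ (Set.Ioi 0) 0 :=
      (hcont 0 Set.self_mem_Ici).mono Set.Ioi_subset_Ici_self
    exact ge_of_tendsto hc (eventually_nhdsWithin_of_forall fun u hu => key u hu)
  · exact key r hr

theorem scatDensity_nonneg (hd : 1 ≤ d) (hv0 : ∀ r, 0 ≤ v r) (ha : 0 < a)
    (hφ : IsScatteringSolution d v R a φ₀)
    (hw : IntegrableOn (scatDensity d v φ₀) (Set.Ioi 0)) {r : ℝ} (hr : 0 ≤ r) :
    0 ≤ scatDensity d v φ₀ r :=
  mul_nonneg (pow_nonneg hr _) (mul_nonneg (mul_nonneg (by norm_num) (hv0 r))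
    (scattering_nonneg hd hv0 ha hφ hw hr))

theorem scatFlux_mono (hd : 1 ≤ d) (hv0 : ∀ r, 0 ≤ v r) (ha : 0 < a)
    (hφ : IsScatteringSolution d v R a φ₀)
    (hw : IntegrableOn (scatDensity d v φ₀) (Set.Ioi 0)) {s t : ℝ} (hs : 0 ≤ s) (hst : s ≤ t) :
    scatFlux d v φ₀ s ≤ scatFlux d v φ₀ t := by
  have h1 := scatFlux_sub hw hs (hs.trans hst)
  have h2 : 0 ≤ ∫ u in s..t, scatDensity d v φ₀ u :=
    intervalIntegral.integral_nonneg hst fun u hu =>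
      scatDensity_nonneg hd hv0 ha hφ hw (hs.trans hu.1)
  linarith

theorem scatFlux_nonneg (hd : 1 ≤ d) (hv0 : ∀ r, 0 ≤ v r) (ha : 0 < a)
    (hφ : IsScatteringSolution d v R a φ₀)
    (hw : IntegrableOn (scatDensity d v φ₀) (Set.Ioi 0)) {s : ℝ} (hs : 0 ≤ s) :
    0 ≤ scatFlux d v φ₀ s := by
  have := scatFlux_mono hd hv0 ha hφ hw le_rfl hs
  simpa [scatFlux] using this

theorem scattering_mono (hd : 1 ≤ d) (hv0 : ∀ r, 0 ≤ v r) (ha : 0 < a)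
    (hφ : IsScatteringSolution d v R a φ₀)
    (hw : IntegrableOn (scatDensity d v φ₀) (Set.Ioi 0)) : MonotoneOn φ₀ (Set.Ici 0) := by
  refine monotoneOn_of_deriv_nonneg (convex_Ici 0) hφ.continuousOn ?_ ?_
  · intro x hx
    rw [interior_Ici] at hx
    exact (hasDerivAt_scattering hd hφ hw hx).differentiableAt.differentiableWithinAt
  · intro x hx
    rw [interior_Ici] at hx
    have hx0 : 0 < x := hx
    rw [(hasDerivAt_scattering hd hφ hw hx).deriv]
    exact mul_nonneg (scatFlux_nonneg hd hv0 ha hφ hw hx0.le) (by positivity)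

/-- Monotonicity reduces the upper bound to `r = R`, where `φ₀` is explicit; for `d = 2` the cutoff
condition says `log (R / a) < 1 / (2 δ)`. -/
theorem normalizedSol_mem_Icc (hd : d = 2 ∨ d = 3) (hv0 : ∀ r, 0 ≤ v r) (ha : 0 < a) (hR : 0 < R)
    (hφ : IsScatteringSolution d v R a φ₀) (hδ : d = 2 → 0 < δ ∧ R < a * Real.exp (1 / (2 * δ)))
    (hw : IntegrableOn (scatDensity d v φ₀) (Set.Ioi 0)) {r : ℝ} (hr : 0 ≤ r) (hrR : r ≤ R) :
    normalizedSol d δ φ₀ r ∈ Set.Icc 0 1 := by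
  have hd1 : 1 ≤ d := by omega
  have h0 := scattering_nonneg hd1 hv0 ha hφ hw hr
  have h1 := scattering_mono hd1 hv0 ha hφ hw hr (hr.trans hrR) hrR
  have h2 := hφ.outside R le_rfl
  unfold normalizedSol
  split_ifs at h2 ⊢ with hd2
  · obtain ⟨hδ0, hδR⟩ := hδ hd2
    refine ⟨by positivity, ?_⟩
    have h3 : Real.log (R / a) ≤ 1 / (2 * δ) := by
      rw [Real.log_le_iff_le_exp (by positivity), div_le_iff₀ ha, mul_comm]
      exact hδR.le
    calc 2 * δ * φ₀ r ≤ 2 * δ * (1 / (2 * δ)) := by gcongr; linarith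
      _ = 1 := by field_simp
  · have : 0 ≤ a / R := by positivity
    exact ⟨h0, by linarith⟩

/-- Finiteness of the energy of the scattering solution near the origin. -/
theorem integrableOn_flux_sq (hd : 1 ≤ d) (hv0 : ∀ r, 0 ≤ v r) (ha : 0 < a)
    (hφ : IsScatteringSolution d v R a φ₀)
    (hw : IntegrableOn (scatDensity d v φ₀) (Set.Ioi 0)) :
    IntegrableOn (fun r => (r ^ (d - 1))⁻¹ * scatFlux d v φ₀ r ^ 2) (Set.Ioc 0 R) := by
  -- A continuous function with nonnegative derivative has an integrable derivative. The claim
  -- follows by multiplying with the flux, which is at most its value at `R`.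
  have h1 : IntegrableOn (fun r => scatFlux d v φ₀ r * (r ^ (d - 1))⁻¹) (Set.Ioc 0 R) :=
    intervalIntegral.integrableOn_deriv_of_nonneg (hφ.continuousOn.mono Set.Icc_subset_Ici_self)
      (fun x hx => hasDerivAt_scattering hd hφ hw hx.1)
      (fun x hx => by
        have hx0 : 0 < x := hx.1
        exact mul_nonneg (scatFlux_nonneg hd hv0 ha hφ hw hx.1.le) (by positivity))
  refine (h1.const_mul (scatFlux d v φ₀ R)).mono' ?_ ?_
  · have hc : ContinuousOn (fun r => (r ^ (d - 1))⁻¹ * scatFlux d v φ₀ r ^ 2) (Set.Ioi 0) :=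
      ContinuousOn.mul (ContinuousOn.inv₀ (continuousOn_id.pow _)
        fun x hx => (pow_pos (show (0 : ℝ) < x from hx) _).ne')
        (((continuousOn_scatFlux hw).mono Set.Ioi_subset_Ici_self).pow 2)
    exact (hc.mono Set.Ioc_subset_Ioi_self).aestronglyMeasurable measurableSet_Ioc
  · refine (ae_restrict_mem measurableSet_Ioc).mono fun r hr => ?_
    have hr0 : 0 < r := hr.1
    have h2 := scatFlux_nonneg hd hv0 ha hφ hw hr0.le
    have h3 := scatFlux_mono hd hv0 ha hφ hw hr0.le hr.2
    have h4 : 0 ≤ (r ^ (d - 1))⁻¹ := by positivity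
    rw [Real.norm_of_nonneg (by positivity)]
    nlinarith [mul_le_mul_of_nonneg_right h3 (mul_nonneg h2 h4)]

end ScatteringSign

/-! ### Functions on the torus supported in a fundamental box -/

section Box

open Filter Topology

variable {d : ℕ} {ℓ : ℝ} [Fact (0 < ℓ)]

/-- The representative of a point of the torus in the box `(-ℓ/2, ℓ/2]^d`. -/
def boxRep (x : Torus d ℓ) : EuclideanSpace ℝ (Fin d) :=
  WithLp.toLp 2 fun c => (AddCircle.equivIoc ℓ (-(ℓ / 2)) (x c) : ℝ)

theorem boxRep_mem (x : Torus d ℓ) (c : Fin d) :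
    boxRep x c ∈ Set.Ioc (-(ℓ / 2)) (ℓ / 2) := by
  have := (AddCircle.equivIoc ℓ (-(ℓ / 2)) (x c)).2
  exact ⟨this.1, this.2.trans_eq (by ring)⟩

theorem coe_boxRep (x : Torus d ℓ) (c : Fin d) : ((boxRep x c : ℝ) : AddCircle ℓ) = x c :=
  (AddCircle.equivIoc ℓ (-(ℓ / 2))).symm_apply_apply (x c)

theorem measurePreserving_boxRep :
    MeasurePreserving (boxRep : Torus d ℓ → EuclideanSpace ℝ (Fin d)) volume
      (volume.restrict {y | ∀ c, y c ∈ Set.Ioc (-(ℓ / 2)) (ℓ / 2)}) := by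
  have h1 : MeasurePreserving (fun x : AddCircle ℓ => (AddCircle.equivIoc ℓ (-(ℓ / 2)) x : ℝ))
      volume (volume.restrict (Set.Ioc (-(ℓ / 2)) (ℓ / 2))) := by
    have := (measurePreserving_subtype_coe (μa := (volume : Measure ℝ))
      (measurableSet_Ioc (a := -(ℓ / 2)) (b := -(ℓ / 2) + ℓ))).comp
        (AddCircle.measurePreserving_equivIoc ℓ (a := -(ℓ / 2)))
    have hI : Set.Ioc (-(ℓ / 2)) (ℓ / 2) = Set.Ioc (-(ℓ / 2)) (-(ℓ / 2) + ℓ) := by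
      congr 1
      ring
    rw [hI]
    exact this
  have h2 := measurePreserving_pi (fun _ : Fin d => (volume : Measure (AddCircle ℓ)))
    (fun _ => volume.restrict (Set.Ioc (-(ℓ / 2)) (ℓ / 2))) (fun _ => h1)
  rw [← Measure.restrict_pi_pi] at h2
  have h3 := (EuclideanSpace.volume_preserving_symm_measurableEquiv_toLp (Fin d)).symm
  have h4 := h3.restrict_preimage (s := {y : EuclideanSpace ℝ (Fin d) |
    ∀ c, y c ∈ Set.Ioc (-(ℓ / 2)) (ℓ / 2)}) (by
      rw [Set.ofPred_forall]
      exact MeasurableSet.iInter fun c => (by fun_prop :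
        Measurable fun y : EuclideanSpace ℝ (Fin d) => y c) measurableSet_Ioc)
  have h5 := h4.comp (f := fun (x : Torus d ℓ) c => (AddCircle.equivIoc ℓ (-(ℓ / 2)) (x c) : ℝ))
    (μa := volume) (by
      rw [show (MeasurableEquiv.toLp 2 (Fin d → ℝ)).symm.symm ⁻¹'
        {y | ∀ c, y c ∈ Set.Ioc (-(ℓ / 2)) (ℓ / 2)} =
          Set.univ.pi fun _ => Set.Ioc (-(ℓ / 2)) (ℓ / 2) by
        ext y
        exact ⟨fun h c _ => h c, fun h c => h c trivial⟩]
      exact h2)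
  exact h5

theorem torusDist_eq_norm_boxRep (x : Torus d ℓ) : torusDist x = ‖boxRep x‖ := by
  have hℓ : 0 < ℓ := Fact.out
  rw [torusDist, EuclideanSpace.norm_eq]
  congr 1
  refine Finset.sum_congr rfl fun c _ => ?_
  have h := boxRep_mem x c
  rw [← coe_boxRep x c, (AddCircle.norm_coe_eq_abs_iff ℓ hℓ.ne').2, Real.norm_eq_abs]
  rw [abs_of_pos hℓ, abs_le]
  exact ⟨h.1.le, h.2⟩

theorem conj_planeWave_eq (k : Mode d) (x : Torus d ℓ) :
    conj (planeWave k x) = Complex.exp (-Complex.I *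
      ((∑ c, (2 * Real.pi / ℓ * k c) * boxRep x c : ℝ) : ℂ)) := by
  have : planeWave k x = Complex.exp (Complex.I *
      ((∑ c, (2 * Real.pi / ℓ * k c) * boxRep x c : ℝ) : ℂ)) := by
    rw [planeWave, Complex.ofReal_sum, Finset.mul_sum, Complex.exp_sum]
    refine Finset.prod_congr rfl fun c _ => ?_
    conv_lhs => rw [← coe_boxRep x c]
    rw [fourier_coe_apply]
    congr 1
    push_cast
    ring
  rw [this, ← Complex.exp_conj, map_mul, Complex.conj_I, Complex.conj_ofReal]

variable {R : ℝ}

theorem ball_subset_box (hR : R ≤ ℓ / 4) {y : EuclideanSpace ℝ (Fin d)} (hy : ‖y‖ ≤ R)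
    (c : Fin d) : y c ∈ Set.Ioc (-(ℓ / 2)) (ℓ / 2) := by
  have hℓ : 0 < ℓ := Fact.out
  have h := abs_le.1 ((PiLp.norm_apply_le y c).trans hy)
  exact ⟨by linarith [h.1], by linarith [h.2]⟩

theorem restrict_box_eq {F : EuclideanSpace ℝ (Fin d) → ℂ} (hR : R ≤ ℓ / 4)
    (hF : ∀ y, R < ‖y‖ → F y = 0) :
    {y : EuclideanSpace ℝ (Fin d) | ∀ c, y c ∈ Set.Ioc (-(ℓ / 2)) (ℓ / 2)}.indicator F = F := by
  funext y
  by_cases hy : ∀ c, y c ∈ Set.Ioc (-(ℓ / 2)) (ℓ / 2)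
  · rw [Set.indicator_of_mem (by exact hy)]
  · rw [Set.indicator_of_notMem (by exact hy), hF]
    by_contra! h
    exact hy (ball_subset_box hR h)

theorem measurableSet_box :
    MeasurableSet {y : EuclideanSpace ℝ (Fin d) | ∀ c, y c ∈ Set.Ioc (-(ℓ / 2)) (ℓ / 2)} := by
  rw [Set.ofPred_forall]
  exact MeasurableSet.iInter fun c => (by fun_prop :
    Measurable fun y : EuclideanSpace ℝ (Fin d) => y c) measurableSet_Ioc

theorem memLp_comp_boxRep {F : EuclideanSpace ℝ (Fin d) → ℂ} {p : ENNReal} (hF : MemLp F p) :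
    MemLp (fun x : Torus d ℓ => F (boxRep x)) p :=
  (hF.restrict _).comp_measurePreserving measurePreserving_boxRep

/-- The condition `R ≤ ℓ / 4` places the ball inside the fundamental box, so restricting to the box
loses nothing. -/
theorem integral_comp_boxRep {F : EuclideanSpace ℝ (Fin d) → ℂ} (hF : Integrable F)
    (hR : R ≤ ℓ / 4) (hF0 : ∀ y, R < ‖y‖ → F y = 0) :
    ∫ x : Torus d ℓ, F (boxRep x) = ∫ y, F y := by
  have h := measurePreserving_boxRep (d := d) (ℓ := ℓ)
  have h2 : ∫ y, F y ∂(Measure.map boxRep (volume : Measure (Torus d ℓ))) =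
      ∫ x : Torus d ℓ, F (boxRep x) :=
    integral_map h.measurable.aemeasurable (by rw [h.map_eq]; exact hF.1.restrict)
  rw [← h2, h.map_eq, ← integral_indicator measurableSet_box, restrict_box_eq hR hF0]

end Box

/-! ### Fourier transforms of radial functions in polar coordinates -/

section Polar

variable {d : ℕ}

/-- Integration in polar coordinates. -/
theorem integral_polar (hd : 1 ≤ d) {F : EuclideanSpace ℝ (Fin d) → ℂ} (hF : Integrable F) :
    ∫ y, F y = ∫ θ : Metric.sphere (0 : EuclideanSpace ℝ (Fin d)) 1,
      (∫ r in Set.Ioi (0 : ℝ), ((r ^ (d - 1) : ℝ) : ℂ) * F (r • (θ : EuclideanSpace ℝ (Fin d))))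
        ∂(volume : Measure (EuclideanSpace ℝ (Fin d))).toSphere := by
  have : Nontrivial (EuclideanSpace ℝ (Fin d)) := by
    have : Nonempty (Fin d) := ⟨⟨0, hd⟩⟩
    infer_instance
  have hmp := (volume : Measure (EuclideanSpace ℝ (Fin d))).measurePreserving_homeomorphUnitSphereProd
  have hemb := (homeomorphUnitSphereProd (EuclideanSpace ℝ (Fin d))).measurableEmbedding
  set g : Metric.sphere (0 : (EuclideanSpace ℝ (Fin d))) 1 × Set.Ioi (0 : ℝ) → ℂ := fun p => F ((p.2 : ℝ) • (p.1 : (EuclideanSpace ℝ (Fin d)))) with hg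
  have hgc : ∀ x : ({0}ᶜ : Set (EuclideanSpace ℝ (Fin d))), g (homeomorphUnitSphereProd (EuclideanSpace ℝ (Fin d)) x) = F x := fun x => by
    have hx : ‖(x : (EuclideanSpace ℝ (Fin d)))‖ ≠ 0 := norm_ne_zero_iff.2 x.2
    simp [hg, smul_smul, hx]
  have h0 : Integrable (fun x : ({0}ᶜ : Set (EuclideanSpace ℝ (Fin d))) => F x) ((volume : Measure (EuclideanSpace ℝ (Fin d))).comap (↑)) :=
    (integrableOn_iff_comap_subtypeVal (measurableSet_singleton _).compl).1 hF.integrableOn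
  have hgi : Integrable g ((volume : Measure (EuclideanSpace ℝ (Fin d))).toSphere.prod (.volumeIoiPow (Module.finrank ℝ (EuclideanSpace ℝ (Fin d)) - 1))) := by
    rw [← hmp.integrable_comp_emb hemb]
    exact h0.congr (ae_of_all _ fun x => (hgc x).symm)
  calc ∫ y, F y = ∫ x : ({0}ᶜ : Set (EuclideanSpace ℝ (Fin d))), F x ∂((volume : Measure (EuclideanSpace ℝ (Fin d))).comap (↑)) := by
        rw [integral_subtype_comap (measurableSet_singleton _).compl F, restrict_compl_singleton]
    _ = ∫ p, g p ∂(volume : Measure (EuclideanSpace ℝ (Fin d))).toSphere.prod (.volumeIoiPow (Module.finrank ℝ (EuclideanSpace ℝ (Fin d)) - 1)) := by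
        rw [← hmp.integral_comp hemb]
        simp only [hgc]
    _ = _ := by
        rw [integral_prod _ hgi]
        refine integral_congr_ae (Filter.Eventually.of_forall fun θ => ?_)
        simp only [hg, Measure.volumeIoiPow, ENNReal.ofReal]
        rw [integral_withDensity_eq_integral_smul
            ((measurable_subtype_coe.pow_const _).real_toNNReal),
          integral_subtype_comap measurableSet_Ioi
            fun a => Real.toNNReal (a ^ (Module.finrank ℝ (EuclideanSpace ℝ (Fin d)) - 1)) • F (a • (θ : (EuclideanSpace ℝ (Fin d))))]
        refine setIntegral_congr_fun measurableSet_Ioi fun r hr => ?_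
        simp only [finrank_euclideanSpace_fin]
        rw [NNReal.smul_def, Real.coe_toNNReal _ (pow_nonneg (le_of_lt hr) _), Complex.real_smul]

/-- Integration by parts for the exponential on a ray. -/
theorem integral_mul_exp_eq_primitive {w : ℝ → ℝ} {B : ℝ}
    (hw : IntervalIntegrable w volume 0 B) (h0 : ∫ r in 0..B, w r = 0) (θ : ℝ) :
    ∫ r in 0..B, (w r : ℂ) * Complex.exp (-Complex.I * ((θ * r : ℝ) : ℂ)) =
      ∫ r in 0..B, Complex.I * ((∫ u in 0..r, w u : ℝ) : ℂ) * (θ : ℂ) *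
        Complex.exp (-Complex.I * ((θ * r : ℝ) : ℂ)) := by
  have hexp : ∀ r : ℝ, Complex.exp (-Complex.I * ((θ * r : ℝ) : ℂ)) =
      ((Real.cos (θ * r) : ℝ) : ℂ) - Complex.I * ((Real.sin (θ * r) : ℝ) : ℂ) := fun r => by
    rw [show -Complex.I * ((θ * r : ℝ) : ℂ) = (-((θ * r : ℝ) : ℂ)) * Complex.I by ring,
      Complex.exp_mul_I, Complex.cos_neg, Complex.sin_neg, Complex.ofReal_cos, Complex.ofReal_sin]
    ring
  have hl : ∀ r : ℝ, HasDerivAt (fun r => θ * r) θ r := fun r => by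
    simpa using (hasDerivAt_id r).const_mul θ
  have hc := integral_mul_eq_sub_primitive hw (K := fun r => Real.cos (θ * r))
    (Real.contDiff_cos.comp (contDiff_const.mul contDiff_id))
  have hs := integral_mul_eq_sub_primitive hw (K := fun r => Real.sin (θ * r))
    (Real.contDiff_sin.comp (contDiff_const.mul contDiff_id))
  have hcd : ∀ r, deriv (fun r => Real.cos (θ * r)) r = -Real.sin (θ * r) * θ := fun r =>
    ((Real.hasDerivAt_cos (θ * r)).comp r (hl r)).deriv
  have hsd : ∀ r, deriv (fun r => Real.sin (θ * r)) r = Real.cos (θ * r) * θ := fun r =>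
    ((Real.hasDerivAt_sin (θ * r)).comp r (hl r)).deriv
  rw [h0, zero_mul, zero_sub] at hc hs
  simp only [hcd, hsd] at hc hs
  set W : ℝ → ℝ := fun r => ∫ u in 0..r, w u with hW
  have hWc : ContinuousOn W (Set.uIcc 0 B) :=
    intervalIntegral.continuousOn_primitive_interval' hw (by simp)
  have ofReal_i : ∀ {g : ℝ → ℝ}, IntervalIntegrable g volume 0 B →
      IntervalIntegrable (fun r => (g r : ℂ)) volume 0 B := fun h => ⟨h.1.ofReal, h.2.ofReal⟩
  have hci : IntervalIntegrable (fun r => w r * Real.cos (θ * r)) volume 0 B :=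
    hw.mul_continuousOn (by fun_prop)
  have hsi : IntervalIntegrable (fun r => w r * Real.sin (θ * r)) volume 0 B :=
    hw.mul_continuousOn (by fun_prop)
  have hci' : IntervalIntegrable (fun r => W r * (-Real.sin (θ * r) * θ)) volume 0 B :=
    (hWc.mul (by fun_prop)).intervalIntegrable
  have hsi' : IntervalIntegrable (fun r => W r * (Real.cos (θ * r) * θ)) volume 0 B :=
    (hWc.mul (by fun_prop)).intervalIntegrable
  have hci'' : IntervalIntegrable (fun r => -((W r * (-Real.sin (θ * r) * θ) : ℝ) : ℂ)) volume 0 B :=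
    (ofReal_i hci').neg
  calc ∫ r in 0..B, (w r : ℂ) * Complex.exp (-Complex.I * ((θ * r : ℝ) : ℂ))
      = ∫ r in 0..B, (((w r * Real.cos (θ * r) : ℝ) : ℂ) -
          Complex.I * ((w r * Real.sin (θ * r) : ℝ) : ℂ)) := by
        refine intervalIntegral.integral_congr fun r _ => ?_
        simp only [hexp]
        push_cast
        ring
    _ = ((∫ r in 0..B, w r * Real.cos (θ * r) : ℝ) : ℂ) -
          Complex.I * ((∫ r in 0..B, w r * Real.sin (θ * r) : ℝ) : ℂ) := by
        rw [intervalIntegral.integral_sub (ofReal_i hci) ((ofReal_i hsi).const_mul _),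
          intervalIntegral.integral_const_mul, intervalIntegral.integral_ofReal,
          intervalIntegral.integral_ofReal]
    _ = -((∫ r in 0..B, W r * (-Real.sin (θ * r) * θ) : ℝ) : ℂ) +
          Complex.I * ((∫ r in 0..B, W r * (Real.cos (θ * r) * θ) : ℝ) : ℂ) := by
        rw [hc, hs]
        push_cast
        ring
    _ = ∫ r in 0..B, (-((W r * (-Real.sin (θ * r) * θ) : ℝ) : ℂ) +
          Complex.I * ((W r * (Real.cos (θ * r) * θ) : ℝ) : ℂ)) := by
        rw [intervalIntegral.integral_add hci'' ((ofReal_i hsi').const_mul _),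
          intervalIntegral.integral_const_mul, intervalIntegral.integral_neg,
          intervalIntegral.integral_ofReal, intervalIntegral.integral_ofReal]
    _ = _ := by
        refine intervalIntegral.integral_congr fun r _ => ?_
        simp only [hexp]
        push_cast
        linear_combination ((W r : ℂ) * θ * Complex.sin (θ * r)) * Complex.I_sq

/-- The Fourier transform of a radial function of mean zero is that of the divergence of the
radial vector field with the same flux. -/
theorem integral_radial_mul_exp (hd : 1 ≤ d) {f : ℝ → ℝ} {R : ℝ} (hR : 0 ≤ R)
    (hfi : Integrable fun y : EuclideanSpace ℝ (Fin d) => f ‖y‖) (hfR : ∀ r, R < r → f r = 0)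
    (hf0 : ∫ r in 0..R, r ^ (d - 1) * f r = 0) {M : ℝ → ℝ}
    (hM : ∀ r, 0 < r → r ≤ R → M r = (∫ u in 0..r, u ^ (d - 1) * f u) / r ^ d)
    (hMR : ∀ r, R < r → M r = 0) (q : EuclideanSpace ℝ (Fin d))
    (hMi : Integrable fun y : EuclideanSpace ℝ (Fin d) => M ‖y‖ * inner ℝ q y) :
    ∫ y : EuclideanSpace ℝ (Fin d), (f ‖y‖ : ℂ) * Complex.exp (-Complex.I * (inner ℝ q y : ℝ)) =
      ∫ y : EuclideanSpace ℝ (Fin d), Complex.I * ((M ‖y‖ * inner ℝ q y : ℝ) : ℂ) *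
        Complex.exp (-Complex.I * (inner ℝ q y : ℝ)) := by
  have hb : ∀ y : EuclideanSpace ℝ (Fin d),
      ‖Complex.exp (-Complex.I * (inner ℝ q y : ℝ))‖ ≤ 1 := fun y => by
    rw [show -Complex.I * ((inner ℝ q y : ℝ) : ℂ) = ((-inner ℝ q y : ℝ) : ℂ) * Complex.I by
      push_cast; ring, Complex.norm_exp_ofReal_mul_I]
  have hem : AEStronglyMeasurable (fun y : EuclideanSpace ℝ (Fin d) =>
      Complex.exp (-Complex.I * (inner ℝ q y : ℝ))) volume :=
    Continuous.aestronglyMeasurable (by fun_prop)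
  have hi1 : Integrable fun y : EuclideanSpace ℝ (Fin d) =>
      (f ‖y‖ : ℂ) * Complex.exp (-Complex.I * (inner ℝ q y : ℝ)) :=
    hfi.ofReal.mul_bdd hem (ae_of_all _ hb)
  have hi2 : Integrable fun y : EuclideanSpace ℝ (Fin d) =>
      Complex.I * ((M ‖y‖ * inner ℝ q y : ℝ) : ℂ) *
        Complex.exp (-Complex.I * (inner ℝ q y : ℝ)) :=
    (hMi.ofReal.const_mul Complex.I).mul_bdd hem (ae_of_all _ hb)
  rw [integral_polar hd hi1, integral_polar hd hi2]
  refine integral_congr_ae (Filter.Eventually.of_forall fun θ => ?_)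
  have hθ : ‖(θ : EuclideanSpace ℝ (Fin d))‖ = 1 := by simp
  have hnorm : ∀ r : ℝ, 0 < r → ‖r • (θ : EuclideanSpace ℝ (Fin d))‖ = r := fun r hr => by
    rw [norm_smul, hθ, mul_one, Real.norm_of_nonneg hr.le]
  have hwi : IntervalIntegrable (fun r => r ^ (d - 1) * f r) volume 0 R := by
    rw [intervalIntegrable_iff, Set.uIoc_of_le hR]
    exact ((integrableOn_radial hd).1 hfi).mono_set Set.Ioc_subset_Ioi_self
  -- On the ray in direction `θ` the exponential is `exp (-i r q·θ)`. The boundary terms of the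
  -- partial integration vanish, at `0` since the primitive starts there and at `R` by the zero
  -- mean.
  have key := integral_mul_exp_eq_primitive hwi hf0
    (inner ℝ q (θ : EuclideanSpace ℝ (Fin d)))
  rw [intervalIntegral.integral_of_le hR, intervalIntegral.integral_of_le hR] at key
  simp only
  rw [setIntegral_eq_of_subset_of_forall_sdiff_eq_zero measurableSet_Ioi
      (fun r hr => hr.1 : Set.Ioc 0 R ⊆ Set.Ioi 0) (fun r hr => ?_),
    setIntegral_eq_of_subset_of_forall_sdiff_eq_zero measurableSet_Ioi
      (fun r hr => hr.1 : Set.Ioc 0 R ⊆ Set.Ioi 0) (fun r hr => ?_)]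
  · refine Eq.trans (setIntegral_congr_fun measurableSet_Ioc fun r hr => ?_)
      (key.trans (setIntegral_congr_fun measurableSet_Ioc fun r hr => ?_))
    · simp only [hnorm r hr.1, inner_smul_right, mul_comm r]
      push_cast
      ring
    · have hr0 : r ≠ 0 := hr.1.ne'
      simp only [hnorm r hr.1, inner_smul_right, hM r hr.1 hr.2]
      obtain ⟨e, rfl⟩ := Nat.exists_eq_add_of_le' hd
      simp only [Nat.add_sub_cancel, mul_comm r]
      push_cast
      have hr1 : (r : ℂ) ≠ 0 := Complex.ofReal_ne_zero.2 hr0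
      field_simp
      ring
  · have h1 : R < r := not_le.1 fun h => hr.2 ⟨hr.1, h⟩
    simp [hnorm r hr.1, hMR r h1]
  · have h1 : R < r := not_le.1 fun h => hr.2 ⟨hr.1, h⟩
    simp [hnorm r hr.1, hfR r h1]

end Polar

/-! ### The renormalized potential on the torus -/

section RenormalizedPotential

open Filter Topology

/-- The hypotheses on the potential and its scattering solution. -/
structure ScatteringData (d : ℕ) (ℓ R a δ : ℝ) (v φ₀ : ℝ → ℝ) : Prop where
  dim : d = 2 ∨ d = 3
  radius_pos : 0 < R
  radius_le : R ≤ ℓ / 4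
  length_pos : 0 < a
  measurable : Measurable v
  nonneg : ∀ r, 0 ≤ v r
  support : ∀ r, R < r → v r = 0
  integrable : Integrable (fun x : EuclideanSpace ℝ (Fin d) => v ‖x‖)
  solution : IsScatteringSolution d v R a φ₀
  cutoff : d = 2 → 0 < δ ∧ R < a * Real.exp (1 / (2 * δ))

/-- The normalization factor `φ / φ₀`. -/
def normConst (d : ℕ) (δ : ℝ) : ℝ := if d = 2 then 2 * δ else 1

theorem normalizedSol_eq (d : ℕ) (δ : ℝ) (φ₀ : ℝ → ℝ) (r : ℝ) :
    normalizedSol d δ φ₀ r = normConst d δ * φ₀ r := by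
  unfold normalizedSol normConst
  split_ifs <;> ring

theorem gFn_eq (v φ : ℝ → ℝ) (r : ℝ) : gFn v φ r = v r * φ r := by
  simp [gFn, omegaFn]

namespace ScatteringData

variable {d : ℕ} {ℓ R a δ : ℝ} {v φ₀ : ℝ → ℝ}

theorem one_le_dim (h : ScatteringData d ℓ R a δ v φ₀) : 1 ≤ d := by
  rcases h.dim with h | h <;> omega

theorem integrableOn_density (h : ScatteringData d ℓ R a δ v φ₀) :
    IntegrableOn (scatDensity d v φ₀) (Set.Ioi 0) :=
  integrableOn_scatDensity h.one_le_dim h.measurable h.nonneg h.support h.integrable h.solution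

theorem sol_mem (h : ScatteringData d ℓ R a δ v φ₀) {r : ℝ} (hr : 0 ≤ r) (hrR : r ≤ R) :
    normalizedSol d δ φ₀ r ∈ Set.Icc 0 1 :=
  normalizedSol_mem_Icc h.dim h.nonneg h.length_pos h.radius_pos h.solution h.cutoff
    h.integrableOn_density hr hrR

/-- From `0 ≤ φ ≤ 1` on the support of `v` comes the chain `0 ≤ g ω ≤ g ≤ v`, which supplies
integrability and, at the end, an error controlled by `ĝ(0)` alone. -/
theorem gFn_nonneg (h : ScatteringData d ℓ R a δ v φ₀) {r : ℝ} (hr : 0 ≤ r) :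
    0 ≤ gFn v (normalizedSol d δ φ₀) r := by
  rw [gFn_eq]
  by_cases hrR : r ≤ R
  · exact mul_nonneg (h.nonneg r) (h.sol_mem hr hrR).1
  · rw [h.support r (not_le.1 hrR), zero_mul]

theorem gFn_le (h : ScatteringData d ℓ R a δ v φ₀) {r : ℝ} (hr : 0 ≤ r) :
    gFn v (normalizedSol d δ φ₀) r ≤ v r := by
  rw [gFn_eq]
  by_cases hrR : r ≤ R
  · exact mul_le_of_le_one_right (h.nonneg r) (h.sol_mem hr hrR).2
  · rw [h.support r (not_le.1 hrR), zero_mul]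

theorem gOmegaFn_nonneg (h : ScatteringData d ℓ R a δ v φ₀) {r : ℝ} (hr : 0 ≤ r) :
    0 ≤ gOmegaFn v (normalizedSol d δ φ₀) r := by
  by_cases hrR : r ≤ R
  · exact mul_nonneg (h.gFn_nonneg hr) (sub_nonneg.2 (h.sol_mem hr hrR).2)
  · rw [gOmegaFn, gFn_eq, h.support r (not_le.1 hrR), zero_mul, zero_mul]

theorem gOmegaFn_le (h : ScatteringData d ℓ R a δ v φ₀) {r : ℝ} (hr : 0 ≤ r) :
    gOmegaFn v (normalizedSol d δ φ₀) r ≤ gFn v (normalizedSol d δ φ₀) r := by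
  by_cases hrR : r ≤ R
  · exact mul_le_of_le_one_right (h.gFn_nonneg hr)
      (sub_le_self _ (h.sol_mem hr hrR).1)
  · rw [gOmegaFn, gFn_eq, h.support r (not_le.1 hrR), zero_mul, zero_mul]

theorem continuous_sol_norm (h : ScatteringData d ℓ R a δ v φ₀) :
    Continuous fun y : EuclideanSpace ℝ (Fin d) => normalizedSol d δ φ₀ ‖y‖ := by
  have h1 : Continuous fun y : EuclideanSpace ℝ (Fin d) => φ₀ ‖y‖ :=
    h.solution.continuousOn.comp_continuous continuous_norm fun y => norm_nonneg y
  simp only [normalizedSol_eq]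
  exact continuous_const.mul h1

theorem integrable_gFn_norm (h : ScatteringData d ℓ R a δ v φ₀) :
    Integrable fun y : EuclideanSpace ℝ (Fin d) => gFn v (normalizedSol d δ φ₀) ‖y‖ := by
  refine h.integrable.mono' ?_ (ae_of_all _ fun y => ?_)
  · simp only [gFn_eq]
    exact h.integrable.1.mul h.continuous_sol_norm.aestronglyMeasurable
  · rw [Real.norm_of_nonneg (h.gFn_nonneg (norm_nonneg y))]
    exact h.gFn_le (norm_nonneg y)

theorem integrable_gOmegaFn_norm (h : ScatteringData d ℓ R a δ v φ₀) :
    Integrable fun y : EuclideanSpace ℝ (Fin d) => gOmegaFn v (normalizedSol d δ φ₀) ‖y‖ := by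
  refine h.integrable_gFn_norm.mono' ?_ (ae_of_all _ fun y => ?_)
  · exact h.integrable_gFn_norm.1.mul
      (continuous_const.sub h.continuous_sol_norm).aestronglyMeasurable
  · rw [Real.norm_of_nonneg (h.gOmegaFn_nonneg (norm_nonneg y))]
    exact h.gOmegaFn_le (norm_nonneg y)

variable [Fact (0 < ℓ)]

theorem _root_.BoseGas.integrable_torusDist {f : ℝ → ℝ}
    (hf : Integrable fun y : EuclideanSpace ℝ (Fin d) => f ‖y‖) :
    Integrable fun x : Torus d ℓ => f (torusDist x) := by
  have h1 := memLp_comp_boxRep (ℓ := ℓ) (p := 1) (F := fun y => (f ‖y‖ : ℂ))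
    (memLp_one_iff_integrable.2 hf.ofReal)
  have h2 := (memLp_one_iff_integrable.1 h1).re
  refine h2.congr (ae_of_all _ fun x => ?_)
  simp [torusDist_eq_norm_boxRep]

theorem integrable_v (h : ScatteringData d ℓ R a δ v φ₀) :
    Integrable fun x : Torus d ℓ => v (torusDist x) := integrable_torusDist h.integrable

theorem integrable_g (h : ScatteringData d ℓ R a δ v φ₀) :
    Integrable fun x : Torus d ℓ => gFn v (normalizedSol d δ φ₀) (torusDist x) :=
  integrable_torusDist h.integrable_gFn_norm

theorem integrable_gOmega (h : ScatteringData d ℓ R a δ v φ₀) :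
    Integrable fun x : Torus d ℓ => gOmegaFn v (normalizedSol d δ φ₀) (torusDist x) :=
  integrable_torusDist h.integrable_gOmegaFn_norm

end ScatteringData

variable {d : ℕ} {ℓ R a δ : ℝ} {v φ₀ : ℝ → ℝ} [Fact (0 < ℓ)]

theorem torusDist_neg (x : Torus d ℓ) : torusDist (-x) = torusDist x := by
  simp [torusDist]

theorem torusDist_nonneg (x : Torus d ℓ) : 0 ≤ torusDist x := Real.sqrt_nonneg _

theorem fourierCoefTorus_eq (f : ℝ → ℝ) (k : Mode d) :
    fourierCoefTorus ℓ f k = torusCoef (fun x : Torus d ℓ => (f (torusDist x) : ℂ)) k :=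
  integral_congr_ae (ae_of_all _ fun _ => mul_comm _ _)

theorem fourierCoefTorus_neg (f : ℝ → ℝ) (k : Mode d) :
    fourierCoefTorus ℓ f (-k) = fourierCoefTorus ℓ f k := by
  unfold fourierCoefTorus
  rw [← integral_neg_eq_self (fun x : Torus d ℓ => (f (torusDist x) : ℂ) * conj (planeWave k x))]
  refine integral_congr_ae (ae_of_all _ fun x => ?_)
  simp only [torusDist_neg, planeWave_arg_neg, planeWave_neg]

theorem conj_fourierCoefTorus (f : ℝ → ℝ) (k : Mode d) :
    conj (fourierCoefTorus ℓ f k) = fourierCoefTorus ℓ f k := by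
  conv_rhs => rw [← fourierCoefTorus_neg]
  unfold fourierCoefTorus
  rw [← integral_conj]
  refine integral_congr_ae (ae_of_all _ fun x => ?_)
  simp [planeWave_neg]

/-- The Fourier coefficient of a radial function, as a real number. -/
def radialCoef (ℓ : ℝ) [Fact (0 < ℓ)] (f : ℝ → ℝ) (k : Mode d) : ℝ := (fourierCoefTorus ℓ f k).re

theorem fourierCoefTorus_eq_ofReal (f : ℝ → ℝ) (k : Mode d) :
    fourierCoefTorus ℓ f k = (radialCoef ℓ f k : ℂ) :=
  (Complex.conj_eq_iff_re.1 (conj_fourierCoefTorus f k)).symm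

theorem radialCoef_neg (f : ℝ → ℝ) (k : Mode d) : radialCoef ℓ f (-k) = radialCoef ℓ f k := by
  rw [radialCoef, fourierCoefTorus_neg, radialCoef]

theorem radialCoef_zero (f : ℝ → ℝ) :
    radialCoef ℓ f (0 : Mode d) = ∫ x : Torus d ℓ, f (torusDist x) := by
  rw [radialCoef, fourierCoefTorus]
  simp only [planeWave_zero, map_one, mul_one]
  rw [integral_complex_ofReal, Complex.ofReal_re]

theorem abs_radialCoef_le {f : ℝ → ℝ} (hf : ∀ r, 0 ≤ r → 0 ≤ f r) (k : Mode d) :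
    |radialCoef ℓ f k| ≤ radialCoef ℓ f (0 : Mode d) := by
  rw [radialCoef_zero]
  refine (Complex.abs_re_le_norm _).trans ((norm_integral_le_integral_norm _).trans_eq ?_)
  refine integral_congr_ae (ae_of_all _ fun x => ?_)
  simp [norm_planeWave, abs_of_nonneg (hf _ (torusDist_nonneg x))]

/-- Cauchy–Schwarz for `(1, √K)` and `(x, √s)`. With `K = k²` it produces the weight `1 + k²`. -/
theorem sq_add_le_of_sq_le {x y s K : ℝ} (hK : 0 ≤ K) (hs : 0 ≤ s) (h : y ^ 2 ≤ K * s) :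
    (x + y) ^ 2 ≤ (1 + K) * (x ^ 2 + s) := by
  have h1 : 2 * x * y ≤ K * x ^ 2 + s := by
    refine le_of_abs_le (abs_le_of_sq_le_sq ?_ (by positivity))
    nlinarith [mul_le_mul_of_nonneg_left h (sq_nonneg x), sq_nonneg (K * x ^ 2 - s)]
  nlinarith

/-- A radial function supported in a small ball is in `H⁻¹` of the torus if the associated radial
field of the same flux is square integrable. -/
theorem summable_coef_sq_div_of_flux (hd : 1 ≤ d) (hR : 0 < R) (hRℓ : R ≤ ℓ / 4) {f g : ℝ → ℝ} {β : ℝ}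
    (hfg : ∀ r, 0 ≤ r → r ≤ R → g r = f r + β) (hfR : ∀ r, R < r → f r = 0)
    (hgR : ∀ r, R < r → g r = 0)
    (hfi : Integrable fun y : EuclideanSpace ℝ (Fin d) => f ‖y‖)
    (hf0 : ∫ r in 0..R, r ^ (d - 1) * f r = 0) {M : ℝ → ℝ} (hMm : Measurable M)
    (hM : ∀ r, 0 < r → r ≤ R → M r = (∫ u in 0..r, u ^ (d - 1) * f u) / r ^ d)
    (hMR : ∀ r, R < r → M r = 0)
    (hM2 : Integrable fun y : EuclideanSpace ℝ (Fin d) => (M ‖y‖ * ‖y‖) ^ 2) :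
    Summable fun k : Mode d => radialCoef ℓ g k ^ 2 / (1 + kSq ℓ k) := by
  have hD : ∀ c, MemLp (fun y : EuclideanSpace ℝ (Fin d) => ((M ‖y‖ * y c : ℝ) : ℂ)) 2 := by
    intro c
    have hm : Measurable fun y : EuclideanSpace ℝ (Fin d) => M ‖y‖ * y c :=
      (hMm.comp measurable_norm).mul (by fun_prop)
    have hm' : AEStronglyMeasurable (fun y : EuclideanSpace ℝ (Fin d) =>
      ((M ‖y‖ * y c : ℝ) : ℂ)) volume := (Complex.measurable_ofReal.comp hm).aestronglyMeasurable
    rw [memLp_two_iff_integrable_sq_norm hm']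
    refine hM2.mono' (hm'.norm.pow 2) (ae_of_all _ fun y => ?_)
    rw [Real.norm_of_nonneg (by positivity), Complex.norm_real, ← Real.norm_of_nonneg
      (norm_nonneg ((M ‖y‖ * y c : ℝ)))]
    rw [norm_norm, Real.norm_eq_abs, sq_abs, mul_pow, mul_pow]
    have : (y c) ^ 2 ≤ ‖y‖ ^ 2 := by
      rw [← sq_abs (y c), ← Real.norm_eq_abs]
      exact pow_le_pow_left₀ (norm_nonneg _) (PiLp.norm_apply_le y c) 2
    gcongr
  have hDt : ∀ c, MemLp (fun x : Torus d ℓ => ((M ‖boxRep x‖ * boxRep x c : ℝ) : ℂ)) 2 :=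
    fun c => memLp_comp_boxRep (hD c)
  have hball : Integrable fun y : EuclideanSpace ℝ (Fin d) =>
      (Metric.closedBall (0 : EuclideanSpace ℝ (Fin d)) R).indicator (fun _ => (1 : ℝ)) y :=
    (integrable_indicator_iff measurableSet_closedBall).2
      (integrableOn_const (measure_closedBall_lt_top.ne))
  have hDi : ∀ c, Integrable fun y : EuclideanSpace ℝ (Fin d) => M ‖y‖ * y c := by
    intro c
    have hm : Measurable fun y : EuclideanSpace ℝ (Fin d) => M ‖y‖ * y c :=
      (hMm.comp measurable_norm).mul (by fun_prop)
    refine (hM2.add hball).mono' hm.aestronglyMeasurable (ae_of_all _ fun y => ?_)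
    by_cases hy : ‖y‖ ≤ R
    · have h1 : |M ‖y‖ * y c| ≤ |M ‖y‖ * ‖y‖| := by
        rw [abs_mul, abs_mul, abs_norm]
        gcongr
        exact PiLp.norm_apply_le y c
      simp only [Pi.add_apply]
      rw [Set.indicator_of_mem (by simpa using hy), Real.norm_eq_abs, ← sq_abs (M ‖y‖ * ‖y‖)]
      nlinarith [sq_nonneg (|M ‖y‖ * ‖y‖| - 1), abs_nonneg (M ‖y‖ * ‖y‖)]
    · rw [hMR _ (not_le.1 hy), zero_mul, norm_zero]
      simp only [Pi.add_apply]
      exact add_nonneg (sq_nonneg _) (Set.indicator_nonneg (fun _ _ => zero_le_one) _)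
  -- On the ball `g` is the constant `β` plus the mean-zero part `f`. The constant part is square
  -- integrable, and `f` is the divergence of the radial field `M(|y|) y`, whose components are
  -- square integrable; both therefore lie in `H⁻¹`.
  set b : Torus d ℓ → ℂ := fun x => if torusDist x ≤ R then 1 else 0 with hb
  set F : Torus d ℓ → ℂ := fun x => (f (torusDist x) : ℂ) with hF
  have hFi : Integrable F := (integrable_torusDist hfi).ofReal
  have hbm : Measurable b := by
    refine Measurable.ite (measurableSet_le ?_ measurable_const) measurable_const measurable_const
    rw [show (torusDist : Torus d ℓ → ℝ) = fun x => ‖boxRep x‖ from funext torusDist_eq_norm_boxRep]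
    exact measurable_norm.comp measurePreserving_boxRep.measurable
  have hb2 : MemLp b 2 volume := MemLp.of_bound hbm.aestronglyMeasurable 1
    (ae_of_all _ fun x => by simp only [hb]; split_ifs <;> simp)
  have hFcoef : ∀ k, torusCoef F k = Complex.I * ∑ c, ((2 * Real.pi / ℓ * k c : ℝ) : ℂ) *
      torusCoef (fun x : Torus d ℓ => ((M ‖boxRep x‖ * boxRep x c : ℝ) : ℂ)) k := by
    intro k
    set q : EuclideanSpace ℝ (Fin d) := WithLp.toLp 2 fun c => 2 * Real.pi / ℓ * k c with hq
    have hqy : ∀ y : EuclideanSpace ℝ (Fin d),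
        inner ℝ q y = ∑ c, (2 * Real.pi / ℓ * k c) * y c := fun y => by
      rw [PiLp.inner_apply]
      refine Finset.sum_congr rfl fun c _ => ?_
      simp [hq, mul_comm]
    have hMq : ∀ y : EuclideanSpace ℝ (Fin d), M ‖y‖ * inner ℝ q y =
        ∑ c, (2 * Real.pi / ℓ * k c) * (M ‖y‖ * y c) := fun y => by
      rw [hqy, Finset.mul_sum]
      exact Finset.sum_congr rfl fun c _ => by ring
    have hMi : Integrable fun y : EuclideanSpace ℝ (Fin d) => M ‖y‖ * inner ℝ q y := by
      simp only [hMq]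
      exact integrable_finsetSum _ fun c _ => (hDi c).const_mul _
    have key := integral_radial_mul_exp hd hR.le hfi hfR hf0 hM hMR q hMi
    have hbd : ∀ y : EuclideanSpace ℝ (Fin d),
        ‖Complex.exp (-Complex.I * (inner ℝ q y : ℝ))‖ ≤ 1 := fun y => by
      rw [show -Complex.I * ((inner ℝ q y : ℝ) : ℂ) = ((-inner ℝ q y : ℝ) : ℂ) * Complex.I by
        push_cast; ring, Complex.norm_exp_ofReal_mul_I]
    have hem : AEStronglyMeasurable (fun y : EuclideanSpace ℝ (Fin d) =>
        Complex.exp (-Complex.I * (inner ℝ q y : ℝ))) volume :=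
      Continuous.aestronglyMeasurable (by fun_prop)
    have hi1 : Integrable fun y : EuclideanSpace ℝ (Fin d) =>
        (f ‖y‖ : ℂ) * Complex.exp (-Complex.I * (inner ℝ q y : ℝ)) :=
      hfi.ofReal.mul_bdd hem (ae_of_all _ hbd)
    have hi2 : Integrable fun y : EuclideanSpace ℝ (Fin d) =>
        Complex.I * ((M ‖y‖ * inner ℝ q y : ℝ) : ℂ) *
          Complex.exp (-Complex.I * (inner ℝ q y : ℝ)) :=
      (hMi.ofReal.const_mul Complex.I).mul_bdd hem (ae_of_all _ hbd)
    rw [← integral_comp_boxRep hi1 hRℓ fun y hy => by simp [hfR _ hy],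
      ← integral_comp_boxRep hi2 hRℓ fun y hy => by simp [hMR _ hy]] at key
    have hpw : ∀ x : Torus d ℓ, Complex.exp (-Complex.I * (inner ℝ q (boxRep x) : ℝ)) =
        conj (planeWave k x) := fun x => by rw [conj_planeWave_eq, hqy]
    simp only [hpw] at key
    have h1 : torusCoef F k = ∫ x : Torus d ℓ, (f ‖boxRep x‖ : ℂ) * conj (planeWave k x) := by
      refine integral_congr_ae (ae_of_all _ fun x => ?_)
      simp only [hF, torusDist_eq_norm_boxRep]
      exact mul_comm _ _
    rw [h1, key, Finset.mul_sum]
    simp only [charCoef]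
    simp_rw [← integral_const_mul]
    rw [← integral_finsetSum]
    · refine integral_congr_ae (ae_of_all _ fun x => ?_)
      simp only [hMq]
      rw [Complex.ofReal_sum, Finset.mul_sum, Finset.sum_mul]
      refine Finset.sum_congr rfl fun c _ => ?_
      rw [show torusChar d ℓ k x = planeWave k x from rfl]
      push_cast
      ring
    · intro c _
      exact ((isCharFamily_torusChar.conj_mul_integrable
        ((hDt c).integrable (by norm_num)) k).const_mul _).const_mul _
  have hgcoef : ∀ k, fourierCoefTorus ℓ g k = β * torusCoef b k + torusCoef F k := by
    intro k
    rw [fourierCoefTorus_eq]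
    simp only [charCoef]
    rw [← integral_const_mul, ← integral_add]
    · refine integral_congr_ae (ae_of_all _ fun x => ?_)
      simp only [hb, hF]
      by_cases hx : torusDist x ≤ R
      · rw [hfg _ (torusDist_nonneg x) hx, if_pos hx]
        push_cast
        ring
      · rw [hgR _ (not_le.1 hx), hfR _ (not_le.1 hx), if_neg hx]
        simp
    · exact (isCharFamily_torusChar.conj_mul_integrable
        (hb2.integrable (by norm_num)) k).const_mul _
    · exact isCharFamily_torusChar.conj_mul_integrable hFi k
  have hvol : 0 < (volume : Measure (Torus d ℓ)).real Set.univ := by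
    rw [volume_real_torus]; exact vol_pos
  have hsum : Summable fun k : Mode d => (|β| * ‖torusCoef b k‖) ^ 2 +
      ∑ c, ‖torusCoef (fun x : Torus d ℓ => ((M ‖boxRep x‖ * boxRep x c : ℝ) : ℂ)) k‖ ^ 2 := by
    refine Summable.add ?_ (summable_sum fun c _ =>
      (isCharFamily_torusChar.hasSum_norm_sq hvol (hDt c)).summable)
    simp only [mul_pow]
    exact (isCharFamily_torusChar.hasSum_norm_sq hvol hb2).summable.mul_left _
  refine hsum.of_nonneg_of_le (fun k => div_nonneg (sq_nonneg _)
    (add_nonneg zero_le_one (kSq_nonneg k))) fun k => ?_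
  rw [div_le_iff₀ (by have := kSq_nonneg (ℓ := ℓ) k; linarith), mul_comm]
  set S := ∑ c, ‖torusCoef (fun x : Torus d ℓ => ((M ‖boxRep x‖ * boxRep x c : ℝ) : ℂ)) k‖ ^ 2
  have hle : |radialCoef ℓ g k| ≤ |β| * ‖torusCoef b k‖ + ∑ c, |2 * Real.pi / ℓ * k c| *
      ‖torusCoef (fun x : Torus d ℓ => ((M ‖boxRep x‖ * boxRep x c : ℝ) : ℂ)) k‖ := by
    refine (Complex.abs_re_le_norm _).trans ?_
    rw [hgcoef, hFcoef]
    refine (norm_add_le _ _).trans ?_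
    rw [norm_mul, norm_mul, Complex.norm_I, one_mul, Complex.norm_real, Real.norm_eq_abs]
    gcongr
    refine (norm_sum_le _ _).trans (Finset.sum_le_sum fun c _ => ?_)
    rw [norm_mul, Complex.norm_real, Real.norm_eq_abs]
  have hcs := Finset.sum_mul_sq_le_sq_mul_sq Finset.univ (fun c => |2 * Real.pi / ℓ * k c|)
    (fun c => ‖torusCoef (fun x : Torus d ℓ => ((M ‖boxRep x‖ * boxRep x c : ℝ) : ℂ)) k‖)
  simp only [sq_abs] at hcs
  rw [← kSq_eq_sum] at hcs
  calc radialCoef ℓ g k ^ 2 = |radialCoef ℓ g k| ^ 2 := (sq_abs _).symm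
    _ ≤ _ := pow_le_pow_left₀ (abs_nonneg _) hle 2
    _ ≤ _ := sq_add_le_of_sq_le (kSq_nonneg k) (Finset.sum_nonneg fun c _ => sq_nonneg _) hcs

/-- Up to the constant `β` on the ball, `g = 2 Δφ` is the divergence of a radial field supported in
the ball: the flux of `2 ∇φ` minus that of a uniform source. The energy estimate for the scattering
solution makes this field square integrable. It is this estimate that allows `v` to be merely
integrable. -/
theorem ScatteringData.summable_coef_sq_div (h : ScatteringData d ℓ R a δ v φ₀) :
    Summable fun k : Mode d =>
      radialCoef ℓ (gFn v (normalizedSol d δ φ₀)) k ^ 2 / (1 + kSq ℓ k) := by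
  have hd := h.one_le_dim
  have hR := h.radius_pos
  have hd0 : (0 : ℝ) < d := by exact_mod_cast hd
  have hw := h.integrableOn_density
  set κ := normConst d δ
  set W := scatFlux d v φ₀ with hW
  -- The average of `g` over the ball, so that the field of `g - β` has zero flux at `R` and can be
  -- cut off there.
  set β := 2 * κ * W R * d / R ^ d with hβ
  set g := gFn v (normalizedSol d δ φ₀) with hg
  set f : ℝ → ℝ := fun r => if r ≤ R then g r - β else 0 with hf
  have hgd : ∀ r, r ^ (d - 1) * g r = 2 * κ * scatDensity d v φ₀ r := fun r => by
    rw [hg, gFn_eq, normalizedSol_eq, scatDensity]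
    ring
  have hflux : ∀ r, 0 ≤ r → r ≤ R → ∫ u in 0..r, u ^ (d - 1) * f u =
      2 * κ * W r - β * (r ^ d / d) := by
    intro r hr hrR
    have h1 : ∫ u in 0..r, u ^ (d - 1) * f u =
        ∫ u in 0..r, (2 * κ * scatDensity d v φ₀ u - β * u ^ (d - 1)) := by
      refine intervalIntegral.integral_congr fun u hu => ?_
      rw [Set.uIcc_of_le hr] at hu
      simp only [hf, if_pos (hu.2.trans hrR), mul_sub, hgd]
      ring
    rw [h1, intervalIntegral.integral_sub
      ((intervalIntegrable_scatDensity hw le_rfl hr).const_mul _)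
      (Continuous.intervalIntegrable (by fun_prop) _ _), intervalIntegral.integral_const_mul,
      intervalIntegral.integral_const_mul, integral_pow, hW, scatFlux]
    obtain ⟨e, rfl⟩ := Nat.exists_eq_add_of_le' hd
    simp
  set M : ℝ → ℝ := (Set.Ioc 0 R).piecewise
    (fun r => (2 * κ * W r - β * (r ^ d / d)) / r ^ d) (fun _ => 0) with hM
  have hMm : Measurable M := by
    refine ContinuousOn.measurable_piecewise ?_ continuousOn_const measurableSet_Ioc
    refine ContinuousOn.div ?_ (by fun_prop) fun r hr => (pow_pos hr.1 d).ne'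
    refine ContinuousOn.sub (continuousOn_const.mul ?_) (by fun_prop)
    exact (continuousOn_scatFlux hw).mono fun r hr => hr.1.le
  refine summable_coef_sq_div_of_flux (f := f) (β := β) (M := M) hd hR h.radius_le
    ?_ ?_ ?_ ?_ ?_ hMm ?_ ?_ ?_
  · intro r _ hr
    simp [hf, hr]
  · intro r hr
    simp [hf, not_le.2 hr]
  · intro r hr
    rw [hg, gFn_eq, h.support r hr, zero_mul]
  · have h1 : Integrable fun y : EuclideanSpace ℝ (Fin d) =>
        (Metric.closedBall (0 : EuclideanSpace ℝ (Fin d)) R).indicator (fun _ => β) y :=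
      (integrable_indicator_iff measurableSet_closedBall).2
        (integrableOn_const (measure_closedBall_lt_top.ne))
    refine (h.integrable_gFn_norm.sub h1).congr (ae_of_all _ fun y => ?_)
    simp only [Pi.sub_apply, hf]
    by_cases hy : ‖y‖ ≤ R
    · rw [if_pos hy, Set.indicator_of_mem (by simpa using hy)]
    · rw [if_neg hy, Set.indicator_of_notMem (by simpa using hy), gFn_eq,
        h.support _ (not_le.1 hy)]
      simp
  · rw [hflux R hR.le le_rfl, hβ]
    field_simp
    ring
  · intro r hr hrR
    rw [hM, Set.piecewise_eq_of_mem _ _ _ (show r ∈ Set.Ioc 0 R from ⟨hr, hrR⟩), hflux r hr.le hrR]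
  · intro r hr
    rw [hM, Set.piecewise_eq_of_notMem _ _ _ fun h' => not_lt.2 h'.2 hr]
  · rw [integrableOn_radial (f := fun r => (M r * r) ^ 2) hd]
    have h1 := integrableOn_flux_sq hd h.nonneg h.length_pos h.solution hw (R := R)
    have h2 : IntegrableOn (fun r : ℝ => r ^ (d + 1)) (Set.Ioc 0 R) :=
      (Continuous.integrableOn_Icc (by fun_prop)).mono_set Set.Ioc_subset_Icc_self
    -- By `(x - y)² ≤ 2 x² + 2 y²` the flux separates into the scattering part, integrable by the
    -- energy estimate, and a polynomial from the uniform source.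
    have h3 : IntegrableOn (fun r => 8 * κ ^ 2 * ((r ^ (d - 1))⁻¹ * W r ^ 2) +
        2 * β ^ 2 / d ^ 2 * r ^ (d + 1)) (Set.Ioc 0 R) := (h1.const_mul _).add (h2.const_mul _)
    have h4 : IntegrableOn (fun r => r ^ (d - 1) * (M r * r) ^ 2) (Set.Ioc 0 R) := by
      refine h3.mono' (Measurable.aestronglyMeasurable (by fun_prop)) ?_
      refine (ae_restrict_mem measurableSet_Ioc).mono fun r hr => ?_
      have hr0 : 0 < r := hr.1
      rw [Real.norm_of_nonneg (by positivity), hM, Set.piecewise_eq_of_mem _ _ _ hr]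
      obtain ⟨e, rfl⟩ := Nat.exists_eq_add_of_le' hd
      simp only [Nat.add_sub_cancel]
      have h5 : r ^ e * ((2 * κ * W r - β * (r ^ (e + 1) / ((e + 1 : ℕ) : ℝ))) / r ^ (e + 1) * r) ^ 2
          = (r ^ e)⁻¹ * (2 * κ * W r - β * (r ^ (e + 1) / ((e + 1 : ℕ) : ℝ))) ^ 2 := by
        rw [pow_succ r e]
        field_simp
      have h6 : 8 * κ ^ 2 * ((r ^ e)⁻¹ * W r ^ 2) +
          2 * β ^ 2 / ((e + 1 : ℕ) : ℝ) ^ 2 * r ^ (e + 1 + 1) = (r ^ e)⁻¹ * (2 * (2 * κ * W r) ^ 2 +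
            2 * (β * (r ^ (e + 1) / ((e + 1 : ℕ) : ℝ))) ^ 2) := by
        rw [pow_succ r (e + 1), pow_succ r e]
        field_simp
        ring
      rw [h5, h6]
      gcongr
      nlinarith [sq_nonneg (2 * κ * W r + β * (r ^ (e + 1) / ((e + 1 : ℕ) : ℝ)))]
    have h7 : IntegrableOn (fun r => r ^ (d - 1) * (M r * r) ^ 2) (Set.Ioi R) := by
      refine (integrableOn_zero (ε' := ℝ)).congr_fun (fun r hr => ?_) measurableSet_Ioi
      rw [hM, Set.piecewise_eq_of_notMem _ _ _ fun h' => not_lt.2 h'.2 hr]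
      simp
    rw [← Set.Ioc_union_Ioi_eq_Ioi hR.le]
    exact h4.union h7

end RenormalizedPotential

/-! ### Occupation numbers of momentum configurations -/

section Occupation

variable {d N : ℕ}

open Classical in
theorem occ_apply (κ : Fin N → Mode d) (k : Mode d) :
    occ κ k = Fintype.card {j // κ j = k} := by
  rw [occ, Finsupp.finsetSum_apply, Fintype.card_subtype, Finset.card_filter]
  exact Finset.sum_congr rfl fun j _ => Finsupp.single_apply

theorem degree_occ (κ : Fin N → Mode d) : (occ κ).degree = N := by
  rw [occ, map_sum]
  simp

theorem occ_comp_perm (κ : Fin N → Mode d) (σ : Equiv.Perm (Fin N)) : occ (κ ∘ σ) = occ κ :=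
  Equiv.sum_comp σ fun j => Finsupp.single (κ j) 1

/-- The fibres over each momentum have the same cardinality, and bijections between them glue to a
permutation. -/
theorem exists_perm_of_occ_eq {κ κ' : Fin N → Mode d} (h : occ κ = occ κ') :
    ∃ σ : Equiv.Perm (Fin N), κ' = κ ∘ σ := by
  classical
  have e : ∀ k, Nonempty ({j // κ' j = k} ≃ {j // κ j = k}) := fun k =>
    Fintype.card_eq.1 (by rw [← occ_apply, ← occ_apply, h])
  refine ⟨Equiv.ofFiberEquiv fun k => (e k).some, ?_⟩
  funext j
  exact (Equiv.ofFiberEquiv_map (fun k => (e k).some) j).symm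

instance finite_occ_fiber (ν : Mode d →₀ ℕ) : Finite {κ : Fin N → Mode d // occ κ = ν} := by
  have : Finite (Fin N → ν.support) := inferInstance
  refine Finite.of_injective
    (β := Fin N → ν.support) (fun κ j => ⟨κ.1 j, ?_⟩) fun κ κ' h => ?_
  · classical
    have h := occ_apply κ.1 (κ.1 j)
    rw [congrFun (congrArg DFunLike.coe κ.2) (κ.1 j)] at h
    rw [Finsupp.mem_support_iff, h, ← pos_iff_ne_zero, Fintype.card_pos_iff]
    exact ⟨⟨j, rfl⟩⟩
  · refine Subtype.ext (funext fun j => ?_)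
    exact congrArg Subtype.val (congrFun h j)

/-- `∏_k ν_k!`. -/
def factProd {ι : Type} (ν : ι →₀ ℕ) : ℝ := ν.prod fun _ m => (m.factorial : ℝ)

theorem factProd_pos {ι : Type} (ν : ι →₀ ℕ) : 0 < factProd ν :=
  Finset.prod_pos fun _ _ => by positivity

/-- Orbit–stabilizer for the action of permutations: the configurations with given occupation form
an orbit, and the stabilizer has order `∏_k ν_k!`. -/
theorem card_occ_fiber (κ : Fin N → Mode d) :
    (Nat.card {κ' : Fin N → Mode d // occ κ' = occ κ} : ℝ) * factProd (occ κ) = N.factorial := by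
  classical
  have h1 : MulAction.orbit (Equiv.Perm (Fin N))ᵈᵐᵃ κ = {κ' | occ κ' = occ κ} := by
    ext κ'
    constructor
    · rintro ⟨σ, rfl⟩
      exact occ_comp_perm κ (DomMulAct.mk.symm σ)
    · intro h
      obtain ⟨σ, rfl⟩ := exists_perm_of_occ_eq (show occ κ' = occ κ from h).symm
      exact ⟨DomMulAct.mk σ, rfl⟩
  have : Finite (MulAction.orbit (Equiv.Perm (Fin N))ᵈᵐᵃ κ) := by
    rw [h1]; exact finite_occ_fiber _
  have h2 := Nat.card_congr (MulAction.orbitProdStabilizerEquivGroup (Equiv.Perm (Fin N))ᵈᵐᵃ κ)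
  rw [Nat.card_prod, h1] at h2
  have h3 : Nat.card (MulAction.stabilizer (Equiv.Perm (Fin N))ᵈᵐᵃ κ) =
      ∏ k ∈ Finset.univ.image κ, (occ κ k).factorial := by
    have := DomMulAct.stabilizer_card' κ
    simp only [← occ_apply] at this
    rw [← this, ← Nat.card_eq_fintype_card]
    exact (Nat.card_congr (Equiv.subtypeEquiv DomMulAct.mk fun _ => Iff.rfl)).symm
  have h4 : Nat.card (Equiv.Perm (Fin N))ᵈᵐᵃ = N.factorial := by
    rw [← Nat.card_congr (DomMulAct.mk (M := Equiv.Perm (Fin N))), Nat.card_eq_fintype_card,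
      Fintype.card_perm, Fintype.card_fin]
  have h5 : (occ κ).support = Finset.univ.image κ := by
    ext k
    rw [Finsupp.mem_support_iff, occ_apply, ← pos_iff_ne_zero, Fintype.card_pos_iff]
    simp
  rw [h3, h4] at h2
  rw [factProd, Finsupp.prod, h5, ← h2]
  push_cast
  rfl

theorem toFock_eq_zero {ℓ : ℝ} [Fact (0 < ℓ)] (Ψ : Config d ℓ N → ℂ) {ν : Mode d →₀ ℕ}
    (h : ν.degree ≠ N) : toFock Ψ ν = 0 := by
  have : IsEmpty {κ : Fin N → Mode d // occ κ = ν} :=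
    ⟨fun κ => h (by rw [← κ.2, degree_occ])⟩
  simp [toFock]

/-- The amplitudes of a symmetric wave function in the occupation number representation. -/
theorem toFock_occ {ℓ : ℝ} [Fact (0 < ℓ)] {Ψ : Config d ℓ N → ℂ}
    (hΨ : ∀ (σ : Equiv.Perm (Fin N)) κ, momentumCoef Ψ (κ ∘ σ) = momentumCoef Ψ κ)
    (κ : Fin N → Mode d) :
    toFock Ψ (occ κ) = (Real.sqrt (N.factorial / factProd (occ κ)) : ℂ) * momentumCoef Ψ κ := by
  have hc : ∀ κ' : {κ' : Fin N → Mode d // occ κ' = occ κ},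
      momentumCoef Ψ κ'.1 = momentumCoef Ψ κ := fun κ' => by
    obtain ⟨σ, h⟩ := exists_perm_of_occ_eq κ'.2.symm
    rw [h, hΨ]
  have := Fintype.ofFinite {κ' : Fin N → Mode d // occ κ' = occ κ}
  rw [toFock, tsum_fintype, Finset.sum_congr rfl fun κ' _ => hc κ', Finset.sum_const,
    Finset.card_univ, ← Nat.card_eq_fintype_card, nsmul_eq_mul, ← mul_assoc]
  congr 1
  have h1 := card_occ_fiber κ
  have h2 := factProd_pos (occ κ)
  have h3 : (0 : ℝ) < N.factorial := by positivity
  have h4 : Real.sqrt (N.factorial / factProd (occ κ)) =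
      Real.sqrt (factProd (occ κ) / N.factorial) *
        (Nat.card {κ' : Fin N → Mode d // occ κ' = occ κ} : ℝ) := by
    rw [eq_div_of_mul_eq h2.ne' h1, ← Real.sqrt_sq (by positivity :
      (0 : ℝ) ≤ N.factorial / factProd (occ κ)), ← Real.sqrt_mul (by positivity),
      Real.sqrt_sq (by positivity)]
    congr 1
    field_simp
  rw [h4]
  push_cast
  rfl

/-- The excitations in a momentum configuration. -/
def excOcc (κ : Fin N → Mode d) : ExcMode d →₀ ℕ :=
  open Classical in ∑ j, if h : κ j ≠ 0 then Finsupp.single ⟨κ j, h⟩ 1 else 0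

/-- The number of particles of momentum `0`. -/
def zeroCount (κ : Fin N → Mode d) : ℕ := occ κ 0

theorem joinOcc_zero (m : Unit →₀ ℕ) (n : ExcMode d →₀ ℕ) : joinOcc m n 0 = m () := by
  rw [joinOcc, Finsupp.add_apply, Finsupp.single_eq_same, Finsupp.embDomain_of_notMem_range, add_zero]
  rintro ⟨k, hk⟩
  exact k.2 hk

theorem joinOcc_apply (m : Unit →₀ ℕ) (n : ExcMode d →₀ ℕ) (k : ExcMode d) :
    joinOcc m n k.1 = n k := by
  rw [joinOcc, Finsupp.add_apply, Finsupp.single_eq_of_ne k.2, zero_add]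
  exact Finsupp.embDomain_apply_self _ _ _

theorem degree_joinOcc (m : Unit →₀ ℕ) (n : ExcMode d →₀ ℕ) :
    (joinOcc m n).degree = m () + n.degree := by
  rw [joinOcc, map_add, Finsupp.degree_single, Finsupp.embDomain_eq_mapDomain,
    Finsupp.degree_mapDomain]

theorem excOcc_apply (κ : Fin N → Mode d) (k : ExcMode d) : excOcc κ k = occ κ k.1 := by
  classical
  rw [excOcc, occ, Finsupp.finsetSum_apply, Finsupp.finsetSum_apply]
  refine Finset.sum_congr rfl fun j _ => ?_
  by_cases h : κ j = 0
  · rw [dif_neg (not_not.2 h), h, Finsupp.single_eq_of_ne k.2]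
    rfl
  · rw [dif_pos h, Finsupp.single_apply, Finsupp.single_apply]
    exact if_congr Subtype.ext_iff rfl rfl

theorem occ_eq_joinOcc_iff (κ : Fin N → Mode d) (m : Unit →₀ ℕ) (n : ExcMode d →₀ ℕ) :
    occ κ = joinOcc m n ↔ zeroCount κ = m () ∧ excOcc κ = n := by
  constructor
  · intro h
    refine ⟨by rw [zeroCount, h, joinOcc_zero], ?_⟩
    ext k
    rw [excOcc_apply, h, joinOcc_apply]
  · rintro ⟨h1, rfl⟩
    ext k
    by_cases hk : k = 0
    · rw [hk, joinOcc_zero, ← h1, zeroCount]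
    · rw [joinOcc_apply m _ ⟨k, hk⟩, excOcc_apply]

theorem zeroCount_add_degree (κ : Fin N → Mode d) : zeroCount κ + (excOcc κ).degree = N := by
  have h := (occ_eq_joinOcc_iff κ (Finsupp.single () (zeroCount κ)) (excOcc κ)).2 ⟨by simp, rfl⟩
  have h2 := degree_joinOcc (Finsupp.single () (zeroCount κ)) (excOcc κ)
  rw [← h, degree_occ] at h2
  simpa using h2.symm

theorem occ_eq_joinOcc (κ : Fin N → Mode d) :
    occ κ = joinOcc (Finsupp.single () (N - (excOcc κ).degree)) (excOcc κ) := by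
  rw [occ_eq_joinOcc_iff]
  have := zeroCount_add_degree κ
  refine ⟨?_, rfl⟩
  simp
  omega

/-- The amplitude of the state with excitations `n`, all other particles having momentum `0`. -/
def excAmp {ℓ : ℝ} [Fact (0 < ℓ)] (Ψ : Config d ℓ N → ℂ) (n : ExcMode d →₀ ℕ) : ℂ :=
  toFock Ψ (joinOcc (Finsupp.single () (N - n.degree)) n)

/-- An `N`-particle state with excitations `n` has exactly `N - |n|` condensate particles, so one
term survives. If `|n| > N` the natural subtraction gives `0`, but the amplitude is then zero
anyway. -/
theorem braCoherent_toFock {ℓ : ℝ} [Fact (0 < ℓ)] (z : ℂ) (Ψ : Config d ℓ N → ℂ)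
    (n : ExcMode d →₀ ℕ) :
    braCoherent z (toFock Ψ) n =
      conj (coherent z (Finsupp.single () (N - n.degree))) * excAmp Ψ n := by
  rw [braCoherent, tsum_eq_single (Finsupp.single () (N - n.degree))]
  · rfl
  · intro m hm
    rw [toFock_eq_zero, mul_zero]
    rw [degree_joinOcc]
    intro h
    refine hm (Finsupp.ext fun u => ?_)
    rw [Subsingleton.elim u (), Finsupp.single_eq_same]
    omega

theorem excAmp_eq_zero {ℓ : ℝ} [Fact (0 < ℓ)] (Ψ : Config d ℓ N → ℂ) {n : ExcMode d →₀ ℕ}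
    (h : N < n.degree) : excAmp Ψ n = 0 := by
  refine toFock_eq_zero Ψ ?_
  rw [degree_joinOcc]
  omega

theorem occ_eq_of_excOcc {κ : Fin N → Mode d} {n : ExcMode d →₀ ℕ} (h : excOcc κ = n) :
    occ κ = joinOcc (Finsupp.single () (N - n.degree)) n := by
  rw [← h]; exact occ_eq_joinOcc κ

theorem excOcc_eq_iff {κ : Fin N → Mode d} {n : ExcMode d →₀ ℕ} :
    excOcc κ = n ↔ occ κ = joinOcc (Finsupp.single () (N - n.degree)) n :=
  ⟨occ_eq_of_excOcc, fun h => ((occ_eq_joinOcc_iff κ _ _).1 h).2⟩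

instance finite_excOcc_fiber (n : ExcMode d →₀ ℕ) :
    Finite {κ : Fin N → Mode d // excOcc κ = n} := by
  simp only [excOcc_eq_iff]
  infer_instance

/-- Sums over momentum configurations, organized by excitations. -/
theorem hasSum_fiber {G : (Fin N → Mode d) → ℂ} {s : ℂ} (hG : HasSum G s) :
    HasSum (fun n : ExcMode d →₀ ℕ => ∑' κ : {κ : Fin N → Mode d // excOcc κ = n}, G κ.1) s := by
  have h := (Equiv.sigmaFiberEquiv (excOcc (d := d) (N := N))).hasSum_iff.2 hG
  exact h.sigma fun n => (Summable.of_finite (f := fun κ : {κ : Fin N → Mode d // excOcc κ = n} =>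
    G κ.1)).hasSum

variable {ℓ : ℝ} [Fact (0 < ℓ)] {Ψ : Config d ℓ N → ℂ}

/-- The square of the norm of an amplitude. -/
theorem sum_fiber_norm_sq
    (hΨ : ∀ (σ : Equiv.Perm (Fin N)) κ, momentumCoef Ψ (κ ∘ σ) = momentumCoef Ψ κ)
    (n : ExcMode d →₀ ℕ) :
    ∑' κ : {κ : Fin N → Mode d // excOcc κ = n}, (‖momentumCoef Ψ κ.1‖ ^ 2 : ℝ) =
      ‖excAmp Ψ n‖ ^ 2 := by
  have := Fintype.ofFinite {κ : Fin N → Mode d // excOcc κ = n}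
  rcases isEmpty_or_nonempty {κ : Fin N → Mode d // excOcc κ = n} with he | ⟨⟨κ, hκ⟩⟩
  · have : IsEmpty {κ : Fin N → Mode d //
        occ κ = joinOcc (Finsupp.single () (N - n.degree)) n} :=
      ⟨fun κ => he.false ⟨κ.1, excOcc_eq_iff.2 κ.2⟩⟩
    simp [excAmp, toFock]
  · have hc : ∀ κ' : {κ' : Fin N → Mode d // excOcc κ' = n},
        ‖momentumCoef Ψ κ'.1‖ ^ 2 = ‖momentumCoef Ψ κ‖ ^ 2 := fun κ' => by
      obtain ⟨σ, h⟩ := exists_perm_of_occ_eq (κ := κ) (κ' := κ'.1)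
        (by rw [occ_eq_of_excOcc hκ, occ_eq_of_excOcc κ'.2])
      rw [h, hΨ]
    rw [tsum_fintype, Finset.sum_congr rfl fun κ' _ => hc κ', Finset.sum_const, Finset.card_univ,
      nsmul_eq_mul, excAmp, ← occ_eq_of_excOcc hκ, toFock_occ hΨ, norm_mul, mul_pow,
      Complex.norm_real, Real.norm_of_nonneg (Real.sqrt_nonneg _), Real.sq_sqrt
        (div_nonneg (by positivity) (factProd_pos _).le),
      ← eq_div_of_mul_eq (factProd_pos (occ κ)).ne' (card_occ_fiber κ), ← Nat.card_eq_fintype_card]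
    congr 2
    refine Nat.card_congr (Equiv.subtypeEquivRight fun κ' => ?_)
    rw [excOcc_eq_iff, occ_eq_of_excOcc hκ]

/-- Diagonal sums in the two pictures. -/
theorem hasSum_excAmp_sq
    (hΨ : ∀ (σ : Equiv.Perm (Fin N)) κ, momentumCoef Ψ (κ ∘ σ) = momentumCoef Ψ κ)
    {F : (ExcMode d →₀ ℕ) → ℂ} {s : ℂ}
    (h : HasSum (fun κ : Fin N → Mode d => ((‖momentumCoef Ψ κ‖ ^ 2 : ℝ) : ℂ) * F (excOcc κ)) s) :
    HasSum (fun n => ((‖excAmp Ψ n‖ ^ 2 : ℝ) : ℂ) * F n) s := by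
  refine hasSum_of_eq (hasSum_fiber h) (fun n => ?_) rfl
  have := Fintype.ofFinite {κ : Fin N → Mode d // excOcc κ = n}
  rw [← sum_fiber_norm_sq hΨ, tsum_fintype, tsum_fintype, Complex.ofReal_sum, Finset.sum_mul]
  exact Finset.sum_congr rfl fun κ _ => by rw [κ.2]

end Occupation

/-! ### Creation of pairs of opposite momenta -/

section Pairs

variable {d N : ℕ}

/-- `ℤ^d` has no 2-torsion, so a pair `k, -k` always occupies two distinct modes and the factors
`√(n_k + 1)` and `√(n_{-k} + 1)` are independent. -/
theorem negMode_ne (k : ExcMode d) : negMode k ≠ k := by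
  intro h
  have h1 : -k.1 = k.1 := congrArg Subtype.val h
  refine k.2 (funext fun c => ?_)
  have := congrFun h1 c
  simp only [Pi.neg_apply] at this
  simp only [Pi.zero_apply]
  omega

theorem negMode_negMode (k : ExcMode d) : negMode (negMode k) = k := Subtype.ext (neg_neg k.1)

/-- Addition of a pair of momenta `k, -k`. -/
def addPair (n : ExcMode d →₀ ℕ) (k : ExcMode d) : ExcMode d →₀ ℕ :=
  n + Finsupp.single k 1 + Finsupp.single (negMode k) 1

theorem addPair_self (n : ExcMode d →₀ ℕ) (k : ExcMode d) : addPair n k k = n k + 1 := by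
  simp [addPair, negMode_ne]

theorem addPair_neg (n : ExcMode d →₀ ℕ) (k : ExcMode d) :
    addPair n k (negMode k) = n (negMode k) + 1 := by
  simp [addPair, (negMode_ne k).symm]

theorem degree_addPair (n : ExcMode d →₀ ℕ) (k : ExcMode d) :
    (addPair n k).degree = n.degree + 2 := by
  simp [addPair]

theorem addPair_injective (k : ExcMode d) :
    Function.Injective fun n : ExcMode d →₀ ℕ => addPair n k := fun n n' h => by
  simpa [addPair] using h

/-- Excitation of two particles at rest to the momenta `k, -k`. -/
def movePair (κ : Fin N → Mode d) (i j : Fin N) (k : Mode d) : Fin N → Mode d :=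
  κ + Pi.single i k - Pi.single j k

theorem occ_update (κ : Fin N → Mode d) (i : Fin N) (a : Mode d) :
    occ (Function.update κ i a) + Finsupp.single (κ i) 1 = occ κ + Finsupp.single a 1 := by
  classical
  rw [occ, occ, ← Finset.add_sum_erase _ _ (Finset.mem_univ i),
    ← Finset.add_sum_erase _ (fun j => Finsupp.single (κ j) 1) (Finset.mem_univ i),
    Function.update_self, Finset.sum_congr rfl fun j hj => by
      rw [Function.update_of_ne (Finset.ne_of_mem_erase hj)]]
  abel

theorem movePair_eq_update {κ : Fin N → Mode d} {i j : Fin N} (hij : i ≠ j) (hi : κ i = 0)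
    (hj : κ j = 0) (k : Mode d) :
    movePair κ i j k = Function.update (Function.update κ i k) j (-k) := by
  funext l
  by_cases h1 : l = j
  · subst h1
    simp [movePair, hj, Pi.single_eq_of_ne hij.symm]
  · by_cases h2 : l = i
    · subst h2
      simp [movePair, hi, Pi.single_eq_of_ne hij, Function.update_of_ne hij]
    · simp [movePair, Pi.single_eq_of_ne h1, Pi.single_eq_of_ne h2, Function.update_of_ne h1,
        Function.update_of_ne h2]

/-- The two condensate particles are added on the left rather than removed on the right, so no
truncated subtraction enters. -/
theorem occ_movePair {κ : Fin N → Mode d} {i j : Fin N} (hij : i ≠ j) (hi : κ i = 0)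
    (hj : κ j = 0) (k : Mode d) :
    occ (movePair κ i j k) + Finsupp.single 0 1 + Finsupp.single 0 1 =
      occ κ + Finsupp.single k 1 + Finsupp.single (-k) 1 := by
  have h1 := occ_update κ i k
  have h2 := occ_update (Function.update κ i k) j (-k)
  rw [Function.update_of_ne hij.symm, hj] at h2
  rw [hi] at h1
  rw [movePair_eq_update hij hi hj, h2, ← h1]
  abel

theorem excOcc_movePair {κ : Fin N → Mode d} {i j : Fin N} (hij : i ≠ j) (hi : κ i = 0)
    (hj : κ j = 0) (k : ExcMode d) :
    excOcc (movePair κ i j k.1) = addPair (excOcc κ) k := by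
  ext p
  have h := congrArg (fun ν : Mode d →₀ ℕ => ν p.1) (occ_movePair hij hi hj k.1)
  simp only [Finsupp.add_apply, Finsupp.single_eq_of_ne p.2, add_zero] at h
  rw [excOcc_apply, h, addPair, Finsupp.add_apply, Finsupp.add_apply, excOcc_apply]
  classical
  simp only [Finsupp.single_apply, negMode, Subtype.ext_iff]

theorem factProd_add_single {ι : Type} (ν : ι →₀ ℕ) (k : ι) :
    factProd (ν + Finsupp.single k 1) = (ν k + 1) * factProd ν := by
  rw [factProd, factProd, ← Finsupp.mul_prod_erase' _ k _ (fun _ => by simp),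
    ← Finsupp.mul_prod_erase' ν k _ (fun _ => by simp)]
  have : (ν + Finsupp.single k 1).erase k = ν.erase k := by
    classical
    ext l
    by_cases h : l = k
    · simp [h]
    · simp [Finsupp.erase_ne h]
  rw [this, Finsupp.add_apply, Finsupp.single_eq_same, Nat.factorial_succ]
  push_cast
  ring

/-- The ratio of the permutation weights before and after the excitation; its square root is the
bosonic matrix element of the pair creation. -/
theorem factProd_movePair {κ : Fin N → Mode d} {i j : Fin N} (hij : i ≠ j) (hi : κ i = 0)
    (hj : κ j = 0) (k : ExcMode d) :
    (zeroCount κ : ℝ) * (zeroCount κ - 1) * factProd (occ (movePair κ i j k.1)) =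
      (excOcc κ k + 1) * (excOcc κ (negMode k) + 1) * factProd (occ κ) := by
  have h := occ_movePair hij hi hj k.1
  have h1 := congrArg factProd h
  have h0 := congrArg (fun ν : Mode d →₀ ℕ => ν 0) h
  simp only [Finsupp.add_apply, Finsupp.single_eq_same, Finsupp.single_eq_of_ne k.2.symm,
    Finsupp.single_eq_of_ne (neg_ne_zero.2 k.2).symm, add_zero] at h0
  rw [factProd_add_single, factProd_add_single, factProd_add_single, factProd_add_single] at h1
  have h2 : (zeroCount κ : ℝ) = (occ (movePair κ i j k.1)) 0 + 1 + 1 := by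
    rw [zeroCount, ← h0]; push_cast; rfl
  have h3 : (Finsupp.single k.1 1 : Mode d →₀ ℕ) (-k.1) = 0 :=
    Finsupp.single_eq_of_ne fun h => negMode_ne k (Subtype.ext h)
  simp only [Finsupp.add_apply, Finsupp.single_eq_same, h3, add_zero] at h1
  rw [excOcc_apply, excOcc_apply, h2]
  push_cast at h1
  simp only [negMode]
  linarith

theorem sum_pairs_eq (κ : Fin N → Mode d) (a : ℂ) :
    ∑ i, ∑ j, (if i ≠ j ∧ κ i = 0 ∧ κ j = 0 then a else 0) =
      (zeroCount κ : ℂ) * (zeroCount κ - 1) * a := by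
  classical
  set Z : Finset (Fin N) := Finset.univ.filter fun i => κ i = 0 with hZ
  have hcard : (zeroCount κ : ℂ) = Z.card := by
    rw [zeroCount, occ_apply, Fintype.card_subtype]
  have h1 : ∀ i, ∑ j, (if i ≠ j ∧ κ i = 0 ∧ κ j = 0 then a else 0) =
      if i ∈ Z then ((Z.card : ℂ) - 1) * a else 0 := by
    intro i
    by_cases hi : κ i = 0
    · rw [if_pos (by simp [hZ, hi]), ← Finset.sum_filter, Finset.sum_const, nsmul_eq_mul]
      have h2 : (Finset.univ.filter fun j => i ≠ j ∧ κ i = 0 ∧ κ j = 0) = Z.erase i := by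
        ext j
        simp [hZ, hi, eq_comm]
      rw [h2, Finset.cast_card_erase_of_mem (by simp [hZ, hi])]
    · rw [if_neg (by simp [hZ, hi])]
      exact Finset.sum_eq_zero fun j _ => if_neg fun h => hi h.2.1
  rw [Finset.sum_congr rfl fun i _ => h1 i, ← Finset.sum_filter, Finset.sum_const, nsmul_eq_mul,
    hcard, Finset.filter_mem_eq_inter, Finset.univ_inter]
  ring

variable {ℓ : ℝ} [Fact (0 < ℓ)] {Ψ : Config d ℓ N → ℂ}

/-- The weight `√(m (m - 1) (n_k + 1) (n_{-k} + 1))` of the pair creation. -/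
def pairWeight (N : ℕ) (n : ExcMode d →₀ ℕ) (k : ExcMode d) : ℝ :=
  Real.sqrt (((N - n.degree : ℕ) : ℝ) * (((N - n.degree : ℕ) : ℝ) - 1)) *
    Real.sqrt ((n k + 1) * (n (negMode k) + 1))

/-- The off-diagonal elements in the two pictures. -/
theorem sum_fiber_pairs
    (hΨ : ∀ (σ : Equiv.Perm (Fin N)) κ, momentumCoef Ψ (κ ∘ σ) = momentumCoef Ψ κ)
    (n : ExcMode d →₀ ℕ) (k : ExcMode d) :
    ∑' κ : {κ : Fin N → Mode d // excOcc κ = n}, ∑ i, ∑ j,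
      (if i ≠ j ∧ κ.1 i = 0 ∧ κ.1 j = 0 then
        conj (momentumCoef Ψ κ.1) * momentumCoef Ψ (movePair κ.1 i j k.1) else 0) =
      (pairWeight N n k : ℂ) * (conj (excAmp Ψ n) * excAmp Ψ (addPair n k)) := by
  have := Fintype.ofFinite {κ : Fin N → Mode d // excOcc κ = n}
  set m : ℕ := N - n.degree with hm
  have hzc : ∀ κ : {κ : Fin N → Mode d // excOcc κ = n}, zeroCount κ.1 = m := fun κ => by
    have := zeroCount_add_degree κ.1
    rw [κ.2] at this
    omega
  have hN0 : (0 : ℝ) < N.factorial := by positivity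
  have hF := factProd_pos (joinOcc (Finsupp.single () m) n)
  set F := factProd (joinOcc (Finsupp.single () m) n) with hFdef
  set w : ℝ := (n k + 1) * (n (negMode k) + 1) with hw
  have hw0 : 0 < w := by positivity
  -- one configuration
  have h1 : ∀ κ : {κ : Fin N → Mode d // excOcc κ = n}, ∑ i, ∑ j,
      (if i ≠ j ∧ κ.1 i = 0 ∧ κ.1 j = 0 then
        conj (momentumCoef Ψ κ.1) * momentumCoef Ψ (movePair κ.1 i j k.1) else 0) =
      ((F / N.factorial : ℝ) : ℂ) *
        ((pairWeight N n k : ℂ) * (conj (excAmp Ψ n) * excAmp Ψ (addPair n k))) := by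
    intro κ
    have hocc := occ_eq_of_excOcc κ.2
    have hT : excAmp Ψ n = (Real.sqrt (N.factorial / F) : ℂ) * momentumCoef Ψ κ.1 := by
      rw [excAmp, ← hocc, toFock_occ hΨ, hocc]
    -- All excited configurations share one occupation pattern, so by symmetry their coefficient is
    -- a common multiple of `excAmp Ψ (addPair n k)`, independent of `i` and `j`.
    have h2 : ∀ i j, (if i ≠ j ∧ κ.1 i = 0 ∧ κ.1 j = 0 then
        conj (momentumCoef Ψ κ.1) * momentumCoef Ψ (movePair κ.1 i j k.1) else 0) =
        if i ≠ j ∧ κ.1 i = 0 ∧ κ.1 j = 0 then conj (momentumCoef Ψ κ.1) *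
          ((Real.sqrt (w * F / (m * (m - 1) * N.factorial)) : ℂ) * excAmp Ψ (addPair n k))
        else 0 := by
      intro i j
      refine if_ctx_congr Iff.rfl (fun ⟨hij, hi, hj⟩ => ?_) fun _ => rfl
      congr 1
      have hocc' := occ_eq_joinOcc (movePair κ.1 i j k.1)
      rw [excOcc_movePair hij hi hj, κ.2] at hocc'
      have hf := factProd_movePair hij hi hj k
      rw [hzc, κ.2, hocc, ← hFdef, ← hw] at hf
      have hF' := factProd_pos (occ (movePair κ.1 i j k.1))
      have hmm : 0 < (m : ℝ) * (m - 1) := by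
        by_contra h
        have := mul_nonpos_of_nonpos_of_nonneg (not_lt.1 h) hF'.le
        have : 0 < w * F := by positivity
        linarith
      rw [excAmp, ← hocc', toFock_occ hΨ, ← mul_assoc, ← Complex.ofReal_mul,
        ← Real.sqrt_mul (by positivity), ← hf]
      have e : ∀ q A B : ℝ, 0 < q → 0 < A → 0 < B → q * A / (q * B) * (B / A) = 1 := by
        intros
        field_simp
      rw [e _ _ _ hmm hF' hN0]
      simp
    rw [Finset.sum_congr rfl fun i _ => Finset.sum_congr rfl fun j _ => h2 i j,
      sum_pairs_eq, hzc, hT, pairWeight, ← hm, ← hw]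
    -- With fewer than two condensate particles there is no pair to excite, and the weight vanishes
    -- too.
    rcases Nat.lt_or_ge m 2 with hm2 | hm2
    · have : (m : ℝ) * (m - 1) = 0 := by interval_cases m <;> simp
      have h' : (m : ℂ) * (m - 1) = 0 := by exact_mod_cast congrArg (fun x : ℝ => (x : ℂ)) this
      rw [h', this]
      simp
    · have hm1 : (1 : ℝ) < m := by exact_mod_cast hm2
      have hmm : 0 < (m : ℝ) * (m - 1) := mul_pos (by linarith) (by linarith)
      have key : ∀ q : ℝ, 0 < q → q * Real.sqrt (w * F / (q * N.factorial)) =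
          F / N.factorial * (Real.sqrt q * Real.sqrt w * Real.sqrt (N.factorial / F)) := by
        intro q hq
        refine (sq_eq_sq₀ (by positivity) (by positivity)).1 ?_
        rw [mul_pow, mul_pow, mul_pow, mul_pow, Real.sq_sqrt (by positivity),
          Real.sq_sqrt hq.le, Real.sq_sqrt hw0.le, Real.sq_sqrt (by positivity)]
        field_simp
      have key' := congrArg (fun x : ℝ => (x : ℂ)) (key _ hmm)
      push_cast at key'
      push_cast
      rw [map_mul, Complex.conj_ofReal]
      linear_combination (conj (momentumCoef Ψ κ.1) * excAmp Ψ (addPair n k)) * key'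
  rw [tsum_fintype, Finset.sum_congr rfl fun κ _ => h1 κ, Finset.sum_const, Finset.card_univ,
    nsmul_eq_mul, ← Nat.card_eq_fintype_card]
  rcases isEmpty_or_nonempty {κ : Fin N → Mode d // excOcc κ = n} with he | ⟨⟨κ, hκ⟩⟩
  · have : IsEmpty {κ : Fin N → Mode d //
        occ κ = joinOcc (Finsupp.single () (N - n.degree)) n} :=
      ⟨fun κ => he.false ⟨κ.1, excOcc_eq_iff.2 κ.2⟩⟩
    simp [excAmp, toFock]
  · have hc := card_occ_fiber κ
    rw [occ_eq_of_excOcc hκ, ← hm, ← hFdef] at hc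
    have hc' : (Nat.card {κ : Fin N → Mode d // excOcc κ = n} : ℝ) * (F / N.factorial) = 1 := by
      rw [← mul_div_assoc, div_eq_one_iff_eq hN0.ne', ← hc]
      congr 2
      exact Nat.card_congr (Equiv.subtypeEquivRight fun κ' => excOcc_eq_iff)
    have hc'' := congrArg (fun x : ℝ => (x : ℂ)) hc'
    push_cast at hc''
    push_cast
    rw [← mul_assoc, hc'', one_mul]

/-- `∑_k n_k F(k)`. -/
def excSum (F : Mode d → ℝ) (n : ExcMode d →₀ ℕ) : ℝ := n.sum fun k m => m * F k.1

theorem hasSum_excSum (F : Mode d → ℝ) (n : ExcMode d →₀ ℕ) :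
    HasSum (fun k : ExcMode d => (n k : ℝ) * F k.1) (excSum F n) :=
  hasSum_sum_of_ne_finset_zero fun k hk => by rw [Finsupp.notMem_support_iff.1 hk]; simp

theorem excSum_excOcc (F : Mode d → ℝ) (κ : Fin N → Mode d) :
    excSum F (excOcc κ) = ∑ j, if κ j = 0 then 0 else F (κ j) := by
  classical
  rw [excSum, excOcc, ← Finsupp.sum_finsetSum_index (by simp) (by intros; push_cast; ring)]
  refine Finset.sum_congr rfl fun j _ => ?_
  by_cases h : κ j = 0
  · rw [dif_neg (not_not.2 h), if_pos h, Finsupp.sum_zero_index]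
  · rw [dif_pos h, if_neg h, Finsupp.sum_single_index (by simp)]
    simp

theorem excSum_nonneg {F : Mode d → ℝ} (hF : ∀ k, 0 ≤ F k) (n : ExcMode d →₀ ℕ) :
    0 ≤ excSum F n := Finset.sum_nonneg fun k _ => mul_nonneg (by positivity) (hF _)

theorem summable_excAmp_sq
    (hΨ : ∀ (σ : Equiv.Perm (Fin N)) κ, momentumCoef Ψ (κ ∘ σ) = momentumCoef Ψ κ)
    {F : (ExcMode d →₀ ℕ) → ℝ}
    (h : Summable fun κ : Fin N → Mode d => ‖momentumCoef Ψ κ‖ ^ 2 * F (excOcc κ)) :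
    Summable fun n => ‖excAmp Ψ n‖ ^ 2 * F n := by
  have h1 := (Complex.hasSum_ofReal.2 h.hasSum)
  have h2 := hasSum_excAmp_sq hΨ (F := fun n => (F n : ℂ))
    (hasSum_of_eq h1 (fun κ => by push_cast; rfl) rfl)
  refine Complex.summable_ofReal.1 (h2.summable.congr fun n => ?_)
  push_cast
  rfl

theorem summable_kinetic_excAmp
    (hΨ : ∀ (σ : Equiv.Perm (Fin N)) κ, momentumCoef Ψ (κ ∘ σ) = momentumCoef Ψ κ)
    (h0 : Summable fun κ : Fin N → Mode d => ‖momentumCoef Ψ κ‖ ^ 2)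
    (h1 : Summable fun κ : Fin N → Mode d => (∑ j, kSq ℓ (κ j)) * ‖momentumCoef Ψ κ‖ ^ 2) :
    Summable fun n => ‖excAmp Ψ n‖ ^ 2 * excSum (fun k => 1 + kSq ℓ k) n := by
  refine summable_excAmp_sq hΨ (((h0.mul_left (N : ℝ)).add h1).of_nonneg_of_le
    (fun κ => mul_nonneg (by positivity)
      (excSum_nonneg (fun k => by have := kSq_nonneg (ℓ := ℓ) k; linarith) _)) fun κ => ?_)
  rw [excSum_excOcc, mul_comm, ← add_mul]
  refine mul_le_mul_of_nonneg_right ?_ (by positivity)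
  calc ∑ j, (if κ j = 0 then 0 else 1 + kSq ℓ (κ j)) ≤ ∑ j, (1 + kSq ℓ (κ j)) := by
        refine Finset.sum_le_sum fun j _ => ?_
        have := kSq_nonneg (ℓ := ℓ) (κ j)
        split_ifs <;> linarith
    _ = N + ∑ j, kSq ℓ (κ j) := by simp [Finset.sum_add_distrib]

/-- The map `(n, k) ↦ (n + pair, k)` is injective and turns the weight into `n_k n_{-k}`. Since at
most `N` particles are excited, `n_{-k} ≤ N`, and the rest is the kinetic energy plus the number of
excitations. -/
theorem summable_pair_kinetic
    (hΨ : ∀ (σ : Equiv.Perm (Fin N)) κ, momentumCoef Ψ (κ ∘ σ) = momentumCoef Ψ κ)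
    (h0 : Summable fun κ : Fin N → Mode d => ‖momentumCoef Ψ κ‖ ^ 2)
    (h1 : Summable fun κ : Fin N → Mode d => (∑ j, kSq ℓ (κ j)) * ‖momentumCoef Ψ κ‖ ^ 2) :
    Summable fun p : (ExcMode d →₀ ℕ) × ExcMode d => (1 + kSq ℓ p.2.1) *
      ((p.1 p.2 + 1) * (p.1 (negMode p.2) + 1) * ‖excAmp Ψ (addPair p.1 p.2)‖ ^ 2) := by
  have hk : ∀ k : Mode d, 0 ≤ 1 + kSq ℓ k := fun k => by
    have := kSq_nonneg (ℓ := ℓ) k; linarith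
  have hle : ∀ (n : ExcMode d →₀ ℕ) (k : ExcMode d),
      (1 + kSq ℓ k.1) * (n k * n (negMode k) * ‖excAmp Ψ n‖ ^ 2) ≤
        n k * (1 + kSq ℓ k.1) * (N * ‖excAmp Ψ n‖ ^ 2) := by
    intro n k
    by_cases hn : N < n.degree
    · rw [excAmp_eq_zero Ψ hn]
      simp
    · have h2 : (n (negMode k) : ℝ) ≤ N := by
        exact_mod_cast (Finsupp.le_degree _ n).trans (not_lt.1 hn)
      have := hk k.1
      calc (1 + kSq ℓ k.1) * (n k * n (negMode k) * ‖excAmp Ψ n‖ ^ 2)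
          = (n k * (1 + kSq ℓ k.1) * ‖excAmp Ψ n‖ ^ 2) * n (negMode k) := by ring
        _ ≤ (n k * (1 + kSq ℓ k.1) * ‖excAmp Ψ n‖ ^ 2) * N := by gcongr
        _ = _ := by ring
  have hnn : ∀ (n : ExcMode d →₀ ℕ) (k : ExcMode d),
      0 ≤ (1 + kSq ℓ k.1) * (n k * n (negMode k) * ‖excAmp Ψ n‖ ^ 2) := fun n k =>
    mul_nonneg (hk _) (by positivity)
  have hinner : ∀ n : ExcMode d →₀ ℕ, Summable fun k : ExcMode d =>
      n k * (1 + kSq ℓ k.1) * (N * ‖excAmp Ψ n‖ ^ 2) := fun n =>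
    (hasSum_excSum (fun k => 1 + kSq ℓ k) n).summable.mul_right _
  have hs : Summable fun p : (ExcMode d →₀ ℕ) × ExcMode d =>
      (1 + kSq ℓ p.2.1) * (p.1 p.2 * p.1 (negMode p.2) * ‖excAmp Ψ p.1‖ ^ 2) := by
    rw [summable_prod_of_nonneg fun p => hnn p.1 p.2]
    refine ⟨fun n => (hinner n).of_nonneg_of_le (hnn n) (hle n), ?_⟩
    refine ((summable_kinetic_excAmp hΨ h0 h1).mul_left (N : ℝ)).of_nonneg_of_le
      (fun n => tsum_nonneg (hnn n)) fun n => ?_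
    refine (Summable.tsum_le_tsum (hle n) ((hinner n).of_nonneg_of_le (hnn n) (hle n))
      (hinner n)).trans_eq ?_
    rw [tsum_mul_right, (hasSum_excSum (fun k => 1 + kSq ℓ k) n).tsum_eq]
    ring
  have hinj : Function.Injective fun p : (ExcMode d →₀ ℕ) × ExcMode d =>
      (addPair p.1 p.2, p.2) := by
    rintro ⟨n, k⟩ ⟨n', k'⟩ h
    simp only [Prod.mk.injEq] at h
    obtain ⟨h1, rfl⟩ := h
    rw [addPair_injective k h1]
  refine (hs.comp_injective hinj).congr fun p => ?_
  simp only [Function.comp_apply, addPair_self, addPair_neg]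
  push_cast
  rfl

end Pairs

/-! ### Gaussian integrals over the complex plane -/

section Gaussian

/-- The radial weight `e^{-|z|²} |z|^{2 p}`. -/
def gauss (p : ℕ) (z : ℂ) : ℝ := Real.exp (-‖z‖ ^ 2) * ‖z‖ ^ (2 * p)

theorem gauss_nonneg (p : ℕ) (z : ℂ) : 0 ≤ gauss p z := by unfold gauss; positivity

theorem gauss_le (p : ℕ) (z : ℂ) : gauss p z ≤ p.factorial := by
  have h := Real.pow_div_factorial_le_exp (‖z‖ ^ 2) (by positivity) p
  rw [div_le_iff₀ (by positivity), ← pow_mul] at h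
  rw [gauss, Real.exp_neg, inv_mul_le_iff₀ (Real.exp_pos _)]
  exact h

theorem continuous_gauss (p : ℕ) : Continuous (gauss p) := by
  unfold gauss
  fun_prop

theorem integral_gauss (p : ℕ) : ∫ z, gauss p z = Real.pi * p.factorial := by
  have h := Complex.integral_rpow_mul_exp_neg_rpow (p := 2) (q := 2 * p) one_le_two
    (by have : (0 : ℝ) ≤ p := by positivity
        linarith)
  rw [show ((2 : ℝ) * p + 2) / 2 = p + 1 by ring, Real.Gamma_nat_eq_factorial] at h
  rw [show (2 * Real.pi / 2 : ℝ) = Real.pi by ring] at h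
  rw [← h]
  refine integral_congr_ae (ae_of_all _ fun z => ?_)
  simp only [gauss]
  rw [mul_comm, show (2 : ℝ) * p = ((2 * p : ℕ) : ℝ) by push_cast; ring, Real.rpow_natCast,
    Real.rpow_two]

theorem integrable_gauss (p : ℕ) : Integrable (gauss p) := by
  -- Without integrability the integral would be `0` by convention, contradicting its value `π p! >
  -- 0`.
  by_contra h
  have h1 := integral_gauss p
  rw [integral_undef h] at h1
  have : 0 < Real.pi * p.factorial := mul_pos Real.pi_pos (by positivity)
  linarith

variable {ι : Type*} {u : ι → ℂ} {p : ι → ℕ} {M : ℕ}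

/-- From `exp (-t) t^p ≤ p!`, the bound on the exponents where `u` is nonzero gives a domination
uniform in `z`; this makes series and integral interchangeable. -/
theorem norm_mul_gauss_le (hp : ∀ i, u i ≠ 0 → p i ≤ M) (i : ι) (z : ℂ) :
    ‖u i * (gauss (p i) z : ℂ)‖ ≤ ‖u i‖ * M.factorial := by
  by_cases hi : u i = 0
  · simp [hi]
  rw [norm_mul, Complex.norm_real, Real.norm_of_nonneg (gauss_nonneg _ _)]
  gcongr
  exact (gauss_le _ z).trans (by exact_mod_cast Nat.factorial_le (hp i hi))

theorem summable_gauss (hu : Summable fun i => ‖u i‖) (hp : ∀ i, u i ≠ 0 → p i ≤ M) (z : ℂ) :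
    Summable fun i => u i * (gauss (p i) z : ℂ) :=
  (hu.mul_right _).of_norm_bounded fun i => norm_mul_gauss_le hp i z

theorem integrable_tsum_gauss (hu : Summable fun i => ‖u i‖)
    (hp : ∀ i, u i ≠ 0 → p i ≤ M) : Integrable fun z => ∑' i, u i * (gauss (p i) z : ℂ) := by
  have hc : Continuous fun z => ∑' i, u i * (gauss (p i) z : ℂ) :=
    continuous_tsum (fun i => continuous_const.mul
      (Complex.continuous_ofReal.comp (continuous_gauss _))) (hu.mul_right _)
      (norm_mul_gauss_le hp)
  have hG : Integrable fun z => (∑' i, ‖u i‖) * ∑ q ∈ Finset.range (M + 1), gauss q z :=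
    (integrable_finsetSum _ fun q _ => integrable_gauss q).const_mul _
  refine hG.mono' hc.aestronglyMeasurable (ae_of_all _ fun z => ?_)
  rw [← tsum_mul_right]
  refine tsum_of_norm_bounded (hu.mul_right _).hasSum fun i => ?_
  by_cases hi : u i = 0
  · simp [hi]
  rw [norm_mul, Complex.norm_real, Real.norm_of_nonneg (gauss_nonneg _ _)]
  gcongr
  exact Finset.single_le_sum (f := fun q => gauss q z) (fun q _ => gauss_nonneg q z)
    (Finset.mem_range.2 (Nat.lt_succ_of_le (hp i hi)))

theorem hasSum_integral_gauss [Countable ι] (hu : Summable fun i => ‖u i‖)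
    (hp : ∀ i, u i ≠ 0 → p i ≤ M) :
    HasSum (fun i => u i * ((p i).factorial : ℂ))
      (1 / (Real.pi : ℂ) * ∫ z, ∑' i, u i * (gauss (p i) z : ℂ)) := by
  have hi : ∀ i, Integrable fun z => u i * (gauss (p i) z : ℂ) := fun i =>
    (integrable_gauss (p i)).ofReal.const_mul _
  have hn : ∀ i, ∫ z, ‖u i * (gauss (p i) z : ℂ)‖ = ‖u i‖ * (Real.pi * (p i).factorial) := by
    intro i
    rw [← integral_gauss, ← integral_const_mul]
    refine integral_congr_ae (ae_of_all _ fun z => ?_)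
    simp only
    rw [norm_mul, Complex.norm_real, Real.norm_of_nonneg (gauss_nonneg _ _)]
  have h := hasSum_integral_of_summable_integral_norm hi (by
    simp only [hn]
    refine (hu.mul_right (Real.pi * M.factorial)).of_nonneg_of_le (fun i => by positivity)
      fun i => ?_
    by_cases hi : u i = 0
    · simp [hi]
    · have := Nat.factorial_le (hp i hi)
      gcongr)
  refine hasSum_of_eq (h.mul_left (1 / (Real.pi : ℂ))) (fun i => ?_) rfl
  rw [integral_const_mul, integral_complex_ofReal, integral_gauss]
  have : (Real.pi : ℂ) ≠ 0 := by exact_mod_cast Real.pi_ne_zero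
  push_cast
  field_simp

end Gaussian

/-! ### The action of the `z`-dependent Hamiltonian -/

section Action

variable {d : ℕ}

theorem cre_smul {ι : Type} (c : ℂ) (k : ι) (Φ : Fock ι) : cre k (c • Φ) = c • cre k Φ := by
  funext n
  simp only [cre, Pi.smul_apply, smul_eq_mul]
  ring

theorem ann_smul {ι : Type} (c : ℂ) (k : ι) (Φ : Fock ι) : ann k (c • Φ) = c • ann k Φ := by
  funext n
  simp only [ann, Pi.smul_apply, smul_eq_mul]
  ring

theorem cre_ann {ι : Type} (k : ι) (Φ : Fock ι) (n : ι →₀ ℕ) :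
    cre k (ann k Φ) n = (n k : ℂ) * Φ n := by
  simp only [cre, ann]
  by_cases h : n k = 0
  · simp [h]
  · have h1 : n - Finsupp.single k 1 + Finsupp.single k 1 = n :=
      tsub_add_cancel_of_le (Finsupp.single_le_iff.2 (Nat.one_le_iff_ne_zero.2 h))
    have h2 : (((n - Finsupp.single k 1 : ι →₀ ℕ) k : ℕ) : ℝ) + 1 = n k := by
      rw [Finsupp.tsub_apply, Finsupp.single_eq_same]
      have : n k - 1 + 1 = n k := by omega
      exact_mod_cast this
    rw [h1, h2, ← mul_assoc, ← Complex.ofReal_mul, Real.mul_self_sqrt (by positivity)]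
    simp

theorem creZ_annZ (z : ℂ) (k : ExcMode d) (Φ : Fock (ExcMode d)) (n : ExcMode d →₀ ℕ) :
    creZ z k (annZ z k Φ) n = (n k : ℂ) * Φ n := by
  rw [creZ, annZ, cre_smul, smul_smul, ← Complex.exp_add]
  rw [show (z.arg : ℂ) * Complex.I + -(z.arg : ℂ) * Complex.I = 0 by ring, Complex.exp_zero,
    one_smul, cre_ann]

theorem annZ_annZ (z : ℂ) (k : ExcMode d) (Φ : Fock (ExcMode d)) (n : ExcMode d →₀ ℕ) :
    annZ z k (annZ z (negMode k) Φ) n = Complex.exp (-(z.arg : ℂ) * Complex.I) ^ 2 *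
      (Real.sqrt ((n k + 1) * (n (negMode k) + 1)) : ℂ) * Φ (addPair n k) := by
  rw [annZ, annZ, ann_smul, smul_smul, ← sq]
  simp only [Pi.smul_apply, smul_eq_mul, ann]
  rw [Finsupp.add_apply, Finsupp.single_eq_of_ne (negMode_ne k), add_zero,
    Real.sqrt_mul (by positivity), addPair]
  push_cast
  ring

theorem creZ_creZ_addPair (z : ℂ) (k : ExcMode d) (Φ : Fock (ExcMode d)) (n : ExcMode d →₀ ℕ) :
    creZ z k (creZ z (negMode k) Φ) (addPair n k) = Complex.exp ((z.arg : ℂ) * Complex.I) ^ 2 *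
      (Real.sqrt ((n k + 1) * (n (negMode k) + 1)) : ℂ) * Φ n := by
  rw [creZ, creZ, cre_smul, smul_smul, ← sq]
  simp only [Pi.smul_apply, smul_eq_mul, cre]
  have h1 : addPair n k - Finsupp.single k 1 = n + Finsupp.single (negMode k) 1 := by
    rw [addPair, add_right_comm, add_tsub_cancel_right]
  rw [h1, add_tsub_cancel_right, addPair_self, Finsupp.add_apply, Finsupp.single_eq_same,
    Real.sqrt_mul (by positivity)]
  push_cast
  ring

theorem creZ_creZ_of_notMem (z : ℂ) (k : ExcMode d) (Φ : Fock (ExcMode d)) {n : ExcMode d →₀ ℕ}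
    (h : ∀ n', addPair n' k ≠ n) : creZ z k (creZ z (negMode k) Φ) n = 0 := by
  rw [creZ, creZ, cre_smul, smul_smul]
  simp only [Pi.smul_apply, smul_eq_mul, cre]
  have h1 : n k = 0 ∨ n (negMode k) = 0 := by
    by_contra! hn
    refine h (n - Finsupp.single (negMode k) 1 - Finsupp.single k 1) ?_
    rw [addPair, tsub_add_cancel_of_le, tsub_add_cancel_of_le]
    · exact Finsupp.single_le_iff.2 (Nat.one_le_iff_ne_zero.2 hn.2)
    · rw [Finsupp.single_le_iff, Finsupp.tsub_apply,
        Finsupp.single_eq_of_ne (negMode_ne k).symm, tsub_zero]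
      exact Nat.one_le_iff_ne_zero.2 hn.1
  rcases h1 with h1 | h1
  · simp [h1]
  · simp [h1]

variable {ℓ : ℝ} [Fact (0 < ℓ)]

/-- The equivalence `k ↦ -k`. -/
def negModeEquiv (d : ℕ) : ExcMode d ≃ ExcMode d where
  toFun := negMode
  invFun := negMode
  left_inv := negMode_negMode
  right_inv := negMode_negMode

theorem kSq_neg (k : Mode d) : kSq ℓ (-k) = kSq ℓ k := by simp [kSq]

/-- The coefficient of `|z|⁰` in the particle number preserving part of `K(z)`. -/
def diagCoef0 (ℓ : ℝ) [Fact (0 < ℓ)] (v φ : ℝ → ℝ) (ρ : ℝ) (n : ExcMode d →₀ ℕ) : ℝ :=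
  excSum (kSq ℓ) n - ρ * radialCoef ℓ (gFn v φ) (0 : Mode d) * excSum (fun _ => 1) n +
    ρ ^ 2 * ℓ ^ d * radialCoef ℓ (gFn v φ) (0 : Mode d)

/-- The coefficient of `|z|²` in the particle number preserving part of `K(z)`. -/
def diagCoef1 (ℓ : ℝ) [Fact (0 < ℓ)] (v φ : ℝ → ℝ) (ρ : ℝ) (n : ExcMode d →₀ ℕ) : ℝ :=
  (ℓ ^ d)⁻¹ * (excSum (radialCoef ℓ (gFn v φ)) n +
    excSum (fun k => radialCoef ℓ (gOmegaFn v φ) k + radialCoef ℓ (gOmegaFn v φ) (0 : Mode d)) n +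
    radialCoef ℓ (gFn v φ) (0 : Mode d) * excSum (fun _ => 1) n) -
    ρ * radialCoef ℓ (gFn v φ) (0 : Mode d)

/-- The coefficient of `|z|⁴` in the particle number preserving part of `K(z)`. -/
def diagCoef2 (d : ℕ) (ℓ : ℝ) [Fact (0 < ℓ)] (v φ : ℝ → ℝ) : ℝ :=
  (radialCoef ℓ (gFn v φ) (0 : Mode d) + radialCoef ℓ (gOmegaFn v φ) (0 : Mode d)) / (2 * ℓ ^ d)

/-- Everything except the pair terms is diagonal in the occupation numbers and polynomial in `|z|²`;
the terms are grouped by powers. The sums with `k` and `-k` in the kinetic part coincide by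
evenness, which removes the factor `1/2`. -/
theorem opK_eq (v φ : ℝ → ℝ) (ρ : ℝ) (z : ℂ) (Φ : Fock (ExcMode d)) (n : ExcMode d →₀ ℕ) :
    opK ℓ v φ ρ z Φ n = ((diagCoef0 ℓ v φ ρ n + diagCoef1 ℓ v φ ρ n * ‖z‖ ^ 2 +
      diagCoef2 d ℓ v φ * ‖z‖ ^ 4 : ℝ) : ℂ) * Φ n +
      1 / 2 * ∑' k, pairTerm ℓ v φ z Φ n k := by
  have hV : ((ℓ : ℂ) ^ d) ≠ 0 := vol_ne_zero
  have hs : ∀ F : Mode d → ℝ, HasSum (fun k : ExcMode d => (n k : ℂ) * (F k.1 : ℂ))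
      (excSum F n : ℂ) := fun F =>
    hasSum_of_eq (Complex.hasSum_ofReal.2 (hasSum_excSum F n)) (fun k => by push_cast; rfl) rfl
  set A : Mode d → ℝ := fun k => kSq ℓ k + rhoZ d ℓ z * radialCoef ℓ (gFn v φ) k with hA
  have hAe : ∀ k, A (-k) = A k := fun k => by simp only [hA, kSq_neg, radialCoef_neg]
  have h1 : ∑' k : ExcMode d, coefA ℓ v φ z k *
      (creZ z k (annZ z k Φ) n + creZ z (negMode k) (annZ z (negMode k) Φ) n) =
      2 * (excSum A n : ℂ) * Φ n := by
    have h2 : HasSum (fun k : ExcMode d => (n (negMode k) : ℂ) * (A k.1 : ℂ)) (excSum A n : ℂ) := by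
      refine hasSum_of_eq ((negModeEquiv d).hasSum_iff.2 (hs A)) (fun k => ?_) rfl
      simp only [Function.comp_apply]
      rw [show negModeEquiv d k = negMode k from rfl, show (negMode k).1 = -k.1 from rfl, hAe]
    have h3 := ((hs A).add h2).mul_right (Φ n)
    rw [show 2 * (excSum A n : ℂ) * Φ n = ((excSum A n : ℂ) + excSum A n) * Φ n by ring,
      ← h3.tsum_eq]
    refine tsum_congr fun k => ?_
    rw [creZ_annZ, creZ_annZ, coefA, fourierCoefTorus_eq_ofReal]
    simp only [hA]
    push_cast
    ring
  have h2 : ∑' k : ExcMode d, (fourierCoefTorus ℓ (gOmegaFn v φ) k.1 +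
      fourierCoefTorus ℓ (gOmegaFn v φ) (0 : Mode d)) * creZ z k (annZ z k Φ) n =
      (excSum (fun k => radialCoef ℓ (gOmegaFn v φ) k +
        radialCoef ℓ (gOmegaFn v φ) (0 : Mode d)) n : ℂ) * Φ n := by
    rw [← ((hs fun k => radialCoef ℓ (gOmegaFn v φ) k +
        radialCoef ℓ (gOmegaFn v φ) (0 : Mode d)).mul_right (Φ n)).tsum_eq]
    refine tsum_congr fun k => ?_
    rw [creZ_annZ, fourierCoefTorus_eq_ofReal, fourierCoefTorus_eq_ofReal]
    push_cast
    ring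
  have h3 : opNplus Φ n = (excSum (fun _ => 1) n : ℂ) * Φ n := by
    rw [opNplus, ← ((hs fun _ => 1).mul_right (Φ n)).tsum_eq]
    refine tsum_congr fun k => ?_
    rw [cre_ann]
    simp
  have h4 : excSum A n = excSum (kSq ℓ) n + rhoZ d ℓ z * excSum (radialCoef ℓ (gFn v φ)) n := by
    simp only [hA, excSum, Finsupp.sum]
    rw [Finset.mul_sum, ← Finset.sum_add_distrib]
    exact Finset.sum_congr rfl fun k _ => by ring
  rw [opK, opQ, opQ2ex, bogHam, h1, h2, h3, h4, fourierCoefTorus_eq_ofReal,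
    fourierCoefTorus_eq_ofReal, diagCoef0, diagCoef1, diagCoef2, rhoZ]
  push_cast
  field_simp
  ring

end Action

/-! ### The integral over the coherent states -/

section CoherentIntegral

variable {d N : ℕ} {ℓ : ℝ} [Fact (0 < ℓ)] {Ψ : Config d ℓ N → ℂ} {v φ : ℝ → ℝ} {ρ : ℝ}

theorem bra_apply (z : ℂ) (Ψ : Config d ℓ N → ℂ) (n : ExcMode d →₀ ℕ) :
    braCoherent z (toFock Ψ) n = (Real.exp (-‖z‖ ^ 2 / 2) : ℂ) * conj z ^ (N - n.degree) /
      (Real.sqrt ((N - n.degree).factorial : ℝ) : ℂ) * excAmp Ψ n := by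
  rw [braCoherent_toFock, coherent_apply, Finsupp.single_eq_same,
    show -(‖z‖ : ℂ) ^ 2 / 2 = ((-‖z‖ ^ 2 / 2 : ℝ) : ℂ) by push_cast; rfl, ← Complex.ofReal_exp,
    map_div₀, map_mul, map_pow, Complex.conj_ofReal, Complex.conj_ofReal]

theorem exp_half_sq (z : ℂ) :
    (Real.exp (-‖z‖ ^ 2 / 2) : ℂ) * (Real.exp (-‖z‖ ^ 2 / 2) : ℂ) = (Real.exp (-‖z‖ ^ 2) : ℂ) := by
  rw [← Complex.ofReal_mul, ← Real.exp_add]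
  congr 2
  ring

theorem pow_mul_conj_pow (z : ℂ) (m : ℕ) : z ^ m * conj z ^ m = (‖z‖ : ℂ) ^ (2 * m) := by
  rw [← mul_pow, Complex.mul_conj, Complex.normSq_eq_norm_sq, pow_mul]
  push_cast
  rfl

theorem sqrt_factorial_mul_self (m : ℕ) : (Real.sqrt (m.factorial : ℝ) : ℂ) *
    (Real.sqrt (m.factorial : ℝ) : ℂ) = (m.factorial : ℂ) := by
  rw [← Complex.ofReal_mul, Real.mul_self_sqrt (by positivity)]
  simp

theorem sqrt_factorial_ne_zero (m : ℕ) : (Real.sqrt (m.factorial : ℝ) : ℂ) ≠ 0 := by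
  rw [Complex.ofReal_ne_zero]; positivity

theorem conj_bra_mul_bra (z : ℂ) (Ψ : Config d ℓ N → ℂ) (n : ExcMode d →₀ ℕ) :
    conj (braCoherent z (toFock Ψ) n) * braCoherent z (toFock Ψ) n =
      ((‖excAmp Ψ n‖ ^ 2 / (N - n.degree).factorial : ℝ) : ℂ) * (gauss (N - n.degree) z : ℂ) := by
  rw [bra_apply]
  set m := N - n.degree
  simp only [map_mul, map_div₀, map_pow, Complex.conj_ofReal, Complex.conj_conj]
  have h1 := exp_half_sq z
  have h2 := pow_mul_conj_pow z m
  have h3 := sqrt_factorial_mul_self m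
  have h4 := sqrt_factorial_ne_zero m
  have h5 := conj_mul_self' (excAmp Ψ n)
  have h6 : (m.factorial : ℂ) ≠ 0 := by exact_mod_cast m.factorial_ne_zero
  calc _ = (↑(Real.exp (-‖z‖ ^ 2 / 2)) * ↑(Real.exp (-‖z‖ ^ 2 / 2))) * (z ^ m * conj z ^ m) *
        (conj (excAmp Ψ n) * excAmp Ψ n) / (↑√(m.factorial : ℝ) * ↑√(m.factorial : ℝ)) := by
        field_simp
    _ = _ := by
        rw [h1, h2, h3, h5, gauss]
        push_cast
        field_simp

/-- The coefficient of the term in which a pair `k, -k` is annihilated. -/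
def pairCoef (v φ : ℝ → ℝ) (Ψ : Config d ℓ N → ℂ) (n : ExcMode d →₀ ℕ) (k : ExcMode d) : ℂ :=
  ((ℓ ^ d)⁻¹ * radialCoef ℓ (gFn v φ) k.1 * Real.sqrt ((n k + 1) * (n (negMode k) + 1)) /
    (Real.sqrt ((N - n.degree).factorial : ℝ) *
      Real.sqrt ((N - n.degree - 2).factorial : ℝ)) : ℝ) *
    (conj (excAmp Ψ n) * excAmp Ψ (addPair n k))

theorem exp_arg_mul (z : ℂ) : z * Complex.exp (-(z.arg : ℂ) * Complex.I) = ‖z‖ := by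
  conv_lhs => rw [← Complex.norm_mul_exp_arg_mul_I z]
  rw [mul_assoc, Complex.norm_mul_exp_arg_mul_I, ← Complex.exp_add]
  simp

/-- With `m + 2` particles in the condensate the powers `z^(m+2) (conj z)^m` carry the phase `exp (2
i θ)`, which the two factors `exp (-i θ)` of the operators remove. Together with `|z|²` from `ρ_z` a
purely radial weight `|z|^(2 (m+2))` remains. -/
theorem conj_bra_mul_annZ (z : ℂ) (n : ExcMode d →₀ ℕ) (k : ExcMode d) :
    conj (braCoherent z (toFock Ψ) n) * (coefB ℓ v φ z k *
      annZ z k (annZ z (negMode k) (braCoherent z (toFock Ψ))) n) =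
      pairCoef v φ Ψ n k * (gauss (N - n.degree) z : ℂ) := by
  rw [annZ_annZ, pairCoef]
  by_cases hn : N < n.degree + 2
  · have h0 : excAmp Ψ (addPair n k) = 0 := excAmp_eq_zero Ψ (by rw [degree_addPair]; omega)
    rw [braCoherent_toFock z Ψ (addPair n k), h0]
    simp
  · obtain ⟨m, hm⟩ : ∃ m, N - n.degree = m + 2 := ⟨N - n.degree - 2, by omega⟩
    have hm' : N - (addPair n k).degree = m := by rw [degree_addPair]; omega
    rw [bra_apply z Ψ n, bra_apply z Ψ (addPair n k), hm', hm, coefB, fourierCoefTorus_eq_ofReal,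
      Nat.add_sub_cancel, rhoZ, gauss]
    simp only [map_mul, map_div₀, map_pow, Complex.conj_ofReal, Complex.conj_conj,
      Complex.ofReal_mul, Complex.ofReal_div, Complex.ofReal_inv, Complex.ofReal_pow]
    have h1 := exp_half_sq z
    have h2 := pow_mul_conj_pow z m
    have h3 := sqrt_factorial_ne_zero m
    have h4 := sqrt_factorial_ne_zero (m + 2)
    have h5 := exp_arg_mul z
    have hV : ((ℓ : ℂ) ^ d) ≠ 0 := vol_ne_zero
    set E := Complex.exp (-(z.arg : ℂ) * Complex.I)
    set e : ℂ := (Real.exp (-‖z‖ ^ 2 / 2) : ℂ)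
    set s1 : ℂ := (Real.sqrt (m.factorial : ℝ) : ℂ)
    set s2 : ℂ := (Real.sqrt ((m + 2).factorial : ℝ) : ℂ)
    set s3 : ℂ := (Real.sqrt (((n k : ℝ) + 1) * ((n (negMode k) : ℝ) + 1)) : ℂ)
    calc _ = (e * e) * (z ^ m * conj z ^ m) * (z * E) ^ 2 * (‖z‖ ^ 2 / ℓ ^ d *
          radialCoef ℓ (gFn v φ) k.1 * s3 * (conj (excAmp Ψ n) * excAmp Ψ (addPair n k)) /
            (s2 * s1)) := by
          field_simp
          ring
      _ = _ := by
          rw [h1, h2, h5]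
          field_simp
          ring

/-- Creation is adjoint to annihilation, so this term is the conjugate of the previous one; hence
only the real part of the pair sum contributes. -/
theorem conj_bra_mul_creZ (z : ℂ) (n : ExcMode d →₀ ℕ) (k : ExcMode d) :
    conj (braCoherent z (toFock Ψ) (addPair n k)) * (coefB ℓ v φ z k *
      creZ z k (creZ z (negMode k) (braCoherent z (toFock Ψ))) (addPair n k)) =
      conj (pairCoef v φ Ψ n k * (gauss (N - n.degree) z : ℂ)) := by
  rw [← conj_bra_mul_annZ, annZ_annZ, creZ_creZ_addPair, coefB, fourierCoefTorus_eq_ofReal]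
  simp only [map_mul, map_pow, Complex.conj_ofReal, Complex.conj_conj, ← Complex.exp_conj, map_neg,
    Complex.conj_I, mul_neg, neg_mul, neg_neg]
  ring

/-- The weighted product inequality distributes the term between the `H⁻¹` norm of `g` and the
kinetic energy; the factorials in the denominator are at least `1`. -/
theorem norm_pairCoef_le (n : ExcMode d →₀ ℕ) (k : ExcMode d) :
    ‖pairCoef v φ Ψ n k‖ ≤ (ℓ ^ d)⁻¹ * ((radialCoef ℓ (gFn v φ) k.1 ^ 2 / (1 + kSq ℓ k.1)) *
      ‖excAmp Ψ n‖ ^ 2 + (1 + kSq ℓ k.1) * ((n k + 1) * (n (negMode k) + 1) *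
        ‖excAmp Ψ (addPair n k)‖ ^ 2)) := by
  have hV : (0 : ℝ) < ℓ ^ d := vol_pos
  have hk : 0 < 1 + kSq ℓ k.1 := by have := kSq_nonneg (ℓ := ℓ) k.1; linarith
  have hf : ∀ m : ℕ, 1 ≤ Real.sqrt (m.factorial : ℝ) := fun m =>
    Real.one_le_sqrt.2 (by exact_mod_cast m.factorial_pos)
  set s := Real.sqrt (((n k : ℝ) + 1) * ((n (negMode k) : ℝ) + 1)) with hs
  have hs2 : s ^ 2 = ((n k : ℝ) + 1) * ((n (negMode k) : ℝ) + 1) := Real.sq_sqrt (by positivity)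
  have h1 := mul_le_weighted (x := |radialCoef ℓ (gFn v φ) k.1| * ‖excAmp Ψ n‖)
    (y := s * ‖excAmp Ψ (addPair n k)‖) hk one_pos
  rw [pairCoef, norm_mul, norm_mul, Complex.norm_real, RCLike.norm_conj, Real.norm_eq_abs, abs_div,
    abs_mul, abs_mul, abs_of_pos (inv_pos.2 hV), ← hs, abs_of_nonneg (Real.sqrt_nonneg _)]
  calc (ℓ ^ d)⁻¹ * |radialCoef ℓ (gFn v φ) k.1| * s / |Real.sqrt ((N - n.degree).factorial : ℝ) *
      Real.sqrt ((N - n.degree - 2).factorial : ℝ)| *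
      (‖excAmp Ψ n‖ * ‖excAmp Ψ (addPair n k)‖)
      ≤ (ℓ ^ d)⁻¹ * |radialCoef ℓ (gFn v φ) k.1| * s *
        (‖excAmp Ψ n‖ * ‖excAmp Ψ (addPair n k)‖) := by
        refine mul_le_mul_of_nonneg_right (div_le_self (by positivity) ?_) (by positivity)
        rw [abs_of_nonneg (by positivity)]
        exact one_le_mul_of_one_le_of_one_le (hf _) (hf _)
    _ = (ℓ ^ d)⁻¹ * ((|radialCoef ℓ (gFn v φ) k.1| * ‖excAmp Ψ n‖) *
        (s * ‖excAmp Ψ (addPair n k)‖)) := by ring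
    _ ≤ _ := by
        refine mul_le_mul_of_nonneg_left (h1.trans_eq ?_) (by positivity)
        rw [mul_pow, mul_pow, sq_abs, hs2]
        ring

theorem summable_excAmp
    (hΨ : ∀ (σ : Equiv.Perm (Fin N)) κ, momentumCoef Ψ (κ ∘ σ) = momentumCoef Ψ κ)
    (h0 : Summable fun κ : Fin N → Mode d => ‖momentumCoef Ψ κ‖ ^ 2) :
    Summable fun n => ‖excAmp Ψ n‖ ^ 2 := by
  simpa using summable_excAmp_sq hΨ (F := fun _ => 1) (by simpa using h0)

theorem summable_norm_pairCoef
    (hΨ : ∀ (σ : Equiv.Perm (Fin N)) κ, momentumCoef Ψ (κ ∘ σ) = momentumCoef Ψ κ)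
    (h0 : Summable fun κ : Fin N → Mode d => ‖momentumCoef Ψ κ‖ ^ 2)
    (h1 : Summable fun κ : Fin N → Mode d => (∑ j, kSq ℓ (κ j)) * ‖momentumCoef Ψ κ‖ ^ 2)
    (hg : Summable fun k : Mode d => radialCoef ℓ (gFn v φ) k ^ 2 / (1 + kSq ℓ k)) :
    Summable fun p : (ExcMode d →₀ ℕ) × ExcMode d => ‖pairCoef v φ Ψ p.1 p.2‖ := by
  have hg' : Summable fun k : ExcMode d => radialCoef ℓ (gFn v φ) k.1 ^ 2 / (1 + kSq ℓ k.1) :=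
    hg.comp_injective Subtype.val_injective
  have hprod := (summable_excAmp hΨ h0).mul_of_nonneg hg' (fun n => by positivity) fun k =>
    div_nonneg (sq_nonneg _) (by have := kSq_nonneg (ℓ := ℓ) k.1; linarith)
  refine (((hprod.add (summable_pair_kinetic hΨ h0 h1)).mul_left (ℓ ^ d)⁻¹)).of_nonneg_of_le
    (fun p => norm_nonneg _) fun p => (norm_pairCoef_le p.1 p.2).trans_eq ?_
  ring

theorem summable_pairTerm
    (hΨ : ∀ (σ : Equiv.Perm (Fin N)) κ, momentumCoef Ψ (κ ∘ σ) = momentumCoef Ψ κ)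
    (h0 : Summable fun κ : Fin N → Mode d => ‖momentumCoef Ψ κ‖ ^ 2)
    (h1 : Summable fun κ : Fin N → Mode d => (∑ j, kSq ℓ (κ j)) * ‖momentumCoef Ψ κ‖ ^ 2)
    (hg : Summable fun k : Mode d => radialCoef ℓ (gFn v φ) k ^ 2 / (1 + kSq ℓ k))
    (z : ℂ) (n : ExcMode d →₀ ℕ) :
    Summable (pairTerm ℓ v φ z (braCoherent z (toFock Ψ)) n) := by
  set Φ := braCoherent z (toFock Ψ) with hΦ
  -- Only modes already occupied in `n` can just have been created, so the creation part is a finite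
  -- sum.
  have hc : Summable fun k => coefB ℓ v φ z k * creZ z k (creZ z (negMode k) Φ) n := by
    refine summable_of_ne_finset_zero (s := n.support) fun k hk => ?_
    rw [creZ_creZ_of_notMem, mul_zero]
    rintro n' rfl
    rw [Finsupp.notMem_support_iff, addPair_self] at hk
    omega
  have hg' : Summable fun k : ExcMode d => radialCoef ℓ (gFn v φ) k.1 ^ 2 / (1 + kSq ℓ k.1) :=
    hg.comp_injective Subtype.val_injective
  have hkin : Summable fun k : ExcMode d => (1 + kSq ℓ k.1) *
      ((n k + 1) * (n (negMode k) + 1) * ‖excAmp Ψ (addPair n k)‖ ^ 2) :=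
    (summable_pair_kinetic hΨ h0 h1).comp_injective
      (i := fun k : ExcMode d => (n, k)) fun k k' h => (Prod.mk.inj h).2
  set b : ℝ := ‖(rhoZ d ℓ z : ℂ)‖ * ‖(Real.exp (-‖z‖ ^ 2 / 2) : ℂ) *
    conj z ^ (N - (n.degree + 2)) / (Real.sqrt ((N - (n.degree + 2)).factorial : ℝ) : ℂ)‖ *
      ‖Complex.exp (-(z.arg : ℂ) * Complex.I) ^ 2‖ with hb
  have ha : Summable fun k => coefB ℓ v φ z k * annZ z k (annZ z (negMode k) Φ) n := by
    refine ((hg'.add hkin).mul_left b).of_norm_bounded fun k => ?_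
    have hk : 0 < 1 + kSq ℓ k.1 := by have := kSq_nonneg (ℓ := ℓ) k.1; linarith
    have h2 := mul_le_weighted (x := |radialCoef ℓ (gFn v φ) k.1|)
      (y := Real.sqrt ((n k + 1) * (n (negMode k) + 1)) * ‖excAmp Ψ (addPair n k)‖) hk one_pos
    rw [mul_pow, Real.sq_sqrt (by positivity), sq_abs, inv_one, one_mul, one_mul] at h2
    rw [annZ_annZ, hΦ, bra_apply, degree_addPair, coefB, fourierCoefTorus_eq_ofReal]
    calc _ = b * (|radialCoef ℓ (gFn v φ) k.1| * (Real.sqrt ((n k + 1) * (n (negMode k) + 1)) *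
          ‖excAmp Ψ (addPair n k)‖)) := by
          rw [hb]
          simp only [norm_mul, Complex.norm_real, Real.norm_eq_abs,
            abs_of_nonneg (Real.sqrt_nonneg _)]
          ring
      _ ≤ _ := mul_le_mul_of_nonneg_left h2 (by positivity)
  exact (hc.add ha).congr fun k => by rw [pairTerm, mul_add]

/-- `⟨Φ(z), K(z) Φ(z)⟩` as a series. -/
theorem hasSum_expectK
    (hΨ : ∀ (σ : Equiv.Perm (Fin N)) κ, momentumCoef Ψ (κ ∘ σ) = momentumCoef Ψ κ)
    (h0 : Summable fun κ : Fin N → Mode d => ‖momentumCoef Ψ κ‖ ^ 2)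
    (h1 : Summable fun κ : Fin N → Mode d => (∑ j, kSq ℓ (κ j)) * ‖momentumCoef Ψ κ‖ ^ 2)
    (hg : Summable fun k : Mode d => radialCoef ℓ (gFn v φ) k ^ 2 / (1 + kSq ℓ k))
    (z : ℂ) {D : ℂ} (hD : HasSum (fun n : ExcMode d →₀ ℕ => ((‖excAmp Ψ n‖ ^ 2 /
      (N - n.degree).factorial * (diagCoef0 ℓ v φ ρ n + diagCoef1 ℓ v φ ρ n * ‖z‖ ^ 2 +
        diagCoef2 d ℓ v φ * ‖z‖ ^ 4) : ℝ) : ℂ) * (gauss (N - n.degree) z : ℂ)) D) :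
    HasSum (fun n => conj (braCoherent z (toFock Ψ) n) *
      opK ℓ v φ ρ z (braCoherent z (toFock Ψ)) n)
      (D + ((∑' p : (ExcMode d →₀ ℕ) × ExcMode d,
        pairCoef v φ Ψ p.1 p.2 * (gauss (N - p.1.degree) z : ℂ)).re : ℂ)) := by
  set Φ := braCoherent z (toFock Ψ) with hΦ
  set X := ∑' p : (ExcMode d →₀ ℕ) × ExcMode d,
    pairCoef v φ Ψ p.1 p.2 * (gauss (N - p.1.degree) z : ℂ) with hX
  have hX1 : HasSum (fun p : (ExcMode d →₀ ℕ) × ExcMode d =>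
      pairCoef v φ Ψ p.1 p.2 * (gauss (N - p.1.degree) z : ℂ)) X :=
    (summable_gauss (M := N) (summable_norm_pairCoef hΨ h0 h1 hg)
      (fun p _ => Nat.sub_le _ _) z).hasSum
  have hann : HasSum (fun p : (ExcMode d →₀ ℕ) × ExcMode d => conj (Φ p.1) *
      (coefB ℓ v φ z p.2 * annZ z p.2 (annZ z (negMode p.2) Φ) p.1)) X :=
    hasSum_of_eq hX1 (fun p => conj_bra_mul_annZ z p.1 p.2) rfl
  have hinj : Function.Injective fun p : (ExcMode d →₀ ℕ) × ExcMode d =>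
      (addPair p.1 p.2, p.2) := by
    rintro ⟨n, k⟩ ⟨n', k'⟩ h
    simp only [Prod.mk.injEq] at h
    obtain ⟨h1, rfl⟩ := h
    rw [addPair_injective k h1]
  -- A creation term vanishes unless the occupation contains the pair, so the sum lives on the image
  -- of the injection `(n, k) ↦ (n + pair, k)`.
  have hcre : HasSum (fun p : (ExcMode d →₀ ℕ) × ExcMode d => conj (Φ p.1) *
      (coefB ℓ v φ z p.2 * creZ z p.2 (creZ z (negMode p.2) Φ) p.1)) (conj X) := by
    refine (hinj.hasSum_iff ?_).1 (hasSum_of_eq (Complex.hasSum_conj'.2 hX1) (fun p =>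
      conj_bra_mul_creZ z p.1 p.2) rfl)
    rintro ⟨n, k⟩ hp
    simp only
    rw [creZ_creZ_of_notMem, mul_zero, mul_zero]
    rintro n' rfl
    exact hp ⟨(n', k), rfl⟩
  have hpair : HasSum (fun p : (ExcMode d →₀ ℕ) × ExcMode d => conj (Φ p.1) *
      pairTerm ℓ v φ z Φ p.1 p.2) (conj X + X) :=
    hasSum_of_eq (hcre.add hann) (fun p => by rw [pairTerm]; ring) rfl
  have hpair' := hpair.prod_fiberwise fun n =>
    ((summable_pairTerm hΨ h0 h1 hg z n).hasSum.mul_left (conj (Φ n)))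
  refine hasSum_of_eq (hD.add (hpair'.mul_left (1 / 2))) (fun n => ?_) ?_
  · rw [opK_eq]
    have h2 := conj_bra_mul_bra z Ψ n
    rw [← hΦ] at h2
    push_cast at h2 ⊢
    linear_combination ((diagCoef0 ℓ v φ ρ n : ℂ) + diagCoef1 ℓ v φ ρ n * ‖z‖ ^ 2 +
      diagCoef2 d ℓ v φ * ‖z‖ ^ 4) * h2
  · rw [Complex.re_eq_add_conj]
    ring

end CoherentIntegral

/-! ### Evaluation of the coherent state integral -/

section CoherentTotal

variable {d N : ℕ} {ℓ : ℝ} [Fact (0 < ℓ)] {Ψ : Config d ℓ N → ℂ} {v φ : ℝ → ℝ} {ρ : ℝ}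

/-- The number preserving part of `π⁻¹ ∫ K(z) |z⟩⟨z| dz`. -/
def diagTotal (ℓ : ℝ) [Fact (0 < ℓ)] (v φ : ℝ → ℝ) (ρ : ℝ) (N : ℕ) (n : ExcMode d →₀ ℕ) : ℝ :=
  diagCoef0 ℓ v φ ρ n + diagCoef1 ℓ v φ ρ n * ((N - n.degree : ℕ) + 1) +
    diagCoef2 d ℓ v φ * (((N - n.degree : ℕ) + 1) * ((N - n.degree : ℕ) + 2))

theorem summable_config_mul {F : (Fin N → Mode d) → ℝ} {C : ℝ}
    (h0 : Summable fun κ : Fin N → Mode d => ‖momentumCoef Ψ κ‖ ^ 2)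
    (h1 : Summable fun κ : Fin N → Mode d => (∑ j, kSq ℓ (κ j)) * ‖momentumCoef Ψ κ‖ ^ 2)
    (hF : ∀ κ, |F κ| ≤ C * (1 + ∑ j, kSq ℓ (κ j))) :
    Summable fun κ : Fin N → Mode d => ‖momentumCoef Ψ κ‖ ^ 2 * F κ := by
  refine ((h0.add h1).mul_left C).of_norm_bounded fun κ => ?_
  rw [norm_mul, Real.norm_of_nonneg (by positivity), Real.norm_eq_abs]
  calc ‖momentumCoef Ψ κ‖ ^ 2 * |F κ|
      ≤ ‖momentumCoef Ψ κ‖ ^ 2 * (C * (1 + ∑ j, kSq ℓ (κ j))) := by gcongr; exact hF κ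
    _ = _ := by ring

theorem abs_excSum_excOcc_le {F : Mode d → ℝ} {B : ℝ} (hF : ∀ k, |F k| ≤ B)
    (κ : Fin N → Mode d) : |excSum F (excOcc κ)| ≤ N * B := by
  rw [excSum_excOcc]
  refine (Finset.abs_sum_le_sum_abs _ _).trans ((Finset.sum_le_sum (g := fun _ => B)
    fun j _ => ?_).trans_eq (by simp))
  split_ifs
  · rw [abs_zero]; exact (abs_nonneg _).trans (hF 0)
  · exact hF _

theorem abs_excSum_kSq_le (κ : Fin N → Mode d) :
    |excSum (kSq ℓ) (excOcc κ)| ≤ ∑ j, kSq ℓ (κ j) := by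
  rw [abs_of_nonneg (excSum_nonneg kSq_nonneg _), excSum_excOcc]
  refine Finset.sum_le_sum fun j _ => ?_
  split_ifs
  · exact kSq_nonneg _
  · exact le_rfl

theorem exists_diagCoef0_le : ∃ C : ℝ, ∀ κ : Fin N → Mode d,
    |diagCoef0 ℓ v φ ρ (excOcc κ)| ≤ C * (1 + ∑ j, kSq ℓ (κ j)) := by
  set g0 := radialCoef ℓ (gFn v φ) (0 : Mode d)
  refine ⟨1 + |ρ * g0| * (N * 1) + |ρ ^ 2 * ℓ ^ d * g0|, fun κ => ?_⟩
  have hS : 0 ≤ ∑ j, kSq ℓ (κ j) := Finset.sum_nonneg fun j _ => kSq_nonneg _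
  have hA : 0 ≤ |ρ * g0| * (N * 1) + |ρ ^ 2 * ℓ ^ d * g0| := by positivity
  have h1 := abs_excSum_kSq_le (ℓ := ℓ) κ
  have h2 := abs_excSum_excOcc_le (F := fun _ => 1) (B := 1) (fun k => by simp) κ
  rw [diagCoef0]
  refine (abs_add_le _ _).trans ((add_le_add_left (abs_sub _ _) _).trans ?_)
  rw [abs_mul (ρ * g0)]
  have h3 := mul_le_mul_of_nonneg_left h2 (abs_nonneg (ρ * g0))
  nlinarith [mul_nonneg hA hS]

theorem exists_diagCoef1_le
    (hgb : ∀ k : Mode d, |radialCoef ℓ (gFn v φ) k| ≤ radialCoef ℓ (gFn v φ) (0 : Mode d))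
    (hwb : ∀ k : Mode d, |radialCoef ℓ (gOmegaFn v φ) k| ≤
      radialCoef ℓ (gOmegaFn v φ) (0 : Mode d)) :
    ∃ C : ℝ, ∀ κ : Fin N → Mode d, |diagCoef1 ℓ v φ ρ (excOcc κ)| ≤ C := by
  set g0 := radialCoef ℓ (gFn v φ) (0 : Mode d)
  set w0 := radialCoef ℓ (gOmegaFn v φ) (0 : Mode d)
  refine ⟨|(ℓ ^ d)⁻¹| * (N * g0 + N * (w0 + w0) + |g0| * (N * 1)) + |ρ * g0|, fun κ => ?_⟩
  have h1 := abs_excSum_excOcc_le hgb κ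
  have h2 := abs_excSum_excOcc_le (F := fun k => radialCoef ℓ (gOmegaFn v φ) k + w0) (B := w0 + w0)
    (fun k => (abs_add_le _ _).trans (add_le_add (hwb k) (hwb 0))) κ
  have h3 := abs_excSum_excOcc_le (F := fun _ => 1) (B := 1) (fun k => by simp) κ
  rw [diagCoef1]
  refine (abs_sub _ _).trans (add_le_add_left ?_ _)
  rw [abs_mul]
  refine mul_le_mul_of_nonneg_left ?_ (abs_nonneg _)
  refine (abs_add_le _ _).trans (add_le_add ((abs_add_le _ _).trans (add_le_add h1 h2)) ?_)
  rw [abs_mul]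
  exact mul_le_mul_of_nonneg_left h3 (abs_nonneg _)

theorem gauss_succ (p : ℕ) (z : ℂ) : gauss (p + 1) z = gauss p z * ‖z‖ ^ 2 := by
  simp only [gauss]
  ring

theorem summable_fact_div {ι : Type*} {T F : ι → ℝ} {m : ι → ℕ} (h : Summable fun n => T n * F n) :
    Summable fun n => ‖((T n / (m n).factorial * F n : ℝ) : ℂ)‖ := by
  refine h.norm.of_nonneg_of_le (fun n => norm_nonneg _) fun n => ?_
  rw [Complex.norm_real, div_mul_eq_mul_div, norm_div, Real.norm_of_nonneg (by positivity :
    (0 : ℝ) ≤ ((m n).factorial : ℝ))]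
  exact div_le_self (norm_nonneg _) (by exact_mod_cast (m n).factorial_pos)

/-- Here the substitution is exact: with `m = N - |n|` the Gaussian integral gives `m!`, and
division by `√(m! (m - 2)!)` leaves `√(m (m - 1))`, the matrix element of `a₀ a₀`. For `m < 2` the
amplitude with the additional pair is zero. -/
theorem pairCoef_mul_factorial (n : ExcMode d →₀ ℕ) (k : ExcMode d) :
    pairCoef (ℓ := ℓ) v φ Ψ n k * ((N - n.degree).factorial : ℂ) = ((ℓ ^ d)⁻¹ : ℂ) *
      ((radialCoef ℓ (gFn v φ) k.1 : ℂ) * ((pairWeight N n k : ℂ) *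
        (conj (excAmp Ψ n) * excAmp Ψ (addPair n k)))) := by
  by_cases hn : N < n.degree + 2
  · have h0 : excAmp Ψ (addPair n k) = 0 :=
      excAmp_eq_zero Ψ (by rw [degree_addPair]; omega)
    simp [pairCoef, h0]
  · obtain ⟨q, hq⟩ : ∃ q, N - n.degree = q + 2 := ⟨N - n.degree - 2, by omega⟩
    simp only [pairCoef, pairWeight, hq, Nat.add_sub_cancel]
    have hnn : (0 : ℝ) ≤ ((q + 2 : ℕ) : ℝ) * (((q + 2 : ℕ) : ℝ) - 1) := by
      have : (0 : ℝ) ≤ q := q.cast_nonneg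
      push_cast
      nlinarith
    have key : Real.sqrt (((q + 2 : ℕ) : ℝ) * (((q + 2 : ℕ) : ℝ) - 1)) *
        (Real.sqrt ((q + 2).factorial : ℝ) * Real.sqrt (q.factorial : ℝ)) =
          (q + 2).factorial := by
      rw [← Real.sqrt_mul (by positivity), ← Real.sqrt_mul hnn,
        Real.sqrt_eq_iff_mul_self_eq (mul_nonneg hnn (by positivity)) (by positivity)]
      rw [Nat.factorial_succ, Nat.factorial_succ]
      push_cast
      ring
    have h1 := sqrt_factorial_ne_zero (q + 2)
    have h2 := sqrt_factorial_ne_zero q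
    have key' := congrArg (fun x : ℝ => (x : ℂ)) key
    simp only [Complex.ofReal_mul, Complex.ofReal_natCast] at key'
    rw [← key']
    simp only [Complex.ofReal_mul, Complex.ofReal_div, Complex.ofReal_inv, Complex.ofReal_pow]
    field_simp

/-- Convergence of the double sum allows summation over `n` first at fixed `k`, where the fibrewise
identity returns the sums over configurations. -/
theorem tsum_pairCoef_eq
    (hΨ : ∀ (σ : Equiv.Perm (Fin N)) κ, momentumCoef Ψ (κ ∘ σ) = momentumCoef Ψ κ)
    {H : ExcMode d → ℂ} (hH : ∀ k : ExcMode d, HasSum (fun κ : Fin N → Mode d => ∑ i, ∑ j,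
      (if i ≠ j ∧ κ i = 0 ∧ κ j = 0 then
        conj (momentumCoef Ψ κ) * momentumCoef Ψ (movePair κ i j k.1) else 0)) (H k)) {a : ℂ}
    (h : HasSum (fun p : (ExcMode d →₀ ℕ) × ExcMode d =>
      pairCoef (ℓ := ℓ) v φ Ψ p.1 p.2 * ((N - p.1.degree).factorial : ℂ)) a) :
    a = ((ℓ ^ d)⁻¹ : ℂ) * ∑' k : ExcMode d, (radialCoef ℓ (gFn v φ) k.1 : ℂ) * H k := by
  have e1 : HasSum (fun p : ExcMode d × (ExcMode d →₀ ℕ) => ((ℓ ^ d)⁻¹ : ℂ) *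
      ((radialCoef ℓ (gFn v φ) p.1.1 : ℂ) * ((pairWeight N p.2 p.1 : ℂ) *
        (conj (excAmp Ψ p.2) * excAmp Ψ (addPair p.2 p.1))))) a :=
    hasSum_of_eq ((Equiv.prodComm (ExcMode d) (ExcMode d →₀ ℕ)).hasSum_iff.2 h)
      (fun p => (pairCoef_mul_factorial p.2 p.1).symm) rfl
  have e2 : ∀ k : ExcMode d, HasSum (fun n : ExcMode d →₀ ℕ => ((ℓ ^ d)⁻¹ : ℂ) *
      ((radialCoef ℓ (gFn v φ) k.1 : ℂ) * ((pairWeight N n k : ℂ) *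
        (conj (excAmp Ψ n) * excAmp Ψ (addPair n k)))))
      (((ℓ ^ d)⁻¹ : ℂ) * ((radialCoef ℓ (gFn v φ) k.1 : ℂ) * H k)) := fun k => by
    refine HasSum.mul_left _ (HasSum.mul_left _ ?_)
    exact hasSum_of_eq (hasSum_fiber (hH k)) (fun n => (sum_fiber_pairs hΨ n k).symm) rfl
  rw [← (e1.prod_fiberwise e2).tsum_eq, tsum_mul_left]

/-- The series is integrated term by term. Against `exp (-|z|²) |z|^(2m) / m!` the powers `1`,
`|z|²`, `|z|⁴` integrate, after division by `π`, to `1`, `m + 1`, `(m + 1) (m + 2)`, which is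
antinormal ordering. The pair sums `H` are kept abstract and are identified with the interaction
later. -/
theorem expectK_integral
    (hΨ : ∀ (σ : Equiv.Perm (Fin N)) κ, momentumCoef Ψ (κ ∘ σ) = momentumCoef Ψ κ)
    (h0 : Summable fun κ : Fin N → Mode d => ‖momentumCoef Ψ κ‖ ^ 2)
    (h1 : Summable fun κ : Fin N → Mode d => (∑ j, kSq ℓ (κ j)) * ‖momentumCoef Ψ κ‖ ^ 2)
    (hg : Summable fun k : Mode d => radialCoef ℓ (gFn v φ) k ^ 2 / (1 + kSq ℓ k))
    (hgb : ∀ k : Mode d, |radialCoef ℓ (gFn v φ) k| ≤ radialCoef ℓ (gFn v φ) (0 : Mode d))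
    (hwb : ∀ k : Mode d, |radialCoef ℓ (gOmegaFn v φ) k| ≤
      radialCoef ℓ (gOmegaFn v φ) (0 : Mode d))
    {H : ExcMode d → ℂ} (hH : ∀ k : ExcMode d, HasSum (fun κ : Fin N → Mode d => ∑ i, ∑ j,
      (if i ≠ j ∧ κ i = 0 ∧ κ j = 0 then
        conj (momentumCoef Ψ κ) * momentumCoef Ψ (movePair κ i j k.1) else 0)) (H k)) :
    (∀ z, Summable fun n => conj (braCoherent z (toFock Ψ) n) *
      opK ℓ v φ ρ z (braCoherent z (toFock Ψ)) n) ∧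
    Integrable (expectK v φ ρ Ψ) ∧
    (Summable fun κ : Fin N → Mode d => ‖momentumCoef Ψ κ‖ ^ 2 * diagTotal ℓ v φ ρ N (excOcc κ)) ∧
    1 / (Real.pi : ℂ) * (∫ z, expectK v φ ρ Ψ z) =
      ((∑' κ : Fin N → Mode d, ‖momentumCoef Ψ κ‖ ^ 2 * diagTotal ℓ v φ ρ N (excOcc κ) : ℝ) : ℂ) +
        (((ℓ ^ d)⁻¹ * (∑' k : ExcMode d, (radialCoef ℓ (gFn v φ) k.1 : ℂ) * H k).re : ℝ) : ℂ) := by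
  set T : (ExcMode d →₀ ℕ) → ℝ := fun n => ‖excAmp Ψ n‖ ^ 2 with hT
  set m : (ExcMode d →₀ ℕ) → ℕ := fun n => N - n.degree with hm
  obtain ⟨C0, hC0⟩ := exists_diagCoef0_le (d := d) (N := N) (ℓ := ℓ) (v := v) (φ := φ) (ρ := ρ)
  obtain ⟨C1, hC1⟩ := exists_diagCoef1_le (N := N) (ρ := ρ) hgb hwb
  have hS : ∀ κ : Fin N → Mode d, (1 : ℝ) ≤ 1 + ∑ j, kSq ℓ (κ j) := fun κ => by
    have : 0 ≤ ∑ j, kSq ℓ (κ j) := Finset.sum_nonneg fun j _ => kSq_nonneg _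
    linarith
  have hC1' : ∀ κ : Fin N → Mode d, |diagCoef1 ℓ v φ ρ (excOcc κ)| ≤
      |C1| * (1 + ∑ j, kSq ℓ (κ j)) := fun κ =>
    ((hC1 κ).trans (le_abs_self _)).trans (le_mul_of_one_le_right (abs_nonneg _) (hS κ))
  have hk0 := summable_config_mul h0 h1 hC0
  have hk1 := summable_config_mul h0 h1 hC1'
  have hs0 : Summable fun n => T n * diagCoef0 ℓ v φ ρ n := summable_excAmp_sq hΨ hk0
  have hs1 : Summable fun n => T n * diagCoef1 ℓ v φ ρ n := summable_excAmp_sq hΨ hk1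
  have hs2 : Summable fun n => T n * diagCoef2 d ℓ v φ := (summable_excAmp hΨ h0).mul_right _
  set u0 : (ExcMode d →₀ ℕ) → ℂ := fun n => ((T n / (m n).factorial * diagCoef0 ℓ v φ ρ n : ℝ) : ℂ)
  set u1 : (ExcMode d →₀ ℕ) → ℂ := fun n => ((T n / (m n).factorial * diagCoef1 ℓ v φ ρ n : ℝ) : ℂ)
  set u2 : (ExcMode d →₀ ℕ) → ℂ := fun n => ((T n / (m n).factorial * diagCoef2 d ℓ v φ : ℝ) : ℂ)
  have hu0 : Summable fun n => ‖u0 n‖ := summable_fact_div hs0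
  have hu1 : Summable fun n => ‖u1 n‖ := summable_fact_div hs1
  have hu2 : Summable fun n => ‖u2 n‖ := summable_fact_div hs2
  have hpc := summable_norm_pairCoef hΨ h0 h1 hg
  -- All exponents are at most `N + 2`, the extra `2` coming from the `|z|⁴` term.
  have hp0 : ∀ n, u0 n ≠ 0 → m n ≤ N + 2 := fun n _ => by simp only [hm]; omega
  have hp1 : ∀ n, u1 n ≠ 0 → m n + 1 ≤ N + 2 := fun n _ => by simp only [hm]; omega
  have hp2 : ∀ n, u2 n ≠ 0 → m n + 2 ≤ N + 2 := fun n _ => by simp only [hm]; omega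
  have hp3 : ∀ p : (ExcMode d →₀ ℕ) × ExcMode d, pairCoef v φ Ψ p.1 p.2 ≠ 0 → m p.1 ≤ N + 2 :=
    fun p _ => by simp only [hm]; omega
  set D : ℂ → ℂ := fun z => (∑' n, u0 n * (gauss (m n) z : ℂ)) +
    (∑' n, u1 n * (gauss (m n + 1) z : ℂ)) + ∑' n, u2 n * (gauss (m n + 2) z : ℂ) with hD
  set X : ℂ → ℂ := fun z => ∑' p : (ExcMode d →₀ ℕ) × ExcMode d,
    pairCoef v φ Ψ p.1 p.2 * (gauss (m p.1) z : ℂ) with hX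
  have hsum : ∀ z, HasSum (fun n => conj (braCoherent z (toFock Ψ) n) *
      opK ℓ v φ ρ z (braCoherent z (toFock Ψ)) n) (D z + ((X z).re : ℂ)) := fun z => by
    refine hasSum_expectK hΨ h0 h1 hg z ?_
    refine hasSum_of_eq (((summable_gauss hu0 hp0 z).hasSum.add
      (summable_gauss hu1 hp1 z).hasSum).add (summable_gauss hu2 hp2 z).hasSum) (fun n => ?_) rfl
    simp only [u0, u1, u2, gauss_succ, hT, hm]
    push_cast
    ring
  have hE : expectK v φ ρ Ψ = fun z => D z + ((X z).re : ℂ) := funext fun z => (hsum z).tsum_eq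
  have hDi0 := integrable_tsum_gauss hu0 hp0
  have hDi1 := integrable_tsum_gauss hu1 hp1
  have hDi2 := integrable_tsum_gauss hu2 hp2
  have hDi : Integrable D := (hDi0.add hDi1).add hDi2
  have hXi : Integrable X := integrable_tsum_gauss hpc hp3
  have hXr : Integrable fun z => ((X z).re : ℂ) := hXi.re.ofReal
  have hmm : ∀ κ : Fin N → Mode d, (m (excOcc κ) : ℝ) ≤ N := fun κ => by
    simp only [hm]; exact_mod_cast Nat.sub_le _ _
  have hdt : Summable fun κ : Fin N → Mode d =>
      ‖momentumCoef Ψ κ‖ ^ 2 * diagTotal ℓ v φ ρ N (excOcc κ) := by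
    refine summable_config_mul (C := C0 + |C1| * (N + 1) +
      |diagCoef2 d ℓ v φ| * ((N + 1) * (N + 2))) h0 h1 fun κ => ?_
    have hm0 : (0 : ℝ) ≤ m (excOcc κ) := by positivity
    have hR : (C0 + |C1| * (N + 1) + |diagCoef2 d ℓ v φ| * ((N + 1) * (N + 2))) *
        (1 + ∑ j, kSq ℓ (κ j)) = C0 * (1 + ∑ j, kSq ℓ (κ j)) +
          |C1| * (1 + ∑ j, kSq ℓ (κ j)) * (N + 1) +
          |diagCoef2 d ℓ v φ| * ((N + 1) * (N + 2)) * (1 + ∑ j, kSq ℓ (κ j)) := by ring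
    rw [diagTotal, hR]
    refine (abs_add_le _ _).trans (add_le_add ((abs_add_le _ _).trans (add_le_add (hC0 κ) ?_)) ?_)
    · rw [abs_mul]
      refine mul_le_mul (hC1' κ) ?_ (abs_nonneg _)
        ((abs_nonneg _).trans (hC1' κ))
      rw [abs_of_nonneg (by positivity)]
      exact add_le_add_left (hmm κ) 1
    · rw [abs_mul]
      refine le_trans (mul_le_mul_of_nonneg_left ?_ (abs_nonneg _))
        (le_mul_of_one_le_right (by positivity) (hS κ))
      rw [abs_of_nonneg (by positivity)]
      exact mul_le_mul (add_le_add_left (hmm κ) 1) (add_le_add_left (hmm κ) 2) (by positivity)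
        (by positivity)
  refine ⟨fun z => (hsum z).summable, by rw [hE]; exact hDi.add hXr, hdt, ?_⟩
  have hDval : 1 / (Real.pi : ℂ) * ∫ z, D z = ((∑' κ : Fin N → Mode d,
      ‖momentumCoef Ψ κ‖ ^ 2 * diagTotal ℓ v φ ρ N (excOcc κ) : ℝ) : ℂ) := by
    have e0 := hasSum_integral_gauss hu0 hp0
    have e1 := hasSum_integral_gauss hu1 hp1
    have e2 := hasSum_integral_gauss hu2 hp2
    have e3 := hasSum_excAmp_sq hΨ (F := fun n => (diagTotal ℓ v φ ρ N n : ℂ))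
      (hasSum_of_eq (Complex.hasSum_ofReal.2 hdt.hasSum) (fun κ => by push_cast; rfl) rfl)
    have e4 : 1 / (Real.pi : ℂ) * ∫ z, D z = 1 / (Real.pi : ℂ) *
        (∫ z, ∑' n, u0 n * (gauss (m n) z : ℂ)) + 1 / (Real.pi : ℂ) *
        (∫ z, ∑' n, u1 n * (gauss (m n + 1) z : ℂ)) + 1 / (Real.pi : ℂ) *
        ∫ z, ∑' n, u2 n * (gauss (m n + 2) z : ℂ) := by
      rw [← mul_add, ← mul_add]
      exact congrArg _ ((integral_add (hDi0.add hDi1) hDi2).trans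
        (congrArg (· + _) (integral_add hDi0 hDi1)))
    rw [e4, ← e3.tsum_eq, ← ((e0.add e1).add e2).tsum_eq]
    refine tsum_congr fun n => ?_
    have hf : ((m n).factorial : ℂ) ≠ 0 := by exact_mod_cast (m n).factorial_ne_zero
    simp only [u0, u1, u2, Nat.factorial_succ, diagTotal, hT]
    push_cast
    field_simp
    ring
  have hXval : 1 / (Real.pi : ℂ) * ∫ z, X z = ((ℓ ^ d)⁻¹ : ℂ) *
      ∑' k : ExcMode d, (radialCoef ℓ (gFn v φ) k.1 : ℂ) * H k :=
    tsum_pairCoef_eq hΨ hH (hasSum_integral_gauss hpc hp3)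
  rw [hE, integral_add hDi hXr, mul_add, hDval]
  congr 1
  have h3 : ∫ z, ((X z).re : ℂ) = ((∫ z, X z).re : ℂ) := by
    rw [integral_complex_ofReal]
    exact congrArg _ (integral_re hXi)
  have h4 := congrArg Complex.re hXval
  have h5 : ((1 / (Real.pi : ℂ)) * ∫ z, X z).re = 1 / Real.pi * (∫ z, X z).re := by
    rw [show (1 / (Real.pi : ℂ)) = ((1 / Real.pi : ℝ) : ℂ) by push_cast; rfl, Complex.re_ofReal_mul]
  rw [h5, show ((ℓ ^ d)⁻¹ : ℂ) = (((ℓ ^ d)⁻¹ : ℝ) : ℂ) by push_cast; rfl,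
    Complex.re_ofReal_mul] at h4
  rw [h3, ← h4]
  push_cast
  rfl

end CoherentTotal

/-! ### Projections acting on two particles -/

section PairProjections

variable {d N : ℕ} {ℓ : ℝ} [Fact (0 < ℓ)] {Ψ : Config d ℓ N → ℂ}

theorem integrable_projQ (hΨ : Integrable Ψ volume) (i : Fin N) :
    Integrable (projQ i Ψ) volume :=
  hΨ.sub (integrable_projP hΨ i)

theorem projQ_projP_ae (hΨ : Integrable Ψ volume) (i j : Fin N) :
    projQ j (projP i Ψ) =ᵐ[volume] projP i (projQ j Ψ) := by
  refine ae_eq_of_momentumCoef_eq (integrable_projQ (integrable_projP hΨ i) j)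
    (integrable_projP (integrable_projQ hΨ j) i) fun κ => ?_
  rw [momentumCoef_projQ (integrable_projP hΨ i), momentumCoef_projP hΨ,
    momentumCoef_projP (integrable_projQ hΨ j), momentumCoef_projQ hΨ]
  split_ifs <;> rfl

theorem projQ_projQ_ae (hΨ : Integrable Ψ volume) (i j : Fin N) :
    projQ j (projQ i Ψ) =ᵐ[volume] projQ i (projQ j Ψ) := by
  refine ae_eq_of_momentumCoef_eq (integrable_projQ (integrable_projQ hΨ i) j)
    (integrable_projQ (integrable_projQ hΨ j) i) fun κ => ?_
  rw [momentumCoef_projQ (integrable_projQ hΨ i), momentumCoef_projQ hΨ,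
    momentumCoef_projQ (integrable_projQ hΨ j), momentumCoef_projQ hΨ]
  split_ifs <;> rfl

/-- `(P_j P_i + P_j Q_i + Q_j P_i) Ψ`: at least one of the two particles in the condensate. -/
def pairLow (Ψ : Config d ℓ N → ℂ) (i j : Fin N) (x : Config d ℓ N) : ℂ :=
  projP j (projP i Ψ) x + projP j (projQ i Ψ) x + projQ j (projP i Ψ) x

theorem pairLow_add_projQ_projQ (i j : Fin N) (x : Config d ℓ N) :
    pairLow Ψ i j x + projQ j (projQ i Ψ) x = Ψ x := by
  simp only [pairLow, projQ]
  ring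

theorem memLp_pairLow (hΨ : MemLp Ψ 2 volume) (i j : Fin N) : MemLp (pairLow Ψ i j) 2 volume :=
  ((memLp_projP (memLp_projP hΨ i) j).add (memLp_projP (memLp_projQ hΨ i) j)).add
    (memLp_projQ (memLp_projP hΨ i) j)

theorem momentumCoef_projP_projP (hΨ : Integrable Ψ volume) (i j : Fin N) (κ : Fin N → Mode d) :
    momentumCoef (projP j (projP i Ψ)) κ = if κ i = 0 ∧ κ j = 0 then momentumCoef Ψ κ else 0 := by
  rw [momentumCoef_projP (integrable_projP hΨ i), momentumCoef_projP hΨ]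
  split_ifs <;> simp_all

theorem momentumCoef_projQ_projQ (hΨ : Integrable Ψ volume) (i j : Fin N) (κ : Fin N → Mode d) :
    momentumCoef (projQ j (projQ i Ψ)) κ = if κ i = 0 ∨ κ j = 0 then 0 else momentumCoef Ψ κ := by
  rw [momentumCoef_projQ (integrable_projQ hΨ i), momentumCoef_projQ hΨ]
  split_ifs <;> simp_all

/-- Obtained as the complement of `Q_j Q_i`, whose coefficients are those with both momenta nonzero.
-/
theorem momentumCoef_pairLow (hΨ : MemLp Ψ 2 volume) (i j : Fin N) (κ : Fin N → Mode d) :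
    momentumCoef (pairLow Ψ i j) κ = if κ i = 0 ∨ κ j = 0 then momentumCoef Ψ κ else 0 := by
  have h1 := hΨ.integrable one_le_two
  have h2 := momentumCoef_add ((memLp_pairLow hΨ i j).integrable one_le_two)
    (integrable_projQ (integrable_projQ h1 i) j) κ
  simp only [pairLow_add_projQ_projQ] at h2
  rw [momentumCoef_projQ_projQ h1] at h2
  have h3 : momentumCoef Ψ κ = momentumCoef (fun x => Ψ x) κ := rfl
  rw [← h3] at h2
  split_ifs at h2 ⊢
  · simpa using h2.symm
  · simpa using h2.symm

end PairProjections

/-! ### Square integrability with respect to the interaction -/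

section Weights

variable {d N : ℕ} {ℓ : ℝ} [Fact (0 < ℓ)] {v : ℝ → ℝ} {i j : Fin N} {Φ Φ' : Config d ℓ N → ℂ}

/-- `√v(x_i - x_j) Φ` is square integrable. -/
def InteractionL2 (v : ℝ → ℝ) (i j : Fin N) (Φ : Config d ℓ N → ℂ) : Prop :=
  MemLp (fun x => (Real.sqrt (v (torusDist (x i - x j))) : ℂ) * Φ x) 2 volume

theorem measurable_torusDist_sub (i j : Fin N) :
    Measurable fun x : Config d ℓ N => torusDist (x i - x j) := by
  unfold torusDist
  fun_prop

theorem torusDist_sub_comm (x y : Torus d ℓ) : torusDist (x - y) = torusDist (y - x) := by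
  rw [← torusDist_neg, neg_sub]

theorem norm_sqrt_mul_sq (hv : ∀ r, 0 ≤ v r) (r : ℝ) (z : ℂ) :
    ‖(Real.sqrt (v r) : ℂ) * z‖ ^ 2 = v r * ‖z‖ ^ 2 := by
  rw [norm_mul, mul_pow, Complex.norm_real, Real.norm_of_nonneg (Real.sqrt_nonneg _),
    Real.sq_sqrt (hv r)]

theorem interactionL2_iff (hvm : Measurable v) (hv : ∀ r, 0 ≤ v r)
    (hΦ : AEStronglyMeasurable Φ volume) :
    InteractionL2 v i j Φ ↔
      Integrable (fun x => v (torusDist (x i - x j)) * ‖Φ x‖ ^ 2) volume := by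
  have hm : AEStronglyMeasurable
      (fun x => (Real.sqrt (v (torusDist (x i - x j))) : ℂ) * Φ x) volume :=
    (Complex.measurable_ofReal.comp ((hvm.comp (measurable_torusDist_sub i j)).sqrt)).aestronglyMeasurable.mul hΦ
  rw [InteractionL2, memLp_two_iff_integrable_sq_norm hm]
  simp only [norm_sqrt_mul_sq hv]

theorem InteractionL2.add (h : InteractionL2 v i j Φ) (h' : InteractionL2 v i j Φ') :
    InteractionL2 v i j fun x => Φ x + Φ' x := by
  unfold InteractionL2
  simp only [mul_add]
  exact MemLp.add h h'

theorem InteractionL2.sub (h : InteractionL2 v i j Φ) (h' : InteractionL2 v i j Φ') :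
    InteractionL2 v i j fun x => Φ x - Φ' x := by
  unfold InteractionL2
  simp only [mul_sub]
  exact MemLp.sub h h'

theorem InteractionL2.congr (h : InteractionL2 v i j Φ) (hΦ : Φ =ᵐ[volume] Φ') :
    InteractionL2 v i j Φ' := by
  refine MemLp.ae_eq ?_ h
  filter_upwards [hΦ] with x hx
  rw [hx]

theorem InteractionL2.symm (h : InteractionL2 v i j Φ) : InteractionL2 v j i Φ := by
  unfold InteractionL2 at *
  simp_rw [fun x : Config d ℓ N => torusDist_sub_comm (x j) (x i)]
  exact h

/-- Multiplication by a continuous radial function which is bounded on the support of `v`. -/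
theorem InteractionL2.radial_mul {f : ℝ → ℝ} (hf : ContinuousOn f (Set.Ici 0))
    (hb : ∀ r, 0 ≤ r → v r ≠ 0 → |f r| ≤ 1) (h : InteractionL2 v i j Φ) :
    InteractionL2 v i j fun x => (f (torusDist (x i - x j)) : ℂ) * Φ x := by
  have hc : Continuous fun x : Config d ℓ N => f (torusDist (x i - x j)) := by
    refine hf.comp_continuous (f := fun x : Config d ℓ N => torusDist (x i - x j)) ?_
      fun x => torusDist_nonneg _
    unfold torusDist
    fun_prop
  have hm : AEStronglyMeasurable (fun x : Config d ℓ N => (f (torusDist (x i - x j)) : ℂ)) volume :=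
    (Complex.continuous_ofReal.comp hc).aestronglyMeasurable
  refine MemLp.mono h ((hm.mul h.1).congr (ae_of_all _ fun x => ?_)) (ae_of_all _ fun x => ?_)
  · simp only [Pi.mul_apply]; ring
  · by_cases hv : v (torusDist (x i - x j)) = 0
    · simp [hv]
    · have := hb _ (torusDist_nonneg _) hv
      simp only [norm_mul, Complex.norm_real, Real.norm_eq_abs]
      rw [mul_left_comm]
      exact mul_le_of_le_one_left (by positivity) this

theorem InteractionL2.integrable_conj_mul (hv : ∀ r, 0 ≤ v r) (h : InteractionL2 v i j Φ)
    (h' : InteractionL2 v i j Φ') :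
    Integrable (fun x => conj (Φ x) * (v (torusDist (x i - x j)) : ℂ) * Φ' x) volume := by
  refine (MemLp.integrable_mul (MemLp.star h) h').congr (ae_of_all _ fun x => ?_)
  have : ((v (torusDist (x i - x j)) : ℝ) : ℂ) = (Real.sqrt (v (torusDist (x i - x j))) : ℂ) ^ 2 := by
    rw [← Complex.ofReal_pow, Real.sq_sqrt (hv _)]
  simp only [Pi.mul_apply, Pi.star_apply, RCLike.star_def, map_mul, Complex.conj_ofReal, this]
  ring

/-- Once one of the two particles is averaged, integrability of `v` alone controls the interaction;
finiteness of the potential energy is not used. -/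
theorem interactionL2_projP (hvm : Measurable v) (hv : ∀ r, 0 ≤ v r)
    (hvi : Integrable fun x : Torus d ℓ => v (torusDist x)) (hΦ : MemLp Φ 2 volume)
    (hij : i ≠ j) : InteractionL2 v i j (projP j Φ) :=
  (interactionL2_iff hvm hv (memLp_projP hΦ j).1).2 (integrable_mul_projP_sq hvi hΦ hij)

variable {Ψ : Config d ℓ N → ℂ}

theorem interactionL2_projQ_projP (hvm : Measurable v) (hv : ∀ r, 0 ≤ v r)
    (hvi : Integrable fun x : Torus d ℓ => v (torusDist x)) (hΨ : MemLp Ψ 2 volume)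
    (hij : i ≠ j) : InteractionL2 v i j (projQ j (projP i Ψ)) :=
  (interactionL2_projP hvm hv hvi (memLp_projQ hΨ j) hij.symm).symm.congr
    (projQ_projP_ae (hΨ.integrable one_le_two) i j).symm

theorem interactionL2_pairLow (hvm : Measurable v) (hv : ∀ r, 0 ≤ v r)
    (hvi : Integrable fun x : Torus d ℓ => v (torusDist x)) (hΨ : MemLp Ψ 2 volume)
    (hij : i ≠ j) : InteractionL2 v i j (pairLow Ψ i j) :=
  ((interactionL2_projP hvm hv hvi (memLp_projP hΨ i) hij).add
    (interactionL2_projP hvm hv hvi (memLp_projQ hΨ i) hij)).add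
    (interactionL2_projQ_projP hvm hv hvi hΨ hij)

/-- The difference of `Ψ`, which has finite potential energy, and the part with a condensed
particle, for which integrability of `v` suffices. -/
theorem interactionL2_projQ_projQ (hvm : Measurable v) (hv : ∀ r, 0 ≤ v r)
    (hvi : Integrable fun x : Torus d ℓ => v (torusDist x)) (hΨ : MemLp Ψ 2 volume)
    (h : InteractionL2 v i j Ψ) (hij : i ≠ j) : InteractionL2 v i j (projQ j (projQ i Ψ)) :=
  (h.sub (interactionL2_pairLow hvm hv hvi hΨ hij)).congr (ae_of_all _ fun x => by
    simp only [pairLow, projQ]; ring)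

end Weights

/-! ### Renormalization of the pair interaction -/

section PairInteraction

variable {d N : ℕ} {ℓ R a δ : ℝ} [Fact (0 < ℓ)] {v φ φ₀ : ℝ → ℝ} {i j : Fin N}
  {Ψ : Config d ℓ N → ℂ}

/-- The integrand of `⟨Ψ, P_i P_j g(x_i - x_j) Q_j Q_i Ψ⟩`. -/
def pairIntegrand (v φ : ℝ → ℝ) (Ψ : Config d ℓ N → ℂ) (i j : Fin N) (x : Config d ℓ N) : ℂ :=
  conj (projP j (projP i Ψ) x) * (gFn v φ (torusDist (x i - x j)) : ℂ) * projQ j (projQ i Ψ) x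

/-- The integrand of the interaction between the particles of which one is in the condensate. -/
def lowIntegrand (v φ : ℝ → ℝ) (Ψ : Config d ℓ N → ℂ) (i j : Fin N) (x : Config d ℓ N) : ℝ :=
  (gFn v φ (torusDist (x i - x j)) + gOmegaFn v φ (torusDist (x i - x j))) * ‖pairLow Ψ i j x‖ ^ 2

theorem norm_add_sq_eq (z w : ℂ) : ‖z + w‖ ^ 2 = ‖z‖ ^ 2 + ‖w‖ ^ 2 + 2 * (conj z * w).re := by
  simp only [← Complex.normSq_eq_norm_sq, Complex.normSq_apply, Complex.add_re, Complex.add_im,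
    Complex.mul_re, Complex.conj_re, Complex.conj_im]
  ring

/-- Completing the square in `A + q`: the cross term keeps the factor `v (1 - ω) = g`, and `|A|²`
keeps `v (1 - ω²) = g + g ω`. -/
theorem interaction_pointwise (v φ : ℝ → ℝ) (Ψ : Config d ℓ N → ℂ) (i j : Fin N)
    (x : Config d ℓ N) :
    v (torusDist (x i - x j)) * ‖Ψ x‖ ^ 2 = q4Integrand v φ Ψ i j x +
      2 * (conj (pairLow Ψ i j x) * (gFn v φ (torusDist (x i - x j)) : ℂ) *
        projQ j (projQ i Ψ) x).re + lowIntegrand v φ Ψ i j x := by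
  set r := torusDist (x i - x j)
  set A := pairLow Ψ i j x with hA
  set q := projQ j (projQ i Ψ) x with hq
  have h1 : Ψ x = A + q := (pairLow_add_projQ_projQ i j x).symm
  have h2 : q4Vector φ Ψ i j x = (omegaFn φ r : ℂ) * A + q := by
    simp only [q4Vector, hA, pairLow, hq]
    ring
  have h3 : (conj A * (gFn v φ r : ℂ) * q).re = gFn v φ r * (conj A * q).re := by
    rw [mul_comm (conj A), mul_assoc, Complex.re_ofReal_mul]
  have h4 : (conj ((omegaFn φ r : ℂ) * A) * q).re = omegaFn φ r * (conj A * q).re := by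
    rw [map_mul, Complex.conj_ofReal, mul_assoc, Complex.re_ofReal_mul]
  rw [q4Integrand, lowIntegrand, h1, h2, h3, norm_add_sq_eq, norm_add_sq_eq, h4, norm_mul,
    Complex.norm_real, Real.norm_eq_abs, mul_pow, sq_abs, gOmegaFn, gFn]
  ring

namespace ScatteringData

theorem continuousOn_sol (h : ScatteringData d ℓ R a δ v φ₀) :
    ContinuousOn (normalizedSol d δ φ₀) (Set.Ici 0) := by
  have : normalizedSol d δ φ₀ = fun r => normConst d δ * φ₀ r :=
    funext fun r => normalizedSol_eq d δ φ₀ r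
  rw [this]
  exact continuousOn_const.mul h.solution.continuousOn

theorem sol_mem_of_ne (h : ScatteringData d ℓ R a δ v φ₀) {r : ℝ} (hr : 0 ≤ r) (hv : v r ≠ 0) :
    normalizedSol d δ φ₀ r ∈ Set.Icc 0 1 :=
  h.sol_mem hr (not_lt.1 fun hR => hv (h.support r hR))

theorem integrable_conj_mul_g (h : ScatteringData d ℓ R a δ v φ₀) {Φ Φ' : Config d ℓ N → ℂ}
    (hΦ : InteractionL2 v i j Φ) (hΦ' : InteractionL2 v i j Φ') :
    Integrable (fun x => conj (Φ x) *
      (gFn v (normalizedSol d δ φ₀) (torusDist (x i - x j)) : ℂ) * Φ' x) volume := by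
  have h1 := hΦ'.radial_mul h.continuousOn_sol fun r hr hv => by
    have := h.sol_mem_of_ne hr hv
    rw [abs_of_nonneg this.1]
    exact this.2
  refine (hΦ.integrable_conj_mul h.nonneg h1).congr (ae_of_all _ fun x => ?_)
  simp only [gFn_eq]
  push_cast
  ring

theorem interactionL2_q4Vector (h : ScatteringData d ℓ R a δ v φ₀) (hΨ : MemLp Ψ 2 volume)
    (hI : InteractionL2 v i j Ψ) (hij : i ≠ j) :
    InteractionL2 v i j (q4Vector (normalizedSol d δ φ₀) Ψ i j) :=
  (interactionL2_projQ_projQ h.measurable h.nonneg h.integrable_v hΨ hI hij).add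
    ((interactionL2_pairLow h.measurable h.nonneg h.integrable_v hΨ hij).radial_mul
      (continuousOn_const.sub h.continuousOn_sol) fun r hr hv => by
        have := h.sol_mem_of_ne hr hv
        rw [omegaFn, abs_of_nonneg (sub_nonneg.2 this.2)]
        linarith [this.1])

theorem integrable_q4Integrand (h : ScatteringData d ℓ R a δ v φ₀) (hΨ : MemLp Ψ 2 volume)
    (hI : InteractionL2 v i j Ψ) (hij : i ≠ j) :
    Integrable (q4Integrand v (normalizedSol d δ φ₀) Ψ i j) volume := by
  have h1 := h.interactionL2_q4Vector hΨ hI hij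
  refine (MemLp.integrable_norm_pow h1 two_ne_zero).congr (ae_of_all _ fun x => ?_)
  exact norm_sqrt_mul_sq h.nonneg _ _

theorem integrable_q3Integrand (h : ScatteringData d ℓ R a δ v φ₀) (hΨ : MemLp Ψ 2 volume)
    (hI : InteractionL2 v i j Ψ) (hij : i ≠ j) :
    Integrable (q3Integrand v (normalizedSol d δ φ₀) Ψ i j) volume :=
  h.integrable_conj_mul_g
    (interactionL2_projP h.measurable h.nonneg h.integrable_v (memLp_projQ hΨ j) hij.symm).symm
    (interactionL2_projQ_projQ h.measurable h.nonneg h.integrable_v hΨ hI hij)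

theorem integrable_pairIntegrand (h : ScatteringData d ℓ R a δ v φ₀) (hΨ : MemLp Ψ 2 volume)
    (hI : InteractionL2 v i j Ψ) (hij : i ≠ j) :
    Integrable (pairIntegrand v (normalizedSol d δ φ₀) Ψ i j) volume :=
  h.integrable_conj_mul_g
    (interactionL2_projP h.measurable h.nonneg h.integrable_v (memLp_projP hΨ i) hij)
    (interactionL2_projQ_projQ h.measurable h.nonneg h.integrable_v hΨ hI hij)

theorem integrable_lowIntegrand (h : ScatteringData d ℓ R a δ v φ₀) (hΨ : MemLp Ψ 2 volume)
    (hij : i ≠ j) : Integrable (lowIntegrand v (normalizedSol d δ φ₀) Ψ i j) volume := by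
  have h1 := interactionL2_pairLow h.measurable h.nonneg h.integrable_v hΨ hij
  have h2 := (h1.radial_mul (f := fun r => 1 - normalizedSol d δ φ₀ r)
    (continuousOn_const.sub h.continuousOn_sol) fun r hr hv => by
      have := h.sol_mem_of_ne hr hv
      rw [abs_of_nonneg (sub_nonneg.2 this.2)]
      linarith [this.1])
  refine ((h.integrable_conj_mul_g h1 h1).re.add (h.integrable_conj_mul_g h1 h2).re).congr
    (ae_of_all _ fun x => ?_)
  have hc := conj_mul_self' (pairLow Ψ i j x)
  simp only [Pi.add_apply, RCLike.re_eq_complex_re, lowIntegrand, gOmegaFn, omegaFn]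
  set g := gFn v (normalizedSol d δ φ₀) (torusDist (x i - x j))
  set r := torusDist (x i - x j)
  set A := pairLow Ψ i j x
  rw [show conj A * (g : ℂ) * A = ((g * ‖A‖ ^ 2 : ℝ) : ℂ) by
      push_cast at hc ⊢; linear_combination (g : ℂ) * hc,
    show conj A * (g : ℂ) * (((1 - normalizedSol d δ φ₀ r : ℝ) : ℂ) * A) =
      ((g * (1 - normalizedSol d δ φ₀ r) * ‖A‖ ^ 2 : ℝ) : ℂ) by
      push_cast at hc ⊢; linear_combination (g : ℂ) * (1 - normalizedSol d δ φ₀ r) * hc,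
    Complex.ofReal_re, Complex.ofReal_re]
  ring

/-- In the cross term the low part is split as `P_j P_i + P_j Q_i + Q_j P_i`. The first piece
creates pairs; the other two are the cubic integrands for `(j, i)` and `(i, j)`, up to commuting
projections almost everywhere. -/
theorem integral_interaction (h : ScatteringData d ℓ R a δ v φ₀) (hΨ : MemLp Ψ 2 volume)
    (hI : InteractionL2 v i j Ψ) (hij : i ≠ j) :
    ∫ x, v (torusDist (x i - x j)) * ‖Ψ x‖ ^ 2 =
      (∫ x, q4Integrand v (normalizedSol d δ φ₀) Ψ i j x) +
        2 * ((∫ x, pairIntegrand v (normalizedSol d δ φ₀) Ψ i j x) +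
          (∫ x, q3Integrand v (normalizedSol d δ φ₀) Ψ i j x) +
          ∫ x, q3Integrand v (normalizedSol d δ φ₀) Ψ j i x).re +
        ∫ x, lowIntegrand v (normalizedSol d δ φ₀) Ψ i j x := by
  have hΨ1 := hΨ.integrable one_le_two
  have hp := h.integrable_pairIntegrand hΨ hI hij
  have hq := h.integrable_q3Integrand hΨ hI hij
  have hq' := h.integrable_q3Integrand hΨ hI.symm hij.symm
  have hs : Integrable (fun x => pairIntegrand v (normalizedSol d δ φ₀) Ψ i j x +
    q3Integrand v (normalizedSol d δ φ₀) Ψ i j x +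
    q3Integrand v (normalizedSol d δ φ₀) Ψ j i x) volume := (hp.add hq).add hq'
  have e : ∫ x, v (torusDist (x i - x j)) * ‖Ψ x‖ ^ 2 =
      ∫ x, (q4Integrand v (normalizedSol d δ φ₀) Ψ i j x +
        2 * (pairIntegrand v (normalizedSol d δ φ₀) Ψ i j x +
          q3Integrand v (normalizedSol d δ φ₀) Ψ i j x +
          q3Integrand v (normalizedSol d δ φ₀) Ψ j i x).re +
        lowIntegrand v (normalizedSol d δ φ₀) Ψ i j x) := by
    refine integral_congr_ae ?_
    filter_upwards [projQ_projP_ae hΨ1 i j, projQ_projQ_ae hΨ1 i j] with x h1 h2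
    rw [interaction_pointwise v (normalizedSol d δ φ₀)]
    congr 3
    simp only [pairIntegrand, q3Integrand, pairLow, map_add, torusDist_sub_comm (x j) (x i), h1, ← h2]
    ring_nf
  have i1 := h.integrable_q4Integrand hΨ hI hij
  have i2 : Integrable (fun x => 2 * (pairIntegrand v (normalizedSol d δ φ₀) Ψ i j x +
          q3Integrand v (normalizedSol d δ φ₀) Ψ i j x +
          q3Integrand v (normalizedSol d δ φ₀) Ψ j i x).re) volume := hs.re.const_mul 2
  have i12 : Integrable (fun x => q4Integrand v (normalizedSol d δ φ₀) Ψ i j x +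
    2 * (pairIntegrand v (normalizedSol d δ φ₀) Ψ i j x +
          q3Integrand v (normalizedSol d δ φ₀) Ψ i j x +
          q3Integrand v (normalizedSol d δ φ₀) Ψ j i x).re) volume := i1.add i2
  have e2 : ∫ x, (pairIntegrand v (normalizedSol d δ φ₀) Ψ i j x +
          q3Integrand v (normalizedSol d δ φ₀) Ψ i j x +
          q3Integrand v (normalizedSol d δ φ₀) Ψ j i x).re =
      (∫ x, (pairIntegrand v (normalizedSol d δ φ₀) Ψ i j x +
          q3Integrand v (normalizedSol d δ φ₀) Ψ i j x +
          q3Integrand v (normalizedSol d δ φ₀) Ψ j i x)).re := integral_re hs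
  rw [e, integral_add i12 (h.integrable_lowIntegrand hΨ hij), integral_add i1 i2,
    integral_const_mul, e2, integral_add (f := fun x => pairIntegrand v (normalizedSol d δ φ₀) Ψ i j x +
      q3Integrand v (normalizedSol d δ φ₀) Ψ i j x) (hp.add hq) hq', integral_add hp hq]

end ScatteringData

end PairInteraction

/-! ### Direct and exchange terms -/

section LowMomenta

variable {d N : ℕ} {ℓ R a δ : ℝ} [Fact (0 < ℓ)] {v φ φ₀ : ℝ → ℝ} {i j : Fin N}
  {Ψ : Config d ℓ N → ℂ}

/-- A sum over configurations is rewritten as a double sum concentrated on a graph, so that the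
summation over the transferred momentum can be performed last. -/
theorem hasSum_graph {α β E : Type*} [DecidableEq β] [AddCommMonoid E] [TopologicalSpace E]
    (K : α → β) {f : α → E} {s : E} (h : HasSum f s) :
    HasSum (fun p : β × α => if p.1 = K p.2 then f p.2 else 0) s := by
  have hinj : Function.Injective fun x => (K x, x) := fun x y hxy => (Prod.mk.inj hxy).2
  refine (hinj.hasSum_iff ?_).1 (hasSum_of_eq h (fun x => by simp) rfl)
  rintro ⟨y, x⟩ hp
  rw [if_neg]
  intro hy
  exact hp ⟨x, Prod.ext hy.symm rfl⟩

/-- The diagonal matrix elements of the interaction between the particles of which one is in the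
condensate. -/
def lowWeight (W : Mode d → ℝ) (i j : Fin N) (κ : Fin N → Mode d) : ℝ :=
  (if κ i = 0 ∨ κ j = 0 then W 0 else 0) + (if κ i = 0 ∧ κ j ≠ 0 then W (κ j) else 0) +
    (if κ j = 0 ∧ κ i ≠ 0 then W (κ i) else 0)

/-- Transferring the difference of the two momenta exchanges the particles; this is why exchange
terms are diagonal for symmetric `Ψ`. -/
theorem shift_eq_comp_swap {κ : Fin N → Mode d} {k : Mode d} (hij : i ≠ j) (h : k = κ i - κ j) :
    κ - Pi.single i k + Pi.single j k = κ ∘ Equiv.swap i j := by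
  funext l
  by_cases h1 : l = i
  · subst h1
    simp [h, Pi.single_eq_of_ne hij]
  · by_cases h2 : l = j
    · subst h2
      simp [h, Pi.single_eq_of_ne h1]
    · simp [Pi.single_eq_of_ne h1, Pi.single_eq_of_ne h2, Equiv.swap_apply_of_ne_of_ne h1 h2]

/-- Only the diagonal and the exchange terms contribute. -/
theorem low_matrix_element
    (hΨ : ∀ (σ : Equiv.Perm (Fin N)) κ, momentumCoef Ψ (κ ∘ σ) = momentumCoef Ψ κ)
    {W : Mode d → ℝ} (hW : ∀ k, W (-k) = W k) (hij : i ≠ j) (k : Mode d) (κ : Fin N → Mode d)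
    {f : (Fin N → Mode d) → ℂ}
    (hf : ∀ κ, f κ = if κ i = 0 ∨ κ j = 0 then momentumCoef Ψ κ else 0) :
    (W k : ℂ) * (conj (f (κ - Pi.single i k + Pi.single j k)) * f κ) =
      (if k = 0 then ((if κ i = 0 ∨ κ j = 0 then ‖momentumCoef Ψ κ‖ ^ 2 * W 0 else 0 : ℝ) : ℂ)
        else 0) +
      (if k = -κ j then
        ((if κ i = 0 ∧ κ j ≠ 0 then ‖momentumCoef Ψ κ‖ ^ 2 * W (κ j) else 0 : ℝ) : ℂ) else 0) +
      (if k = κ i then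
        ((if κ j = 0 ∧ κ i ≠ 0 then ‖momentumCoef Ψ κ‖ ^ 2 * W (κ i) else 0 : ℝ) : ℂ) else 0) := by
  set κ' := κ - Pi.single i k + Pi.single j k with hκ'
  have hi : κ' i = κ i - k := by simp [hκ', Pi.single_eq_of_ne hij]
  have hj : κ' j = κ j + k := by simp [hκ', Pi.single_eq_of_ne hij.symm]
  have hc : ∀ w : ℝ, (w : ℂ) * (conj (momentumCoef Ψ κ) * momentumCoef Ψ κ) =
      ((‖momentumCoef Ψ κ‖ ^ 2 * w : ℝ) : ℂ) := fun w => by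
    rw [conj_mul_self']; push_cast; ring
  have hsw : k = κ i - κ j → momentumCoef Ψ κ' = momentumCoef Ψ κ := fun h => by
    rw [hκ', shift_eq_comp_swap hij h, hΨ]
  rw [hf, hf κ, hi, hj]
  by_cases h1 : κ i = 0 <;> by_cases h2 : κ j = 0
  · by_cases hk : k = 0
    · have : κ' = κ := by simp [hκ', hk]
      simp [h1, h2, hk, this, ← hc]
    · simp [h1, h2, hk]
  · by_cases hk : k = 0
    · have : κ' = κ := by simp [hκ', hk]
      have h3 : ¬ (0 : Mode d) = -κ j := fun h => h2 (neg_eq_zero.1 h.symm)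
      simp [h1, h2, hk, this, ← hc, h3]
    · by_cases hk2 : k = -κ j
      · have h3 : κ j + k = 0 := by rw [hk2]; abel
        rw [hsw (by rw [h1, hk2, zero_sub])]
        have h4 : W k = W (κ j) := by rw [hk2, hW]
        simp [h1, h2, hk, h3, ← hc, h4, ← hk2]
      · have h3 : ¬ κ j + k = 0 := fun h => hk2 (eq_neg_of_add_eq_zero_right h)
        simp [h1, h2, hk, hk2, h3]
  · by_cases hk : k = 0
    · have : κ' = κ := by simp [hκ', hk]
      have h3 : ¬ (0 : Mode d) = κ i := fun h => h1 h.symm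
      simp [h1, h2, hk, this, ← hc, h3]
    · by_cases hk2 : k = κ i
      · rw [hsw (by rw [h2, hk2, sub_zero])]
        simp [h1, h2, hk2, ← hc]
      · have h3 : ¬ κ i - k = 0 := fun h => hk2 (sub_eq_zero.1 h).symm
        simp [h1, h2, hk, hk2, h3]
  · simp [h1, h2]

theorem abs_lowWeight_le {W : Mode d → ℝ} {B : ℝ} (hB : ∀ k, |W k| ≤ B) (i j : Fin N)
    (κ : Fin N → Mode d) : |lowWeight W i j κ| ≤ 3 * B := by
  have hB0 : 0 ≤ B := (abs_nonneg _).trans (hB 0)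
  have hite : ∀ (p : Prop) [Decidable p] k, |if p then W k else 0| ≤ B := fun p _ k => by
    split_ifs
    · exact hB k
    · simpa using hB0
  have := abs_add_three (if κ i = 0 ∨ κ j = 0 then W 0 else 0)
    (if κ i = 0 ∧ κ j ≠ 0 then W (κ j) else 0) (if κ j = 0 ∧ κ i ≠ 0 then W (κ i) else 0)
  have h1 := hite (κ i = 0 ∨ κ j = 0) 0
  have h2 := hite (κ i = 0 ∧ κ j ≠ 0) (κ j)
  have h3 := hite (κ j = 0 ∧ κ i ≠ 0) (κ i)
  rw [lowWeight]
  linarith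

/-- With a zero momentum both before and after the transfer, `k` can only be `0`, `-κ j` or `κ i`:
one direct and two exchange terms, each concentrated on a graph. -/
theorem hasSum_lowWeight (h0 : Summable fun κ : Fin N → Mode d => ‖momentumCoef Ψ κ‖ ^ 2)
    (hΨ : ∀ (σ : Equiv.Perm (Fin N)) κ, momentumCoef Ψ (κ ∘ σ) = momentumCoef Ψ κ)
    {W : Mode d → ℝ} (hW : ∀ k, W (-k) = W k) {B : ℝ} (hB : ∀ k, |W k| ≤ B) (hij : i ≠ j)
    {f : (Fin N → Mode d) → ℂ}
    (hf : ∀ κ, f κ = if κ i = 0 ∨ κ j = 0 then momentumCoef Ψ κ else 0) {T : Mode d → ℂ}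
    (hT : ∀ k, HasSum (fun κ => conj (f (κ - Pi.single i k + Pi.single j k)) * f κ) (T k)) :
    HasSum (fun k => (W k : ℂ) * T k)
      ((∑' κ : Fin N → Mode d, ‖momentumCoef Ψ κ‖ ^ 2 * lowWeight W i j κ : ℝ) : ℂ) := by
  have hB0 : 0 ≤ B := (abs_nonneg _).trans (hB 0)
  have hs : ∀ (p : (Fin N → Mode d) → Prop) [DecidablePred p] (K : (Fin N → Mode d) → Mode d),
      Summable fun κ => if p κ then ‖momentumCoef Ψ κ‖ ^ 2 * W (K κ) else 0 := fun p _ K => by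
    refine (h0.mul_right B).of_norm_bounded fun κ => ?_
    split_ifs
    · rw [norm_mul, Real.norm_of_nonneg (by positivity)]
      exact mul_le_mul_of_nonneg_left (hB _) (by positivity)
    · rw [norm_zero]; positivity
  have s1 := (hs (fun κ => κ i = 0 ∨ κ j = 0) fun _ => 0).hasSum
  have s2 := (hs (fun κ => κ i = 0 ∧ κ j ≠ 0) fun κ => κ j).hasSum
  have s3 := (hs (fun κ => κ j = 0 ∧ κ i ≠ 0) fun κ => κ i).hasSum
  have hl := ((s1.add s2).add s3).tsum_eq
  have g1 := hasSum_graph (fun _ => (0 : Mode d)) (Complex.hasSum_ofReal.2 s1)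
  have g2 := hasSum_graph (fun κ => -κ j) (Complex.hasSum_ofReal.2 s2)
  have g3 := hasSum_graph (fun κ => κ i) (Complex.hasSum_ofReal.2 s3)
  have key : HasSum (fun p : Mode d × (Fin N → Mode d) => (W p.1 : ℂ) *
      (conj (f (p.2 - Pi.single i p.1 + Pi.single j p.1)) * f p.2))
      ((∑' κ : Fin N → Mode d, ‖momentumCoef Ψ κ‖ ^ 2 * lowWeight W i j κ : ℝ) : ℂ) := by
    refine hasSum_of_eq ((g1.add g2).add g3)
      (fun p => low_matrix_element hΨ hW hij p.1 p.2 hf) ?_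
    rw [← Complex.ofReal_add, ← Complex.ofReal_add, ← hl]
    congr 1
    refine tsum_congr fun κ => ?_
    simp only [lowWeight, mul_add, mul_ite, mul_zero]
  exact key.prod_fiberwise fun k => (hT k).mul_left _

theorem torusCoef_radial_neg (f : ℝ → ℝ) (k : Mode d) :
    torusCoef (fun x : Torus d ℓ => (f (torusDist x) : ℂ)) (-k) = (radialCoef ℓ f k : ℂ) := by
  rw [← fourierCoefTorus_eq, fourierCoefTorus_eq_ofReal, radialCoef_neg]

/-- The diagonal of the interaction between the particles of which one is in the condensate. -/
theorem integral_lowIntegrand (h : ScatteringData d ℓ R a δ v φ₀) (hΨ2 : MemLp Ψ 2 volume)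
    (hΨ : ∀ (σ : Equiv.Perm (Fin N)) κ, momentumCoef Ψ (κ ∘ σ) = momentumCoef Ψ κ) (hij : i ≠ j) :
    ∫ x, lowIntegrand v (normalizedSol d δ φ₀) Ψ i j x = (ℓ ^ d)⁻¹ *
      ∑' κ : Fin N → Mode d, ‖momentumCoef Ψ κ‖ ^ 2 * lowWeight (fun k =>
        radialCoef ℓ (gFn v (normalizedSol d δ φ₀)) k +
          radialCoef ℓ (gOmegaFn v (normalizedSol d δ φ₀)) k) i j κ := by
  set φ := normalizedSol d δ φ₀
  set W : Mode d → ℝ := fun k => radialCoef ℓ (gFn v φ) k + radialCoef ℓ (gOmegaFn v φ) k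
  have hA := memLp_pairLow hΨ2 i j
  have hF : Integrable (fun x => conj (pairLow Ψ i j x) * pairLow Ψ i j x) volume :=
    MemLp.integrable_mul (MemLp.star hA) hA
  obtain ⟨t, ht, htG⟩ := exists_difference_density hF hij
  have hT : ∀ k, HasSum (fun κ => conj (momentumCoef (pairLow Ψ i j)
      (κ - Pi.single i k + Pi.single j k)) * momentumCoef (pairLow Ψ i j) κ) (torusCoef t k) :=
    fun k => by
      have hpw : Integrable (fun x => (fun y => conj (planeWave k y)) (x i - x j) *
          (conj (pairLow Ψ i j x) * pairLow Ψ i j x)) volume := by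
        refine hF.bdd_mul (c := 1) (Continuous.aestronglyMeasurable ?_) (ae_of_all _ fun x => ?_)
        · exact Complex.continuous_conj.comp ((continuous_planeWave k).comp (by fun_prop))
        · simp [norm_planeWave]
      exact hasSum_of_eq (hasSum_coef_difference hA hA i j k) (fun κ => rfl) (htG _ hpw).2
  have h0 := (hasSum_norm_momentumCoef_sq hΨ2).summable
  have hf := momentumCoef_pairLow hΨ2 i j
  -- With weight `1` the same identity shows that the density has absolutely summable Fourier
  -- coefficients, so it may be paired with the merely integrable `g + g ω`.
  have hone := hasSum_lowWeight h0 hΨ (W := fun _ => 1) (B := 1) (fun k => rfl) (fun k => by simp)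
    hij hf hT
  simp only [Complex.ofReal_one, one_mul] at hone
  have hWs := hasSum_lowWeight h0 hΨ (W := W)
    (B := radialCoef ℓ (gFn v φ) (0 : Mode d) + radialCoef ℓ (gOmegaFn v φ) (0 : Mode d))
    (fun k => by simp only [W, radialCoef_neg])
    (fun k => (abs_add_le _ _).trans (add_le_add (abs_radialCoef_le (fun r => h.gFn_nonneg) k)
      (abs_radialCoef_le (fun r => h.gOmegaFn_nonneg) k))) hij hf hT
  have hV : 0 < (volume : Measure (Torus d ℓ)).real Set.univ := by
    rw [volume_real_torus]; exact vol_pos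
  set G : Torus d ℓ → ℂ := fun y =>
    (((fun r => gFn v φ r + gOmegaFn v φ r) (torusDist y) : ℝ) : ℂ) with hG
  have hGi : Integrable G volume := (h.integrable_g.add h.integrable_gOmega).ofReal
  have hGc : ∀ k, torusCoef G (-k) = (W k : ℂ) := fun k => by
    refine (torusCoef_radial_neg (fun r => gFn v φ r + gOmegaFn v φ r) k).trans
      (congrArg _ ?_)
    simp only [W, radialCoef, fourierCoefTorus]
    rw [← Complex.add_re, ← integral_add]
    · simp only [Complex.ofReal_add, add_mul]
    · refine h.integrable_g.ofReal.mul_bdd (c := 1) (Continuous.aestronglyMeasurable ?_)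
        (ae_of_all _ fun x => ?_)
      · exact Complex.continuous_conj.comp (continuous_planeWave k)
      · simp [norm_planeWave]
    · refine h.integrable_gOmega.ofReal.mul_bdd (c := 1) (Continuous.aestronglyMeasurable ?_)
        (ae_of_all _ fun x => ?_)
      · exact Complex.continuous_conj.comp (continuous_planeWave k)
      · simp [norm_planeWave]
  have hmain := isCharFamily_torusChar.hasSum_integral_mul hV hGi ht hone.summable.norm
  have e1 : ∀ x, G (x i - x j) * (conj (pairLow Ψ i j x) * pairLow Ψ i j x) =
      ((lowIntegrand v φ Ψ i j x : ℝ) : ℂ) := fun x => by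
    rw [conj_mul_self', hG, lowIntegrand]
    push_cast
    rfl
  have hlow : Integrable (fun x => G (x i - x j) * (conj (pairLow Ψ i j x) * pairLow Ψ i j x))
      volume := by
    simp only [e1]
    exact (h.integrable_lowIntegrand hΨ2 hij).ofReal
  rw [(htG G hlow).2, volume_real_torus] at hmain
  simp only [e1, integral_complex_ofReal] at hmain
  have := (hasSum_of_eq hmain (fun k => congrArg (· * _) (hGc k).symm) rfl).unique hWs
  rw [← Complex.ofReal_mul] at this
  rw [← Complex.ofReal_injective this, inv_mul_cancel_left₀ vol_pos.ne']

end LowMomenta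

/-! ### Pair creation and the pairing of `H⁻¹` with `H¹` -/

section PairCreation

variable {d N : ℕ} {ℓ R a δ : ℝ} [Fact (0 < ℓ)] {v φ φ₀ : ℝ → ℝ} {i j : Fin N}
  {Ψ : Config d ℓ N → ℂ}

theorem norm_sq_le_of_hasSum {ι : Type*} {a b : ι → ℂ} {T : ℂ}
    (h : HasSum (fun x => conj (a x) * b x) T) (ha : Summable fun x => ‖a x‖ ^ 2)
    (hb : Summable fun x => ‖b x‖ ^ 2) : ‖T‖ ^ 2 ≤ (∑' x, ‖a x‖ ^ 2) * ∑' x, ‖b x‖ ^ 2 := by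
  have key := Real.inner_le_Lp_mul_Lq_tsum_of_nonneg Real.HolderConjugate.two_two
    (f := fun x => ‖a x‖) (g := fun x => ‖b x‖) (fun x => norm_nonneg _) (fun x => norm_nonneg _)
    (by simpa using ha) (by simpa using hb)
  simp only [Real.rpow_two, ← Real.sqrt_eq_rpow] at key
  have hA : 0 ≤ ∑' x, ‖a x‖ ^ 2 := tsum_nonneg fun x => by positivity
  have hB : 0 ≤ ∑' x, ‖b x‖ ^ 2 := tsum_nonneg fun x => by positivity
  have h1 : ‖T‖ ≤ ∑' x, ‖a x‖ * ‖b x‖ := by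
    rw [← h.tsum_eq]
    have hn := norm_tsum_le_tsum_norm h.summable.norm
    simpa only [norm_mul, RCLike.norm_conj] using hn
  rw [← Real.sq_sqrt hA, ← Real.sq_sqrt hB, ← mul_pow]
  exact pow_le_pow_left₀ (norm_nonneg _) (h1.trans key) 2

/-- The Fourier coefficients of the density of pairs are those of an `H¹` function. -/
theorem summable_movePair (hij : i ≠ j)
    (h0 : Summable fun κ : Fin N → Mode d => ‖momentumCoef Ψ κ‖ ^ 2)
    (h1 : Summable fun κ : Fin N → Mode d => (∑ j, kSq ℓ (κ j)) * ‖momentumCoef Ψ κ‖ ^ 2) :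
    Summable fun p : Mode d × (Fin N → Mode d) => if p.2 i = 0 ∧ p.2 j = 0 then
      (1 + kSq ℓ p.1) * ‖momentumCoef Ψ (movePair p.2 i j p.1)‖ ^ 2 else 0 := by
  set S : Set (Mode d × (Fin N → Mode d)) := {p | p.2 i = 0 ∧ p.2 j = 0}
  -- The momentum `k` is read off from particle `i`, which was at rest before; the double sum is
  -- therefore part of a single sum over configurations.
  have hinj : Function.Injective fun p : S => movePair p.1.2 i j p.1.1 := by
    rintro ⟨⟨k, κ⟩, hi, hj⟩ ⟨⟨k', κ'⟩, hi', hj'⟩ h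
    simp only at hi hj hi' hj' h
    have hk : k = k' := by
      have := congrFun h i
      simpa [movePair, hi, hi', Pi.single_eq_of_ne hij] using this
    subst hk
    have : κ = κ' := by simpa [movePair] using h
    subst this
    rfl
  have hs := (h0.add h1).comp_injective hinj
  have hs2 := (summable_subtype_iff_indicator (f := fun p : Mode d × (Fin N → Mode d) =>
    ‖momentumCoef Ψ (movePair p.2 i j p.1)‖ ^ 2 + (∑ l, kSq ℓ (movePair p.2 i j p.1 l)) *
      ‖momentumCoef Ψ (movePair p.2 i j p.1)‖ ^ 2) (s := S)).1 hs
  refine hs2.of_nonneg_of_le (fun p => ?_) fun p => ?_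
  · have := kSq_nonneg (ℓ := ℓ) p.1
    split_ifs <;> positivity
  · by_cases hp : p.2 i = 0 ∧ p.2 j = 0
    · rw [if_pos hp, Set.indicator_of_mem (show p ∈ S from hp)]
      have h2 : kSq ℓ p.1 ≤ ∑ l, kSq ℓ (movePair p.2 i j p.1 l) := by
        have h3 := Finset.single_le_sum (f := fun l => kSq ℓ (movePair p.2 i j p.1 l))
          (fun l _ => kSq_nonneg _) (Finset.mem_univ i)
        have h4 : movePair p.2 i j p.1 i = p.1 := by
          simp [movePair, hp.1, Pi.single_eq_of_ne hij]
        rwa [h4] at h3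
      have := mul_le_mul_of_nonneg_right h2 (sq_nonneg ‖momentumCoef Ψ (movePair p.2 i j p.1)‖)
      linarith
    · rw [if_neg hp, Set.indicator_of_notMem (show p ∉ S from hp)]

/-- The matrix elements of the creation of pairs. -/
theorem exists_pair_coef (h : ScatteringData d ℓ R a δ v φ₀) (hΨ : MemLp Ψ 2 volume)
    (hI : InteractionL2 v i j Ψ)
    (h1 : Summable fun κ : Fin N → Mode d => (∑ j, kSq ℓ (κ j)) * ‖momentumCoef Ψ κ‖ ^ 2)
    (hij : i ≠ j) :
    ∃ T : Mode d → ℂ, (∀ k, k ≠ 0 → HasSum (fun κ : Fin N → Mode d => if κ i = 0 ∧ κ j = 0 then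
        conj (momentumCoef Ψ κ) * momentumCoef Ψ (movePair κ i j k) else 0) (T k)) ∧ T 0 = 0 ∧
      HasSum (fun k => (radialCoef ℓ (gFn v (normalizedSol d δ φ₀)) k : ℂ) * T k)
        (ℓ ^ d * ∫ x, pairIntegrand v (normalizedSol d δ φ₀) Ψ i j x) := by
  set φ := normalizedSol d δ φ₀
  have hΨ1 := hΨ.integrable one_le_two
  have h0 := (hasSum_norm_momentumCoef_sq hΨ).summable
  have hP := memLp_projP (memLp_projP hΨ i) j
  have hQ := memLp_projQ (memLp_projQ hΨ i) j
  have hF : Integrable (fun x => conj (projP j (projP i Ψ) x) * projQ j (projQ i Ψ) x) volume :=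
    MemLp.integrable_mul (MemLp.star hP) hQ
  obtain ⟨t, ht, htG⟩ := exists_difference_density hF hij
  have hT : ∀ k, HasSum (fun κ : Fin N → Mode d =>
      conj (if κ i = 0 ∧ κ j = 0 then momentumCoef Ψ κ else 0) *
        (if k = 0 ∨ ¬(κ i = 0 ∧ κ j = 0) then 0 else momentumCoef Ψ (movePair κ i j k)))
      (torusCoef t k) := fun k => by
    have hpw : Integrable (fun x => (fun y => conj (planeWave k y)) (x i - x j) *
        (conj (projP j (projP i Ψ) x) * projQ j (projQ i Ψ) x)) volume := by
      refine hF.bdd_mul (c := 1) (Continuous.aestronglyMeasurable ?_) (ae_of_all _ fun x => ?_)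
      · exact Complex.continuous_conj.comp ((continuous_planeWave k).comp (by fun_prop))
      · simp [norm_planeWave]
    -- The substitution makes `κ` the configuration with the two particles at rest and moves the
    -- excitation into the second factor.
    have e := (Equiv.addRight (Pi.single i k - Pi.single j k : Fin N → Mode d)).hasSum_iff.2
      (hasSum_coef_difference hP hQ i j k)
    refine hasSum_of_eq e (fun κ => ?_) (htG _ hpw).2
    have e1 : movePair κ i j k - Pi.single i k + Pi.single j k = κ := by rw [movePair]; abel
    have e2 : κ + (Pi.single i k - Pi.single j k) = movePair κ i j k := by
      rw [movePair]; abel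
    have e3 : movePair κ i j k i = κ i + k := by simp [movePair, Pi.single_eq_of_ne hij]
    have e4 : movePair κ i j k j = κ j - k := by simp [movePair, Pi.single_eq_of_ne hij.symm]
    simp only [Function.comp_apply, Equiv.coe_addRight, e2, e1, momentumCoef_projP_projP hΨ1,
      momentumCoef_projQ_projQ hΨ1, e3, e4]
    by_cases hκ : κ i = 0 ∧ κ j = 0
    · simp [hκ.1, hκ.2]
    · simp [hκ]
  have hT0 : torusCoef t 0 = 0 := (hasSum_of_eq (hT 0) (fun κ => by simp) rfl).unique hasSum_zero
  refine ⟨torusCoef t, fun k hk => hasSum_of_eq (hT k) (fun κ => ?_) rfl, hT0, ?_⟩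
  · by_cases hκ : κ i = 0 ∧ κ j = 0
    · simp [hκ, hk]
    · simp [hκ]
  have hsm := summable_movePair hij h0 h1
  have hw : ∀ k : Mode d, 0 < 1 + kSq ℓ k := fun k => by linarith [kSq_nonneg (ℓ := ℓ) k]
  have hb : ∀ k, Summable fun κ : Fin N → Mode d =>
      ‖if k = 0 ∨ ¬(κ i = 0 ∧ κ j = 0) then (0 : ℂ) else momentumCoef Ψ (movePair κ i j k)‖ ^ 2 :=
    fun k => by
      refine (hsm.prod_factor k).of_nonneg_of_le (fun κ => by positivity) fun κ => ?_
      by_cases hκ : κ i = 0 ∧ κ j = 0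
      · by_cases hk : k = 0
        · simp only [hk, true_or, if_true, norm_zero, if_pos hκ]
          exact (zero_pow two_ne_zero).trans_le (mul_nonneg (hw 0).le (by positivity))
        · simp only [hκ, hk]
          simp only [and_self, not_true_eq_false, or_self, if_false, if_true]
          exact le_mul_of_one_le_left (by positivity) (by linarith [kSq_nonneg (ℓ := ℓ) k])
      · simp [hκ]
  have ha : Summable fun κ : Fin N → Mode d =>
      ‖if κ i = 0 ∧ κ j = 0 then momentumCoef Ψ κ else 0‖ ^ 2 := by
    refine h0.of_nonneg_of_le (fun κ => by positivity) fun κ => ?_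
    split_ifs
    · exact le_rfl
    · simp
  -- Cauchy–Schwarz over configurations puts the whole weight `1 + k²` on the excited factor, where
  -- particle `i` has momentum `k`, so the kinetic energy dominates it.
  have hh1 : Summable fun k : Mode d => (1 + kSq ℓ k) * ‖torusCoef t k‖ ^ 2 := by
    refine (hsm.prod.mul_left (∑' κ : Fin N → Mode d,
      ‖if κ i = 0 ∧ κ j = 0 then momentumCoef Ψ κ else 0‖ ^ 2)).of_nonneg_of_le
      (fun k => mul_nonneg (hw k).le (by positivity)) fun k => ?_
    have h2 := norm_sq_le_of_hasSum (hT k) ha (hb k)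
    refine (mul_le_mul_of_nonneg_left h2 (hw k).le).trans ?_
    rw [mul_left_comm, ← tsum_mul_left]
    refine mul_le_mul_of_nonneg_left (((hb k).mul_left _).tsum_le_tsum (fun κ => ?_)
      (hsm.prod_factor k)) (tsum_nonneg fun κ => by positivity)
    by_cases hκ : κ i = 0 ∧ κ j = 0
    · by_cases hk : k = 0
      · simp only [hk, true_or, if_true, norm_zero, if_pos hκ]
        have := hw 0
        rw [zero_pow two_ne_zero, mul_zero]
        positivity
      · simp [hκ, hk]
    · simp [hκ]
  set G : Torus d ℓ → ℂ := fun y => ((gFn v φ (torusDist y) : ℝ) : ℂ)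
  have hGi : Integrable G volume := h.integrable_g.ofReal
  have hGc : ∀ k, torusCoef G (-k) = (radialCoef ℓ (gFn v φ) k : ℂ) := fun k =>
    torusCoef_radial_neg (gFn v φ) k
  have e1 : (fun x => G (x i - x j) * (conj (projP j (projP i Ψ) x) * projQ j (projQ i Ψ) x)) =
      pairIntegrand v φ Ψ i j := funext fun x => by
    rw [pairIntegrand]; ring
  obtain ⟨hgi, hgv⟩ := htG G (by rw [e1]; exact h.integrable_pairIntegrand hΨ hI hij)
  have hg1 : Summable fun k : Mode d => ‖torusCoef G (-k)‖ ^ 2 / (1 + kSq ℓ k) := by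
    refine h.summable_coef_sq_div.congr fun k => ?_
    rw [hGc, Complex.norm_real, Real.norm_eq_abs, sq_abs]
  refine hasSum_of_eq (hasSum_integral_mul_of_h1 hGi ht hgi hg1 hh1)
    (fun k => congrArg (· * _) (hGc k).symm) ?_
  rw [hgv, e1]

/-- Summation of the matrix elements over ordered pairs of particles; `k = 0` may be dropped since
its coefficient vanishes. -/
theorem exists_pair_sums (h : ScatteringData d ℓ R a δ v φ₀) (hΨ : MemLp Ψ 2 volume)
    (hI : ∀ i j : Fin N, i ≠ j → InteractionL2 v i j Ψ)
    (h1 : Summable fun κ : Fin N → Mode d => (∑ j, kSq ℓ (κ j)) * ‖momentumCoef Ψ κ‖ ^ 2) :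
    ∃ H : ExcMode d → ℂ, (∀ k : ExcMode d, HasSum (fun κ : Fin N → Mode d => ∑ i, ∑ j,
        (if i ≠ j ∧ κ i = 0 ∧ κ j = 0 then
          conj (momentumCoef Ψ κ) * momentumCoef Ψ (movePair κ i j k.1) else 0)) (H k)) ∧
      HasSum (fun k : ExcMode d =>
          (radialCoef ℓ (gFn v (normalizedSol d δ φ₀)) k.1 : ℂ) * H k)
        (ℓ ^ d * ∑ i : Fin N, ∑ j : Fin N, if i ≠ j then
          ∫ x, pairIntegrand v (normalizedSol d δ φ₀) Ψ i j x else 0) := by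
  set φ := normalizedSol d δ φ₀
  have key : ∀ i j : Fin N, ∃ T : ExcMode d → ℂ,
      (∀ k : ExcMode d, HasSum (fun κ : Fin N → Mode d => if i ≠ j ∧ κ i = 0 ∧ κ j = 0 then
          conj (momentumCoef Ψ κ) * momentumCoef Ψ (movePair κ i j k.1) else 0) (T k)) ∧
      HasSum (fun k : ExcMode d => (radialCoef ℓ (gFn v φ) k.1 : ℂ) * T k)
        (ℓ ^ d * if i ≠ j then ∫ x, pairIntegrand v φ Ψ i j x else 0) := fun i j => by
    by_cases hij : i = j
    · refine ⟨fun _ => 0, fun k => ?_, ?_⟩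
      · simp [hij]
      · simp [hij]
    · obtain ⟨T, hT, hT0, hTs⟩ := exists_pair_coef h hΨ (hI i j hij) h1 hij
      refine ⟨fun k => T k.1, fun k => hasSum_of_eq (hT k.1 k.2) (fun κ => by simp [hij]) rfl, ?_⟩
      rw [if_pos hij]
      refine (hasSum_subtype_iff_of_support_subset (s := {k : Mode d | k ≠ 0})
        (f := fun k => (radialCoef ℓ (gFn v φ) k : ℂ) * T k) fun k hk => ?_).2 hTs
      rintro rfl
      exact hk (by simp [hT0])
  choose T hT hTs using key
  refine ⟨fun k => ∑ i, ∑ j, T i j k, fun k =>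
    hasSum_sum fun i _ => hasSum_sum fun j _ => hT i j k, ?_⟩
  simp only [Finset.mul_sum]
  exact hasSum_sum fun i _ => hasSum_sum fun j _ => hTs i j

end PairCreation

/-! ### Comparison of the diagonal terms -/

section Remainder

variable {d N : ℕ} {ℓ R a δ : ℝ} [Fact (0 < ℓ)] {v φ φ₀ : ℝ → ℝ} {ρ : ℝ} {Ψ : Config d ℓ N → ℂ}

theorem sum_ite_ne {E : Type*} [AddCommGroup E] (f : Fin N → Fin N → E) :
    (∑ i, ∑ j, if i ≠ j then f i j else 0) = (∑ i, ∑ j, f i j) - ∑ i, f i i := by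
  rw [eq_sub_iff_add_eq, ← Finset.sum_add_distrib]
  refine Finset.sum_congr rfl fun i _ => ?_
  rw [show f i i = ∑ j, if i = j then f i j else 0 by simp, ← Finset.sum_add_distrib]
  refine Finset.sum_congr rfl fun j _ => ?_
  by_cases h : i = j <;> simp [h]

theorem two_mul_sum_lt {f : Fin N → Fin N → ℝ} (hf : ∀ i j, f i j = f j i) :
    2 * (∑ i, ∑ j, if i < j then f i j else 0) = ∑ i, ∑ j, if i ≠ j then f i j else 0 := by
  have h : (∑ i : Fin N, ∑ j, if i < j then f i j else 0) = ∑ i, ∑ j, if j < i then f i j else 0 := by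
    rw [Finset.sum_comm]
    refine Finset.sum_congr rfl fun i _ => Finset.sum_congr rfl fun j _ => ?_
    rw [hf]
  rw [two_mul]
  nth_rewrite 2 [h]
  rw [← Finset.sum_add_distrib]
  refine Finset.sum_congr rfl fun i _ => ?_
  rw [← Finset.sum_add_distrib]
  refine Finset.sum_congr rfl fun j _ => ?_
  rcases lt_trichotomy i j with h | h | h
  · simp [h, h.ne, h.not_gt]
  · simp [h]
  · simp [h, h.ne', h.not_gt]

/-- The energy counts unordered pairs and the renormalized terms ordered ones. Symmetrization turns
the two cubic terms of each pair into the sum with its hermitian conjugate, and puts the factor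
`1/2` on the quartic and low parts. -/
theorem sum_pair_decomposition {e q l : Fin N → Fin N → ℝ} {p s : Fin N → Fin N → ℂ}
    (he : ∀ i j, e i j = e j i)
    (h : ∀ i j, i ≠ j → e i j = q i j + 2 * (p i j + s i j + s j i).re + l i j) :
    ((∑ i, ∑ j, if i < j then e i j else 0 : ℝ) : ℂ) =
      (((∑ i, ∑ j, if i ≠ j then p i j else 0).re : ℝ) : ℂ) +
      (∑ i, ∑ j, if i ≠ j then s i j + conj (s i j) else 0) +
      ((1 / 2 * ∑ i, ∑ j, if i ≠ j then q i j else 0 : ℝ) : ℂ) +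
      ((1 / 2 * ∑ i, ∑ j, if i ≠ j then l i j else 0 : ℝ) : ℂ) := by
  have h1 := two_mul_sum_lt he
  have hs : (∑ i, ∑ j, if i ≠ j then s i j + conj (s i j) else 0) =
      ((∑ i, ∑ j, if i ≠ j then 2 * (s i j).re else 0 : ℝ) : ℂ) := by
    push_cast
    refine Finset.sum_congr rfl fun i _ => Finset.sum_congr rfl fun j _ => ?_
    split_ifs
    · rw [Complex.add_conj]
    · simp
  have hp : (∑ i, ∑ j, if i ≠ j then p i j else 0).re = ∑ i, ∑ j, if i ≠ j then (p i j).re else 0 := by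
    simp only [Complex.re_sum]
    refine Finset.sum_congr rfl fun i _ => Finset.sum_congr rfl fun j _ => ?_
    split_ifs <;> rfl
  have hc : (∑ i, ∑ j, if i ≠ j then (s j i).re else 0) = ∑ i, ∑ j, if i ≠ j then (s i j).re else 0 := by
    rw [Finset.sum_comm]
    refine Finset.sum_congr rfl fun i _ => Finset.sum_congr rfl fun j _ => ?_
    simp only [ne_comm]
  have h2 : (∑ i, ∑ j, if i ≠ j then e i j else 0) =
      (∑ i, ∑ j, if i ≠ j then q i j else 0) + 2 * (∑ i, ∑ j, if i ≠ j then (p i j).re else 0) +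
      2 * (∑ i, ∑ j, if i ≠ j then (s i j).re else 0) +
      2 * (∑ i, ∑ j, if i ≠ j then (s j i).re else 0) + ∑ i, ∑ j, if i ≠ j then l i j else 0 := by
    simp only [Finset.mul_sum, ← Finset.sum_add_distrib]
    refine Finset.sum_congr rfl fun i _ => Finset.sum_congr rfl fun j _ => ?_
    split_ifs with hij
    · simp [h i j hij]; ring
    · simp
  have h3 : (∑ i, ∑ j, if i ≠ j then 2 * (s i j).re else 0) =
      2 * ∑ i, ∑ j, if i ≠ j then (s i j).re else 0 := by
    simp only [Finset.mul_sum, mul_ite, mul_zero]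
  rw [hs, hp, h3, ← Complex.ofReal_add, ← Complex.ofReal_add, ← Complex.ofReal_add]
  congr 1
  rw [hc] at h2
  linarith

theorem excSum_one (n : ExcMode d →₀ ℕ) : excSum (fun _ => 1) n = n.degree := by
  rw [excSum, Finsupp.degree_apply, Finsupp.sum]
  push_cast
  simp

theorem excSum_add (F G : Mode d → ℝ) (n : ExcMode d →₀ ℕ) :
    excSum (fun k => F k + G k) n = excSum F n + excSum G n := by
  simp only [excSum, Finsupp.sum, mul_add, Finset.sum_add_distrib]

theorem excSum_const (c : ℝ) (n : ExcMode d →₀ ℕ) : excSum (fun _ => c) n = n.degree * c := by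
  rw [← excSum_one, excSum, excSum, Finsupp.sum, Finsupp.sum, Finset.sum_mul]
  simp

theorem sum_kSq_eq (κ : Fin N → Mode d) : ∑ j, kSq ℓ (κ j) = excSum (kSq ℓ) (excOcc κ) := by
  rw [excSum_excOcc]
  refine Finset.sum_congr rfl fun j _ => ?_
  split_ifs with h
  · simp [h, kSq]
  · rfl

/-- With `z_i` the indicator of `κ i = 0`, the condition that `i` or `j` is at rest is `z_i + z_j -
z_i z_j`, so the double sum factorizes once the diagonal `i = j` is subtracted. -/
theorem sum_lowWeight (W : Mode d → ℝ) (κ : Fin N → Mode d) :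
    (∑ i, ∑ j, if i ≠ j then lowWeight W i j κ else 0) =
      W 0 * (2 * N * zeroCount κ - (zeroCount κ : ℝ) ^ 2 - zeroCount κ) +
        2 * (zeroCount κ * excSum W (excOcc κ)) := by
  set z : Fin N → ℝ := fun i => if κ i = 0 then 1 else 0 with hz
  set y : Fin N → ℝ := fun i => if κ i = 0 then 0 else W (κ i) with hy
  have hZ : ∑ i, z i = zeroCount κ := by
    have h1 := zeroCount_add_degree κ
    have h2 : ((excOcc κ).degree : ℝ) = ∑ i, (1 - z i) := by
      rw [← excSum_one, excSum_excOcc]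
      refine Finset.sum_congr rfl fun i _ => ?_
      simp only [hz]
      split_ifs <;> simp
    rw [Finset.sum_sub_distrib] at h2
    have h3 : (zeroCount κ : ℝ) + (excOcc κ).degree = N := by exact_mod_cast h1
    simp only [Finset.sum_const, Finset.card_univ, Fintype.card_fin, nsmul_eq_mul, mul_one] at h2
    linarith
  have hY : ∑ i, y i = excSum W (excOcc κ) := (excSum_excOcc W κ).symm
  have hw : ∀ i j, lowWeight W i j κ = W 0 * z i + W 0 * z j - W 0 * z i * z j + z i * y j +
      y i * z j := fun i j => by
    by_cases h1 : κ i = 0 <;> by_cases h2 : κ j = 0 <;> simp [lowWeight, hz, hy, h1, h2]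
  have hd : ∀ i, W 0 * z i + W 0 * z i - W 0 * z i * z i + z i * y i + y i * z i = W 0 * z i :=
    fun i => by by_cases h1 : κ i = 0 <;> simp [hz, hy, h1]
  rw [sum_ite_ne]
  simp only [hw, hd]
  simp only [Finset.sum_add_distrib, Finset.sum_sub_distrib, ← Finset.mul_sum, ← Finset.sum_mul,
    Finset.sum_const, Finset.card_univ, Fintype.card_fin, nsmul_eq_mul, hZ, hY]
  ring

/-- The diagonal matrix elements of the error term. -/
def remainder (ℓ : ℝ) [Fact (0 < ℓ)] (v φ : ℝ → ℝ) (κ : Fin N → Mode d) : ℝ :=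
  (ℓ ^ d)⁻¹ * (N * radialCoef ℓ (gFn v φ) (0 : Mode d) -
    excSum (fun k => radialCoef ℓ (gFn v φ) k + radialCoef ℓ (gOmegaFn v φ) k) (excOcc κ) -
    (radialCoef ℓ (gFn v φ) (0 : Mode d) + radialCoef ℓ (gOmegaFn v φ) (0 : Mode d)) *
      (2 * zeroCount κ + 1 + (excOcc κ).degree))

/-- Write `m` and `n` for the numbers of condensed and excited particles, so `N = m + n`. Antinormal
ordering replaces `m` by `m + 1` and `m (m - 1)` by `(m + 1) (m + 2)`, while the terms with `ρ`
collapse to `-ρ ĝ(0)`. All expressions quadratic in `m`, `n` cancel, and only the linear discrepancy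
is left. -/
theorem remainder_eq (hρ : (N : ℝ) = ρ * ℓ ^ d) (κ : Fin N → Mode d) :
    (∑ j, kSq ℓ (κ j)) + 1 / 2 * ((ℓ ^ d)⁻¹ * ∑ i, ∑ j, if i ≠ j then lowWeight (fun k =>
      radialCoef ℓ (gFn v φ) k + radialCoef ℓ (gOmegaFn v φ) k) i j κ else 0) -
      diagTotal ℓ v φ ρ N (excOcc κ) = remainder ℓ v φ κ := by
  have hV := (vol_pos (d := d) (ℓ := ℓ)).ne'
  have hN : (N : ℝ) = zeroCount κ + (excOcc κ).degree := by exact_mod_cast (zeroCount_add_degree κ).symm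
  have hz : N - (excOcc κ).degree = zeroCount κ := by have := zeroCount_add_degree κ; omega
  have hr : ρ = (ℓ ^ d)⁻¹ * (zeroCount κ + (excOcc κ).degree) := by
    rw [← hN, hρ]; field_simp
  rw [sum_lowWeight, sum_kSq_eq, diagTotal, diagCoef0, diagCoef1, diagCoef2, remainder, hz]
  simp only [excSum_add, excSum_const, hr, hN]
  field_simp
  ring

/-- Each Fourier coefficient is bounded by its value at `0`, and `0 ≤ (g ω)^(0) ≤ ĝ(0)`. The three
terms are then at most `1`, `2` and `6` times `N ĝ(0)`; the last uses `2 m + 1 + n ≤ 3 N`, which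
needs `N ≥ 1`. -/
theorem abs_remainder_le (h : ScatteringData d ℓ R a δ v φ₀) (hN : 1 ≤ N) (κ : Fin N → Mode d) :
    |remainder ℓ v (normalizedSol d δ φ₀) κ| ≤
      10 * N * (ℓ ^ d)⁻¹ * radialCoef ℓ (gFn v (normalizedSol d δ φ₀)) (0 : Mode d) := by
  set φ := normalizedSol d δ φ₀
  set g0 := radialCoef ℓ (gFn v φ) (0 : Mode d) with hg0
  set w0 := radialCoef ℓ (gOmegaFn v φ) (0 : Mode d) with hw0
  have hw : 0 ≤ w0 := by
    rw [hw0, radialCoef_zero]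
    exact integral_nonneg fun x => h.gOmegaFn_nonneg (torusDist_nonneg x)
  have hwg : w0 ≤ g0 := by
    rw [hw0, hg0, radialCoef_zero, radialCoef_zero]
    exact integral_mono h.integrable_gOmega h.integrable_g fun x => h.gOmegaFn_le (torusDist_nonneg x)
  have hY := abs_excSum_excOcc_le (F := fun k => radialCoef ℓ (gFn v φ) k +
    radialCoef ℓ (gOmegaFn v φ) k) (B := g0 + w0) (fun k => (abs_add_le _ _).trans
      (add_le_add (abs_radialCoef_le (fun r => h.gFn_nonneg) k)
        (abs_radialCoef_le (fun r => h.gOmegaFn_nonneg) k))) κ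
  have hNe : (N : ℝ) = zeroCount κ + (excOcc κ).degree := by exact_mod_cast (zeroCount_add_degree κ).symm
  have hN1 : (1 : ℝ) ≤ N := by exact_mod_cast hN
  have hm : (0 : ℝ) ≤ zeroCount κ := by positivity
  have hn : (0 : ℝ) ≤ (excOcc κ).degree := by positivity
  have hi : (0 : ℝ) < (ℓ ^ d)⁻¹ := inv_pos.2 vol_pos
  rw [remainder, abs_mul, abs_of_pos hi,
    show 10 * (N : ℝ) * (ℓ ^ d)⁻¹ * g0 = (ℓ ^ d)⁻¹ * (10 * N * g0) by ring]
  refine mul_le_mul_of_nonneg_left ?_ hi.le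
  have h1 := abs_le.1 hY
  have h2 : (g0 + w0) * (2 * zeroCount κ + 1 + (excOcc κ).degree) ≤ (2 * g0) * (3 * N) :=
    mul_le_mul (by linarith) (by linarith) (by linarith) (by linarith)
  have h3 : 0 ≤ (g0 + w0) * (2 * zeroCount κ + 1 + (excOcc κ).degree) :=
    mul_nonneg (by linarith) (by linarith)
  have h4 : (N : ℝ) * (g0 + w0) ≤ N * (2 * g0) := mul_le_mul_of_nonneg_left (by linarith) (by linarith)
  have h5 : 0 ≤ (N : ℝ) * g0 := mul_nonneg (by linarith) (by linarith)
  rw [abs_le]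
  constructor <;> linarith [h1.1, h1.2]

theorem excOcc_comp_perm (κ : Fin N → Mode d) (σ : Equiv.Perm (Fin N)) :
    excOcc (κ ∘ σ) = excOcc κ := by
  ext k
  rw [excOcc_apply, excOcc_apply, occ_comp_perm]

theorem remainder_comp_perm (κ : Fin N → Mode d) (σ : Equiv.Perm (Fin N)) :
    remainder ℓ v φ (κ ∘ σ) = remainder ℓ v φ κ := by
  simp only [remainder, excOcc_comp_perm, zeroCount, occ_comp_perm]

end Remainder

/-! ### Bounded operators diagonal in momentum space -/

section Multiplier

variable {d N : ℕ} {ℓ : ℝ} [Fact (0 < ℓ)]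

theorem momentumCoef_comp_perm {Ψ : Config d ℓ N → ℂ} (hΨ : Integrable Ψ volume)
    (σ : Equiv.Perm (Fin N)) (κ : Fin N → Mode d) :
    momentumCoef (fun x => Ψ (x ∘ σ)) κ = momentumCoef Ψ (κ ∘ σ) := by
  have hmp := measurePreserving_perm (d := d) (ℓ := ℓ) σ
  have hc := isCharFamily_configChar.conj_mul_integrable hΨ (κ ∘ σ)
  have h := integral_map hmp.measurable.aemeasurable (by rw [hmp.map_eq]; exact hc.1)
  rw [hmp.map_eq] at h
  rw [momentumCoef_eq, momentumCoef_eq, charCoef, charCoef, h]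
  congr 1
  refine integral_congr_ae (ae_of_all _ fun x => ?_)
  simp only [configChar, ContinuousMap.coe_mk, Function.comp_apply]
  rw [Equiv.prod_comp σ fun j => planeWave (κ j) (x j)]

theorem momentumCoef_perm_of_mem {Ψ : L2 d ℓ N} (hΨ : Ψ ∈ L2sym d ℓ N) (σ : Equiv.Perm (Fin N))
    (κ : Fin N → Mode d) : momentumCoef Ψ (κ ∘ σ) = momentumCoef Ψ κ := by
  rw [← momentumCoef_comp_perm ((Lp.memLp Ψ).integrable one_le_two),
    momentumCoef_congr (hΨ σ)]

theorem mem_L2sym_of_momentumCoef {Ψ : L2 d ℓ N}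
    (h : ∀ (σ : Equiv.Perm (Fin N)) κ, momentumCoef Ψ (κ ∘ σ) = momentumCoef Ψ κ) :
    Ψ ∈ L2sym d ℓ N := fun σ => by
  have hi := (Lp.memLp Ψ).integrable one_le_two
  refine ae_eq_of_momentumCoef_eq ((measurePreserving_perm σ).integrable_comp_of_integrable hi) hi
    fun κ => ?_
  exact (momentumCoef_comp_perm hi σ κ).trans (h σ κ)

/-- The bounded operators which are diagonal in momentum space. -/
theorem exists_multiplier {E : (Fin N → Mode d) → ℝ} {B : ℝ} (hB : 0 ≤ B) (hE : ∀ κ, |E κ| ≤ B) :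
    ∃ M : L2 d ℓ N →L[ℂ] L2 d ℓ N, (∀ Ψ, ‖M Ψ‖ ≤ B * ‖Ψ‖) ∧
      ∀ Ψ κ, momentumCoef (M Ψ) κ = E κ * momentumCoef Ψ κ := by
  set b := isCharFamily_configChar.basis (volume_real_config_pos (d := d) (ℓ := ℓ) (N := N))
  set D := lp.mapCLM (𝕜 := ℂ) (E := fun _ : Fin N → Mode d => ℂ) (F := fun _ => ℂ) 2
    (fun κ => (E κ : ℂ) • ContinuousLinearMap.id ℂ ℂ) hB (fun κ => by
      refine (norm_smul_le _ _).trans ?_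
      rw [Complex.norm_real, Real.norm_eq_abs]
      exact (mul_le_of_le_one_right (abs_nonneg _) ContinuousLinearMap.norm_id_le).trans (hE κ))
    with hD
  refine ⟨(b.repr.symm.toContinuousLinearEquiv : _ →L[ℂ] L2 d ℓ N) ∘L D ∘L
    (b.repr.toContinuousLinearEquiv : L2 d ℓ N →L[ℂ] _), fun Ψ => ?_, fun Ψ κ => ?_⟩
  · have h1 : ‖b.repr.symm (D (b.repr Ψ))‖ ≤ B * ‖Ψ‖ := by
      rw [LinearIsometryEquiv.norm_map]
      refine (D.le_of_opNorm_le (lp.norm_mapCLM_le _ _ hB _) _).trans_eq ?_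
      rw [LinearIsometryEquiv.norm_map]
    exact h1
  · have h1 : b.repr (b.repr.symm (D (b.repr Ψ))) κ = E κ * b.repr Ψ κ := by
      rw [LinearIsometryEquiv.apply_symm_apply, hD]
      simp
    rw [isCharFamily_configChar.basis_repr, isCharFamily_configChar.basis_repr,
      mul_left_comm] at h1
    have h2 : ((Real.sqrt ((volume : Measure (Config d ℓ N)).real Set.univ))⁻¹ : ℂ) ≠ 0 := by
      have := volume_real_config_pos (d := d) (ℓ := ℓ) (N := N)
      refine inv_ne_zero (Complex.ofReal_ne_zero.2 ?_)
      positivity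
    have h3 := mul_left_cancel₀ h2 h1
    rw [momentumCoef_eq, momentumCoef_eq, mul_left_comm, ← h3]
    rfl

/-- Invariance of the multiplier under permutations of the momenta keeps the symmetric subspace
invariant, and Parseval's identity evaluates its quadratic form. -/
theorem exists_symmetric_multiplier {E : (Fin N → Mode d) → ℝ} {B : ℝ} (hB : 0 ≤ B)
    (hE : ∀ κ, |E κ| ≤ B) (hs : ∀ (σ : Equiv.Perm (Fin N)) κ, E (κ ∘ σ) = E κ) :
    ∃ M : L2sym d ℓ N →L[ℂ] L2sym d ℓ N,
      (∀ Ψ : L2sym d ℓ N, inner ℂ Ψ (M Ψ) =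
        ((∑' κ, ‖momentumCoef (Ψ : L2 d ℓ N) κ‖ ^ 2 * E κ : ℝ) : ℂ)) ∧
      ∀ Ψ : L2sym d ℓ N, ‖Ψ‖ = 1 → ‖inner ℂ Ψ (M Ψ)‖ ≤ B := by
  obtain ⟨M, hM, hMc⟩ := exists_multiplier (ℓ := ℓ) hB hE
  refine ⟨(M ∘L (L2sym d ℓ N).subtypeL).codRestrict (L2sym d ℓ N) fun Ψ =>
    mem_L2sym_of_momentumCoef fun σ κ => ?_, fun Ψ => ?_, fun Ψ hΨ => ?_⟩
  · have h1 := hMc (Ψ : L2 d ℓ N) (κ ∘ σ)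
    rw [momentumCoef_perm_of_mem Ψ.2, hs] at h1
    exact h1.trans (hMc _ κ).symm
  · have h1 := hasSum_conj_momentumCoef_mul (Lp.memLp (Ψ : L2 d ℓ N)) (Lp.memLp (M Ψ))
    have h2 : inner ℂ (Ψ : L2 d ℓ N) (M Ψ) = ∫ x, conj ((Ψ : L2 d ℓ N) x) * M Ψ x := by
      rw [L2.inner_def]
      refine integral_congr_ae (ae_of_all _ fun x => ?_)
      simp only [RCLike.inner_apply]
      ring
    refine h2.trans ?_
    rw [← h1.tsum_eq, Complex.ofReal_tsum]
    refine tsum_congr fun κ => ?_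
    rw [hMc, mul_left_comm, conj_mul_self']
    push_cast
    ring
  · refine (norm_inner_le_norm (𝕜 := ℂ) Ψ _).trans ?_
    rw [hΨ, one_mul]
    refine (hM _).trans_eq ?_
    exact (congrArg (B * ·) hΨ).trans (mul_one B)

end Multiplier

/-! ### Assembly of the energy identity -/

section Energy

variable {d N : ℕ} {ℓ R a δ : ℝ} [Fact (0 < ℓ)] {v φ₀ : ℝ → ℝ} {ρ : ℝ} {Ψ : Config d ℓ N → ℂ}

/-- The same pair sums `H` appear in the interaction energy and in the coherent integral, so they
cancel. What remains of the energy besides `Q₃^ren` and `Q₄^ren` is diagonal, and subtracting the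
diagonal part of the coherent integral leaves the remainder. -/
theorem energy_decomposition (h : ScatteringData d ℓ R a δ v φ₀) (hρ : (N : ℝ) = ρ * ℓ ^ d)
    (hΨ2 : MemLp Ψ 2 volume)
    (hΨ : ∀ (σ : Equiv.Perm (Fin N)) κ, momentumCoef Ψ (κ ∘ σ) = momentumCoef Ψ κ)
    (hdom : InFormDomain v Ψ) :
    TermsConverge v (normalizedSol d δ φ₀) ρ Ψ ∧
      (energy v Ψ : ℂ) =
        1 / (Real.pi : ℂ) * (∫ z : ℂ, expectK v (normalizedSol d δ φ₀) ρ Ψ z) +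
          q3Ren v (normalizedSol d δ φ₀) Ψ + q4Ren v (normalizedSol d δ φ₀) Ψ +
          ((∑' κ, ‖momentumCoef Ψ κ‖ ^ 2 * remainder ℓ v (normalizedSol d δ φ₀) κ : ℝ) : ℂ) := by
  set φ := normalizedSol d δ φ₀
  obtain ⟨h1, hint⟩ := hdom
  have h0 := (hasSum_norm_momentumCoef_sq hΨ2).summable
  have hI : ∀ i j : Fin N, i ≠ j → InteractionL2 v i j Ψ := fun i j hij => by
    have hlt : ∀ i j : Fin N, i < j → InteractionL2 v i j Ψ := fun i j hij =>
      (interactionL2_iff h.measurable h.nonneg hΨ2.1).2 (hint i j hij)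
    rcases lt_or_gt_of_ne hij with h' | h'
    · exact hlt i j h'
    · exact (hlt j i h').symm
  have hg := h.summable_coef_sq_div
  have hgb := fun k : Mode d => abs_radialCoef_le (ℓ := ℓ) (fun r hr => h.gFn_nonneg hr) k
  have hwb := fun k : Mode d => abs_radialCoef_le (ℓ := ℓ) (fun r hr => h.gOmegaFn_nonneg hr) k
  obtain ⟨H, hH, hHs⟩ := exists_pair_sums h hΨ2 hI h1
  obtain ⟨k1, k2, k3, k4⟩ := expectK_integral (ρ := ρ) hΨ h0 h1 hg hgb hwb hH
  refine ⟨⟨fun z n => summable_pairTerm hΨ h0 h1 hg z n, k1, k2, fun i j hij =>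
    ⟨h.integrable_q3Integrand hΨ2 (hI i j hij) hij,
      h.integrable_q4Integrand hΨ2 (hI i j hij) hij⟩⟩, ?_⟩
  have hsplit := sum_pair_decomposition
    (e := fun i j => ∫ x, v (torusDist (x i - x j)) * ‖Ψ x‖ ^ 2)
    (q := fun i j => ∫ x, q4Integrand v φ Ψ i j x) (l := fun i j => ∫ x, lowIntegrand v φ Ψ i j x)
    (p := fun i j => ∫ x, pairIntegrand v φ Ψ i j x) (s := fun i j => ∫ x, q3Integrand v φ Ψ i j x)
    (fun i j => by simp only [fun x : Config d ℓ N => torusDist_sub_comm (x i) (x j)])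
    (fun i j hij => h.integral_interaction hΨ2 (hI i j hij) hij)
  set W : Mode d → ℝ := fun k => radialCoef ℓ (gFn v φ) k + radialCoef ℓ (gOmegaFn v φ) k with hW
  have hlowS : ∀ i j : Fin N, Summable fun κ : Fin N → Mode d =>
      ‖momentumCoef Ψ κ‖ ^ 2 * lowWeight W i j κ := fun i j => by
    refine (h0.mul_right (3 * (W 0))).of_norm_bounded fun κ => ?_
    rw [norm_mul, Real.norm_of_nonneg (by positivity)]
    exact mul_le_mul_of_nonneg_left (abs_lowWeight_le (fun k => (abs_add_le _ _).trans
      (add_le_add (hgb k) (hwb k))) i j κ) (by positivity)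
  have hlow : HasSum (fun κ : Fin N → Mode d => ‖momentumCoef Ψ κ‖ ^ 2 *
      (1 / 2 * ((ℓ ^ d)⁻¹ * ∑ i, ∑ j, if i ≠ j then lowWeight W i j κ else 0)))
      (1 / 2 * ∑ i, ∑ j, if i ≠ j then ∫ x, lowIntegrand v φ Ψ i j x else 0) := by
    have e : HasSum (fun κ : Fin N → Mode d => 1 / 2 * ∑ i, ∑ j, if i ≠ j then
        (ℓ ^ d)⁻¹ * (‖momentumCoef Ψ κ‖ ^ 2 * lowWeight W i j κ) else 0)
        (1 / 2 * ∑ i, ∑ j, if i ≠ j then ∫ x, lowIntegrand v φ Ψ i j x else 0) := by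
      refine HasSum.mul_left _ (hasSum_sum fun i _ => hasSum_sum fun j _ => ?_)
      by_cases hij : i = j
      · simp [hij]
      · simp only [ne_eq, hij, not_false_eq_true, if_true]
        rw [integral_lowIntegrand h hΨ2 hΨ hij]
        exact (hlowS i j).hasSum.mul_left _
    refine hasSum_of_eq e (fun κ => ?_) rfl
    simp only [Finset.mul_sum, mul_ite, mul_zero]
    refine Finset.sum_congr rfl fun i _ => Finset.sum_congr rfl fun j _ => ?_
    split_ifs <;> ring
  have hrem : ∑' κ, ‖momentumCoef Ψ κ‖ ^ 2 * remainder ℓ v φ κ =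
      (∑' κ : Fin N → Mode d, (∑ j, kSq ℓ (κ j)) * ‖momentumCoef Ψ κ‖ ^ 2) +
      (1 / 2 * ∑ i, ∑ j, if i ≠ j then ∫ x, lowIntegrand v φ Ψ i j x else 0) -
      ∑' κ : Fin N → Mode d, ‖momentumCoef Ψ κ‖ ^ 2 * diagTotal ℓ v φ ρ N (excOcc κ) := by
    refine (hasSum_of_eq ((h1.hasSum.add hlow).sub k3.hasSum) (fun κ => ?_) rfl).tsum_eq
    rw [← remainder_eq hρ]
    ring
  have hV := (vol_pos (d := d) (ℓ := ℓ)).ne'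
  have hpair : (ℓ ^ d)⁻¹ * (∑' k : ExcMode d, (radialCoef ℓ (gFn v φ) k.1 : ℂ) * H k).re =
      (∑ i : Fin N, ∑ j : Fin N, if i ≠ j then ∫ x, pairIntegrand v φ Ψ i j x else 0).re := by
    rw [hHs.tsum_eq, ← Complex.ofReal_pow, Complex.re_ofReal_mul, inv_mul_cancel_left₀ hV]
  rw [energy, k4, hpair, hrem, q3Ren, q4Ren, Complex.ofReal_add, hsplit]
  push_cast
  ring

end Energy

end
end BoseGas

/-! ### The proposition -/

open BoseGas in
theorem mainTheorem8 :
    ∃ C : ℝ, 0 < C ∧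
      ∀ (d : ℕ) (_ : d = 2 ∨ d = 3) (ℓ : ℝ) [Fact (0 < ℓ)] (N : ℕ) (ρ R a δ : ℝ) (v φ₀ : ℝ → ℝ),
        0 < ρ → (N : ℝ) = ρ * ℓ ^ d →
        0 < R → R ≤ ℓ / 4 → 0 < a →
        Measurable v → (∀ r, 0 ≤ v r) → (∀ r, R < r → v r = 0) →
        Integrable (fun x : EuclideanSpace ℝ (Fin d) => v ‖x‖) →
        IsScatteringSolution d v R a φ₀ →
        (d = 2 → 0 < δ ∧ R < a * Real.exp (1 / (2 * δ))) →
        ∃ R₀ : L2sym d ℓ N →L[ℂ] L2sym d ℓ N,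
          (∀ Ψ : L2sym d ℓ N, InFormDomain v (Ψ : L2 d ℓ N) →
            TermsConverge v (normalizedSol d δ φ₀) ρ (Ψ : L2 d ℓ N) ∧
            (energy v (Ψ : L2 d ℓ N) : ℂ) =
              1 / (Real.pi : ℂ) * (∫ z : ℂ, expectK v (normalizedSol d δ φ₀) ρ (Ψ : L2 d ℓ N) z) +
              q3Ren v (normalizedSol d δ φ₀) (Ψ : L2 d ℓ N) +
              q4Ren v (normalizedSol d δ φ₀) (Ψ : L2 d ℓ N) +
              inner ℂ Ψ (R₀ Ψ)) ∧
          ∀ Ψ : L2sym d ℓ N, ‖Ψ‖ = 1 →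
            ‖inner ℂ Ψ (R₀ Ψ)‖ ≤ C * N * (ℓ ^ d)⁻¹ *
              (fourierCoefTorus ℓ (gFn v (normalizedSol d δ φ₀)) (0 : Mode d)).re := by
  -- A convenient bound for the constant in `abs_remainder_le`.
  refine ⟨10, by norm_num, ?_⟩
  intro d hd ℓ hℓ N ρ R a δ v φ₀ hρ hN hR hRℓ ha hvm hv0 hsupp hvi hsol hcut
  have h : ScatteringData d ℓ R a δ v φ₀ :=
    ⟨hd, hR, hRℓ, ha, hvm, hv0, hsupp, hvi, hsol, hcut⟩
  -- Positivity of the density gives at least one particle, which absorbs the constant term of the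
  -- remainder into `N`.
  have hN1 : 1 ≤ N := by
    have : (0 : ℝ) < N := by rw [hN]; exact mul_pos hρ vol_pos
    exact_mod_cast this
  have hB := abs_remainder_le (N := N) h hN1
  obtain ⟨R₀, hR₀, hbound⟩ := exists_symmetric_multiplier (ℓ := ℓ)
    ((abs_nonneg _).trans (hB 0)) hB fun σ κ => remainder_comp_perm κ σ
  refine ⟨R₀, fun Ψ hdom => ?_, fun Ψ hΨ => hbound Ψ hΨ⟩
  rw [hR₀]
  exact energy_decomposition h hN (Lp.memLp _) (momentumCoef_perm_of_mem Ψ.2) hdom
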